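/- Let $D_8=\langle s,t \mid t^2=s^4=(ts)^2=1\rangle$ act on $(\mathbb Z/4)^3$ with basis $v_1,v_2,v_3$ (written additively) by $$s:\ v_1\mapsto v_2,\quad v_2\mapsto v_3,\quad v_3\mapsto v_1-v_2+v_3,\qquad t:\ v_1\mapsto -v_3,\quad v_2\mapsto -v_2,\quad v_3\mapsto -v_1,$$ and let $S=4^3:D_8=(\mathbb Z/4)^3\rtimes D_8$ be the resulting semidirect product (the Sylow $2$-subgroup of the Higman--Sims group). Let $$E_2^{p,q}=H^p\bigl(D_8,\,H^q((\mathbb Z/4)^3,\mathbb F_2)\bigr)$$ be the $E_2$ term, a bigraded $\mathbb F_2$-algebra under the cup product, of the Lyndon--Hochschild--Serre spectral sequence of the extension $1\to(\mathbb Z/4)^3\to S\to D_8\to 1$ with coefficients in $\mathbb F_2$. Let $U_3$ be the group of invertible upper triangular $3\times 3$ matrices over $\mathbb F_2$ and $M=\mathbb F_2^3$ its natural module. Grade the $U_3$-algebra $\Lambda^*(M)\otimes S^*(M)$ by placing $\Lambda^i(M)\otimes S^j(M)$ in degree $i+2j$. Then: (1) $E_2^{*,*}\cong H^*(U_3,\Lambda^*(M)\otimes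 S^*(M))$ as bigraded $\mathbb F_2$-algebras. (2) Every $E_2^{p,q}$ is finite-dimensional, and the Poincaré series by total degree is $$\sum_{n\ge 0}\Bigl(\sum_{p+q=n}\dim_{\mathbb F_2}E_2^{p,q}\Bigr)x^n=\frac{(1+x)^2(1-x+x^2)(1+2x^2-x^5)}{(1-x)^2(1-x^4)(1-x^8)}.$$ (3) $E_2^{*,*}$ is generated as an $\mathbb F_2$-algebra by elements of total degree at most $8$. -/

import Mathlib

noncomputable section

open CategoryTheory

namespace HS

namespace CupProduct

variable {k G : Type} [CommRing k] [Group G] {A B C : Rep.{0} k G}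

/-- A `G`-equivariant bilinear map `A × B → C`. -/
structure Pairing (A B C : Rep.{0} k G) where
  toLin : A.V →ₗ[k] B.V →ₗ[k] C.V
  map_ρ : ∀ (g : G) (a : A.V) (b : B.V), toLin (A.ρ g a) (B.ρ g b) = C.ρ g (toLin a b)

/-- The cup product of inhomogeneous cochains:
`(f ∪ g)(x₁, …, x_{p+q}) = f(x₁, …, x_p) · (x₁ ⋯ x_p) g(x_{p+1}, …, x_{p+q})`. -/
def cochain (μ : Pairing A B C) {p q : ℕ} (f : (Fin p → G) → A.V) (g : (Fin q → G) → B.V) :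
    (Fin (p + q) → G) → C.V := fun x =>
  μ.toLin (f fun i => x (Fin.castAdd q i))
    (B.ρ (List.ofFn fun i : Fin p => x (Fin.castAdd q i)).prod (g fun j => x (Fin.natAdd p j)))

/-- A function of `n` variables, evaluated on the first `n` terms of a sequence. -/
def ev {G : Type} {n : ℕ} {V : Type} (f : (Fin n → G) → V) (x : ℕ → G) : V := f fun i => x i

theorem ext_ev {n : ℕ} {V : Type} {f g : (Fin n → G) → V} (h : ∀ x, ev f x = ev g x) : f = g := by
  funext y
  have := h fun i => if hi : i < n then y ⟨i, hi⟩ else 1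
  simpa [ev] using this

/-- Multiply the terms with indices `j` and `j + 1` of a sequence. -/
def contr (j : ℕ) (x : ℕ → G) : ℕ → G := fun i =>
  if i < j then x i else if i = j then x i * x (i + 1) else x (i + 1)

/-- The product of the first `p` terms of a sequence. -/
def headProd (p : ℕ) (x : ℕ → G) : G := (List.ofFn fun i : Fin p => x i).prod

/-- Drop the first `p` terms of a sequence. -/
def shift (p : ℕ) (x : ℕ → G) : ℕ → G := fun i => x (p + i)

/-- The differential on inhomogeneous cochains, as a map between function spaces. -/
def dd (A : Rep.{0} k G) (n : ℕ) (f : (Fin n → G) → A.V) : (Fin (n + 1) → G) → A.V :=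
  (inhomogeneousCochains.d A n).hom f

theorem ev_d {n : ℕ} (f : (Fin n → G) → A.V) (x : ℕ → G) :
    ev (dd A n f) x = A.ρ (x 0) (ev f (shift 1 x)) +
      ∑ j ∈ Finset.range (n + 1), (-1 : k) ^ (j + 1) • ev f (contr j x) := by
  rw [Finset.sum_range]
  simp only [ev, dd, inhomogeneousCochains.d_hom_apply]
  congr 1
  simp [shift, add_comm]

theorem ev_cochain (μ : Pairing A B C) {p q : ℕ} (f : (Fin p → G) → A.V)
    (g : (Fin q → G) → B.V) (x : ℕ → G) :
    ev (cochain μ f g) x = μ.toLin (ev f x) (B.ρ (headProd p x) (ev g (shift p x))) := rfl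

theorem headProd_succ (p : ℕ) (x : ℕ → G) : headProd (p + 1) x = headProd p x * x p := by
  rw [headProd, List.ofFn_succ']; simp [headProd]

theorem headProd_succ_left (p : ℕ) (x : ℕ → G) :
    headProd (p + 1) x = x 0 * headProd p (shift 1 x) := by
  rw [headProd, List.ofFn_succ]; simp [headProd, shift, add_comm]

theorem ev_congr {G : Type} {n : ℕ} {V : Type} (f : (Fin n → G) → V) {x y : ℕ → G}
    (h : ∀ i < n, x i = y i) : ev f x = ev f y := by
  unfold ev; congr 1; funext i; exact h i i.2

theorem headProd_congr {n : ℕ} {x y : ℕ → G} (h : ∀ i < n, x i = y i) :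
    headProd n x = headProd n y := by
  unfold headProd; congr 2; funext i; exact h i i.2

theorem headProd_contr {p j : ℕ} (x : ℕ → G) (h : j < p) :
    headProd p (contr j x) = headProd (p + 1) x := by
  induction p with
  | zero => omega
  | succ p ih =>
    rw [headProd_succ, headProd_succ (p + 1)]
    rcases Nat.lt_succ_iff_lt_or_eq.mp h with h' | rfl
    · rw [ih h']
      simp [contr, show ¬ p < j by omega, show p ≠ j by omega]
    · rw [headProd_succ, headProd_congr (y := x)]
      · simp [contr, mul_assoc]
      · intro i hi; simp [contr, hi]

theorem leibniz (μ : Pairing A B C) {p q : ℕ} (f : (Fin p → G) → A.V)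
    (g : (Fin q → G) → B.V) (x : ℕ → G) :
    ev (dd C (p + q) (cochain μ f g)) x =
      μ.toLin (ev (dd A p f) x)
        (B.ρ (headProd (p + 1) x) (ev g (shift (p + 1) x))) +
      (-1 : k) ^ p • μ.toLin (ev f x)
        (B.ρ (headProd p x) (ev (dd B q g) (shift p x))) := by
  simp only [ev_d, ev_cochain]
  have h1 : ∀ j ∈ Finset.range p, (-1 : k) ^ (j + 1) • μ.toLin (ev f (contr j x))
      (B.ρ (headProd p (contr j x)) (ev g (shift p (contr j x)))) =
      (-1 : k) ^ (j + 1) • μ.toLin (ev f (contr j x))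
        (B.ρ (headProd (p + 1) x) (ev g (shift (p + 1) x))) := by
    intro j hj
    have hj := Finset.mem_range.mp hj
    rw [headProd_contr x hj]
    congr 4
    funext i
    simp [shift, contr, show ¬ p + i < j by omega, show p + i ≠ j by omega, add_right_comm]
  have h2 : ∀ j ∈ Finset.range (q + 1), (-1 : k) ^ (p + j + 1) • μ.toLin (ev f (contr (p + j) x))
      (B.ρ (headProd p (contr (p + j) x)) (ev g (shift p (contr (p + j) x)))) =
      (-1 : k) ^ p • μ.toLin (ev f x)
        (B.ρ (headProd p x) ((-1 : k) ^ (j + 1) • ev g (contr j (shift p x)))) := by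
    intro j _
    have e1 : ∀ i < p, contr (p + j) x i = x i := by
      intro i hi; simp [contr, show i < p + j by omega]
    rw [ev_congr f e1, headProd_congr e1]
    have e2 : shift p (contr (p + j) x) = contr j (shift p x) := by
      funext i; simp [shift, contr, add_assoc]
    rw [e2, map_smul, map_smul, smul_smul, ← pow_add, add_assoc]
  have h3 : μ.toLin (ev f (contr p x)) (B.ρ (headProd (p + 1) x) (ev g (shift (p + 1) x))) =
      μ.toLin (ev f x) (B.ρ (headProd p x) (B.ρ (shift p x 0) (ev g (shift 1 (shift p x))))) := by
    have e1 : ∀ i < p, contr p x i = x i := by intro i hi; simp [contr, hi]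
    rw [ev_congr f e1, headProd_succ, map_mul]
    have e2 : shift 1 (shift p x) = shift (p + 1) x := by
      funext i; simp [shift, add_assoc]
    rw [e2]; rfl
  have h4 : C.ρ (x 0) (μ.toLin (ev f (shift 1 x))
      (B.ρ (headProd p (shift 1 x)) (ev g (shift p (shift 1 x))))) =
      μ.toLin (A.ρ (x 0) (ev f (shift 1 x)))
        (B.ρ (headProd (p + 1) x) (ev g (shift (p + 1) x))) := by
    rw [← μ.map_ρ, headProd_succ_left, map_mul]
    have e2 : shift p (shift 1 x) = shift (p + 1) x := by
      funext i; simp [shift]; congr 1; omega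
    rw [e2]; rfl
  rw [show p + q + 1 = p + (q + 1) from rfl, Finset.sum_range_add, Finset.sum_congr rfl h1, Finset.sum_congr rfl h2,
    Finset.sum_range_succ _ p, h4]
  simp only [map_add, LinearMap.add_apply, map_sum, LinearMap.sum_apply, LinearMap.map_smul,
    LinearMap.smul_apply, LinearMap.map_neg, LinearMap.neg_apply, smul_add, Finset.smul_sum, h3, pow_succ (-1 : k) p,
    mul_neg, mul_one, neg_smul]
  abel

theorem isCocycle_cochain (μ : Pairing A B C) {p q : ℕ} {f : (Fin p → G) → A.V}
    {g : (Fin q → G) → B.V} (hf : dd A p f = 0)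
    (hg : dd B q g = 0) :
    dd C (p + q) (cochain μ f g) = 0 := by
  refine ext_ev fun x => ?_
  rw [leibniz, hf, hg]
  simp only [ev, Pi.zero_apply, map_zero, LinearMap.zero_apply, smul_zero, add_zero]

open groupCohomology

theorem d_iCocycles {n : ℕ} (a : cocycles A n) :
    dd A n (iCocycles A n a) = 0 := by
  have := (inhomogeneousCochains A).iCycles_d n (n + 1)
  rw [inhomogeneousCochains.d_def] at this
  exact congr($this a)

theorem d_cochain (μ : Pairing A B C) {p q : ℕ} (a : cocycles A p) (b : cocycles B q) :
    inhomogeneousCochains.d C (p + q)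
      (cochain μ ((iCocycles A p).hom a) ((iCocycles B q).hom b)) = 0 :=
  isCocycle_cochain μ (d_iCocycles a) (d_iCocycles b)

/-- The cup product of two cocycles. -/
def cocycle (μ : Pairing A B C) {p q : ℕ} (a : cocycles A p) (b : cocycles B q) :
    cocycles C (p + q) :=
  cocyclesMk _ (d_cochain μ a b)

theorem iCocycles_cocycle (μ : Pairing A B C) {p q : ℕ} (a : cocycles A p) (b : cocycles B q) :
    (iCocycles C (p + q)).hom (cocycle μ a b) =
      cochain μ ((iCocycles A p).hom a) ((iCocycles B q).hom b) :=
  iCocycles_mk _ (d_cochain μ a b)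

theorem iCocycles_injective (n : ℕ) : Function.Injective (iCocycles A n).hom :=
  (ModuleCat.mono_iff_injective _).1 inferInstance

theorem π_surjective (n : ℕ) : Function.Surjective (π A n).hom := fun x =>
  groupCohomology_induction_on x fun y => ⟨y, rfl⟩

theorem π_eq_zero_zero (a : cocycles A 0) (h : (π A 0).hom a = 0) : a = 0 := by
  have : IsIso (π A 0) := CochainComplex.isIso_homologyπ₀ (inhomogeneousCochains A)
  have : Mono (π A 0) := @IsIso.mono_of_iso _ _ _ _ _ this
  exact (ModuleCat.mono_iff_injective _).1 this (by rw [map_zero]; exact h)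

theorem π_eq_zero_succ {n : ℕ} (a : cocycles A (n + 1)) :
    (π A (n + 1)).hom a = 0 ↔ ∃ h : (Fin n → G) → A.V,
      (iCocycles A (n + 1)).hom a = dd A n h := by
  have hd : ∀ h : (Fin n → G) → A.V,
      (iCocycles A (n + 1)).hom ((toCocycles A n (n + 1)).hom h) = dd A n h := by
    intro h
    have := (inhomogeneousCochains A).toCycles_i n (n + 1)
    rw [inhomogeneousCochains.d_def] at this
    exact congr($(this).hom h)
  constructor
  · intro h
    have hex := ShortComplex.exact_of_g_is_cokernel
      (ShortComplex.mk _ _ ((inhomogeneousCochains A).toCycles_comp_homologyπ n (n + 1)))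
      ((inhomogeneousCochains A).homologyIsCokernel n (n + 1) (by simp))
    obtain ⟨b, hb⟩ := (ShortComplex.moduleCat_exact_iff _).1 hex a h
    refine ⟨b, ?_⟩
    rw [← hd]
    exact congrArg _ hb.symm
  · rintro ⟨h, hh⟩
    rw [← hd] at hh
    rw [iCocycles_injective _ hh]
    have := (inhomogeneousCochains A).toCycles_comp_homologyπ n (n + 1)
    exact congr($(this).hom h)

theorem cochain_add_left (μ : Pairing A B C) {p q : ℕ} (f f' : (Fin p → G) → A.V)
    (g : (Fin q → G) → B.V) : cochain μ (f + f') g = cochain μ f g + cochain μ f' g := by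
  funext x; simp [cochain]

theorem cochain_add_right (μ : Pairing A B C) {p q : ℕ} (f : (Fin p → G) → A.V)
    (g g' : (Fin q → G) → B.V) : cochain μ f (g + g') = cochain μ f g + cochain μ f g' := by
  funext x; simp [cochain]

theorem cochain_smul_left (μ : Pairing A B C) {p q : ℕ} (c : k) (f : (Fin p → G) → A.V)
    (g : (Fin q → G) → B.V) : cochain μ (c • f) g = c • cochain μ f g := by
  funext x; simp [cochain]

theorem cochain_smul_right (μ : Pairing A B C) {p q : ℕ} (c : k) (f : (Fin p → G) → A.V)
    (g : (Fin q → G) → B.V) : cochain μ f (c • g) = c • cochain μ f g := by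
  funext x; simp [cochain]

/-- The cup product of cocycles, as a bilinear map. -/
def cocycleLin (μ : Pairing A B C) (p q : ℕ) :
    cocycles A p →ₗ[k] cocycles B q →ₗ[k] cocycles C (p + q) :=
  LinearMap.mk₂ k (cocycle μ)
    (fun a a' b => iCocycles_injective _ <| by
      rw [map_add, iCocycles_cocycle, iCocycles_cocycle, iCocycles_cocycle, map_add]
      exact cochain_add_left μ _ _ _)
    (fun c a b => iCocycles_injective _ <| by
      rw [LinearMap.map_smul, iCocycles_cocycle, iCocycles_cocycle, LinearMap.map_smul]
      exact cochain_smul_left μ _ _ _)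
    (fun a b b' => iCocycles_injective _ <| by
      rw [map_add, iCocycles_cocycle, iCocycles_cocycle, iCocycles_cocycle, map_add]
      exact cochain_add_right μ _ _ _)
    (fun c a b => iCocycles_injective _ <| by
      rw [LinearMap.map_smul, iCocycles_cocycle, iCocycles_cocycle, LinearMap.map_smul]
      exact cochain_smul_right μ _ _ _)

/-- A cocycle is null-cohomologous as soon as it agrees, after reindexing, with a coboundary. -/
theorem π_eq_zero_of_ev {n m : ℕ} (hn : n = m + 1) (a : cocycles A n) (h : (Fin m → G) → A.V)
    (hh : ∀ x, ev ((iCocycles A n).hom a : (Fin n → G) → A.V) x = ev (dd A m h) x) :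
    (π A n).hom a = 0 := by
  subst hn
  exact (π_eq_zero_succ a).2 ⟨h, ext_ev hh⟩

theorem π_cocycle_left (μ : Pairing A B C) {p q : ℕ} (a : cocycles A p) (b : cocycles B q)
    (ha : (π A p).hom a = 0) : (π C (p + q)).hom (cocycleLin μ p q a b) = 0 := by
  cases p with
  | zero => rw [π_eq_zero_zero a ha, map_zero, LinearMap.zero_apply, map_zero]
  | succ p =>
    obtain ⟨h, hh⟩ := (π_eq_zero_succ a).1 ha
    refine π_eq_zero_of_ev (m := p + q) (by omega) _ (cochain μ h ((iCocycles B q).hom b)) fun x => ?_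
    rw [leibniz, d_iCocycles]
    have : ev (0 : (Fin (q + 1) → G) → B.V) (shift p x) = 0 := rfl
    rw [this, map_zero, map_zero, smul_zero, add_zero, ← hh]
    exact congr(ev $(iCocycles_cocycle μ a b) x)

theorem π_cocycle_right (μ : Pairing A B C) {p q : ℕ} (a : cocycles A p) (b : cocycles B q)
    (hb : (π B q).hom b = 0) : (π C (p + q)).hom (cocycleLin μ p q a b) = 0 := by
  cases q with
  | zero => rw [π_eq_zero_zero b hb, map_zero, map_zero]
  | succ q =>
    obtain ⟨h, hh⟩ := (π_eq_zero_succ b).1 hb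
    refine π_eq_zero_of_ev (m := p + q) (by omega) _
      ((-1 : k) ^ p • cochain μ ((iCocycles A p).hom a) h) fun x => ?_
    have e : dd C (p + q) ((-1 : k) ^ p • cochain μ ((iCocycles A p).hom a) h) =
        (-1 : k) ^ p • dd C (p + q) (cochain μ ((iCocycles A p).hom a) h) :=
      LinearMap.map_smul _ _ _
    have e' : ∀ (c : k) (F : (Fin (p + q + 1) → G) → C.V), ev (c • F) x = c • ev F x :=
      fun _ _ => rfl
    rw [e, e', leibniz, d_iCocycles]
    have : ev (0 : (Fin (p + 1) → G) → A.V) x = 0 := rfl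
    rw [this, map_zero, LinearMap.zero_apply, zero_add, smul_smul, ← mul_pow, ← hh]
    simp only [mul_neg, mul_one, neg_neg, one_pow, one_smul]
    exact congr(ev $(iCocycles_cocycle μ a b) x)

theorem descend_congr {Z₁ Z₂ H₁ H₂ H₃ : Type} [AddCommGroup Z₁] [AddCommGroup Z₂]
    [AddCommGroup H₁] [AddCommGroup H₂] [AddCommGroup H₃] [Module k Z₁] [Module k Z₂] [Module k H₁]
    [Module k H₂] [Module k H₃] {π₁ : Z₁ →ₗ[k] H₁} {π₂ : Z₂ →ₗ[k] H₂} {β : Z₁ →ₗ[k] Z₂ →ₗ[k] H₃}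
    (h₁ : ∀ a b, π₁ a = 0 → β a b = 0) (h₂ : ∀ a b, π₂ b = 0 → β a b = 0) {a a' : Z₁} {b b' : Z₂}
    (ha : π₁ a = π₁ a') (hb : π₂ b = π₂ b') : β a b = β a' b' := by
  have e₁ := h₁ (a - a') b (by rw [map_sub, ha, sub_self])
  have e₂ := h₂ a' (b - b') (by rw [map_sub, hb, sub_self])
  rw [map_sub, LinearMap.sub_apply, sub_eq_zero] at e₁
  rw [map_sub, sub_eq_zero] at e₂
  rw [e₁, e₂]

/-- A bilinear map descends along surjections whose kernels it annihilates. -/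
def descend {Z₁ Z₂ H₁ H₂ H₃ : Type} [AddCommGroup Z₁] [AddCommGroup Z₂]
    [AddCommGroup H₁] [AddCommGroup H₂] [AddCommGroup H₃] [Module k Z₁] [Module k Z₂] [Module k H₁]
    [Module k H₂] [Module k H₃] (π₁ : Z₁ →ₗ[k] H₁) (π₂ : Z₂ →ₗ[k] H₂) (β : Z₁ →ₗ[k] Z₂ →ₗ[k] H₃)
    (s₁ : Function.Surjective π₁) (s₂ : Function.Surjective π₂)
    (h₁ : ∀ a b, π₁ a = 0 → β a b = 0) (h₂ : ∀ a b, π₂ b = 0 → β a b = 0) :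
    H₁ →ₗ[k] H₂ →ₗ[k] H₃ :=
  LinearMap.mk₂ k (fun x y => β (Function.surjInv s₁ x) (Function.surjInv s₂ y))
    (fun x x' y => by
      rw [← LinearMap.add_apply, ← map_add]
      exact descend_congr h₁ h₂ (by simp [Function.surjInv_eq]) rfl)
    (fun c x y => by
      rw [← LinearMap.smul_apply, ← LinearMap.map_smul]
      exact descend_congr h₁ h₂ (by simp [Function.surjInv_eq]) rfl)
    (fun x y y' => by
      rw [← map_add]
      exact descend_congr h₁ h₂ rfl (by simp [Function.surjInv_eq]))
    (fun c x y => by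
      rw [← LinearMap.map_smul]
      exact descend_congr h₁ h₂ rfl (by simp [Function.surjInv_eq]))

theorem descend_apply {Z₁ Z₂ H₁ H₂ H₃ : Type} [AddCommGroup Z₁] [AddCommGroup Z₂]
    [AddCommGroup H₁] [AddCommGroup H₂] [AddCommGroup H₃] [Module k Z₁] [Module k Z₂] [Module k H₁]
    [Module k H₂] [Module k H₃] (π₁ : Z₁ →ₗ[k] H₁) (π₂ : Z₂ →ₗ[k] H₂) (β : Z₁ →ₗ[k] Z₂ →ₗ[k] H₃)
    (s₁ : Function.Surjective π₁) (s₂ : Function.Surjective π₂)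
    (h₁ : ∀ a b, π₁ a = 0 → β a b = 0) (h₂ : ∀ a b, π₂ b = 0 → β a b = 0) (a : Z₁) (b : Z₂) :
    descend π₁ π₂ β s₁ s₂ h₁ h₂ (π₁ a) (π₂ b) = β a b :=
  descend_congr h₁ h₂ (Function.surjInv_eq s₁ _) (Function.surjInv_eq s₂ _)

/-- The cup product `H^p(G, A) × H^q(G, B) → H^{p+q}(G, C)` induced by a `G`-equivariant pairing
`A × B → C`: the class of the cup product of representing cocycles. -/
def cup (μ : Pairing A B C) (p q : ℕ) :
    groupCohomology A p →ₗ[k] groupCohomology B q →ₗ[k] groupCohomology C (p + q) :=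
  descend (π A p).hom (π B q).hom ((cocycleLin μ p q).compr₂ (π C (p + q)).hom)
    (π_surjective p) (π_surjective q) (fun a b h => π_cocycle_left μ a b h)
    (fun a b h => π_cocycle_right μ a b h)

theorem cup_π (μ : Pairing A B C) {p q : ℕ} (a : cocycles A p) (b : cocycles B q) :
    cup μ p q ((π A p).hom a) ((π B q).hom b) = (π C (p + q)).hom (cocycle μ a b) :=
  descend_apply ..

end CupProduct

namespace CupProduct

variable {k G H : Type} [CommRing k] [Group G] [Group H]

open groupCohomology

/-- Cup products are natural in the group and in the coefficients. -/
theorem map_cup {A B C : Rep.{0} k H} {A' B' C' : Rep.{0} k G} (f : G →* H)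
    (μ : Pairing A B C) (μ' : Pairing A' B' C') (α : Rep.res f A ⟶ A') (β : Rep.res f B ⟶ B')
    (γ : Rep.res f C ⟶ C')
    (h : ∀ (a : A.V) (b : B.V), γ.hom (μ.toLin a b) = μ'.toLin (α.hom a) (β.hom b)) (p q : ℕ)
    (x : groupCohomology A p) (y : groupCohomology B q) :
    (groupCohomology.map f γ (p + q)).hom (cup μ p q x y) =
      cup μ' p q ((groupCohomology.map f α p).hom x) ((groupCohomology.map f β q).hom y) := by
  obtain ⟨a, rfl⟩ := π_surjective p x
  obtain ⟨b, rfl⟩ := π_surjective q y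
  have hπ : ∀ {A : Rep.{0} k H} {A' : Rep.{0} k G} (α : Rep.res f A ⟶ A') (n : ℕ)
      (a : cocycles A n), (groupCohomology.map f α n).hom ((π A n).hom a) =
        (π A' n).hom ((cocyclesMap f α n).hom a) :=
    fun α n a => congr($(π_map f α n).hom a)
  have hi : ∀ {A : Rep.{0} k H} {A' : Rep.{0} k G} (α : Rep.res f A ⟶ A') (n : ℕ)
      (a : cocycles A n), (iCocycles A' n).hom ((cocyclesMap f α n).hom a) =
        fun x : Fin n → G => α.hom (((iCocycles A n).hom a : (Fin n → H) → A.V) (f ∘ x)) :=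
    fun α n a => congr($(HomologicalComplex.cyclesMap_i (cochainsMap f α) n).hom a)
  rw [hπ, hπ, cup_π, hπ, cup_π]
  congr 1
  refine iCocycles_injective _ ?_
  rw [hi, iCocycles_cocycle, iCocycles_cocycle, hi, hi]
  funext x
  simp only [cochain, h]
  congr 1
  have := Rep.hom_comm_apply β (List.ofFn fun i : Fin p => x (Fin.castAdd q i)).prod
    (((iCocycles B q).hom b : (Fin q → H) → B.V) (f ∘ fun j => x (Fin.natAdd p j)))
  rw [← this]
  simp only [Rep.res, map_list_prod, List.map_ofFn]
  rfl

end CupProduct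

/-- A graded system of coefficients for the group `G`: `G`-modules `A⁰, A¹, A², …` with
`G`-equivariant products `Aⁱ × Aʲ → Aⁱ⁺ʲ`. -/
structure GradedCoeff (k G : Type) [CommRing k] [Group G] where
  obj : ℕ → Rep.{0} k G
  mul : ∀ i j, CupProduct.Pairing (obj i) (obj j) (obj (i + j))

namespace GradedCoeff

variable {k G : Type} [CommRing k] [Group G] (X : GradedCoeff k G)

/-- The bigraded cohomology `H^p(G, A^q)`. -/
abbrev H (p q : ℕ) : ModuleCat k := groupCohomology (X.obj q) p

/-- The product `H^p(G, A^q) × H^p'(G, A^q') → H^{p+p'}(G, A^{q+q'})`: the cup product with respect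
to the multiplication of the coefficients. -/
def cup {p q p' q' : ℕ} (x : X.H p q) (y : X.H p' q') : X.H (p + p') (q + q') :=
  CupProduct.cup (X.mul q q') p p' x y

/-- The bigraded algebra `H^*(G, A^*)` is generated by its elements of total degree at most `d`:
a bigraded subspace closed under products which contains all elements of total degree at most `d`
is everything. -/
def GeneratedInDegreesLE (d : ℕ) : Prop :=
  ∀ F : (p q : ℕ) → Submodule k (X.H p q),
    (∀ p q, p + q ≤ d → F p q = ⊤) →
    (∀ p q p' q' (x : X.H p q) (y : X.H p' q'), x ∈ F p q → y ∈ F p' q' →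
      X.cup x y ∈ F (p + p') (q + q')) →
    ∀ p q, F p q = ⊤

/-- The Poincaré series `∑ₙ (∑_{p+q=n} dim H^p(G, A^q)) xⁿ`. -/
def poincareSeries : PowerSeries ℤ :=
  PowerSeries.mk fun n => ∑ pq ∈ Finset.HasAntidiagonal.antidiagonal n, (Module.finrank k (X.H pq.1 pq.2) : ℤ)

/-- An isomorphism of bigraded algebras between `H^*(G, A^*)` and `H^*(G', A'^*)`. -/
structure CohomologyIso {G' : Type} [Group G'] (Y : GradedCoeff k G') where
  equiv : ∀ p q, X.H p q ≃ₗ[k] Y.H p q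
  map_cup : ∀ {p q p' q' : ℕ} (x : X.H p q) (y : X.H p' q'),
    equiv (p + p') (q + q') (X.cup x y) = Y.cup (equiv p q x) (equiv p' q' y)

end GradedCoeff

/-- Multiplication in `k` as a pairing of trivial modules. -/
def trivialPairing (k N : Type) [CommRing k] [Group N] :
    CupProduct.Pairing (Rep.trivial k N k) (Rep.trivial k N k) (Rep.trivial k N k) where
  toLin := LinearMap.mul k k
  map_ρ _ _ _ := rfl

section LHS

variable (k : Type) {N Q : Type} [CommRing k] [Group N] [Group Q]

/-- The map on `H^n(N, k)` induced by an endomorphism of `N`. -/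
def pullback (f : N →* N) (n : ℕ) :
    groupCohomology (Rep.trivial k N k) n →ₗ[k] groupCohomology (Rep.trivial k N k) n :=
  (groupCohomology.map f (𝟙 (Rep.trivial k N k) : Rep.res f (Rep.trivial k N k) ⟶ _) n).hom

/-- For a semidirect product `N ⋊[φ] Q`, the `Q`-module `H^n(N, k)`: `g` acts as the map induced by
`x ↦ g⁻¹ x g` on `N`. -/
def cohomologyRep (φ : Q →* MulAut N) (n : ℕ) : Rep.{0} k Q :=
  Rep.of (X := groupCohomology (Rep.trivial k N k) n)
    { toFun := fun g => pullback k (φ g⁻¹).toMonoidHom n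
      map_one' := by
        have : (φ (1 : Q)⁻¹).toMonoidHom = MonoidHom.id N := by ext; simp
        rw [this]
        exact congr($(groupCohomology.map_id (B := Rep.trivial k N k) n).hom)
      map_mul' := fun g h => by
        have : (φ (g * h)⁻¹).toMonoidHom = (φ h⁻¹).toMonoidHom.comp (φ g⁻¹).toMonoidHom := by
          ext; simp
        rw [this]
        exact congr($(groupCohomology.map_comp (A := Rep.trivial k N k) (B := Rep.trivial k N k)
          (C := Rep.trivial k N k) (φ h⁻¹).toMonoidHom (φ g⁻¹).toMonoidHom (𝟙 _) (𝟙 _) n).hom) }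

/-- The cohomology ring `H^*(N, k)` as graded coefficients for `Q`. -/
def cohomologyCoeff (φ : Q →* MulAut N) : GradedCoeff k Q where
  obj n := cohomologyRep k φ n
  mul i j :=
    { toLin := CupProduct.cup (trivialPairing k N) i j
      map_ρ := fun g a b => (CupProduct.map_cup (φ g⁻¹).toMonoidHom (trivialPairing k N)
        (trivialPairing k N) (𝟙 _) (𝟙 _) (𝟙 _) (fun _ _ => rfl) i j a b).symm }

/-- The `E₂` page `E₂^{p,q} = H^p(Q, H^q(N, 𝔽₂))`, with its cup product, of the
Lyndon–Hochschild–Serre spectral sequence of the split extension `1 → N → N ⋊[φ] Q → Q → 1` with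
coefficients `𝔽₂` (where no signs enter the product). -/
abbrev lhsE2 (φ : Q →* MulAut N) : GradedCoeff (ZMod 2) Q := cohomologyCoeff (ZMod 2) φ

end LHS

/-- The matrices of the action of `D₈` on `(ℤ/4)³`, acting on column vectors in the basis
`v₁, v₂, v₃`: the rotation `r 1` maps `v₁ ↦ v₂`, `v₂ ↦ v₃`, `v₃ ↦ v₁ - v₂ + v₃`, the reflection
`sr 0` maps `v₁ ↦ -v₃`, `v₂ ↦ -v₂`, `v₃ ↦ -v₁`. -/
def hsMatrix : DihedralGroup 4 → Matrix (Fin 3) (Fin 3) (ZMod 4)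
  | .r i => !![0, 0, 1; 1, 0, -1; 0, 1, 1] ^ i.val
  | .sr i => !![0, 0, -1; 0, -1, 0; -1, 0, 0] * !![0, 0, 1; 1, 0, -1; 0, 1, 1] ^ i.val

theorem hsMatrix_one : hsMatrix 1 = 1 := by decide

theorem hsMatrix_mul (g h : DihedralGroup 4) : hsMatrix (g * h) = hsMatrix g * hsMatrix h := by
  revert g h
  decide

/-- The action of `D₈` on `(ℤ/4)³` defining the semidirect product `4³ : D₈`. -/
def hsAction : DihedralGroup 4 →* MulAut (Multiplicative (Fin 3 → ZMod 4)) where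
  toFun g :=
    { toFun := fun v => .ofAdd ((hsMatrix g).mulVec v.toAdd)
      invFun := fun v => .ofAdd ((hsMatrix g⁻¹).mulVec v.toAdd)
      left_inv := fun v => by
        simp [Matrix.mulVec_mulVec, ← hsMatrix_mul, hsMatrix_one]
      right_inv := fun v => by
        simp [Matrix.mulVec_mulVec, ← hsMatrix_mul, hsMatrix_one]
      map_mul' := fun v w => by simp [Matrix.mulVec_add] }
  map_one' := by ext v; simp [hsMatrix_one]
  map_mul' g h := by ext v; simp [hsMatrix_mul, Matrix.mulVec_mulVec]

/-- The `E₂` page of the Lyndon–Hochschild–Serre spectral sequence of the extension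
`1 → (ℤ/4)³ → S → D₈ → 1`, where `S = 4³ : D₈` is the semidirect product defined by `hsAction`. -/
def E2 : GradedCoeff (ZMod 2) (DihedralGroup 4) := lhsE2 hsAction

/-- The group `U₃` of upper triangular invertible `3 × 3` matrices over `𝔽₂`. -/
def U3 : Subgroup (GL (Fin 3) (ZMod 2)) where
  carrier := {g | ∀ i j : Fin 3, j < i → g.val i j = 0}
  one_mem' := fun i j h => by simp [h.ne']
  mul_mem' := fun {g h} hg hh => Matrix.BlockTriangular.mul (b := id) hg hh
  inv_mem' := fun {g} hg => by
    have : Matrix.BlockTriangular g.val id := hg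
    have h2 := Matrix.blockTriangular_inv_of_blockTriangular this
    intro i j h
    rw [Matrix.coe_units_inv]
    exact h2 h

section natural

open scoped TensorProduct

/-- The underlying space of the natural `U₃`-module `M`. -/
abbrev M : Type := Fin 3 → ZMod 2

/-- The action of `U3` on the natural module. -/
def natural : U3 →* (M →ₗ[ZMod 2] M) where
  toFun g := Matrix.mulVecLin g.val.val
  map_one' := by ext; simp
  map_mul' g h := by ext; simp

/-- The algebra `Λ(M) ⊗ S(M)`. -/
abbrev ExtSym : Type := ExteriorAlgebra (ZMod 2) M ⊗[ZMod 2] SymmetricAlgebra (ZMod 2) M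

/-- The inclusion of `M` as `Λ¹(M) ⊗ 1`. -/
def extι : M →ₗ[ZMod 2] ExtSym :=
  (Algebra.TensorProduct.includeLeft (R := ZMod 2) (S := ZMod 2)).toLinearMap ∘ₗ
    ExteriorAlgebra.ι (ZMod 2)

/-- The inclusion of `M` as `1 ⊗ S¹(M)`. -/
def symι : M →ₗ[ZMod 2] ExtSym :=
  (Algebra.TensorProduct.includeRight (R := ZMod 2)).toLinearMap ∘ₗ SymmetricAlgebra.ι (ZMod 2) M

/-- The algebra endomorphism of `Λ(M) ⊗ S(M)` induced by a linear endomorphism of `M`. -/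
def extSymMap (f : M →ₗ[ZMod 2] M) : ExtSym →ₐ[ZMod 2] ExtSym :=
  Algebra.TensorProduct.map (ExteriorAlgebra.map f)
    (SymmetricAlgebra.lift (SymmetricAlgebra.ι (ZMod 2) M ∘ₗ f))

/-- The degree `n` part of `Λ(M) ⊗ S(M)`, where `Λⁱ(M) ⊗ Sʲ(M)` has degree `i + 2 j`. -/
def extSymDeg (n : ℕ) : Submodule (ZMod 2) ExtSym :=
  ⨆ (i : ℕ) (j : ℕ) (_ : i + 2 * j = n), LinearMap.range extι ^ i * LinearMap.range symι ^ j

theorem extSymMap_id : extSymMap LinearMap.id = AlgHom.id _ _ := by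
  have : SymmetricAlgebra.lift (SymmetricAlgebra.ι (ZMod 2) M ∘ₗ LinearMap.id) =
      AlgHom.id (ZMod 2) (SymmetricAlgebra (ZMod 2) M) := by
    rw [LinearMap.comp_id, SymmetricAlgebra.lift_ι]
  rw [extSymMap, this, ExteriorAlgebra.map_id, Algebra.TensorProduct.map_id]

theorem extSymMap_comp (f g : M →ₗ[ZMod 2] M) : extSymMap (f ∘ₗ g) = (extSymMap f).comp (extSymMap g) := by
  rw [extSymMap, extSymMap, extSymMap, ← Algebra.TensorProduct.map_comp, ExteriorAlgebra.map_comp_map]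
  congr 1
  ext x
  simp

theorem extSymMap_mem (f : M →ₗ[ZMod 2] M) {n : ℕ} {x : ExtSym} (hx : x ∈ extSymDeg n) :
    extSymMap f x ∈ extSymDeg n := by
  have h1 : (LinearMap.range extι).map (extSymMap f).toLinearMap ≤ LinearMap.range extι := by
    rintro _ ⟨_, ⟨m, rfl⟩, rfl⟩
    exact ⟨f m, by simp [extι, extSymMap]⟩
  have h2 : (LinearMap.range symι).map (extSymMap f).toLinearMap ≤ LinearMap.range symι := by
    rintro _ ⟨_, ⟨m, rfl⟩, rfl⟩
    exact ⟨f m, by simp [symι, extSymMap]⟩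
  have : (extSymDeg n).map (extSymMap f).toLinearMap ≤ extSymDeg n := by
    simp only [extSymDeg, Submodule.map_iSup, Submodule.map_mul, Submodule.map_pow]
    gcongr
  exact this ⟨x, hx, rfl⟩

theorem pow_mul_pow_mul {R A : Type} [CommSemiring R] [Semiring A] [Algebra R A]
    {U V : Submodule R A} (h : V * U = U * V) (i j i' j' : ℕ) :
    U ^ i' * V ^ j' * (U ^ i * V ^ j) = U ^ (i' + i) * V ^ (j' + j) := by
  have hc : Commute V U := h
  rw [pow_add, pow_add, mul_assoc, mul_assoc]
  congr 1
  rw [← mul_assoc, ← mul_assoc, (hc.pow_pow j' i).eq]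

theorem extSymDeg_mul {m n : ℕ} {x y : ExtSym} (hx : x ∈ extSymDeg m) (hy : y ∈ extSymDeg n) :
    x * y ∈ extSymDeg (m + n) := by
  have hc : LinearMap.range symι * LinearMap.range extι =
      LinearMap.range extι * LinearMap.range symι := by
    have h : ∀ a b, symι a * extι b = extι b * symι a := fun a b => by simp [symι, extι]
    refine le_antisymm ?_ ?_
    · rw [Submodule.mul_le]
      rintro _ ⟨a, rfl⟩ _ ⟨b, rfl⟩
      rw [h]
      exact Submodule.mul_mem_mul ⟨_, rfl⟩ ⟨_, rfl⟩
    · rw [Submodule.mul_le]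
      rintro _ ⟨a, rfl⟩ _ ⟨b, rfl⟩
      rw [← h]
      exact Submodule.mul_mem_mul ⟨_, rfl⟩ ⟨_, rfl⟩
  have : extSymDeg m * extSymDeg n ≤ extSymDeg (m + n) := by
    simp only [extSymDeg, Submodule.iSup_mul, Submodule.mul_iSup, iSup_le_iff]
    intro i j hij i' j' hij'
    refine le_trans (le_of_eq ?_) (le_iSup_of_le (i + i') (le_iSup_of_le (j + j')
      (le_iSup_of_le (by omega) le_rfl)))
    rw [add_comm i, add_comm j]
    exact pow_mul_pow_mul hc _ _ _ _
  exact this (Submodule.mul_mem_mul hx hy)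

/-- The `U₃`-module given by the degree `n` part of `Λ(M) ⊗ S(M)`. -/
def extSymRep (n : ℕ) : Rep.{0} (ZMod 2) U3 :=
  Rep.of (X := extSymDeg n)
    { toFun := fun g => (extSymMap (natural g)).toLinearMap.restrict fun _ hx => extSymMap_mem _ hx
      map_one' := by
        ext x
        simp [map_one, Module.End.one_eq_id, extSymMap_id]
      map_mul' := fun g h => by
        refine LinearMap.ext fun x => Subtype.ext ?_
        have := congr($(extSymMap_comp (natural g) (natural h)) x.1)
        rw [← Module.End.mul_eq_comp, ← map_mul] at this
        exact this }

/-- The graded algebra `Λ(M) ⊗ S(M)` as graded coefficients for `U₃`. -/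
def extSym : GradedCoeff (ZMod 2) U3 where
  obj := extSymRep
  mul i j :=
    { toLin := LinearMap.mk₂ (ZMod 2)
        (fun (x : extSymDeg i) (y : extSymDeg j) => (⟨x.1 * y.1, extSymDeg_mul x.2 y.2⟩ : extSymDeg (i + j)))
        (fun _ _ _ => Subtype.ext (add_mul _ _ _)) (fun _ _ _ => Subtype.ext (smul_mul_assoc _ _ _))
        (fun _ _ _ => Subtype.ext (mul_add _ _ _)) (fun _ _ _ => Subtype.ext (mul_smul_comm _ _ _))
      map_ρ := fun g a b => Subtype.ext
        (map_mul (extSymMap (natural g)) (a : extSymDeg i).1 (b : extSymDeg j).1).symm }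

end natural

end HS

end

/-!
Write `k` for the field with two elements. The proof computes the cohomology ring of `(ℤ/4)³` with
its action of the dihedral group, and then the cohomology of the dihedral group with coefficients in
that ring.

*The coefficients.* A character `χ : G → ℤ/4` gives the module of functions on its values, an extension
`0 → Z → k[ℤ/4] → k → 0` (`augSES`) and an extension `0 → k → k[ℤ/4] → Z → 0` (`coaugSES`), where `Z`
consists of the functions with sum zero. Their connecting homomorphisms lead to classes `degOne χ` and
`degTwo χ` in `H¹(G, k)` and `H²(G, k)` (`coaug_δ_constCls`, `coaug_δ_θ`): the reduction of `χ` modulo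
two, and the pullback of the extension `ℤ/2 → ℤ/8 → ℤ/4`. Starting from the regular module of `(ℤ/4)³`,
which is acyclic, and removing one coordinate at a time, these sequences show that the cohomology ring
is generated by the classes of the three coordinate characters (`gysin_surjective`,
`cohomology_generated`) and has dimension `(n + 1) (n + 2) / 2` in degree `n` (`gysin_hdim`,
`hdim_triv`). The classes commute by an explicit choice of `∪₁`-products, and the classes of degree one
have square zero, so there is a homomorphism `compare` from `Λ(M) ⊗ S(M)` to the cohomology ring. It is
equivariant (`compareDeg_act`), because `χ ↦ degOne χ` and `χ ↦ degTwo χ` are additive and natural, and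
the action on characters modulo two is the natural module `M` of `U₃`, which the dihedral group is
isomorphic to by `toU3`. It is surjective, and bijective by dimensions (`compareDeg_bijective`). This
gives the isomorphism of `E₂` with `H(U₃, Λ(M) ⊗ S(M))` (`isoExtSym`).

*The decomposition.* Let `x, y, z` be the basis of `M`, with `x` invariant. Modulo the invariants
`polyD`, the product of the conjugates of `z`, and `polyQ`, which is `x² + x y + y²`, the polynomial
ring `S(M)` is a direct sum of copies of a few modules: the trivial module, `M`, the spans of the orbits
of `z (z + y)` and of `z (z + x)`, the product of the latter with `M`, and the free module spanned by
the orbit of `y z³`, some of them multiplied by powers of `x` (`polyM_pow_le_polyS`). The products of these blocks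
with `Λⁱ(M)` span `Λ(M) ⊗ S(M)` (`dec_extSymDeg`). It is not checked directly that the sum is direct: the
dimensions of the blocks in degree `n` add up to `(n + 1) (n + 2) / 2`, and the surjection `compare`
shows that the graded piece is at least as large.

*The cohomology of the blocks.* Both `M` and `Λ²(M)` are kernels of augmentations of permutation modules
on four cosets of a non-central reflection (`Ea`, `Eb`). Let `sig` in `H¹(D₈, k)` be the class whose
kernel is cyclic of order four. This subgroup meets the conjugates of the reflection trivially, so
multiplication by `sig` is onto on the cohomology of `k[Ω] ⊗ W`, for each of these permutation modules
`k[Ω]` and all `W`. If the transfer from the subgroup generated by the reflection vanishes on `W`, the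
augmentation vanishes on the cohomology of `k[Ω] ⊗ W`. Then the cohomology of `M ⊗ W`, or `Λ²(M) ⊗ W`,
has a known dimension and is generated over that of `W` by one class of degree one, together with
`sig` and invariants (`CosetExt.hdim_succ`, `CosetExt.generation`). The kernel of the product
`M ⊗ Λ²(M) → Λ³(M)` is free (`Efree`), and hence the same holds for `W` itself in place of
`M ⊗ Λ²(M) ⊗ W` (`generation_of_traces`). This treats all blocks except the free ones.

*Generation in degrees at most eight.* The invariants `x`, `polyQ`, `polyD` and the generator of `Λ³(M)`
have degree at most eight, so only products of blocks with `k`, `Λ¹(M)` and `Λ²(M)` need be considered.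
These lie in degrees at most eight, and their cohomology is generated by elements of total degree at
most eight (`Gen.of_traces`, `Gen.fam`). The only exceptions are the products of the free block, of
degree eight, with `Λ¹(M)` and `Λ²(M)`. Their cohomology consists of transfers, which are polynomials in
invariants of degree at most eight (`genInv_trF_eX` and the lemmas following it). The Poincaré series is
the sum of the series of the blocks (`tot_cohA`).
-/

noncomputable section

open CategoryTheory

namespace HS

open groupCohomology CupProduct

/-! ### Cohomology classes, coefficient maps and connecting homomorphisms -/

section classes

variable {k G : Type} [CommRing k] [Group G] {A B C : Rep.{0} k G}

/-- The cohomology class of an inhomogeneous cocycle. -/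
def cls {n : ℕ} (f : (Fin n → G) → A.V) (hf : dd A n f = 0) : groupCohomology A n :=
  (π A n).hom (cocyclesMk f hf)

theorem cls_surjective {n : ℕ} (u : groupCohomology A n) :
    ∃ (f : (Fin n → G) → A.V) (hf : dd A n f = 0), cls f hf = u := by
  obtain ⟨a, rfl⟩ := π_surjective n u
  refine ⟨_, d_iCocycles a, ?_⟩
  unfold cls
  congr 1
  exact iCocycles_injective _ (iCocycles_mk _ _)

theorem dd_add {n : ℕ} (f g : (Fin n → G) → A.V) : dd A n (f + g) = dd A n f + dd A n g :=
  map_add _ _ _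

theorem dd_dd {n : ℕ} (f : (Fin n → G) → A.V) : dd A (n + 1) (dd A n f) = 0 :=
  congr($(inhomogeneousCochains.d_comp_d (A := A) n).hom f)

theorem cls_add {n : ℕ} {f g : (Fin n → G) → A.V} (hf : dd A n f = 0) (hg : dd A n g = 0)
    (h : dd A n (f + g) = 0) : cls (f + g) h = cls f hf + cls g hg := by
  unfold cls
  rw [← map_add]
  congr 1
  refine iCocycles_injective _ ?_
  rw [map_add]
  exact (iCocycles_mk _ _).trans (congrArg₂ _ (iCocycles_mk _ _) (iCocycles_mk _ _)).symm

theorem cls_smul {n : ℕ} (c : k) {f : (Fin n → G) → A.V} (hf : dd A n f = 0)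
    (h : dd A n (c • f) = 0) : cls (c • f) h = c • cls f hf := by
  unfold cls
  rw [← map_smul]
  congr 1
  refine iCocycles_injective _ ?_
  rw [map_smul]
  exact (iCocycles_mk _ _).trans (congrArg _ (iCocycles_mk _ _)).symm

theorem cls_congr {n : ℕ} {f g : (Fin n → G) → A.V} (hf : dd A n f = 0) (hfg : f = g) :
    cls f hf = cls g (hfg ▸ hf) := by
  subst hfg; rfl

theorem cls_eq_zero_succ {n : ℕ} {f : (Fin (n + 1) → G) → A.V} (hf : dd A (n + 1) f = 0) :
    cls f hf = 0 ↔ ∃ h : (Fin n → G) → A.V, f = dd A n h := by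
  unfold cls
  rw [π_eq_zero_succ]
  exact exists_congr fun h => by rw [show _ = f from iCocycles_mk f hf]

theorem cls_eq_zero_zero {f : (Fin 0 → G) → A.V} (hf : dd A 0 f = 0) :
    cls f hf = 0 ↔ f = 0 := by
  constructor
  · intro h
    have := congrArg (iCocycles A 0).hom (π_eq_zero_zero _ h)
    rw [map_zero] at this
    exact (iCocycles_mk f hf).symm.trans this
  · rintro rfl
    have h0 : dd A 0 ((0 : k) • (0 : (Fin 0 → G) → A.V)) = 0 := by rw [zero_smul]; exact hf
    rw [← zero_smul k (cls (0 : (Fin 0 → G) → A.V) hf), ← cls_smul 0 hf h0]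
    exact cls_congr _ (by simp)

/-- Cocycles which differ by a coboundary have the same class. -/
theorem cls_eq_of_sub {n : ℕ} {f g : (Fin (n + 1) → G) → A.V} (hf : dd A (n + 1) f = 0)
    (hg : dd A (n + 1) g = 0) (h : (Fin n → G) → A.V) (e : f = g + dd A n h) :
    cls f hf = cls g hg := by
  have h0 : cls (dd A n h) (dd_dd h) = 0 := (cls_eq_zero_succ _).2 ⟨h, rfl⟩
  rw [cls_congr hf e, cls_add hg (dd_dd h), h0, add_zero]

theorem cup_cls (μ : Pairing A B C) {p q : ℕ} {f : (Fin p → G) → A.V} {g : (Fin q → G) → B.V}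
    (hf : dd A p f = 0) (hg : dd B q g = 0) :
    cup μ p q (cls f hf) (cls g hg) = cls (cochain μ f g) (isCocycle_cochain μ hf hg) := by
  unfold cls
  rw [cup_π]
  congr 1
  refine iCocycles_injective _ ?_
  rw [iCocycles_cocycle]
  refine Eq.trans ?_ (iCocycles_mk _ _).symm
  exact congrArg₂ _ (iCocycles_mk f hf) (iCocycles_mk g hg)

theorem dd_map {G H : Type} [Group G] [Group H] {A : Rep.{0} k H} {B : Rep.{0} k G} (φ : G →* H)
    (α : Rep.res φ A ⟶ B) {n : ℕ} {f : (Fin n → H) → A.V} (hf : dd A n f = 0) :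
    dd B n (fun x => α.hom (f (φ ∘ x))) = 0 := by
  have := (cochainsMap φ α).comm n (n + 1)
  rw [inhomogeneousCochains.d_def, inhomogeneousCochains.d_def] at this
  have h2 := congr($(this).hom f)
  refine h2.trans ?_
  have h3 : (inhomogeneousCochains.d A n).hom f = 0 := hf
  simp only [ModuleCat.hom_comp, LinearMap.comp_apply]
  rw [h3, map_zero]

theorem map_cls {G H : Type} [Group G] [Group H] {A : Rep.{0} k H} {B : Rep.{0} k G} (φ : G →* H)
    (α : Rep.res φ A ⟶ B) {n : ℕ} {f : (Fin n → H) → A.V} (hf : dd A n f = 0) :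
    (groupCohomology.map φ α n).hom (cls f hf) =
      cls (fun x => α.hom (f (φ ∘ x))) (dd_map φ α hf) := by
  have h1 : (groupCohomology.map φ α n).hom ((π A n).hom (cocyclesMk f hf)) =
        (π B n).hom ((cocyclesMap φ α n).hom (cocyclesMk f hf)) :=
    congr($(π_map φ α n).hom (cocyclesMk f hf))
  unfold cls
  rw [h1]
  congr 1
  refine iCocycles_injective _ (Eq.trans ?_ (iCocycles_mk _ _).symm)
  have h2 := congr($(HomologicalComplex.cyclesMap_i (cochainsMap φ α) n).hom (cocyclesMk f hf))
  refine h2.trans ?_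
  have h3 : (iCocycles A n).hom (cocyclesMk f hf) = f := iCocycles_mk f hf
  simp only [ModuleCat.hom_comp, LinearMap.comp_apply]
  erw [h3]
  rfl

end classes

section morphisms

variable {k G : Type} [CommRing k] [Group G] {A B C : Rep.{0} k G}

/-- A morphism of representations, from an equivariant linear map. -/
def mkHom (e : A.V →ₗ[k] B.V) (h : ∀ g a, e (A.ρ g a) = B.ρ g (e a)) : A ⟶ B :=
  Rep.ofHom (ρ := A.ρ) (σ := B.ρ) { e with isIntertwining' := fun g => LinearMap.ext (h g) }

/-- The map induced on cohomology by a morphism of coefficients. -/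
def Hmap (f : A ⟶ B) (n : ℕ) : groupCohomology A n →ₗ[k] groupCohomology B n :=
  (groupCohomology.map (MonoidHom.id G) f n).hom

theorem dd_comp (f : A ⟶ B) {n : ℕ} (c : (Fin n → G) → A.V) :
    dd B n (fun x => f.hom (c x)) = fun x => f.hom (dd A n c x) := by
  have := (cochainsMap (MonoidHom.id G) f).comm n (n + 1)
  rw [inhomogeneousCochains.d_def, inhomogeneousCochains.d_def] at this
  exact congr($(this).hom c)

theorem dd_comp_eq_zero (f : A ⟶ B) {n : ℕ} {c : (Fin n → G) → A.V} (hc : dd A n c = 0) :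
    dd B n (fun x => f.hom (c x)) = 0 := by
  rw [dd_comp, hc]; funext x; exact map_zero f.hom

theorem Hmap_cls (f : A ⟶ B) {n : ℕ} {c : (Fin n → G) → A.V} (hc : dd A n c = 0) :
    Hmap f n (cls c hc) = cls (fun x => f.hom (c x)) (dd_comp_eq_zero f hc) :=
  map_cls (MonoidHom.id G) f hc

theorem Hmap_comp_apply (f : A ⟶ B) (g : B ⟶ C) (n : ℕ) (u : groupCohomology A n) :
    Hmap (f ≫ g) n u = Hmap g n (Hmap f n u) := by
  obtain ⟨c, hc, rfl⟩ := cls_surjective u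
  rw [Hmap_cls, Hmap_cls, Hmap_cls]
  rfl

theorem Hmap_id_apply (n : ℕ) (u : groupCohomology A n) : Hmap (𝟙 A) n u = u := by
  obtain ⟨c, hc, rfl⟩ := cls_surjective u
  rw [Hmap_cls]
  rfl

theorem Hmap_congr {f g : A ⟶ B} (h : ∀ a, f.hom a = g.hom a) (n : ℕ) : Hmap f n = Hmap g n := by
  have : f = g := Rep.hom_ext (DFunLike.ext _ _ h)
  rw [this]

/-- A bijective morphism of coefficients induces isomorphisms on cohomology. -/
def HmapEquiv (f : A ⟶ B) (h : Function.Bijective f.hom) (n : ℕ) :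
    groupCohomology A n ≃ₗ[k] groupCohomology B n :=
  let e := LinearEquiv.ofBijective f.hom.toLinearMap h
  let g : B ⟶ A := mkHom e.symm.toLinearMap fun g b => by
    obtain ⟨a, rfl⟩ := e.surjective b
    have : B.ρ g (e a) = e (A.ρ g a) := (Rep.hom_comm_apply f g a).symm
    rw [this]
    simp
  LinearEquiv.ofLinearMap (Hmap f n) (Hmap g n)
    (LinearMap.ext fun u => by
      rw [LinearMap.comp_apply, ← Hmap_comp_apply, Hmap_congr (g := 𝟙 B), Hmap_id_apply]; rfl
      intro b; exact e.apply_symm_apply b)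
    (LinearMap.ext fun u => by
      rw [LinearMap.comp_apply, ← Hmap_comp_apply, Hmap_congr (g := 𝟙 A), Hmap_id_apply]; rfl
      intro b; exact e.symm_apply_apply b)

/-- Cup products are natural in the coefficients. -/
theorem Hmap_cup {A B C A' B' C' : Rep.{0} k G} (μ : Pairing A B C) (μ' : Pairing A' B' C')
    (α : A ⟶ A') (β : B ⟶ B') (γ : C ⟶ C')
    (h : ∀ a b, γ.hom (μ.toLin a b) = μ'.toLin (α.hom a) (β.hom b)) {p q : ℕ}
    (x : groupCohomology A p) (y : groupCohomology B q) :
    Hmap γ (p + q) (cup μ p q x y) = cup μ' p q (Hmap α p x) (Hmap β q y) :=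
  map_cup (MonoidHom.id G) μ μ' α β γ h p q x y

end morphisms

section exact

variable {k G : Type} [CommRing k] [Group G]

/-- A short exact sequence `0 → A → B → C → 0` of representations. -/
structure SES (A B C : Rep.{0} k G) where
  i : A ⟶ B
  p : B ⟶ C
  inj : Function.Injective i.hom
  surj : Function.Surjective p.hom
  exact : ∀ b, p.hom b = 0 ↔ ∃ a, i.hom a = b

namespace SES

variable {A B C : Rep.{0} k G} (S : SES A B C)

/-- The underlying short complex. -/
def toShortComplex : ShortComplex (Rep.{0} k G) :=
  ShortComplex.mk S.i S.p (Rep.hom_ext (DFunLike.ext _ _ fun a => (S.exact _).2 ⟨a, rfl⟩))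

theorem shortExact : S.toShortComplex.ShortExact where
  exact := by
    rw [← ShortComplex.exact_map_iff_of_faithful _ (forget₂ (Rep.{0} k G) (ModuleCat k)),
      ShortComplex.moduleCat_exact_iff]
    exact fun b hb => (S.exact b).1 hb
  mono_f := (Rep.mono_iff_injective _).2 S.inj
  epi_g := (Rep.epi_iff_surjective _).2 S.surj

/-- The connecting homomorphism. -/
def δ (n : ℕ) : groupCohomology C n →ₗ[k] groupCohomology A (n + 1) :=
  (groupCohomology.δ S.shortExact n (n + 1) rfl).hom

theorem exact₁ (n : ℕ) : Function.Exact (S.δ n) (Hmap S.i (n + 1)) :=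
  (ShortComplex.ShortExact.moduleCat_exact_iff_function_exact _).1
    (mapShortComplex₁_exact S.shortExact rfl)

theorem exact₂ (n : ℕ) : Function.Exact (Hmap S.i n) (Hmap S.p n) :=
  (ShortComplex.ShortExact.moduleCat_exact_iff_function_exact _).1
    (mapShortComplex₂_exact S.shortExact n)

theorem exact₃ (n : ℕ) : Function.Exact (Hmap S.p n) (S.δ n) :=
  (ShortComplex.ShortExact.moduleCat_exact_iff_function_exact _).1
    (mapShortComplex₃_exact S.shortExact rfl)

theorem injective_zero : Function.Injective (Hmap S.i 0) := by
  rw [injective_iff_map_eq_zero]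
  intro u hu
  obtain ⟨c, hc, rfl⟩ := cls_surjective u
  rw [Hmap_cls, cls_eq_zero_zero] at hu
  rw [cls_eq_zero_zero]
  funext x
  exact S.inj ((congr_fun hu x).trans (map_zero S.i.hom).symm)

theorem δ_cls {n : ℕ} {c : (Fin n → G) → C.V} (hc : dd C n c = 0) (b : (Fin n → G) → B.V)
    (hb : ∀ x, S.p.hom (b x) = c x) (a : (Fin (n + 1) → G) → A.V)
    (ha : ∀ x, S.i.hom (a x) = dd B n b x) (ha' : dd A (n + 1) a = 0) :
    S.δ n (cls c hc) = cls a ha' := by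
  refine δ_apply S.shortExact rfl c ?_ b (funext hb) a ?_
  · change (inhomogeneousCochains C).d n (n + 1) c = 0
    rw [inhomogeneousCochains.d_def]; exact hc
  · change _ = (inhomogeneousCochains B).d n (n + 1) b
    rw [inhomogeneousCochains.d_def]; exact funext ha

end SES

end exact

/-! ### Cup products: associativity, invariants and connecting homomorphisms -/

section cupAssoc

theorem shift_shift {G : Type} (p q : ℕ) (x : ℕ → G) : shift q (shift p x) = shift (p + q) x := by
  funext i; simp [shift, add_assoc]

variable {k G : Type} [CommRing k] [Group G]

theorem headProd_add (p q : ℕ) (x : ℕ → G) :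
    headProd (p + q) x = headProd p x * headProd q (shift p x) := by
  induction q with
  | zero => simp [headProd]
  | succ q ih => rw [← add_assoc, headProd_succ, ih, headProd_succ, mul_assoc]; rfl

/-- Classes of cocycles which agree, up to the identification of the degrees, are equal. -/
theorem sigma_cls {A : Rep.{0} k G} {m n : ℕ} (h : m = n) {f : (Fin m → G) → A.V}
    {g : (Fin n → G) → A.V} (hf : dd A m f = 0) (hg : dd A n g = 0)
    (e : ∀ x, ev f x = ev g x) :
    (⟨m, cls f hf⟩ : Σ n, groupCohomology A n) = ⟨n, cls g hg⟩ := by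
  subst h
  obtain rfl := ext_ev e
  rfl

/-- Cup products are associative. -/
theorem cup_assoc {A B C AB BC D : Rep.{0} k G} (μ : Pairing A B AB) (ν : Pairing AB C D)
    (μ' : Pairing B C BC) (ν' : Pairing A BC D)
    (h : ∀ a b c, ν.toLin (μ.toLin a b) c = ν'.toLin a (μ'.toLin b c)) {p q r : ℕ}
    (x : groupCohomology A p) (y : groupCohomology B q) (z : groupCohomology C r) :
    (⟨p + q + r, cup ν (p + q) r (cup μ p q x y) z⟩ : Σ n, groupCohomology D n) =
      ⟨p + (q + r), cup ν' p (q + r) x (cup μ' q r y z)⟩ := by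
  obtain ⟨f, hf, rfl⟩ := cls_surjective x
  obtain ⟨g, hg, rfl⟩ := cls_surjective y
  obtain ⟨l, hl, rfl⟩ := cls_surjective z
  rw [cup_cls, cup_cls, cup_cls, cup_cls]
  refine sigma_cls (add_assoc p q r) _ _ fun x => ?_
  rw [ev_cochain, ev_cochain, ev_cochain, ev_cochain, h, headProd_add, shift_shift, map_mul,
    ← μ'.map_ρ]
  rfl

theorem cup_assoc_one {A B C AB BC D : Rep.{0} k G} (μ : Pairing A B AB) (ν : Pairing AB C D)
    (μ' : Pairing B C BC) (ν' : Pairing A BC D)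
    (h : ∀ a b c, ν.toLin (μ.toLin a b) c = ν'.toLin a (μ'.toLin b c)) {p : ℕ}
    (x : groupCohomology A p) (y : groupCohomology B 1) (z : groupCohomology C 1) :
    cup ν (p + 1) 1 (cup μ p 1 x y) z = cup ν' p (1 + 1) x (cup μ' 1 1 y z) :=
  eq_of_heq (Sigma.mk.inj (cup_assoc μ ν μ' ν' h x y z)).2

/-- Cup product with the class of an invariant, from the left. -/
theorem cup_zero_left {A B C : Rep.{0} k G} (μ : Pairing A B C) (f : B ⟶ C)
    (a : (Fin 0 → G) → A.V) (ha : dd A 0 a = 0)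
    (h : ∀ b, f.hom b = μ.toLin (ev a 1) b) {q : ℕ} (y : groupCohomology B q) :
    (⟨0 + q, cup μ 0 q (cls a ha) y⟩ : Σ n, groupCohomology C n) = ⟨q, Hmap f q y⟩ := by
  obtain ⟨g, hg, rfl⟩ := cls_surjective y
  rw [cup_cls, Hmap_cls]
  refine sigma_cls (zero_add q) _ _ fun x => ?_
  rw [ev_cochain, ev_congr a (y := 1) (by simp), ← h]
  have e : shift 0 x = x := by funext i; simp [shift]
  simp [headProd, e]
  rfl

/-- Cup product with the class of an invariant, from the right. -/
theorem cup_zero_right {A B C : Rep.{0} k G} (μ : Pairing A B C) (f : A ⟶ C)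
    (b : B.V) (hb : ∀ g, B.ρ g b = b) (hb' : dd B 0 (fun _ => b) = 0)
    (h : ∀ a, f.hom a = μ.toLin a b) {p : ℕ} (x : groupCohomology A p) :
    cup μ p 0 x (cls (fun _ => b) hb') = Hmap f p x := by
  obtain ⟨g, hg, rfl⟩ := cls_surjective x
  rw [cup_cls, Hmap_cls]
  refine cls_congr _ (funext fun x => ?_)
  rw [h]
  unfold cochain
  rw [hb]
  rfl

end cupAssoc

section invariants

variable {k G : Type} [CommRing k] [Group G] {A B : Rep.{0} k G}

theorem dd_zero_apply (f : (Fin 0 → G) → A.V) (x : ℕ → G) :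
    ev (dd A 0 f) x = A.ρ (x 0) (ev f 1) - ev f 1 := by
  rw [ev_d, ev_congr f (x := shift 1 x) (y := 1) (by simp)]
  simp only [zero_add, Finset.range_one, Finset.sum_singleton, pow_one, neg_smul, one_smul]
  rw [ev_congr f (x := contr 0 x) (y := 1) (by simp), sub_eq_add_neg]

theorem dd_const_iff (a : A.V) : dd A 0 (fun _ => a) = 0 ↔ ∀ g, A.ρ g a = a := by
  constructor
  · intro h g
    have := dd_zero_apply (A := A) (fun _ => a) (fun _ => g)
    rw [h] at this
    exact (sub_eq_zero.1 this.symm)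
  · intro h
    refine ext_ev fun x => ?_
    rw [dd_zero_apply]
    exact sub_eq_zero.2 (h _)

/-- The class in `H⁰` of an invariant element. -/
def cls₀ (a : A.V) (h : ∀ g, A.ρ g a = a) : groupCohomology A 0 :=
  cls (fun _ => a) ((dd_const_iff a).2 h)

theorem cls₀_surjective (u : groupCohomology A 0) : ∃ a, ∃ h : ∀ g, A.ρ g a = a, cls₀ a h = u := by
  obtain ⟨f, hf, rfl⟩ := cls_surjective u
  have e : f = fun _ => ev f 1 := by
    funext x; exact congrArg f (Subsingleton.elim _ _)
  exact ⟨ev f 1, (dd_const_iff _).1 (by rw [← e]; exact hf), (cls_congr hf e).symm⟩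

theorem Hmap_cls₀ (f : A ⟶ B) (a : A.V) (h : ∀ g, A.ρ g a = a) :
    Hmap f 0 (cls₀ a h) = cls₀ (f.hom a) (fun g => by rw [← Rep.hom_comm_apply, h]) :=
  Hmap_cls f _

theorem cls₀_eq_zero (a : A.V) (h : ∀ g, A.ρ g a = a) : cls₀ a h = 0 ↔ a = 0 :=
  (cls_eq_zero_zero _).trans ⟨fun e => congr_fun e ![], fun e => funext fun _ => e⟩

/-- `H⁰` is the space of invariants. -/
def H0Equiv (A : Rep.{0} k G) : A.ρ.invariants ≃ₗ[k] groupCohomology A 0 :=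
  let f : A.ρ.invariants →ₗ[k] groupCohomology A 0 :=
    { toFun := fun a => cls₀ a.1 a.2
      map_add' := fun a b => cls_add ((dd_const_iff _).2 a.2) ((dd_const_iff _).2 b.2)
        ((dd_const_iff _).2 (a + b).2)
      map_smul' := fun c a => cls_smul c ((dd_const_iff _).2 a.2) ((dd_const_iff _).2 (c • a).2) }
  LinearEquiv.ofBijective f
    ⟨(injective_iff_map_eq_zero f).2 fun a h => Subtype.ext ((cls₀_eq_zero a.1 a.2).1 h),
      fun u => by
        obtain ⟨a, h, rfl⟩ := cls₀_surjective u
        exact ⟨⟨a, h⟩, rfl⟩⟩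

end invariants

section finite

variable {k G : Type} [Field k] [Group G] [Finite G]

theorem finite_groupCohomology (A : Rep.{0} k G) [Module.Finite k A.V] (n : ℕ) :
    Module.Finite k (groupCohomology A n) := by
  have : Module.Finite k ((Fin n → G) → A.V) := inferInstance
  have h1 : Module.Finite k (cocycles A n) :=
    Module.Finite.of_injective (iCocycles A n).hom (iCocycles_injective n)
  exact Module.Finite.of_surjective (π A n).hom (π_surjective n)

end finite

section char2

variable {G : Type} [Group G]

theorem smul_neg_one_pow {V : Type} [AddCommGroup V] [Module (ZMod 2) V] (n : ℕ) (v : V) :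
    (-1 : ZMod 2) ^ n • v = v := by
  rw [show (-1 : ZMod 2) = 1 by decide, one_pow, one_smul]

theorem char_two_add_self {V : Type} [AddCommGroup V] [Module (ZMod 2) V] (v : V) : v + v = 0 := by
  rw [← two_smul (ZMod 2) v, show (2 : ZMod 2) = 0 by decide, zero_smul]

theorem char_two_neg {V : Type} [AddCommGroup V] [Module (ZMod 2) V] (v : V) : -v = v :=
  neg_eq_of_add_eq_zero_left (char_two_add_self v)

theorem char_two_sub {V : Type} [AddCommGroup V] [Module (ZMod 2) V] (v w : V) : v - w = v + w := by
  rw [sub_eq_add_neg, char_two_neg]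

theorem ev_dd {A : Rep.{0} (ZMod 2) G} {n : ℕ} (f : (Fin n → G) → A.V) (x : ℕ → G) :
    ev (dd A n f) x = A.ρ (x 0) (ev f (shift 1 x)) +
      ∑ j ∈ Finset.range (n + 1), ev f (contr j x) := by
  rw [ev_d]
  simp only [smul_neg_one_pow]

/-- Over a field of characteristic two, connecting homomorphisms commute with cup products from the
left. -/
theorem δ_cup {A B C A' B' C' Z : Rep.{0} (ZMod 2) G} (S : SES A B C) (S' : SES A' B' C')
    (μA : Pairing Z A A') (μB : Pairing Z B B') (μC : Pairing Z C C')
    (hi : ∀ z a, S'.i.hom (μA.toLin z a) = μB.toLin z (S.i.hom a))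
    (hp : ∀ z b, S'.p.hom (μB.toLin z b) = μC.toLin z (S.p.hom b)) {p q : ℕ}
    (z : groupCohomology Z p) (c : groupCohomology C q) :
    S'.δ (p + q) (cup μC p q z c) = cup μA p (q + 1) z (S.δ q c) := by
  obtain ⟨z, hz, rfl⟩ := cls_surjective z
  obtain ⟨c, hc, rfl⟩ := cls_surjective c
  choose b hb using fun x => S.surj (c x)
  have h0 : ∀ x, S.p.hom (dd B q b x) = 0 := by
    intro x
    have h1 := congr_fun (dd_comp S.p b) x
    rw [funext hb, hc] at h1
    exact h1.symm
  choose a ha using fun x => (S.exact _).1 (h0 x)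
  have ha' : dd A (q + 1) a = 0 := by
    funext x
    refine S.inj ?_
    have h1 := congr_fun (dd_comp S.i a) x
    rw [funext ha, dd_dd] at h1
    rw [← h1, Pi.zero_apply, Pi.zero_apply, map_zero]
  rw [S.δ_cls hc b hb a ha ha', cup_cls, cup_cls]
  refine S'.δ_cls _ (cochain μB z b) (fun x => ?_) _ (fun x => ?_) _
  · unfold cochain
    rw [hp, Rep.hom_comm_apply, hb]
  · have e := ext_ev (f := dd B' (p + q) (cochain μB z b))
      (g := cochain (q := q + 1) μB z (dd B q b)) fun x => by
      rw [leibniz, hz, smul_neg_one_pow]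
      have : ev (0 : (Fin (p + 1) → G) → Z.V) x = 0 := rfl
      rw [this, map_zero, LinearMap.zero_apply, zero_add]
      rfl
    rw [e]
    unfold cochain
    rw [hi, Rep.hom_comm_apply, ha]

end char2

/-! ### Direct sums and tensor products with matrix representations -/

section dimensions

variable {k : Type} [Field k] {U V W : Type} [AddCommGroup U] [AddCommGroup V] [AddCommGroup W]
  [Module k U] [Module k V] [Module k W]

theorem finrank_eq_add_of_exact [Module.Finite k V] (f : U →ₗ[k] V) (g : V →ₗ[k] W)
    (hf : Function.Injective f) (h : Function.Exact f g) (hg : Function.Surjective g) :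
    Module.finrank k V = Module.finrank k U + Module.finrank k W := by
  rw [← LinearMap.finrank_range_add_finrank_ker g, LinearMap.exact_iff.1 h,
    LinearMap.finrank_range_of_inj hf, LinearMap.range_eq_top.2 hg, finrank_top, add_comm]

end dimensions

section sums

variable {k G : Type} [Field k] [Group G] {A B C : Rep.{0} k G}

/-- The action on a direct sum of two representations. -/
def prodρ (A B : Rep.{0} k G) : Representation k G (A.V × B.V) where
  toFun := fun g => (A.ρ g).prodMap (B.ρ g)
  map_one' := by ext <;> simp
  map_mul' := fun g h => by ext <;> simp

theorem prodρ_apply (g : G) (x : A.V × B.V) : prodρ A B g x = (A.ρ g x.1, B.ρ g x.2) := rfl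

/-- The direct sum of two representations. -/
abbrev prodRep (A B : Rep.{0} k G) : Rep.{0} k G := Rep.of (prodρ A B)

/-- The first inclusion. -/
def prodInl : A ⟶ prodRep A B :=
  mkHom (B := prodRep A B) (LinearMap.inl k A.V B.V) fun g a => by
    rw [prodρ_apply]; simp

/-- The second inclusion. -/
def prodInr : B ⟶ prodRep A B :=
  mkHom (B := prodRep A B) (LinearMap.inr k A.V B.V) fun g a => by
    rw [prodρ_apply]; simp

/-- The first projection. -/
def prodFst : prodRep A B ⟶ A := mkHom (A := prodRep A B) (LinearMap.fst k A.V B.V) fun _ _ => rfl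

/-- The second projection. -/
def prodSnd : prodRep A B ⟶ B := mkHom (A := prodRep A B) (LinearMap.snd k A.V B.V) fun _ _ => rfl

/-- The morphism out of a direct sum. -/
def prodDesc (f : A ⟶ C) (g : B ⟶ C) : prodRep A B ⟶ C :=
  mkHom (A := prodRep A B) (f.hom.toLinearMap.coprod g.hom.toLinearMap) fun x a => by
    rw [prodρ_apply]
    change f.hom (A.ρ x a.1) + g.hom (B.ρ x a.2) = C.ρ x (f.hom a.1 + g.hom a.2)
    rw [map_add, Rep.hom_comm_apply, Rep.hom_comm_apply]

theorem prodDesc_apply (f : A ⟶ C) (g : B ⟶ C) (x : (prodRep A B).V) :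
    (prodDesc f g).hom x = f.hom x.1 + g.hom x.2 := rfl

theorem Hmap_add_apply (f g h : A ⟶ B) (e : ∀ a, h.hom a = f.hom a + g.hom a) {n : ℕ}
    (u : groupCohomology A n) : Hmap h n u = Hmap f n u + Hmap g n u := by
  obtain ⟨c, hc, rfl⟩ := cls_surjective u
  rw [Hmap_cls, Hmap_cls, Hmap_cls, ← cls_add]
  · exact cls_congr _ (funext fun x => e _)

theorem Hmap_zero_apply (f : A ⟶ B) (e : ∀ a, f.hom a = 0) {n : ℕ}
    (u : groupCohomology A n) : Hmap f n u = 0 := by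
  have := Hmap_add_apply f f f (fun a => by rw [e, add_zero]) u
  exact add_eq_left.1 this.symm

/-- Cohomology of a direct sum. -/
def HprodEquiv (A B : Rep.{0} k G) (n : ℕ) :
    groupCohomology (prodRep A B) n ≃ₗ[k] groupCohomology A n × groupCohomology B n :=
  LinearEquiv.ofLinearMap ((Hmap prodFst n).prod (Hmap prodSnd n))
    ((Hmap prodInl n).coprod (Hmap prodInr n))
    (LinearMap.ext fun u => by
      have h1 := Hmap_congr (f := prodInl (A := A) (B := B) ≫ prodFst) (g := 𝟙 A) (fun _ => rfl) n
      have h2 := Hmap_congr (f := prodInr (A := A) (B := B) ≫ prodSnd) (g := 𝟙 B) (fun _ => rfl) n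
      have h3 := Hmap_zero_apply (n := n) (prodInr (A := A) (B := B) ≫ prodFst) (fun _ => rfl) u.2
      have h4 := Hmap_zero_apply (n := n) (prodInl (A := A) (B := B) ≫ prodSnd) (fun _ => rfl) u.1
      rw [Hmap_comp_apply] at h3 h4
      have h1 := LinearMap.congr_fun h1 u.1
      have h2 := LinearMap.congr_fun h2 u.2
      rw [Hmap_comp_apply, Hmap_id_apply] at h1 h2
      refine Prod.ext ?_ ?_
      · simp [h1, h3]
      · simp [h2, h4])
    (LinearMap.ext fun u => by
      have := Hmap_add_apply (prodFst (A := A) (B := B) ≫ prodInl) (prodSnd ≫ prodInr) (𝟙 _)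
        (fun a => Prod.ext (add_zero _).symm (zero_add _).symm) u
      rw [Hmap_comp_apply, Hmap_comp_apply, Hmap_id_apply] at this
      exact this.symm)

theorem Hprod_decomp (f : A ⟶ C) (g : B ⟶ C) {n : ℕ} (u : groupCohomology (prodRep A B) n) :
    ∃ a b, Hmap (prodDesc f g) n u = Hmap f n a + Hmap g n b := by
  refine ⟨Hmap prodFst n u, Hmap prodSnd n u, ?_⟩
  rw [← Hmap_comp_apply, ← Hmap_comp_apply]
  exact Hmap_add_apply _ _ _ (fun _ => rfl) u

variable [Finite G] in
theorem finrank_Hprod [Module.Finite k A.V] [Module.Finite k B.V] (n : ℕ) :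
    Module.finrank k (groupCohomology (prodRep A B) n) =
      Module.finrank k (groupCohomology A n) + Module.finrank k (groupCohomology B n) := by
  have := finite_groupCohomology A n
  have := finite_groupCohomology B n
  rw [(HprodEquiv A B n).finrank_eq, Module.finrank_prod]

end sums

section act

variable {k : Type} [CommRing k] {I J L V W : Type} [Fintype I] [Fintype J] [Fintype L]
  [AddCommGroup V] [Module k V] [AddCommGroup W] [Module k W]

omit [Fintype I] in
/-- A matrix over `k` acting on vectors with entries in a `k`-module. -/
def act (P : Matrix I J k) : (J → V) →ₗ[k] (I → V) where
  toFun f i := ∑ j, P i j • f j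
  map_add' f g := by ext i; simp [Finset.sum_add_distrib]
  map_smul' c f := by ext i; simp [Finset.smul_sum, smul_comm c]

omit [Fintype I] in
theorem act_apply (P : Matrix I J k) (f : J → V) (i : I) : act P f i = ∑ j, P i j • f j := rfl

omit [Fintype I] in
theorem act_mul (P : Matrix I J k) (Q : Matrix J L k) (f : L → V) :
    act (P * Q) f = act P (act Q f) := by
  ext i
  simp only [act_apply, Matrix.mul_apply, Finset.sum_smul, Finset.smul_sum, mul_smul]
  exact Finset.sum_comm

theorem act_one [DecidableEq I] (f : I → V) : act (1 : Matrix I I k) f = f := by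
  ext i
  simp [act_apply, Matrix.one_apply]

omit [Fintype I] in
theorem act_zero (f : J → V) : act (0 : Matrix I J k) f = 0 := by
  ext i
  simp [act_apply]

omit [Fintype I] in
theorem act_add (P Q : Matrix I J k) (f : J → V) : act (P + Q) f = act P f + act Q f := by
  ext i
  simp [act_apply, add_smul, Finset.sum_add_distrib]

omit [Fintype I] in
theorem act_map (P : Matrix I J k) (e : V →ₗ[k] W) (f : J → V) (i : I) :
    act P (fun j => e (f j)) i = e (act P f i) := by
  simp [act_apply]

end act

section T

variable {k G : Type} [CommRing k] [Group G] {I J L : Type} [Fintype I] [Fintype J] [Fintype L]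
  [DecidableEq I] [DecidableEq J] [DecidableEq L]

/-- The action on the tensor product of the matrix representation `ρ` with the representation `W`,
realized on the vectors with entries in `W`. -/
def Tρ (ρ : G →* Matrix I I k) (W : Rep.{0} k G) : Representation k G (I → W.V) where
  toFun := fun g => (act (ρ g)).comp ((W.ρ g).compLeft I)
  map_one' := by
    refine LinearMap.ext fun f => ?_
    change act (ρ 1) (fun i => W.ρ 1 (f i)) = f
    simp [act_one]
  map_mul' := fun g h => by
    refine LinearMap.ext fun f => ?_
    change act (ρ (g * h)) (fun i => W.ρ (g * h) (f i)) =
      act (ρ g) (fun i => W.ρ g (act (ρ h) (fun i => W.ρ h (f i)) i))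
    rw [map_mul, act_mul]
    congr 1
    funext i
    rw [← act_map, map_mul]
    rfl

/-- The tensor product of the matrix representation `ρ` with the representation `W`. -/
abbrev T (ρ : G →* Matrix I I k) (W : Rep.{0} k G) : Rep.{0} k G := Rep.of (Tρ ρ W)

variable {ρ : G →* Matrix I I k} {ρ' : G →* Matrix J J k} {ρ'' : G →* Matrix L L k}
  {W W' W'' : Rep.{0} k G}

theorem T_ρ (g : G) (f : I → W.V) :
    Tρ ρ W g f = act (ρ g) (fun i => W.ρ g (f i)) := rfl

instance [Module.Finite k W.V] : Module.Finite k (T ρ W).V :=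
  inferInstanceAs (Module.Finite k (I → W.V))

/-- The morphism `T ρ W ⟶ T ρ' W` given by an intertwining matrix. -/
def Tmat (W : Rep.{0} k G) (P : Matrix J I k) (h : ∀ g, P * ρ g = ρ' g * P) : T ρ W ⟶ T ρ' W :=
  mkHom (A := T ρ W) (B := T ρ' W) (act P) fun g f => by
    rw [T_ρ, T_ρ, ← act_mul, h, act_mul]
    congr 1
    funext i
    exact act_map P (W.ρ g) f i

theorem Tmat_apply (P : Matrix J I k) (h : ∀ g, P * ρ g = ρ' g * P) (f : I → W.V) :
    (Tmat W P h).hom f = act P f := rfl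

open Kronecker in
/-- The tensor product of two matrix representations. -/
def kron (ρ : G →* Matrix I I k) (ρ' : G →* Matrix J J k) : G →* Matrix (I × J) (I × J) k where
  toFun g := (ρ g) ⊗ₖ (ρ' g)
  map_one' := by simp
  map_mul' g h := by rw [map_mul, map_mul, Matrix.mul_kronecker_mul]

/-- Associativity of the tensor product with matrix representations. -/
def Tcurry (ρ : G →* Matrix I I k) (ρ' : G →* Matrix J J k) (W : Rep.{0} k G) :
    T (kron ρ ρ') W ⟶ T ρ (T ρ' W) :=
  mkHom (A := T (kron ρ ρ') W) (B := T ρ (T ρ' W))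
    { toFun := fun f i j => f (i, j), map_add' := fun _ _ => rfl, map_smul' := fun _ _ => rfl }
    fun g f => by
      funext i j
      change ∑ p : I × J, (ρ g i p.1 * ρ' g j p.2) • W.ρ g (f p) =
        act (ρ g) (fun i => Tρ ρ' W g (fun j => f (i, j))) i j
      simp only [act_apply, T_ρ, Finset.sum_apply, Pi.smul_apply, Finset.smul_sum,
        Fintype.sum_prod_type, mul_smul]

theorem Tcurry_bijective : Function.Bijective (Tcurry ρ ρ' W).hom :=
  ⟨fun _ _ h => funext fun p => congr_fun (congr_fun h p.1) p.2,
    fun f => ⟨fun p => f p.1 p.2, rfl⟩⟩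

/-- Collapsing a trivial matrix factor. -/
def Tone (W : Rep.{0} k G) : T (1 : G →* Matrix Unit Unit k) W ⟶ W :=
  mkHom (A := T (1 : G →* Matrix Unit Unit k) W) (LinearMap.proj ()) fun g f => by
    change ∑ j : Unit, (1 : Matrix Unit Unit k) () j • W.ρ g (f j) = W.ρ g (f ())
    simp

theorem Tone_bijective : Function.Bijective (Tone W).hom :=
  ⟨fun _ _ h => funext fun _ => h, fun w => ⟨fun _ => w, rfl⟩⟩

end T

/-! ### Permutation modules and extensions of the trivial module -/

section perm

variable {k G : Type} [CommRing k] [Group G] {Ω : Type} [Fintype Ω] [DecidableEq Ω]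

/-- The matrices of a permutation representation. -/
def permMat (k : Type) [CommRing k] {G : Type} [Group G] (Ω : Type) [Fintype Ω] [DecidableEq Ω]
    [MulAction G Ω] : G →* Matrix Ω Ω k where
  toFun g := Matrix.of fun i j => if i = g • j then 1 else 0
  map_one' := by ext i j; simp [Matrix.one_apply]
  map_mul' g h := by
    ext i j
    simp [Matrix.mul_apply, mul_smul]

theorem act_permMat [MulAction G Ω] {V : Type} [AddCommGroup V] [Module k V] (g : G) (f : Ω → V)
    (i : Ω) : act (permMat k Ω g) f i = f (g⁻¹ • i) := by
  have h : ∀ j, (i = g • j) ↔ (g⁻¹ • i = j) := fun j => inv_smul_eq_iff.symm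
  simp [act_apply, permMat, h]

theorem permMat_ρ_apply [MulAction G Ω] {W : Rep.{0} k G} (g : G) (f : Ω → W.V) (i : Ω) :
    Tρ (permMat k Ω) W g f i = W.ρ g (f (g⁻¹ • i)) :=
  act_permMat g _ i

end perm

section regular

variable {G : Type} [Group G] [Fintype G] [DecidableEq G] {W : Rep.{0} (ZMod 2) G}

/-- The free module `k[G] ⊗ W` has no cohomology in positive degrees: evaluating the first variable
of a homogeneous cochain at the group element indexing the component is a contraction. -/
theorem eq_zero_of_regular (n : ℕ)
    (u : groupCohomology (T (permMat (ZMod 2) G) W) (n + 1)) : u = 0 := by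
  obtain ⟨f, hf, rfl⟩ := cls_surjective u
  rw [cls_eq_zero_succ]
  let cons : G → (ℕ → G) → ℕ → G := fun u x i => if i = 0 then u else x (i - 1)
  have hcons : ∀ (m : ℕ) (c : (Fin (m + 1) → G) → G → W.V) (u : G) (x : ℕ → G),
      ev c (cons u x) = c (Fin.cons u fun i => x i) := by
    intro m c u x
    unfold ev
    congr 1
    funext i
    refine Fin.cases ?_ (fun j => ?_) i
    · simp [cons]
    · simp [cons]
  let s : (Fin n → G) → G → W.V := fun x u => W.ρ u (f (Fin.cons u⁻¹ x) 1)
  have hs : ∀ (x : ℕ → G) (u : G), ev s x u = W.ρ u (ev f (cons u⁻¹ x) 1) := fun x u => by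
    rw [hcons]; rfl
  refine ⟨s, ext_ev fun x => funext fun u => ?_⟩
  have h : ev (dd (T (permMat (ZMod 2) G) W) (n + 1) f) (cons u⁻¹ x) = (0 : G → W.V) := by
    rw [hf]; rfl
  rw [ev_dd] at h
  have h := congrArg (W.ρ u) (congr_fun h 1)
  rw [Finset.sum_range_succ'] at h
  have e1 : shift 1 (cons u⁻¹ x) = x := by funext i; simp [shift, cons]
  have e2 : ∀ j, contr (j + 1) (cons u⁻¹ x) = cons u⁻¹ (contr j x) := by
    intro j
    funext i
    rcases i with _ | i
    · simp [contr, cons]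
    · rcases i with _ | i
      · simp [contr, cons, eq_comm]
      · simp [contr, cons]
  have e3 : contr 0 (cons u⁻¹ x) = cons (u⁻¹ * x 0) (shift 1 x) := by
    funext i
    rcases i with _ | i
    · simp [contr, cons]
    · simp [contr, cons, shift, add_comm]
  have e4 : cons u⁻¹ x 0 = u⁻¹ := rfl
  rw [Pi.add_apply, permMat_ρ_apply, e1, e3, e4] at h
  simp only [e2, Pi.add_apply, Finset.sum_apply, map_add, map_sum, Pi.zero_apply, map_zero] at h
  rw [← Module.End.mul_apply, ← map_mul, mul_inv_cancel, map_one, Module.End.one_apply, inv_inv,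
    smul_eq_mul, mul_one] at h
  rw [ev_dd, Pi.add_apply, permMat_ρ_apply, hs, ← Module.End.mul_apply, ← map_mul, Finset.sum_apply]
  simp only [hs]
  rw [smul_eq_mul, mul_inv_cancel_left, mul_inv_rev, inv_inv]
  rw [add_comm (Finset.sum _ _)] at h
  exact sub_eq_zero.1 ((char_two_sub _ _).trans h)

end regular

/-- The trivial one-dimensional matrix representation. -/
abbrev oneMat (k G : Type) [CommRing k] [Group G] : G →* Matrix Unit Unit k := 1

section matSES

variable {k G : Type} [CommRing k] [Group G] {I J L : Type} [Fintype I] [Fintype J] [Fintype L]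
  [DecidableEq I] [DecidableEq J] [DecidableEq L]

/-- A short exact sequence of matrix representations, with a splitting over `k`. -/
structure MatSES (ρ₁ : G →* Matrix I I k) (ρ₂ : G →* Matrix J J k) (ρ₃ : G →* Matrix L L k) where
  P : Matrix J I k
  Q : Matrix L J k
  P' : Matrix I J k
  Q' : Matrix J L k
  hP : ∀ g, P * ρ₁ g = ρ₂ g * P
  hQ : ∀ g, Q * ρ₂ g = ρ₃ g * Q
  left_inv : P' * P = 1
  right_inv : Q * Q' = 1
  comp : Q * P = 0
  split : P * P' + Q' * Q = 1

variable {ρ₁ : G →* Matrix I I k} {ρ₂ : G →* Matrix J J k} {ρ₃ : G →* Matrix L L k}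

/-- The short exact sequence obtained by tensoring with a representation. -/
def MatSES.ses (E : MatSES ρ₁ ρ₂ ρ₃) (W : Rep.{0} k G) : SES (T ρ₁ W) (T ρ₂ W) (T ρ₃ W) where
  i := Tmat W E.P E.hP
  p := Tmat W E.Q E.hQ
  inj f g h := by
    have := congrArg (act E.P') h
    rwa [Tmat_apply, Tmat_apply, ← act_mul, ← act_mul, E.left_inv, act_one, act_one] at this
  surj f := ⟨act E.Q' f, by rw [Tmat_apply, ← act_mul, E.right_inv, act_one]⟩
  exact f := by
    constructor
    · intro h
      refine ⟨act E.P' f, ?_⟩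
      have := act_add (E.P * E.P') (E.Q' * E.Q) f
      rw [E.split, act_one, act_mul, act_mul] at this
      rw [Tmat_apply] at h
      rw [h, map_zero, add_zero] at this
      exact this.symm
    · rintro ⟨f, rfl⟩
      rw [Tmat_apply, Tmat_apply, ← act_mul, E.comp, act_zero]

/-- The inverse of a bijective morphism. -/
def invHom {A B : Rep.{0} k G} (e : A ⟶ B) (h : Function.Bijective e.hom) : B ⟶ A :=
  mkHom (LinearEquiv.ofBijective e.hom.toLinearMap h).symm.toLinearMap fun g b => by
    refine h.1 ?_
    rw [Rep.hom_comm_apply]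
    exact ((LinearEquiv.ofBijective e.hom.toLinearMap h).apply_symm_apply _).trans
      (congrArg _ ((LinearEquiv.ofBijective e.hom.toLinearMap h).apply_symm_apply _).symm)

theorem hom_invHom {A B : Rep.{0} k G} (e : A ⟶ B) (h : Function.Bijective e.hom) (b : B.V) :
    e.hom ((invHom e h).hom b) = b :=
  (LinearEquiv.ofBijective e.hom.toLinearMap h).apply_symm_apply b

theorem invHom_hom {A B : Rep.{0} k G} (e : A ⟶ B) (h : Function.Bijective e.hom) (a : A.V) :
    (invHom e h).hom (e.hom a) = a :=
  (LinearEquiv.ofBijective e.hom.toLinearMap h).symm_apply_apply a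

/-- Replacing the quotient of a short exact sequence along an isomorphism. -/
def SES.congrRight {A B C C' : Rep.{0} k G} (S : SES A B C) (e : C ⟶ C')
    (h : Function.Bijective e.hom) : SES A B C' where
  i := S.i
  p := S.p ≫ e
  inj := S.inj
  surj := h.2.comp S.surj
  exact b := by
    rw [← S.exact]
    exact map_eq_zero_iff e.hom h.1

/-- Replacing the subobject of a short exact sequence along an isomorphism. -/
def SES.congrLeft {A A' B C : Rep.{0} k G} (S : SES A B C) (e : A' ⟶ A)
    (h : Function.Bijective e.hom) : SES A' B C where
  i := e ≫ S.i
  p := S.p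
  inj := S.inj.comp h.1
  surj := S.surj
  exact b := by
    rw [S.exact]
    constructor
    · rintro ⟨a, rfl⟩
      obtain ⟨a, rfl⟩ := h.2 a
      exact ⟨a, rfl⟩
    · rintro ⟨a, rfl⟩
      exact ⟨e.hom a, rfl⟩

/-- The morphism `W ⟶ T 1 W`. -/
def ToneInv (W : Rep.{0} k G) : W ⟶ T (oneMat k G) W :=
  invHom (Tone W) Tone_bijective

theorem ToneInv_bijective (W : Rep.{0} k G) : Function.Bijective (ToneInv W).hom :=
  ⟨(Function.RightInverse.injective (hom_invHom _ Tone_bijective)),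
    Function.LeftInverse.surjective (invHom_hom _ Tone_bijective)⟩

theorem ToneInv_apply (W : Rep.{0} k G) (w : W.V) : (ToneInv W).hom w = fun _ => w :=
  Tone_bijective.1 (hom_invHom _ _ w)

/-- A sequence of matrix representations whose quotient is trivial, tensored with `W`. -/
def MatSES.aug (E : MatSES ρ₁ ρ₂ (oneMat k G)) (W : Rep.{0} k G) :
    SES (T ρ₁ W) (T ρ₂ W) W :=
  (E.ses W).congrRight (Tone W) Tone_bijective

/-- A sequence of matrix representations whose subobject is trivial, tensored with `W`. -/
def MatSES.coaug (E : MatSES (oneMat k G) ρ₂ ρ₃) (W : Rep.{0} k G) :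
    SES W (T ρ₂ W) (T ρ₃ W) :=
  (E.ses W).congrLeft (ToneInv W) (ToneInv_bijective W)

/-- A self-extension of the trivial matrix representation, tensored with `W`. -/
def MatSES.biaug (E : MatSES (oneMat k G) ρ₂ (oneMat k G))
    (W : Rep.{0} k G) : SES W (T ρ₂ W) W :=
  (E.aug W).congrLeft (ToneInv W) (ToneInv_bijective W)

theorem MatSES.aug_p_apply (E : MatSES ρ₁ ρ₂ (oneMat k G)) (W : Rep.{0} k G)
    (f : J → W.V) : (E.aug W).p.hom f = ∑ j, E.Q () j • f j := rfl

theorem MatSES.coaug_i_apply (E : MatSES (oneMat k G) ρ₂ ρ₃) (W : Rep.{0} k G)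
    (w : W.V) : (E.coaug W).i.hom w = fun j => E.P j () • w := by
  funext j
  change act E.P ((ToneInv W).hom w) j = _
  rw [ToneInv_apply]
  simp [act_apply]

theorem MatSES.biaug_i_apply (E : MatSES (oneMat k G) ρ₂ (oneMat _ G)) (W : Rep.{0} k G)
    (w : W.V) : (E.biaug W).i.hom w = fun j => E.P j () • w :=
  E.coaug_i_apply W w

/-- The trivial representation. -/
abbrev triv (k G : Type) [CommRing k] [Group G] : Rep.{0} k G := Rep.trivial k G k

/-- The product `W × (T ρ k) → T ρ W`. -/
def pairT (ρ : G →* Matrix I I k) (W : Rep.{0} k G) : Pairing W (T ρ (triv k G)) (T ρ W) where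
  toLin := LinearMap.mk₂ k (fun w (f : I → k) i => f i • w)
    (fun _ _ _ => funext fun _ => smul_add _ _ _) (fun _ _ _ => funext fun _ => smul_comm _ _ _)
    (fun _ _ _ => funext fun _ => add_smul _ _ _) (fun _ _ _ => funext fun _ => mul_smul _ _ _)
  map_ρ g w f := by
    funext i
    change (∑ j, ρ g i j • f j) • W.ρ g w = ∑ j, ρ g i j • W.ρ g ((f j : k) • w)
    simp only [map_smul, Finset.sum_smul, smul_smul, smul_eq_mul]

/-- The product `W × k → W`. -/
def pair1 (W : Rep.{0} k G) : Pairing W (triv k G) W where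
  toLin := LinearMap.mk₂ k (fun w (c : k) => c • w)
    (fun _ _ _ => smul_add _ _ _) (fun _ _ _ => smul_comm _ _ _)
    (fun _ _ _ => add_smul _ _ _) (fun _ _ _ => mul_smul _ _ _)
  map_ρ g w c := (map_smul (W.ρ g) c w).symm

theorem pair1_apply (W : Rep.{0} k G) (w : W.V) (c : k) : (pair1 W).toLin w c = c • w := rfl

/-- The unit class in `H⁰(G, k)`. -/
def oneCls (k G : Type) [CommRing k] [Group G] : groupCohomology (triv k G) 0 :=
  cls₀ (A := triv k G) (1 : k) fun _ => rfl

theorem cup_one (W : Rep.{0} k G) {p : ℕ} (z : groupCohomology W p) :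
    cup (pair1 W) p 0 z (oneCls k G) = z := by
  refine (cup_zero_right (pair1 W) (𝟙 W) (1 : k) (fun _ => rfl) _ (fun a => ?_) z).trans
    (Hmap_id_apply p z)
  exact (one_smul k a).symm

end matSES

section gysin

variable {G : Type} [Group G] {I J L : Type} [Fintype I] [Fintype J] [Fintype L]
  [DecidableEq I] [DecidableEq J] [DecidableEq L]
  {ρ₁ : G →* Matrix I I (ZMod 2)} {ρ₂ : G →* Matrix J J (ZMod 2)} {ρ₃ : G →* Matrix L L (ZMod 2)}

/-- The class in `H¹` of an extension of the trivial module. -/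
def MatSES.θ (E : MatSES ρ₁ ρ₂ (oneMat (ZMod 2) G)) :
    groupCohomology (T ρ₁ (triv (ZMod 2) G)) 1 :=
  (E.aug (triv (ZMod 2) G)).δ 0 (oneCls (ZMod 2) G)

/-- The class in `H¹(G, k)` of a self-extension of the trivial module. -/
def MatSES.σ (E : MatSES (oneMat (ZMod 2) G) ρ₂ (oneMat _ G)) :
    groupCohomology (triv (ZMod 2) G) 1 :=
  (E.biaug (triv (ZMod 2) G)).δ 0 (oneCls (ZMod 2) G)

omit [Fintype J] [DecidableEq I] [DecidableEq J] in
theorem smul_eq_act {V : Type} [AddCommGroup V] [Module (ZMod 2) V] (P : Matrix J I (ZMod 2)) (w : V)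
    (f : I → ZMod 2) : act P (fun i => f i • w) = fun j => act P f j • w := by
  funext j
  simp [act_apply, Finset.sum_smul, smul_smul]

omit [DecidableEq I] in
theorem sum_smul_eq {V : Type} [AddCommGroup V] [Module (ZMod 2) V] (Q : I → ZMod 2) (w : V)
    (f : I → ZMod 2) : ∑ i, Q i • f i • w = (∑ i, Q i • f i) • w := by
  simp [Finset.sum_smul, smul_smul]

/-- The connecting homomorphism of an extension of the trivial module is the cup product with its
class. -/
theorem MatSES.aug_δ (E : MatSES ρ₁ ρ₂ (oneMat (ZMod 2) G))
    (W : Rep.{0} (ZMod 2) G) {p : ℕ} (z : groupCohomology W p) :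
    (E.aug W).δ p z = cup (pairT ρ₁ W) p 1 z E.θ := by
  have h := δ_cup (E.aug (triv (ZMod 2) G)) (E.aug W) (pairT ρ₁ W) (pairT ρ₂ W) (pair1 W)
    (fun w f => smul_eq_act E.P w f) (fun w f => sum_smul_eq (E.Q ()) w f) z (oneCls (ZMod 2) G)
  rw [cup_one W z] at h
  exact h

theorem MatSES.biaug_δ (E : MatSES (oneMat (ZMod 2) G) ρ₂ (oneMat _ G))
    (W : Rep.{0} (ZMod 2) G) {p : ℕ} (z : groupCohomology W p) :
    (E.biaug W).δ p z = cup (pair1 W) p 1 z E.σ := by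
  have hi : ∀ w (c : ZMod 2), (E.biaug W).i.hom ((pair1 W).toLin w c) =
      (pairT ρ₂ W).toLin w ((E.biaug (triv (ZMod 2) G)).i.hom c) := fun w c =>
    (E.biaug_i_apply W _).trans (Eq.trans (funext fun j => smul_smul (E.P j ()) (c : ZMod 2) w)
      (congrArg ((pairT ρ₂ W).toLin w) (E.biaug_i_apply (triv (ZMod 2) G) c)).symm)
  have h := δ_cup (E.biaug (triv (ZMod 2) G)) (E.biaug W) (pair1 W) (pairT ρ₂ W) (pair1 W)
    hi (fun w f => sum_smul_eq (E.Q ()) w f) z (oneCls (ZMod 2) G)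
  rw [cup_one W z] at h
  exact h

theorem MatSES.coaug_δ (E : MatSES (oneMat (ZMod 2) G) ρ₂ ρ₃)
    (W : Rep.{0} (ZMod 2) G) {p q : ℕ} (z : groupCohomology W p)
    (c : groupCohomology (T ρ₃ (triv (ZMod 2) G)) q) :
    (E.coaug W).δ (p + q) (cup (pairT ρ₃ W) p q z c) =
      cup (pair1 W) p (q + 1) z ((E.coaug (triv (ZMod 2) G)).δ q c) := by
  refine δ_cup (E.coaug (triv (ZMod 2) G)) (E.coaug W) (pair1 W) (pairT ρ₂ W) (pairT ρ₃ W)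
    (fun w c => ?_) (fun w f => smul_eq_act E.Q w f) z _
  refine (E.coaug_i_apply W _).trans (Eq.trans ?_
    (congrArg ((pairT ρ₂ W).toLin w) (E.coaug_i_apply (triv (ZMod 2) G) c)).symm)
  exact funext fun j => smul_smul (E.P j ()) (c : ZMod 2) w

/-- Classes of degree one commute, if one of them has trivial coefficients. -/
theorem cup_comm_one (B : Rep.{0} (ZMod 2) G) (μ : Pairing (triv (ZMod 2) G) B B)
    (hμ : ∀ (c : ZMod 2) b, μ.toLin c b = c • b) (s : groupCohomology (triv (ZMod 2) G) 1)
    (t : groupCohomology B 1) : cup μ 1 1 s t = cup (pair1 B) 1 1 t s := by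
  obtain ⟨f, hf, rfl⟩ := cls_surjective s
  obtain ⟨g, hg, rfl⟩ := cls_surjective t
  rw [cup_cls, cup_cls]
  refine cls_eq_of_sub _ _ (fun x => (f x : ZMod 2) • g x) (ext_ev fun x => ?_)
  have h1 : ∀ x, (ev f (contr 0 x) : ZMod 2) = ev f (shift 1 x) + ev f x := by
    intro x
    have : ev (dd (triv (ZMod 2) G) 1 f) x = (0 : ZMod 2) := by rw [hf]; rfl
    rw [ev_dd, Finset.sum_range_succ, Finset.sum_range_one] at this
    rw [ev_congr f (x := contr 1 x) (y := x) (by simp [contr])] at this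
    have key : ∀ a b c : ZMod 2, a + (b + c) = 0 → b = a + c := by decide
    exact key _ _ _ this
  have h2 : ∀ x, ev g (contr 0 x) = B.ρ (x 0) (ev g (shift 1 x)) + ev g x := by
    intro x
    have : ev (dd B 1 g) x = 0 := by rw [hg]; rfl
    rw [ev_dd, Finset.sum_range_succ, Finset.sum_range_one] at this
    rw [ev_congr g (x := contr 1 x) (y := x) (by simp [contr])] at this
    rw [add_left_comm] at this
    exact sub_eq_zero.1 ((char_two_sub _ _).trans this)
  have e1 : ∀ (c c' : (Fin (1 + 1) → G) → B.V), ev (c + c') x = ev c x + ev c' x := fun _ _ => rfl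
  have e2 : ∀ x, ev (fun x => (f x : ZMod 2) • g x) x = (ev f x : ZMod 2) • ev g x := fun _ => rfl
  rw [e1, ev_cochain, ev_cochain, ev_dd, Finset.sum_range_succ, Finset.sum_range_one, hμ,
      pair1_apply]
  have e3 : ev (fun x => (f x : ZMod 2) • g x) (contr 1 x) = (ev f x : ZMod 2) • ev g x := by
    rw [e2, ev_congr f (x := contr 1 x) (y := x) (by simp [contr]),
      ev_congr g (x := contr 1 x) (y := x) (by simp [contr])]
  have e4 : headProd 1 x = x 0 := by simp [headProd]
  rw [e3, e2, e2, h1, h2, e4, map_smul]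
  change _ = (ev f (shift 1 x) : ZMod 2) • ev g x + _
  generalize B.ρ (x 0) (ev g (shift 1 x)) = b
  generalize (ev f (shift 1 x) : ZMod 2) = a
  generalize (ev f x : ZMod 2) = c
  generalize ev g x = d
  have h3 := char_two_add_self (a • b)
  have h4 := char_two_add_self (a • d)
  have h5 := char_two_add_self (c • d)
  have : a • d + (a • b + ((a + c) • (b + d) + c • d)) =
    (a • b + a • b) + (a • d + a • d) + (c • d + c • d) + c • b := by module
  rw [this, h3, h4, h5]
  simp

end gysin

/-! ### Dimensions and generation from acyclic modules -/

section dims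

variable {G : Type} [Group G]

/-- The dimension of the cohomology in degree `n`. -/
def hdim (W : Rep.{0} (ZMod 2) G) (n : ℕ) : ℕ := Module.finrank (ZMod 2) (groupCohomology W n)

theorem hdim_congr {A B : Rep.{0} (ZMod 2) G} (f : A ⟶ B) (h : Function.Bijective f.hom) (n : ℕ) :
    hdim A n = hdim B n :=
  (HmapEquiv f h n).finrank_eq

theorem Hmap_pair1 {A B : Rep.{0} (ZMod 2) G} (f : A ⟶ B) {p q : ℕ} (z : groupCohomology A p)
    (s : groupCohomology (triv (ZMod 2) G) q) :
    Hmap f (p + q) (cup (pair1 A) p q z s) = cup (pair1 B) p q (Hmap f p z) s := by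
  rw [Hmap_cup (pair1 A) (pair1 B) f (𝟙 _) f fun a (b : ZMod 2) => map_smul f.hom b a,
    Hmap_id_apply]

variable [Finite G]

theorem hdim_prod (A B : Rep.{0} (ZMod 2) G) [Module.Finite (ZMod 2) A.V]
    [Module.Finite (ZMod 2) B.V] (n : ℕ) : hdim (prodRep A B) n = hdim A n + hdim B n :=
  finrank_Hprod n

variable {I J : Type} [Fintype I] [Fintype J] [DecidableEq I] [DecidableEq J]
  {ρ₁ : G →* Matrix I I (ZMod 2)} {ρ₂ : G →* Matrix J J (ZMod 2)}

/-- `s` is surjective as a multiplication operator on the cohomology of `V`. -/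
def MulSurj (s : groupCohomology (triv (ZMod 2) G) 1) (V : Rep.{0} (ZMod 2) G) : Prop :=
  ∀ (p : ℕ) (u : groupCohomology V (p + 1)), ∃ z, u = cup (pair1 V) p 1 z s

/-- `V` has no cohomology in positive degrees. -/
def Acyclic (V : Rep.{0} (ZMod 2) G) : Prop := ∀ (n : ℕ) (u : groupCohomology V (n + 1)), u = 0

omit [Finite G] in
theorem Acyclic.congr {A B : Rep.{0} (ZMod 2) G} (hA : Acyclic A) (f : A ⟶ B)
    (h : Function.Bijective f.hom) : Acyclic B := fun n u => by
  have e := hA n ((HmapEquiv f h (n + 1)).symm u)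
  rw [← (HmapEquiv f h (n + 1)).apply_symm_apply u, e, map_zero]

omit [Finite G] in
theorem Acyclic.hdim {V : Rep.{0} (ZMod 2) G} (hV : Acyclic V) (n : ℕ) : hdim V (n + 1) = 0 := by
  have : Subsingleton (groupCohomology V (n + 1)) := ⟨fun a b => (hV n a).trans (hV n b).symm⟩
  exact Module.finrank_zero_of_subsingleton

section periodic

variable (K : MatSES (oneMat (ZMod 2) G) ρ₂ (oneMat (ZMod 2) G)) {V : Rep.{0} (ZMod 2) G}

omit [Finite G] in
/-- Multiplication by the class of a self-extension of the trivial module is the connecting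
homomorphism of that extension, which is onto if the middle term is acyclic. -/
theorem mulSurj_of_acyclic (h : Acyclic (T ρ₂ V)) : MulSurj K.σ V := fun p u => by
  obtain ⟨z, rfl⟩ := ((K.biaug V).exact₁ p u).1 (h p _)
  exact ⟨z, K.biaug_δ V z⟩

variable [Module.Finite (ZMod 2) V.V]

include K

omit [Finite G] [Module.Finite (ZMod 2) V.V] in
theorem hdim_succ_of_acyclic (h : Acyclic (T ρ₂ V)) (p : ℕ) : hdim V (p + 2) = hdim V (p + 1) := by
  refine (LinearEquiv.ofBijective ((K.biaug V).δ (p + 1)) ⟨?_, fun u => ?_⟩).finrank_eq.symm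
  · rw [injective_iff_map_eq_zero]
    intro z hz
    obtain ⟨y, rfl⟩ := ((K.biaug V).exact₃ (p + 1) z).1 hz
    rw [h p y, map_zero]
  · exact ((K.biaug V).exact₁ (p + 1) u).1 (h (p + 1) _)

theorem hdim_one_of_acyclic (h : Acyclic (T ρ₂ V)) :
    hdim V 1 + hdim (T ρ₂ V) 0 = 2 * hdim V 0 := by
  have := finite_groupCohomology V 0
  have := finite_groupCohomology (T ρ₂ V) 0
  have e1 := LinearMap.finrank_range_add_finrank_ker ((K.biaug V).δ 0)
  have e2 := LinearMap.finrank_range_add_finrank_ker (Hmap (K.biaug V).p 0)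
  rw [LinearMap.exact_iff.1 ((K.biaug V).exact₃ 0), LinearMap.range_eq_top.2 fun u =>
    ((K.biaug V).exact₁ 0 u).1 (h 0 _), finrank_top] at e1
  change Module.finrank (ZMod 2) (groupCohomology V 1) + _ = _ at e1
  rw [LinearMap.exact_iff.1 ((K.biaug V).exact₂ 0), LinearMap.finrank_range_of_inj
    (K.biaug V).injective_zero] at e2
  unfold hdim
  omega

end periodic

section extension

variable (E : MatSES ρ₁ ρ₂ (oneMat (ZMod 2) G)) {W : Rep.{0} (ZMod 2) G}
  {s : groupCohomology (triv (ZMod 2) G) 1} (hs : MulSurj s (T ρ₂ W))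
  (h0 : ∀ f : J → W.V, (∀ g, Tρ ρ₂ W g f = f) → ∑ j, E.Q () j • f j = 0)

include hs h0

omit [Finite G] in
/-- If the augmentation kills the invariants, it kills the whole cohomology, which is generated by
the invariants under multiplication by `s`. -/
theorem aug_eq_zero (p : ℕ) (u : groupCohomology (T ρ₂ W) p) : Hmap (E.aug W).p p u = 0 := by
  induction p with
  | zero =>
    obtain ⟨f, hf, rfl⟩ := cls₀_surjective u
    rw [Hmap_cls₀, cls₀_eq_zero]
    exact h0 f hf
  | succ p ih =>
    obtain ⟨z, rfl⟩ := hs p u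
    rw [Hmap_pair1, ih, map_zero, LinearMap.zero_apply]

omit [Finite G] in
/-- The cohomology of the kernel of the augmentation is generated by the class of the extension and
by invariants. -/
theorem aug_generation (p : ℕ) (u : groupCohomology (T ρ₁ W) (p + 1)) :
    ∃ (a : groupCohomology W p) (b : groupCohomology (T ρ₁ W) p),
      u = cup (pairT ρ₁ W) p 1 a E.θ + cup (pair1 (T ρ₁ W)) p 1 b s := by
  obtain ⟨z, hz⟩ := hs p (Hmap (E.aug W).i (p + 1) u)
  obtain ⟨b, rfl⟩ := ((E.aug W).exact₂ p z).1 (aug_eq_zero E hs h0 p z)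
  rw [← Hmap_pair1, ← sub_eq_zero, ← map_sub] at hz
  obtain ⟨a, ha⟩ := ((E.aug W).exact₁ p _).1 hz
  rw [E.aug_δ] at ha
  exact ⟨a, b, by rw [ha, sub_add_cancel]⟩

variable [Module.Finite (ZMod 2) W.V]

/-- The long exact sequence of `E` splits into short exact sequences, because the augmentation
vanishes on cohomology. -/
theorem hdim_aug_succ (p : ℕ) :
    hdim (T ρ₁ W) (p + 1) = hdim W p + hdim (T ρ₂ W) (p + 1) := by
  have := finite_groupCohomology (T ρ₁ W) (p + 1)
  refine finrank_eq_add_of_exact ((E.aug W).δ p) (Hmap (E.aug W).i (p + 1)) ?_ ((E.aug W).exact₁ p)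
    fun u => ((E.aug W).exact₂ (p + 1) u).1 (aug_eq_zero E hs h0 _ u)
  rw [injective_iff_map_eq_zero]
  intro z hz
  obtain ⟨y, rfl⟩ := ((E.aug W).exact₃ p z).1 hz
  exact aug_eq_zero E hs h0 p y

omit [Finite G] [Module.Finite (ZMod 2) W.V] in
theorem hdim_aug_zero : hdim (T ρ₁ W) 0 = hdim (T ρ₂ W) 0 :=
  (LinearEquiv.ofBijective (Hmap (E.aug W).i 0) ⟨(E.aug W).injective_zero, fun u =>
    ((E.aug W).exact₂ 0 u).1 (aug_eq_zero E hs h0 0 u)⟩).finrank_eq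

end extension

omit [Finite G] in
theorem SES.surjective_of_acyclic {A B C : Rep.{0} (ZMod 2) G} (S : SES A B C) (h : Acyclic A)
    (p : ℕ) : Function.Surjective (Hmap S.p p) := fun u => ((S.exact₃ p u).1 (h p _))

omit [Finite G] in
theorem SES.hdim_of_acyclic {A B C : Rep.{0} (ZMod 2) G} (S : SES A B C) (h : Acyclic A)
    (p : ℕ) : hdim B (p + 1) = hdim C (p + 1) := by
  refine (LinearEquiv.ofBijective (Hmap S.p (p + 1))
    ⟨?_, S.surjective_of_acyclic h (p + 1)⟩).finrank_eq
  rw [injective_iff_map_eq_zero]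
  intro z hz
  obtain ⟨y, rfl⟩ := (S.exact₂ (p + 1) z).1 hz
  rw [h p y, map_zero]

end dims

section regular

variable {G : Type} [Group G] [Fintype G] [DecidableEq G]

theorem acyclic_regular (W : Rep.{0} (ZMod 2) G) : Acyclic (T (permMat (ZMod 2) G) W) :=
  fun n u => eq_zero_of_regular n u

theorem invariant_regular {W : Rep.{0} (ZMod 2) G} (f : G → W.V)
    (h : ∀ g, Tρ (permMat (ZMod 2) G) W g f = f) (g : G) : f g = W.ρ g (f 1) := by
  have := congr_fun (h g) g
  rw [permMat_ρ_apply, smul_eq_mul, inv_mul_cancel] at this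
  exact this.symm

theorem hdim_regular_zero (W : Rep.{0} (ZMod 2) G) :
    hdim (T (permMat (ZMod 2) G) W) 0 = Module.finrank (ZMod 2) W.V := by
  refine (H0Equiv _).finrank_eq.symm.trans ?_
  let f : (T (permMat (ZMod 2) G) W).ρ.invariants →ₗ[ZMod 2] W.V :=
    (LinearMap.proj (R := ZMod 2) (φ := fun _ : G => W.V) (1 : G)).comp (Submodule.subtype _)
  refine (LinearEquiv.ofBijective f ⟨?_, fun w => ?_⟩).finrank_eq
  · intro a b h
    refine Subtype.ext (funext fun g => ?_)
    rw [invariant_regular a.1 a.2, invariant_regular b.1 b.2]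
    exact congrArg (W.ρ g) h
  · refine ⟨⟨fun g => W.ρ g w, fun g => funext fun i => ?_⟩, ?_⟩
    · refine (permMat_ρ_apply (W := W) g _ i).trans ?_
      rw [← Module.End.mul_apply, ← map_mul]
      simp
    · change W.ρ 1 w = w
      simp

end regular

/-! ### Modules of the dihedral group -/

section dihedral

/-- The dihedral group of order eight. -/
abbrev D8 : Type := DihedralGroup 4

/-- The natural three-dimensional matrix representation of the dihedral group, which identifies it
with the group of unitriangular matrices. The basis is called `x, y, z`; the reflection `sr 0` fixes
`x, y` and maps `z` to `z + y`, the reflection `sr 1` fixes `x, z` and maps `y` to `y + x`. -/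
def natFun : D8 → Matrix (Fin 3) (Fin 3) (ZMod 2)
  | .r i => ![!![1, 0, 0; 0, 1, 0; 0, 0, 1],
      !![1, 1, 0; 0, 1, 1; 0, 0, 1],
      !![1, 0, 1; 0, 1, 0; 0, 0, 1],
      !![1, 1, 1; 0, 1, 1; 0, 0, 1]] i
  | .sr i => ![!![1, 0, 0; 0, 1, 1; 0, 0, 1],
      !![1, 1, 0; 0, 1, 0; 0, 0, 1],
      !![1, 0, 1; 0, 1, 1; 0, 0, 1],
      !![1, 1, 1; 0, 1, 0; 0, 0, 1]] i

/-- The exterior square of the natural representation, in the basis `xy, xz, yz`. -/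
def wedgeFun : D8 → Matrix (Fin 3) (Fin 3) (ZMod 2)
  | .r i => ![!![1, 0, 0; 0, 1, 0; 0, 0, 1],
      !![1, 1, 1; 0, 1, 1; 0, 0, 1],
      !![1, 0, 1; 0, 1, 0; 0, 0, 1],
      !![1, 1, 0; 0, 1, 1; 0, 0, 1]] i
  | .sr i => ![!![1, 1, 0; 0, 1, 0; 0, 0, 1],
      !![1, 0, 0; 0, 1, 1; 0, 0, 1],
      !![1, 1, 1; 0, 1, 0; 0, 0, 1],
      !![1, 0, 1; 0, 1, 1; 0, 0, 1]] i

/-- The natural representation. -/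
def natMat : D8 →* Matrix (Fin 3) (Fin 3) (ZMod 2) where
  toFun := natFun
  map_one' := by decide
  map_mul' := by decide +kernel

/-- The exterior square of the natural representation. -/
def wedgeMat : D8 →* Matrix (Fin 3) (Fin 3) (ZMod 2) where
  toFun := wedgeFun
  map_one' := by decide
  map_mul' := by decide +kernel

/-- The cosets of the subgroup generated by `sr 0`. -/
def Ωa : Type := ZMod 4

instance : Fintype Ωa := inferInstanceAs (Fintype (ZMod 4))
instance : DecidableEq Ωa := inferInstanceAs (DecidableEq (ZMod 4))

/-- The action of the dihedral group on `Ωa`. -/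
def Ωa.act : D8 → ZMod 4 → ZMod 4
  | .r i, v => v + i
  | .sr i, v => -v - i

instance : MulAction D8 Ωa where
  smul := Ωa.act
  one_smul := by decide
  mul_smul := by decide +kernel

/-- The cosets of the subgroup generated by `sr 1`. -/
def Ωb : Type := ZMod 4

instance : Fintype Ωb := inferInstanceAs (Fintype (ZMod 4))
instance : DecidableEq Ωb := inferInstanceAs (DecidableEq (ZMod 4))

/-- The action of the dihedral group on `Ωb`. -/
def Ωb.act : D8 → ZMod 4 → ZMod 4
  | .r i, v => v + i
  | .sr i, v => -v - i + 1

instance : MulAction D8 Ωb where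
  smul := Ωb.act
  one_smul := by decide
  mul_smul := by decide +kernel

/-- The cosets of the cyclic subgroup of order four. -/
def Ωk : Type := ZMod 2

instance : Fintype Ωk := inferInstanceAs (Fintype (ZMod 2))
instance : DecidableEq Ωk := inferInstanceAs (DecidableEq (ZMod 2))

/-- The action of the dihedral group on `Ωk`. -/
def Ωk.act : D8 → ZMod 2 → ZMod 2
  | .r _, v => v
  | .sr _, v => v + 1

instance : MulAction D8 Ωk where
  smul := Ωk.act
  one_smul := by decide
  mul_smul := by decide +kernel

/-- The cosets of the four-group generated by `sr 1` and the centre. -/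
def Ωx : Type := ZMod 2

instance : Fintype Ωx := inferInstanceAs (Fintype (ZMod 2))
instance : DecidableEq Ωx := inferInstanceAs (DecidableEq (ZMod 2))

/-- The action of the dihedral group on `Ωx`. -/
def Ωx.act : D8 → ZMod 2 → ZMod 2
  | .r i, v => v + ![0, 1, 0, 1] i
  | .sr i, v => v + ![1, 0, 1, 0] i

instance : MulAction D8 Ωx where
  smul := Ωx.act
  one_smul := by decide
  mul_smul := by decide +kernel

/-- The natural representation is the kernel of the augmentation of `k[Ωa]`. -/
def Ea : MatSES natMat (permMat (ZMod 2) Ωa) (oneMat (ZMod 2) D8) where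
  P := (!![1, 0, 0; 1, 1, 1; 1, 0, 1; 1, 1, 0] : Matrix (Fin 4) (Fin 3) (ZMod 2))
  Q := fun _ _ => 1
  P' := (!![0, 1, 1, 1; 0, 1, 1, 0; 0, 1, 0, 1] : Matrix (Fin 3) (Fin 4) (ZMod 2))
  Q' := fun i _ => (!![1; 0; 0; 0] : Matrix (Fin 4) (Fin 1) (ZMod 2)) i 0
  hP := by decide +kernel
  hQ := by decide +kernel
  left_inv := by decide +kernel
  right_inv := by decide +kernel
  comp := by decide +kernel
  split := by decide +kernel

/-- The exterior square is the kernel of the augmentation of `k[Ωb]`. -/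
def Eb : MatSES wedgeMat (permMat (ZMod 2) Ωb) (oneMat (ZMod 2) D8) where
  P := (!![1, 0, 0; 1, 1, 0; 1, 0, 1; 1, 1, 1] : Matrix (Fin 4) (Fin 3) (ZMod 2))
  Q := fun _ _ => 1
  P' := (!![0, 1, 1, 1; 0, 0, 1, 1; 0, 1, 0, 1] : Matrix (Fin 3) (Fin 4) (ZMod 2))
  Q' := fun i _ => (!![1; 0; 0; 0] : Matrix (Fin 4) (Fin 1) (ZMod 2)) i 0
  hP := by decide +kernel
  hQ := by decide +kernel
  left_inv := by decide +kernel
  right_inv := by decide +kernel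
  comp := by decide +kernel
  split := by decide +kernel

/-- The module `k[Ωk]` is an extension of the trivial module by itself. -/
def Ek : MatSES (oneMat (ZMod 2) D8) (permMat (ZMod 2) Ωk) (oneMat (ZMod 2) D8) where
  P := fun _ _ => 1
  Q := fun _ _ => 1
  P' := fun _ j => (![1, 0] : Fin 2 → ZMod 2) j
  Q' := fun i _ => (![0, 1] : Fin 2 → ZMod 2) i
  hP := by decide +kernel
  hQ := by decide +kernel
  left_inv := by decide +kernel
  right_inv := by decide +kernel
  comp := by decide +kernel
  split := by decide +kernel

/-- The coordinates of the orbit of `z ⊗ yz`. -/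
def freeP : Matrix (Fin 3 × Fin 3) D8 (ZMod 2) := fun p g => natFun g p.1 2 * wedgeFun g p.2 2

/-- A left inverse of `freeP`. -/
def freeP' : D8 → Matrix (Fin 3) (Fin 3) (ZMod 2)
  | .r i => ![!![1, 1, 0; 1, 0, 1; 0, 1, 1],
      !![1, 0, 0; 0, 0, 0; 1, 0, 0],
      !![1, 1, 0; 1, 1, 0; 0, 0, 0],
      !![1, 0, 0; 0, 1, 0; 1, 0, 0]] i
  | .sr i => ![!![1, 0, 0; 1, 1, 1; 1, 0, 0],
      !![1, 1, 0; 0, 0, 0; 1, 1, 0],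
      !![1, 0, 0; 1, 0, 0; 1, 0, 0],
      !![1, 1, 0; 0, 1, 0; 1, 0, 0]] i

/-- The kernel of the product `M ⊗ Λ²M → Λ³M` is free on `z ⊗ yz`. -/
def Efree : MatSES (permMat (ZMod 2) D8) (kron natMat wedgeMat) (oneMat (ZMod 2) D8) where
  P := freeP
  Q := fun _ p => if p.1.val + p.2.val = 2 then 1 else 0
  P' := fun g p => freeP' g p.1 p.2
  Q' := fun p _ => if p = (0, 2) then 1 else 0
  hP := by decide +kernel
  hQ := by decide +kernel
  left_inv := by decide +kernel
  right_inv := by decide +kernel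
  comp := by decide +kernel
  split := by decide +kernel

end dihedral

/-! ### Cohomology of modules obtained from permutation modules of the dihedral group -/

section freeProducts

variable {G : Type} [Group G] [Fintype G] [DecidableEq G] {Ω Ω' : Type} [Fintype Ω] [DecidableEq Ω]
  [Fintype Ω'] [DecidableEq Ω'] [MulAction G Ω] [MulAction G Ω']

/-- Evaluation on the orbit of a pair of points. -/
def evalPair (ω : Ω) (ω' : Ω') (W : Rep.{0} (ZMod 2) G) :
    T (permMat (ZMod 2) Ω) (T (permMat (ZMod 2) Ω') W) ⟶ T (permMat (ZMod 2) G) W :=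
  mkHom (A := T (permMat (ZMod 2) Ω) (T (permMat (ZMod 2) Ω') W)) (B := T (permMat (ZMod 2) G) W)
    { toFun := fun F g => F (g • ω) (g • ω'), map_add' := fun _ _ => rfl, map_smul' :=
        fun _ _ => rfl }
    fun g F => funext fun u => by
      refine Eq.trans ?_ (permMat_ρ_apply (W := W) g _ u).symm
      change Tρ (permMat (ZMod 2) Ω) (T (permMat (ZMod 2) Ω') W) g F (u • ω) (u • ω') = _
      rw [permMat_ρ_apply, permMat_ρ_apply, smul_smul, smul_smul]
      rfl

theorem evalPair_bijective {ω : Ω} {ω' : Ω'} (h : Function.Bijective fun g : G => (g • ω, g • ω'))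
    (W : Rep.{0} (ZMod 2) G) : Function.Bijective (evalPair ω ω' W).hom := by
  constructor
  · intro F F' e
    funext i j
    obtain ⟨g, hg⟩ := h.2 (i, j)
    have := congr_fun e g
    change F (g • ω) (g • ω') = F' (g • ω) (g • ω') at this
    rwa [(Prod.mk.inj hg).1, (Prod.mk.inj hg).2] at this
  · intro f
    refine ⟨fun i j => f ((Equiv.ofBijective _ h).symm (i, j)), funext fun g => ?_⟩
    exact congrArg f ((Equiv.ofBijective _ h).symm_apply_apply g)

/-- If the group acts simply transitively on `Ω × Ω'`, the module `k[Ω] ⊗ k[Ω']` is free. -/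
theorem acyclic_perm_perm {ω : Ω} {ω' : Ω'} (h : Function.Bijective fun g : G => (g • ω, g • ω'))
    (W : Rep.{0} (ZMod 2) G) : Acyclic (T (permMat (ZMod 2) Ω) (T (permMat (ZMod 2) Ω') W)) :=
  (acyclic_regular W).congr (invHom _ (evalPair_bijective h W))
    ⟨(Function.RightInverse.injective (hom_invHom _ _)),
      Function.LeftInverse.surjective (invHom_hom _ _)⟩

theorem hdim_perm_perm_zero {ω : Ω} {ω' : Ω'}
    (h : Function.Bijective fun g : G => (g • ω, g • ω')) (W : Rep.{0} (ZMod 2) G) :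
    hdim (T (permMat (ZMod 2) Ω) (T (permMat (ZMod 2) Ω') W)) 0 = Module.finrank (ZMod 2) W.V :=
  (hdim_congr _ (evalPair_bijective h W) 0).trans (hdim_regular_zero W)

omit [Fintype G] [DecidableEq G] in
theorem permMat_invariant {W : Rep.{0} (ZMod 2) G} {f : Ω → W.V}
    (hf : ∀ g, Tρ (permMat (ZMod 2) Ω) W g f = f) (g : G) (ω : Ω) : f (g • ω) = W.ρ g (f ω) := by
  have := congr_fun (hf g) (g • ω)
  rw [permMat_ρ_apply, inv_smul_smul] at this
  exact this.symm

omit [Fintype G] [DecidableEq G] in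
/-- The number of invariants of a transitive permutation module, tensored with `W`, is the number
of invariants of the stabilizer of a point in `W`. -/
theorem two_pow_hdim_perm_zero (ω : Ω) (s : Ω → G) (hs : ∀ i, s i • ω = i) (a : G)
    (ha : ∀ g : G, g • ω = ω → g = 1 ∨ g = a) (ha' : a • ω = ω) (W : Rep.{0} (ZMod 2) G)
    [Module.Finite (ZMod 2) W.V] :
    2 ^ hdim (T (permMat (ZMod 2) Ω) W) 0 = Nat.card {w : W.V // W.ρ a w = w} := by
  have e1 := (H0Equiv (T (permMat (ZMod 2) Ω) W)).finrank_eq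
  have := Module.natCard_eq_pow_finrank (K := ZMod 2)
    (V := (T (permMat (ZMod 2) Ω) W).ρ.invariants)
  rw [Nat.card_zmod, e1] at this
  refine this.symm.trans (Nat.card_congr ?_)
  refine Equiv.ofBijective (fun f => ⟨f.1 ω, ?_⟩) ⟨fun f f' h => ?_, fun w => ?_⟩
  · rw [← permMat_invariant f.2, ha']
  · refine Subtype.ext (funext fun i => ?_)
    rw [← hs i, permMat_invariant f.2, permMat_invariant f'.2]
    exact congrArg (W.ρ (s i)) (congrArg Subtype.val h)
  · have key : ∀ g h : G, g • ω = h • ω → W.ρ g w.1 = W.ρ h w.1 := by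
      intro g h e
      have e2 : W.ρ (h⁻¹ * g) w.1 = w.1 := by
        rcases ha (h⁻¹ * g) (by rw [mul_smul, e, inv_smul_smul]) with e3 | e3 <;> rw [e3]
        · simp
        · exact w.2
      have := congrArg (W.ρ h) e2
      rw [← Module.End.mul_apply, ← map_mul, mul_inv_cancel_left] at this
      exact this
    refine ⟨⟨fun i => W.ρ (s i) w.1, fun g => funext fun i => ?_⟩, Subtype.ext ?_⟩
    · refine (permMat_ρ_apply (W := W) g _ i).trans ?_
      rw [← Module.End.mul_apply, ← map_mul]
      exact key _ _ (by rw [mul_smul, hs, hs, smul_inv_smul])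
    · exact (key (s ω) 1 (by rw [hs, one_smul])).trans (by simp)

end freeProducts

section zero

variable {G : Type} [Group G]

theorem two_pow_hdim_zero (W : Rep.{0} (ZMod 2) G) [Module.Finite (ZMod 2) W.V] :
    2 ^ hdim W 0 = Nat.card {w : W.V // ∀ g, W.ρ g w = w} := by
  have := Module.natCard_eq_pow_finrank (K := ZMod 2) (V := W.ρ.invariants)
  rw [Nat.card_zmod, (H0Equiv W).finrank_eq] at this
  exact this.symm

theorem hdim_zero_eq {W : Rep.{0} (ZMod 2) G} [Module.Finite (ZMod 2) W.V] {n : ℕ}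
    (h : Nat.card {w : W.V // ∀ g, W.ρ g w = w} = 2 ^ n) : hdim W 0 = n :=
  Nat.pow_right_injective le_rfl ((two_pow_hdim_zero W).trans h)

end zero

section tables

/-- The trivial module. -/
abbrev W1 : Rep.{0} (ZMod 2) D8 := triv (ZMod 2) D8

open DihedralGroup

/-- The base point of `Ωk`. -/
def Ωk.pt : Ωk := (0 : ZMod 2)

/-- The base point of `Ωa`. -/
def Ωa.pt : Ωa := (0 : ZMod 4)

/-- The base point of `Ωb`. -/
def Ωb.pt : Ωb := (0 : ZMod 4)

/-- An extension of the trivial module by the matrix representation `ρ`, whose middle term is the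
permutation module on the four cosets of the subgroup of order two generated by the non-central
reflection `a`. -/
structure CosetExt (ρ : D8 →* Matrix (Fin 3) (Fin 3) (ZMod 2)) (a : D8) (Ω : Type) [Fintype Ω]
    [DecidableEq Ω] [MulAction D8 Ω] extends
    MatSES ρ (permMat (ZMod 2) Ω) (oneMat (ZMod 2) D8) where
  pt : Ω
  sec : Ω ≃ ZMod 4
  r_smul_pt : ∀ i, r (sec i) • pt = i
  stab : ∀ g : D8, g • pt = pt → g = 1 ∨ g = a
  smul_pt : a • pt = pt
  free : Function.Bijective fun g : D8 => (g • Ωk.pt, g • pt)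
  Q_eq : ∀ i, Q () i = 1

/-- The extension `Ea`, with its permutation module. -/
def Ca : CosetExt natMat (sr 0) Ωa where
  toMatSES := Ea
  pt := Ωa.pt
  sec := Equiv.refl (ZMod 4)
  r_smul_pt := by decide
  stab := by decide
  smul_pt := by decide
  free := by decide
  Q_eq _ := rfl

/-- The extension `Eb`, with its permutation module. -/
def Cb : CosetExt wedgeMat (sr 1) Ωb where
  toMatSES := Eb
  pt := Ωb.pt
  sec := Equiv.refl (ZMod 4)
  r_smul_pt := by decide
  stab := by decide
  smul_pt := by decide
  free := by decide
  Q_eq _ := rfl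

/-- The class in `H¹(D8, k)` with kernel the cyclic group of order four. -/
def sig : groupCohomology (triv (ZMod 2) D8) 1 := Ek.σ

section rows

variable {ρ : D8 →* Matrix (Fin 3) (Fin 3) (ZMod 2)} {a : D8} {Ω : Type} [Fintype Ω]
    [DecidableEq Ω] [MulAction D8 Ω] (E : CosetExt ρ a Ω)

/-- The transfer from the subgroup generated by `a` vanishes on `H⁰(W)`. -/
def TraceZero (a : D8) (W : Rep.{0} (ZMod 2) D8) : Prop :=
  ∀ w : W.V, W.ρ a w = w → ∑ i : ZMod 4, W.ρ (r i) w = 0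

variable (W : Rep.{0} (ZMod 2) D8)

include E

/-- Two points, one of `Ωk` and one of `Ω`, have a trivial common stabilizer, so that `k[Ωk] ⊗ k[Ω]`
is free, and multiplication by the class of the extension `k[Ωk]` is onto. -/
theorem CosetExt.mulSurj : MulSurj sig (T (permMat (ZMod 2) Ω) W) :=
  mulSurj_of_acyclic Ek (acyclic_perm_perm E.free W)

section

variable [Module.Finite (ZMod 2) W.V] {n : ℕ}

theorem CosetExt.hdim_perm_zero (hc : Nat.card {w : W.V // W.ρ a w = w} = 2 ^ n) :
    hdim (T (permMat (ZMod 2) Ω) W) 0 = n :=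
  Nat.pow_right_injective le_rfl
    ((two_pow_hdim_perm_zero E.pt _ E.r_smul_pt a E.stab E.smul_pt W).trans hc)

/-- The cohomology of `k[Ω] ⊗ W` is that of the group of order two generated by `a` in `W`, hence of
constant dimension in positive degrees. -/
theorem CosetExt.hdim_perm_succ (hc : Nat.card {w : W.V // W.ρ a w = w} = 2 ^ n) (p : ℕ) :
    hdim (T (permMat (ZMod 2) Ω) W) (p + 1) + Module.finrank (ZMod 2) W.V = 2 * n := by
  induction p with
  | zero =>
    have := hdim_one_of_acyclic Ek (acyclic_perm_perm E.free W)
    rwa [hdim_perm_perm_zero E.free, E.hdim_perm_zero W hc] at this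
  | succ p ih => rw [hdim_succ_of_acyclic Ek (acyclic_perm_perm E.free W), ih]

end

variable {W}

/-- The augmentation on the invariants of `k[Ω] ⊗ W` is the transfer from the subgroup generated by
`a`. -/
theorem CosetExt.aug_eq_zero (h : TraceZero a W) (f : Ω → W.V)
    (hf : ∀ g, Tρ (permMat (ZMod 2) Ω) W g f = f) : ∑ j, E.Q () j • f j = 0 := by
  rw [← h (f E.pt) (by rw [← permMat_invariant hf, E.smul_pt]), ← E.sec.sum_comp]
  refine Finset.sum_congr rfl fun i _ => ?_
  rw [E.Q_eq, one_smul, ← permMat_invariant hf, E.r_smul_pt]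

/-- The cohomology of `ρ ⊗ W` in positive degrees is generated by the class of the extension over
the cohomology of `W`, and by `sig`. -/
theorem CosetExt.generation (h : TraceZero a W) (p : ℕ) (u : groupCohomology (T ρ W) (p + 1)) :
    ∃ (z : groupCohomology W p) (b : groupCohomology (T ρ W) p),
      u = cup (pairT ρ W) p 1 z E.θ + cup (pair1 (T ρ W)) p 1 b sig :=
  aug_generation E.toMatSES (E.mulSurj W) (E.aug_eq_zero h) p u

variable [Module.Finite (ZMod 2) W.V] {n : ℕ}

theorem CosetExt.hdim_zero (h : TraceZero a W)
    (hc : Nat.card {w : W.V // W.ρ a w = w} = 2 ^ n) : hdim (T ρ W) 0 = n :=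
  (hdim_aug_zero E.toMatSES (E.mulSurj W) (E.aug_eq_zero h)).trans (E.hdim_perm_zero W hc)

theorem CosetExt.hdim_succ (h : TraceZero a W)
    (hc : Nat.card {w : W.V // W.ρ a w = w} = 2 ^ n) (p : ℕ) :
    hdim (T ρ W) (p + 1) + Module.finrank (ZMod 2) W.V = hdim W p + 2 * n := by
  rw [hdim_aug_succ E.toMatSES (E.mulSurj W) (E.aug_eq_zero h), add_assoc, E.hdim_perm_succ W hc]

end rows

section periodicity

/-- The product of a scalar and a vector, as a pairing. -/
def scalPair {G : Type} [Group G] (B : Rep.{0} (ZMod 2) G) : Pairing (triv (ZMod 2) G) B B where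
  toLin := LinearMap.lsmul (ZMod 2) B.V
  map_ρ g c b := (map_smul (B.ρ g) (c : ZMod 2) b).symm

variable (W : Rep.{0} (ZMod 2) D8)

/-- The product `M ⊗ Λ²M ⊗ W → Λ³M ⊗ W = W`. -/
def wedgeHom : T natMat (T wedgeMat W) ⟶ W :=
  invHom (Tcurry natMat wedgeMat W) Tcurry_bijective ≫ (Efree.aug W).p

theorem wedgeHom_apply (F : Fin 3 → Fin 3 → W.V) :
    (wedgeHom W).hom F = ∑ p : Fin 3 × Fin 3, Efree.Q () p • F p.1 p.2 := by
  have e : (invHom (Tcurry natMat wedgeMat W) Tcurry_bijective).hom F = fun p => F p.1 p.2 :=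
    Tcurry_bijective.1 (hom_invHom (Tcurry natMat wedgeMat W) Tcurry_bijective F)
  change (Efree.aug W).p.hom ((invHom (Tcurry natMat wedgeMat W) Tcurry_bijective).hom F) = _
  rw [e, MatSES.aug_p_apply]

/-- The product is onto on cohomology, because its kernel is free. -/
theorem wedgeHom_surjective (n : ℕ) : Function.Surjective (Hmap (wedgeHom W) n) := fun u => by
  obtain ⟨v, rfl⟩ := (Efree.aug W).surjective_of_acyclic (acyclic_regular W) n u
  refine ⟨Hmap (Tcurry natMat wedgeMat W) n v, ?_⟩
  rw [← Hmap_comp_apply]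
  refine LinearMap.congr_fun (Hmap_congr (fun a => ?_) n) v
  exact congrArg (Efree.aug W).p.hom (invHom_hom _ Tcurry_bijective a)

theorem hdim_succ_eq_wedge [Module.Finite (ZMod 2) W.V] (p : ℕ) :
    hdim W (p + 1) = hdim (T natMat (T wedgeMat W)) (p + 1) :=
  ((Efree.aug W).hdim_of_acyclic (acyclic_regular W) p).symm.trans
    (hdim_congr (Tcurry natMat wedgeMat W) Tcurry_bijective _)

/-- The product `W × (M ⊗ Λ²M) → M ⊗ Λ²M ⊗ W`. -/
def pairTT : Pairing W (T natMat (T wedgeMat W1)) (T natMat (T wedgeMat W)) where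
  toLin := LinearMap.mk₂ (ZMod 2) (fun w (F : Fin 3 → Fin 3 → ZMod 2) i j => F i j • w)
    (fun _ _ _ => funext fun _ => funext fun _ => smul_add _ _ _)
    (fun _ _ _ => funext fun _ => funext fun _ => smul_comm _ _ _)
    (fun _ _ _ => funext fun _ => funext fun _ => add_smul _ _ _)
    (fun _ _ _ => funext fun _ => funext fun _ => mul_smul _ _ _)
  map_ρ g w F := by
    funext i
    change (fun j => (∑ i', natMat g i i' • Tρ wedgeMat W1 g (F i')) j • W.ρ g w) =
      ∑ i', natMat g i i' • Tρ wedgeMat W g ((pairT wedgeMat W).toLin w (F i'))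
    have h3 : ∀ i', Tρ wedgeMat W g ((pairT wedgeMat W).toLin w (F i')) =
      (pairT wedgeMat W).toLin (W.ρ g w) (Tρ wedgeMat W1 g (F i')) := fun i' =>
        ((pairT wedgeMat W).map_ρ g w (F i')).symm
    simp only [h3, ← map_smul ((pairT wedgeMat W).toLin (W.ρ g w)),
      ← map_sum ((pairT wedgeMat W).toLin (W.ρ g w))]
    rfl

/-- The class in `H²(D8, k)` which is the product of the classes of the extensions `Eb` and `Ea`. -/
def wcls : groupCohomology W1 2 :=
  Hmap (wedgeHom W1) 2 (cup (pairT natMat (T wedgeMat W1)) 1 1 Cb.θ Ca.θ)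

variable {W}

/-- Every class of degree at least two in `W` is the image of a class in `M ⊗ Λ²M ⊗ W`, to which
`CosetExt.generation` applies twice. -/
theorem generation_of_traces (hb : TraceZero (sr 1) W) (ha : TraceZero (sr 0) (T wedgeMat W)) (p : ℕ)
    (u : groupCohomology W (p + 2)) :
    ∃ (a : groupCohomology W (p + 1)) (b : groupCohomology W p),
      u = cup (pair1 W) (p + 1) 1 a sig + cup (pair1 W) p 2 b wcls := by
  obtain ⟨v, rfl⟩ := wedgeHom_surjective W (p + 2) u
  obtain ⟨a, b, rfl⟩ := Ca.generation ha (p + 1) v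
  obtain ⟨a', b', rfl⟩ := Cb.generation hb p a
  refine ⟨Hmap (wedgeHom W) (p + 1) b +
    Hmap (wedgeHom W) (p + 1) (cup (pairT natMat (T wedgeMat W)) p 1 b' Ca.θ), a', ?_⟩
  have e1 : cup (pairT natMat (T wedgeMat W)) (p + 1) 1 (cup (pairT wedgeMat W) p 1 a' Cb.θ) Ca.θ =
      cup (pairTT W) p 2 a' (cup (pairT natMat (T wedgeMat W1)) 1 1 Cb.θ Ca.θ) :=
    cup_assoc_one (pairT wedgeMat W) (pairT natMat (T wedgeMat W))
      (pairT natMat (T wedgeMat W1)) (pairTT W) (fun w f f' => funext fun i => funext fun j =>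
        smul_smul ((f' : Fin 3 → ZMod 2) i) ((f : Fin 3 → ZMod 2) j) w) _ _ _
  have e2 : cup (pairT natMat (T wedgeMat W)) (p + 1) 1
        (cup (pair1 (T wedgeMat W)) p 1 b' sig) Ca.θ =
      cup (pair1 (T natMat (T wedgeMat W))) (p + 1) 1
        (cup (pairT natMat (T wedgeMat W)) p 1 b' Ca.θ) sig := by
    rw [cup_assoc_one (pair1 (T wedgeMat W)) (pairT natMat (T wedgeMat W)) (scalPair _)
      (pairT natMat (T wedgeMat W)), cup_comm_one _ (scalPair _) (fun _ _ => rfl)]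
    · refine (cup_assoc_one (pairT natMat (T wedgeMat W)) (pair1 (T natMat (T wedgeMat W)))
        (pair1 (T natMat W1)) (pairT natMat (T wedgeMat W)) ?_ _ _ _).symm
      exact fun w f c => funext fun i => smul_smul (c : ZMod 2) ((f : Fin 3 → ZMod 2) i) w
    · exact fun w c f => funext fun i =>
        (smul_smul ((f : Fin 3 → ZMod 2) i) (c : ZMod 2) w).trans
        (congrArg (fun c : ZMod 2 => c • w) (mul_comm _ _))
  have e3 : ∀ v, Hmap (wedgeHom W) (p + 2) (cup (pairTT W) p 2 a' v) =
      cup (pair1 W) p 2 a' (Hmap (wedgeHom W1) 2 v) := fun v => by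
    rw [Hmap_cup (pairTT W) (pair1 W) (𝟙 W) (wedgeHom W1) (wedgeHom W), Hmap_id_apply]
    intro w F
    refine (wedgeHom_apply W _).trans (Eq.trans ?_ (congrArg (fun c : ZMod 2 => c • w) (wedgeHom_apply W1 F)).symm)
    exact sum_smul_eq _ _ _
  have e4 : ∀ v, Hmap (wedgeHom W) (p + 2)
      (cup (pair1 (T natMat (T wedgeMat W))) (p + 1) 1 v sig) =
        cup (pair1 W) (p + 1) 1 (Hmap (wedgeHom W) (p + 1) v) sig := fun v =>
    Hmap_pair1 (wedgeHom W) v sig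
  rw [map_add, map_add, LinearMap.add_apply, map_add, e1, e3, e2, e4, e4, map_add,
    LinearMap.add_apply]
  change cup (pair1 W) p 2 a' wcls + _ + _ = _
  abel

end periodicity

end tables

/-! ### Dimensions of cohomology groups of the dihedral group -/

section tables

open DihedralGroup

/-- The natural module. -/
abbrev WM : Rep.{0} (ZMod 2) D8 := T natMat W1

/-- The exterior square of the natural module. -/
abbrev WM2 : Rep.{0} (ZMod 2) D8 := T wedgeMat W1

/-- The permutation module on the cosets of a four-group. -/
abbrev WX : Rep.{0} (ZMod 2) D8 := T (permMat (ZMod 2) Ωx) W1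

/-- The tensor product of the natural module and `WX`. -/
abbrev WMX : Rep.{0} (ZMod 2) D8 := T natMat WX

/-- The tensor product of the exterior square and `WX`. -/
abbrev WM2X : Rep.{0} (ZMod 2) D8 := T wedgeMat WX

-- The modules below have at most 64 elements, and traces and fixed vectors are found by enumeration.

theorem traceZero_a_W1 : TraceZero (sr 0) W1 := by
  change ∀ w : ZMod 2, _
  decide +kernel

theorem card_a_W1 : Nat.card {w : W1.V // W1.ρ (sr 0) w = w} = 2 ^ 1 := by
  refine (Nat.card_eq_fintype_card (α := {w : ZMod 2 // W1.ρ (sr 0) w = w})).trans ?_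
  decide +kernel

theorem traceZero_a_WM : TraceZero (sr 0) WM := by
  change ∀ w : Fin 3 → ZMod 2, _
  decide +kernel

theorem card_a_WM : Nat.card {w : WM.V // WM.ρ (sr 0) w = w} = 2 ^ 2 := by
  refine (Nat.card_eq_fintype_card (α := {w : Fin 3 → ZMod 2 // WM.ρ (sr 0) w = w})).trans ?_
  decide +kernel

theorem traceZero_a_WM2 : TraceZero (sr 0) WM2 := by
  change ∀ w : Fin 3 → ZMod 2, _
  decide +kernel

theorem card_a_WM2 : Nat.card {w : WM2.V // WM2.ρ (sr 0) w = w} = 2 ^ 2 := by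
  refine (Nat.card_eq_fintype_card (α := {w : Fin 3 → ZMod 2 // WM2.ρ (sr 0) w = w})).trans ?_
  decide +kernel

theorem traceZero_a_WX : TraceZero (sr 0) WX := by
  change ∀ w : Ωx → ZMod 2, _
  decide +kernel

theorem card_a_WX : Nat.card {w : WX.V // WX.ρ (sr 0) w = w} = 2 ^ 1 := by
  refine (Nat.card_eq_fintype_card (α := {w : Ωx → ZMod 2 // WX.ρ (sr 0) w = w})).trans ?_
  decide +kernel

theorem traceZero_a_WMX : TraceZero (sr 0) WMX := by
  change ∀ w : Fin 3 → Ωx → ZMod 2, _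
  decide +kernel

theorem card_a_WMX : Nat.card {w : WMX.V // WMX.ρ (sr 0) w = w} = 2 ^ 3 := by
  refine (Nat.card_eq_fintype_card (α := {w : Fin 3 → Ωx → ZMod 2 // WMX.ρ (sr 0) w = w})).trans ?_
  decide +kernel

theorem traceZero_a_WM2X : TraceZero (sr 0) WM2X := by
  change ∀ w : Fin 3 → Ωx → ZMod 2, _
  decide +kernel

theorem card_a_WM2X : Nat.card {w : WM2X.V // WM2X.ρ (sr 0) w = w} = 2 ^ 3 := by
  refine (Nat.card_eq_fintype_card (α := {w : Fin 3 → Ωx → ZMod 2 // WM2X.ρ (sr 0) w = w})).trans ?_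
  decide +kernel

theorem traceZero_b_W1 : TraceZero (sr 1) W1 := by
  change ∀ w : ZMod 2, _
  decide +kernel

theorem card_b_W1 : Nat.card {w : W1.V // W1.ρ (sr 1) w = w} = 2 ^ 1 := by
  refine (Nat.card_eq_fintype_card (α := {w : ZMod 2 // W1.ρ (sr 1) w = w})).trans ?_
  decide +kernel

theorem traceZero_b_WX : TraceZero (sr 1) WX := by
  change ∀ w : Ωx → ZMod 2, _
  decide +kernel

theorem card_b_WX : Nat.card {w : WX.V // WX.ρ (sr 1) w = w} = 2 ^ 2 := by
  refine (Nat.card_eq_fintype_card (α := {w : Ωx → ZMod 2 // WX.ρ (sr 1) w = w})).trans ?_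
  decide +kernel

theorem finrank_W1 : Module.finrank (ZMod 2) W1.V = 1 := by
  change Module.finrank (ZMod 2) (ZMod 2) = 1
  simp

theorem finrank_WM : Module.finrank (ZMod 2) WM.V = 3 := by
  change Module.finrank (ZMod 2) (Fin 3 → ZMod 2) = 3
  simp

theorem finrank_WM2 : Module.finrank (ZMod 2) WM2.V = 3 := by
  change Module.finrank (ZMod 2) (Fin 3 → ZMod 2) = 3
  simp

theorem finrank_WX : Module.finrank (ZMod 2) WX.V = 2 := by
  change Module.finrank (ZMod 2) (Ωx → ZMod 2) = 2
  simp
  rfl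

theorem finrank_WMX : Module.finrank (ZMod 2) WMX.V = 6 := by
  change Module.finrank (ZMod 2) (Fin 3 → Ωx → ZMod 2) = 6
  simp [Module.finrank_pi_fintype]
  rfl

theorem finrank_WM2X : Module.finrank (ZMod 2) WM2X.V = 6 := by
  change Module.finrank (ZMod 2) (Fin 3 → Ωx → ZMod 2) = 6
  simp [Module.finrank_pi_fintype]
  rfl

theorem hdim_W1_zero : hdim W1 0 = 1 := by
  refine hdim_zero_eq ((Nat.card_eq_fintype_card (α := {w : ZMod 2 // ∀ g, W1.ρ g w = w})).trans ?_)
  decide +kernel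

theorem hdim_WX_zero : hdim WX 0 = 1 := by
  refine hdim_zero_eq
    ((Nat.card_eq_fintype_card (α := {w : Ωx → ZMod 2 // ∀ g, WX.ρ g w = w})).trans ?_)
  decide +kernel

section twoStep

variable {W : Rep.{0} (ZMod 2) D8} [Module.Finite (ZMod 2) W.V] {m n : ℕ}
  (hb : TraceZero (sr 1) W) (hm : Nat.card {w : W.V // W.ρ (sr 1) w = w} = 2 ^ m)
  (ha : TraceZero (sr 0) (T wedgeMat W))
  (hn : Nat.card {w : (T wedgeMat W).V // (T wedgeMat W).ρ (sr 0) w = w} = 2 ^ n)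

include hb hm ha hn

theorem hdim_one_of_traces :
    hdim W 1 + Module.finrank (ZMod 2) (T wedgeMat W).V = m + 2 * n := by
  rw [hdim_succ_eq_wedge W 0, Ca.hdim_succ ha hn 0, Cb.hdim_zero hb hm]

/-- Passing from `W` to `M ⊗ Λ²M ⊗ W` changes the cohomology by a free module only, and
`CosetExt.hdim_succ` computes the dimensions for the two factors in turn. -/
theorem hdim_add_two_of_traces (p : ℕ) :
    hdim W (p + 2) + Module.finrank (ZMod 2) (T wedgeMat W).V + Module.finrank (ZMod 2) W.V =
      hdim W p + 2 * m + 2 * n := by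
  rw [hdim_succ_eq_wedge W (p + 1), Ca.hdim_succ ha hn (p + 1), add_right_comm,
    Cb.hdim_succ hb hm p]

end twoStep

theorem hdim_W1 (p : ℕ) : hdim W1 p = p + 1 := by
  induction p using Nat.twoStepInduction with
  | zero => exact hdim_W1_zero
  | one =>
    have := hdim_one_of_traces traceZero_b_W1 card_b_W1 traceZero_a_WM2 card_a_WM2
    rw [finrank_WM2] at this
    omega
  | more p ih _ =>
    have := hdim_add_two_of_traces traceZero_b_W1 card_b_W1 traceZero_a_WM2 card_a_WM2 p
    rw [finrank_WM2, finrank_W1] at this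
    omega

theorem hdim_WX (p : ℕ) : hdim WX p = p + 1 := by
  induction p using Nat.twoStepInduction with
  | zero => exact hdim_WX_zero
  | one =>
    have := hdim_one_of_traces traceZero_b_WX card_b_WX traceZero_a_WM2X card_a_WM2X
    rw [finrank_WM2X] at this
    omega
  | more p ih _ =>
    have := hdim_add_two_of_traces traceZero_b_WX card_b_WX traceZero_a_WM2X card_a_WM2X p
    rw [finrank_WM2X, finrank_WX] at this
    omega

theorem hdim_WM (p : ℕ) : hdim WM p = p + 1 := by
  rcases p with _ | p
  · exact Ca.hdim_zero traceZero_a_W1 card_a_W1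
  · have : hdim WM (p + 1) + _ = _ := Ca.hdim_succ traceZero_a_W1 card_a_W1 p
    rw [finrank_W1, hdim_W1] at this
    omega

theorem hdim_WM2 (p : ℕ) : hdim WM2 p = p + 1 := by
  rcases p with _ | p
  · exact Cb.hdim_zero traceZero_b_W1 card_b_W1
  · have : hdim WM2 (p + 1) + _ = _ := Cb.hdim_succ traceZero_b_W1 card_b_W1 p
    rw [finrank_W1, hdim_W1] at this
    omega

theorem hdim_MM_zero : hdim (T natMat WM) 0 = 2 := Ca.hdim_zero traceZero_a_WM card_a_WM

theorem hdim_MM_succ (p : ℕ) : hdim (T natMat WM) (p + 1) = p + 2 := by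
  have : hdim (T natMat WM) (p + 1) + _ = _ := Ca.hdim_succ traceZero_a_WM card_a_WM p
  rw [finrank_WM, hdim_WM] at this
  omega

theorem hdim_MM2_zero : hdim (T natMat WM2) 0 = 2 := Ca.hdim_zero traceZero_a_WM2 card_a_WM2

theorem hdim_MM2_succ (p : ℕ) : hdim (T natMat WM2) (p + 1) = p + 2 := by
  have : hdim (T natMat WM2) (p + 1) + _ = _ := Ca.hdim_succ traceZero_a_WM2 card_a_WM2 p
  rw [finrank_WM2, hdim_WM2] at this
  omega

theorem hdim_WMX_zero : hdim WMX 0 = 1 := Ca.hdim_zero traceZero_a_WX card_a_WX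

theorem hdim_WMX_succ (p : ℕ) : hdim WMX (p + 1) = p + 1 := by
  have : hdim WMX (p + 1) + _ = _ := Ca.hdim_succ traceZero_a_WX card_a_WX p
  rw [finrank_WX, hdim_WX] at this
  omega

theorem hdim_WM2X (p : ℕ) : hdim WM2X p = p + 2 := by
  rcases p with _ | p
  · exact Cb.hdim_zero traceZero_b_WX card_b_WX
  · have : hdim WM2X (p + 1) + _ = _ := Cb.hdim_succ traceZero_b_WX card_b_WX p
    rw [finrank_WX, hdim_WX] at this
    omega

theorem hdim_MMX_zero : hdim (T natMat WMX) 0 = 3 := Ca.hdim_zero traceZero_a_WMX card_a_WMX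

theorem hdim_MMX_succ (p : ℕ) : hdim (T natMat WMX) (p + 1) = hdim WMX p := by
  have : hdim (T natMat WMX) (p + 1) + _ = _ := Ca.hdim_succ traceZero_a_WMX card_a_WMX p
  rw [finrank_WMX] at this
  omega

theorem hdim_MM2X_zero : hdim (T natMat WM2X) 0 = 3 := Ca.hdim_zero traceZero_a_WM2X card_a_WM2X

theorem hdim_MM2X_succ (p : ℕ) : hdim (T natMat WM2X) (p + 1) = p + 2 := by
  have : hdim (T natMat WM2X) (p + 1) + _ = _ := Ca.hdim_succ traceZero_a_WM2X card_a_WM2X p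
  rw [finrank_WM2X, hdim_WM2X] at this
  omega

/-- The permutation module on the cosets of `⟨sr 0⟩`. -/
abbrev permA : D8 →* Matrix Ωa Ωa (ZMod 2) := permMat (ZMod 2) Ωa

theorem hdim_permA_zero : hdim (T permA W1) 0 = 1 := Ca.hdim_perm_zero W1 card_a_W1

theorem hdim_permA_succ (p : ℕ) : hdim (T permA W1) (p + 1) = 1 := by
  have : hdim (T permA W1) (p + 1) + _ = _ := Ca.hdim_perm_succ W1 card_a_W1 p
  rw [finrank_W1] at this
  omega

theorem hdim_permA_M_zero : hdim (T permA WM) 0 = 2 := Ca.hdim_perm_zero WM card_a_WM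

theorem hdim_permA_M_succ (p : ℕ) : hdim (T permA WM) (p + 1) = 1 := by
  have : hdim (T permA WM) (p + 1) + _ = _ := Ca.hdim_perm_succ WM card_a_WM p
  rw [finrank_WM] at this
  omega

theorem hdim_permA_M2_zero : hdim (T permA WM2) 0 = 2 := Ca.hdim_perm_zero WM2 card_a_WM2

theorem hdim_permA_M2_succ (p : ℕ) : hdim (T permA WM2) (p + 1) = 1 := by
  have : hdim (T permA WM2) (p + 1) + _ = _ := Ca.hdim_perm_succ WM2 card_a_WM2 p
  rw [finrank_WM2] at this
  omega

/-- The regular representation. -/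
abbrev regMat : D8 →* Matrix D8 D8 (ZMod 2) := permMat (ZMod 2) D8

theorem hdim_reg_succ (W : Rep.{0} (ZMod 2) D8) (p : ℕ) : hdim (T regMat W) (p + 1) = 0 :=
  (acyclic_regular W).hdim p

end tables

open DihedralGroup

/-! ### `Λ(M) ⊗ S(M)` as an algebra with an action of the dihedral group -/

section commutative

variable {V : Type} [AddCommGroup V] [Module (ZMod 2) V]

theorem exterior_mul_comm (a b : ExteriorAlgebra (ZMod 2) V) : a * b = b * a := by
  have h0 : ∀ v w : V, Commute (ExteriorAlgebra.ι (ZMod 2) v) (ExteriorAlgebra.ι (ZMod 2) w) :=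
    fun v w => by
      have h := ExteriorAlgebra.ι_add_mul_swap (R := ZMod 2) v w
      exact sub_eq_zero.1 ((char_two_sub _ _).trans h)
  have h1 : ∀ (v : V) (b : ExteriorAlgebra (ZMod 2) V), Commute (ExteriorAlgebra.ι (ZMod 2) v) b :=
    fun v b => by
      induction b using ExteriorAlgebra.induction with
      | algebraMap r => exact (Algebra.commutes r _).symm
      | ι w => exact h0 v w
      | mul a b ha hb => exact ha.mul_right hb
      | add a b ha hb => exact ha.add_right hb
  change Commute a b
  induction a using ExteriorAlgebra.induction with
  | algebraMap r => exact Algebra.commutes r b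
  | ι v => exact h1 v b
  | mul a a' ha hb => exact ha.mul_left hb
  | add a a' ha hb => exact ha.add_left hb

/-- In characteristic two the exterior algebra is commutative. -/
instance : CommRing (ExteriorAlgebra (ZMod 2) V) where
  mul_comm := exterior_mul_comm

end commutative

theorem extSym_two : (2 : ExtSym) = 0 := by
  have : (2 : ExtSym) = (2 : ZMod 2) • (1 : ExtSym) := by rw [two_smul, one_add_one_eq_two]
  rw [this, show (2 : ZMod 2) = 0 by decide, zero_smul]

theorem extι_mul_self (v : M) : extι v * extι v = 0 := by
  simp [extι]

section dihedralAction

/-- The isomorphism of the dihedral group with `U3`. -/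
def toU3 : D8 →* U3 :=
  (natMat.toHomUnits).codRestrict U3 fun g => by
    have : ∀ g : D8, natFun g 1 0 = 0 ∧ natFun g 2 0 = 0 ∧ natFun g 2 1 = 0 := by decide +kernel
    change ∀ i j : Fin 3, j < i → natFun g i j = 0
    intro i j h
    fin_cases i <;> fin_cases j <;> simp_all

theorem toU3_bijective : Function.Bijective toU3 := by
  constructor
  · intro g h e
    have e1 : natFun g = natFun h := congrArg (fun u : U3 => u.1.1) e
    have : ∀ g h : D8, natFun g = natFun h → g = h := by decide +kernel
    exact this g h e1
  · intro u
    have hu := u.2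
    have hdet : u.1.1.det ≠ 0 := ((Matrix.isUnit_iff_isUnit_det _).1 u.1.isUnit).ne_zero
    rw [Matrix.det_of_isUpperTriangular (M := u.1.1) fun i j h => hu i j h,
        Fin.prod_univ_three] at hdet
    have key : ∀ a b c d e f : ZMod 2, a * b * c ≠ 0 → ∃ g, natFun g = !![a, d, e; 0, b, f; 0, 0,
        c] := by
      decide +kernel
    obtain ⟨g, hg⟩ := key _ _ _ (u.1.1 0 1) (u.1.1 0 2) (u.1.1 1 2) hdet
    refine ⟨g, Subtype.ext (Units.ext (Eq.trans hg ?_))⟩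
    ext i j
    have h1 := hu 1 0 (by decide)
    have h2 := hu 2 0 (by decide)
    have h3 := hu 2 1 (by decide)
    fin_cases i <;> fin_cases j <;> simp [h1, h2, h3]

/-- The action of the dihedral group on `Λ(M) ⊗ S(M)`. -/
def actA (g : D8) : ExtSym →ₐ[ZMod 2] ExtSym := extSymMap (natural (toU3 g))

theorem actA_mul (g h : D8) (a : ExtSym) : actA (g * h) a = actA g (actA h a) := by
  have := congr($(extSymMap_comp (natural (toU3 g)) (natural (toU3 h))) a)
  rw [← Module.End.mul_eq_comp, ← map_mul, ← map_mul] at this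
  exact this

theorem actA_one (a : ExtSym) : actA 1 a = a := by
  rw [actA, map_one, map_one, Module.End.one_eq_id, extSymMap_id, AlgHom.id_apply]

theorem actA_ext (g : D8) (v : M) : actA g (extι v) = extι ((natFun g).mulVec v) := by
  change actA g (extι v) = extι (natural (toU3 g) v)
  simp [actA, extι, extSymMap]

theorem actA_sym (g : D8) (v : M) : actA g (symι v) = symι ((natFun g).mulVec v) := by
  change actA g (symι v) = symι (natural (toU3 g) v)
  simp [actA, symι, extSymMap]

/-- Invariance can be checked on generators. -/
theorem actA_eq_of_generators {u : ExtSym} (h1 : actA (r 1) u = u) (h2 : actA (sr 0) u =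
    u) (g : D8) :
    actA g u = u := by
  have h3 : ∀ n : ℕ, actA (r 1 ^ n) u = u := by
    intro n
    induction n with
    | zero => rw [pow_zero, actA_one]
    | succ n ih => rw [pow_succ, actA_mul, h1, ih]
  have h4 : ∀ i : ZMod 4, actA (r i) u = u := fun i => by
    have := h3 i.val
    rwa [r_one_pow, ZMod.natCast_zmod_val] at this
  rcases g with i | i
  · exact h4 i
  · rw [show (sr i : D8) = sr 0 * r i by rw [sr_mul_r, zero_add], actA_mul, h4, h2]

/-- The action of the dihedral group on the graded pieces of `Λ(M) ⊗ S(M)`. -/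
def Aρ (n : ℕ) : Representation (ZMod 2) D8 (extSymDeg n) := (extSymRep n).ρ.comp toU3

/-- The graded pieces of `Λ(M) ⊗ S(M)` as representations of the dihedral group. -/
abbrev A (n : ℕ) : Rep.{0} (ZMod 2) D8 := Rep.of (Aρ n)

theorem Aρ_apply (n : ℕ) (g : D8) (a : extSymDeg n) : (Aρ n g a).1 = actA g a.1 := rfl

/-- `Λ(M) ⊗ S(M)` as graded coefficients for the dihedral group. -/
abbrev Y : GradedCoeff (ZMod 2) D8 where
  obj := A
  mul i j :=
    { toLin := (extSym.mul i j).toLin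
      map_ρ := fun g a b => (extSym.mul i j).map_ρ (toU3 g) a b }

end dihedralAction

section degrees

section generic

variable {R B : Type} [CommSemiring R] [Semiring B] [Algebra R B] (U V : Submodule R B)

theorem mem_pow_one_mul_pow_zero {a : B} (h : a ∈ U) : a ∈ U ^ 1 * V ^ 0 := by
  rwa [pow_one, pow_zero, mul_one]

theorem mem_pow_zero_mul_pow_one {a : B} (h : a ∈ V) : a ∈ U ^ 0 * V ^ 1 := by
  rwa [pow_one, pow_zero, one_mul]

theorem one_mem_pow_zero_mul_pow_zero : (1 : B) ∈ U ^ 0 * V ^ 0 := by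
  rw [pow_zero, pow_zero, one_mul]
  exact Submodule.one_le.1 le_rfl

theorem pow_mul_pow_le {N : ℕ → ℕ → Submodule R B} (h1 : 1 ∈ N 0 0)
    (hV : ∀ j, ∀ v ∈ V, ∀ a ∈ N 0 j, v * a ∈ N 0 (j + 1))
    (hU : ∀ i j, ∀ u ∈ U, ∀ a ∈ N i j, u * a ∈ N (i + 1) j) (i j : ℕ) : U ^ i * V ^ j ≤ N i j := by
  induction i with
  | zero =>
    rw [pow_zero, one_mul]
    induction j with
    | zero => rw [pow_zero]; exact Submodule.one_le.2 h1
    | succ j ih =>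
      rw [pow_succ', Submodule.mul_le]
      exact fun v hv a ha => hV j v hv a (ih ha)
  | succ i ih =>
    rw [pow_succ', mul_assoc, Submodule.mul_le]
    exact fun v hv a ha => hU i j v hv a (ih ha)

end generic

theorem extι_mem (v : M) : extι v ∈ extSymDeg 1 :=
  Submodule.mem_iSup_of_mem 1 (Submodule.mem_iSup_of_mem 0 (Submodule.mem_iSup_of_mem rfl
    (mem_pow_one_mul_pow_zero (B := ExtSym) _ _ ⟨v, rfl⟩)))

theorem symι_mem (v : M) : symι v ∈ extSymDeg 2 :=
  Submodule.mem_iSup_of_mem 0 (Submodule.mem_iSup_of_mem 1 (Submodule.mem_iSup_of_mem rfl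
    (mem_pow_zero_mul_pow_one (B := ExtSym) _ _ ⟨v, rfl⟩)))

theorem one_mem_deg : (1 : ExtSym) ∈ extSymDeg 0 :=
  Submodule.mem_iSup_of_mem 0 (Submodule.mem_iSup_of_mem 0 (Submodule.mem_iSup_of_mem rfl
    (one_mem_pow_zero_mul_pow_zero (B := ExtSym) _ _)))

/-- To bound the graded pieces of `Λ(M) ⊗ S(M)` it suffices to find bigraded subspaces closed under
multiplication by the generators. -/
theorem extSymDeg_le {N : ℕ → ℕ → Submodule (ZMod 2) ExtSym} (h1 : 1 ∈ N 0 0)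
    (hV : ∀ j v, ∀ a ∈ N 0 j, symι v * a ∈ N 0 (j + 1))
    (hU : ∀ i j v, ∀ a ∈ N i j, extι v * a ∈ N (i + 1) j) {n : ℕ}
    {N' : Submodule (ZMod 2) ExtSym} (h : ∀ i j, i + 2 * j = n → N i j ≤ N') :
    extSymDeg n ≤ N' := by
  refine iSup_le fun i => iSup_le fun j => iSup_le fun e => le_trans ?_ (h i j e)
  refine pow_mul_pow_le (B := ExtSym) _ _ h1 ?_ ?_ i j
  · rintro j _ ⟨v, rfl⟩ a ha
    exact hV j v a ha
  · rintro i j _ ⟨v, rfl⟩ a ha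
    exact hU i j v a ha

theorem mem_deg_of_eq {m n : ℕ} (h : m = n) {a : ExtSym} (ha : a ∈ extSymDeg m) :
    a ∈ extSymDeg n := h ▸ ha

theorem pow_mem_deg {m : ℕ} {a : ExtSym} (ha : a ∈ extSymDeg m) (n : ℕ) :
    a ^ n ∈ extSymDeg (m * n) := by
  induction n with
  | zero => rw [pow_zero]; exact one_mem_deg
  | succ n ih => rw [pow_succ]; exact extSymDeg_mul ih ha

end degrees

section generators

/-- The basis vector `x` as an element of `Λ¹(M)`. -/
def eX : ExtSym := extι (Pi.single 0 1)
/-- The basis vector `y` as an element of `Λ¹(M)`. -/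
def eY : ExtSym := extι (Pi.single 1 1)
/-- The basis vector `z` as an element of `Λ¹(M)`. -/
def eZ : ExtSym := extι (Pi.single 2 1)
/-- The basis vector `x` as a linear form in `S¹(M)`. -/
def sx : ExtSym := symι (Pi.single 0 1)
/-- The basis vector `y` as a linear form in `S¹(M)`. -/
def sy : ExtSym := symι (Pi.single 1 1)
/-- The basis vector `z` as a linear form in `S¹(M)`. -/
def sz : ExtSym := symι (Pi.single 2 1)

theorem ext_sum (v : M) : extι v = v 0 • eX + v 1 • eY + v 2 • eZ := by
  conv_lhs => rw [pi_eq_sum_univ' v, map_sum, Fin.sum_univ_three]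
  simp only [map_smul]
  rfl

theorem sym_sum (v : M) : symι v = v 0 • sx + v 1 • sy + v 2 • sz := by
  conv_lhs => rw [pi_eq_sum_univ' v, map_sum, Fin.sum_univ_three]
  simp only [map_smul]
  rfl


theorem eX_mem : eX ∈ extSymDeg 1 := extι_mem _
theorem eY_mem : eY ∈ extSymDeg 1 := extι_mem _
theorem eZ_mem : eZ ∈ extSymDeg 1 := extι_mem _
theorem sx_mem : sx ∈ extSymDeg 2 := symι_mem _
theorem sy_mem : sy ∈ extSymDeg 2 := symι_mem _
theorem sz_mem : sz ∈ extSymDeg 2 := symι_mem _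

theorem eX_mul_self : eX * eX = 0 := extι_mul_self _
theorem eY_mul_self : eY * eY = 0 := extι_mul_self _
theorem eZ_mul_self : eZ * eZ = 0 := extι_mul_self _

theorem mulVec_single (g : D8) (j : Fin 3) :
    (natFun g).mulVec (Pi.single j 1) = fun i => natFun g i j := by
  simp [Matrix.col]
  rfl

theorem actA_gen_ext (g : D8) (j : Fin 3) : actA g (extι (Pi.single j 1)) =
    natFun g 0 j • eX + natFun g 1 j • eY + natFun g 2 j • eZ := by
  rw [actA_ext, mulVec_single, ext_sum]

theorem actA_gen_sym (g : D8) (j : Fin 3) : actA g (symι (Pi.single j 1)) =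
    natFun g 0 j • sx + natFun g 1 j • sy + natFun g 2 j • sz := by
  rw [actA_sym, mulVec_single, sym_sum]


@[simp] theorem act_r1_eX : actA (r 1) eX = eX := by
  refine (actA_gen_ext _ 0).trans ?_
  simp [natFun]

@[simp] theorem act_r1_eY : actA (r 1) eY = eX + eY := by
  refine (actA_gen_ext _ 1).trans ?_
  simp [natFun]

@[simp] theorem act_r1_eZ : actA (r 1) eZ = eY + eZ := by
  refine (actA_gen_ext _ 2).trans ?_
  simp [natFun]

@[simp] theorem act_r1_sx : actA (r 1) sx = sx := by
  refine (actA_gen_sym _ 0).trans ?_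
  simp [natFun]

@[simp] theorem act_r1_sy : actA (r 1) sy = sx + sy := by
  refine (actA_gen_sym _ 1).trans ?_
  simp [natFun]

@[simp] theorem act_r1_sz : actA (r 1) sz = sy + sz := by
  refine (actA_gen_sym _ 2).trans ?_
  simp [natFun]

@[simp] theorem act_sr0_eX : actA (sr 0) eX = eX := by
  refine (actA_gen_ext _ 0).trans ?_
  simp [natFun]

@[simp] theorem act_sr0_eY : actA (sr 0) eY = eY := by
  refine (actA_gen_ext _ 1).trans ?_
  simp [natFun]

@[simp] theorem act_sr0_eZ : actA (sr 0) eZ = eY + eZ := by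
  refine (actA_gen_ext _ 2).trans ?_
  simp [natFun]

@[simp] theorem act_sr0_sx : actA (sr 0) sx = sx := by
  refine (actA_gen_sym _ 0).trans ?_
  simp [natFun]

@[simp] theorem act_sr0_sy : actA (sr 0) sy = sy := by
  refine (actA_gen_sym _ 1).trans ?_
  simp [natFun]

@[simp] theorem act_sr0_sz : actA (sr 0) sz = sy + sz := by
  refine (actA_gen_sym _ 2).trans ?_
  simp [natFun]

@[simp] theorem act_sr1_sx : actA (sr 1) sx = sx := by
  refine (actA_gen_sym _ 0).trans ?_
  simp [natFun]

@[simp] theorem act_sr1_sy : actA (sr 1) sy = sx + sy := by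
  refine (actA_gen_sym _ 1).trans ?_
  simp [natFun]

@[simp] theorem act_sr1_sz : actA (sr 1) sz = sz := by
  refine (actA_gen_sym _ 2).trans ?_
  simp [natFun]

@[simp] theorem act_r2_eX : actA (r 2) eX = eX := by
  refine (actA_gen_ext _ 0).trans ?_
  simp [natFun]

@[simp] theorem act_r2_eY : actA (r 2) eY = eY := by
  refine (actA_gen_ext _ 1).trans ?_
  simp [natFun]

@[simp] theorem act_r2_eZ : actA (r 2) eZ = eX + eZ := by
  refine (actA_gen_ext _ 2).trans ?_
  simp [natFun]

@[simp] theorem act_r2_sx : actA (r 2) sx = sx := by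
  refine (actA_gen_sym _ 0).trans ?_
  simp [natFun]

@[simp] theorem act_r2_sy : actA (r 2) sy = sy := by
  refine (actA_gen_sym _ 1).trans ?_
  simp [natFun]

@[simp] theorem act_r2_sz : actA (r 2) sz = sx + sz := by
  refine (actA_gen_sym _ 2).trans ?_
  simp [natFun]

end generators

/-! ### The subring of the cohomology generated in degrees at most eight -/

section pairings

variable {G : Type} [Group G] {A B C W : Rep.{0} (ZMod 2) G} {I : Type} [Fintype I] [DecidableEq I]
  {ρ : G →* Matrix I I (ZMod 2)}

/-- The morphism `T ρ W ⟶ C` obtained from a pairing `A × B → C`, a morphism `W ⟶ A` and a family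
of elements of `B` which transforms according to `ρ`. -/
def pairHom (μ : Pairing A B C) (l : I → B.V) (hl : ∀ g j, B.ρ g (l j) = ∑ i, ρ g i j • l i)
    (e : W ⟶ A) : T ρ W ⟶ C :=
  mkHom (A := T ρ W)
    { toFun := fun f => ∑ i, μ.toLin (e.hom (f i)) (l i)
      map_add' := fun f f' => by
        rw [← Finset.sum_add_distrib]
        refine Finset.sum_congr rfl fun i _ => ?_
        rw [← LinearMap.add_apply, ← map_add, ← map_add]
        rfl
      map_smul' := fun c f => by
        rw [RingHom.id_apply, Finset.smul_sum]
        refine Finset.sum_congr rfl fun i _ => ?_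
        rw [← LinearMap.smul_apply, ← map_smul, ← map_smul]
        rfl }
    fun g f => by
      change ∑ i, μ.toLin (e.hom (∑ j, ρ g i j • W.ρ g (f j))) (l i) =
        C.ρ g (∑ i, μ.toLin (e.hom (f i)) (l i))
      simp only [map_sum, map_smul, LinearMap.sum_apply, LinearMap.smul_apply]
      rw [Finset.sum_comm]
      refine Finset.sum_congr rfl fun j _ => ?_
      rw [← μ.map_ρ, hl, map_sum]
      refine Finset.sum_congr rfl fun i _ => ?_
      rw [map_smul, Rep.hom_comm_apply]

end pairings

section generation

/-- A bigraded subspace of the cohomology which is closed under products and contains all elements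
of total degree at most eight. -/
structure Good (F : (p q : ℕ) → Submodule (ZMod 2) (Y.H p q)) : Prop where
  low : ∀ p q, p + q ≤ 8 → F p q = ⊤
  mul : ∀ p q p' q' (x : Y.H p q) (y : Y.H p' q'), x ∈ F p q → y ∈ F p' q' →
    Y.cup x y ∈ F (p + p') (q + q')

theorem Good.mem {F : (p q : ℕ) → Submodule (ZMod 2) (Y.H p q)} (hF : Good F) {p q : ℕ}
    (h : p + q ≤ 8) (x : Y.H p q) : x ∈ F p q := by
  rw [hF.low p q h]; trivial

/-- The underlying element of `Λ(M) ⊗ S(M)`. -/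
def val {q : ℕ} (a : (Y.obj q).V) : ExtSym := (a : extSymDeg q).1

theorem val_injective {q : ℕ} : Function.Injective (val (q := q)) := Subtype.val_injective

theorem val_mul {i j : ℕ} (a : (Y.obj i).V) (b : (Y.obj j).V) :
    val ((Y.mul i j).toLin a b) = val a * val b := rfl

theorem val_ρ {q : ℕ} (g : D8) (a : (Y.obj q).V) : val ((Y.obj q).ρ g a) = actA g (val a) := rfl

theorem val_add {q : ℕ} (a b : (Y.obj q).V) : val (a + b) = val a + val b := rfl

theorem val_smul {q : ℕ} (c : ZMod 2) (a : (Y.obj q).V) : val (c • a) = c • val a := rfl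

theorem val_sum {q : ℕ} {ι : Type} (s : Finset ι) (a : ι → (Y.obj q).V) :
    val (∑ i ∈ s, a i) = ∑ i ∈ s, val (a i) :=
  map_sum (extSymDeg q).subtype a s

variable {W W' : Rep.{0} (ZMod 2) D8} {q r : ℕ}

/-- The image of `e` on cohomology is contained in the subring generated in degrees at most eight. -/
def Gen (e : W ⟶ Y.obj q) : Prop :=
  ∀ F, Good F → ∀ p (u : groupCohomology W p), Hmap e p u ∈ F p q

/-- The analogue of `Gen` for `H⁰`. -/
def GenZero (e : W ⟶ Y.obj q) : Prop :=
  ∀ F, Good F → ∀ u : groupCohomology W 0, Hmap e 0 u ∈ F 0 q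

theorem genZero_of_le (h : q ≤ 8) (e : W ⟶ Y.obj q) : GenZero e :=
  fun _ hF _ => hF.mem (by omega) _

/-- The unit. -/
def unitHom : W1 ⟶ Y.obj 0 :=
  mkHom (LinearMap.toSpanSingleton (ZMod 2) (Y.obj 0).V (⟨1, one_mem_deg⟩ : extSymDeg 0))
    fun g c => by
      change _ = (Y.obj 0).ρ g ((c : ZMod 2) • (⟨1, one_mem_deg⟩ : extSymDeg 0))
      rw [map_smul]
      refine congrArg ((c : ZMod 2) • ·) (val_injective ?_)
      rw [val_ρ]
      exact (map_one _).symm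

theorem val_unitHom (c : ZMod 2) : val (unitHom.hom c) = c • 1 := rfl

theorem Hmap_cup_scalar (e : W ⟶ Y.obj q) {p p' : ℕ} (z : groupCohomology W p)
    (s : groupCohomology W1 p') :
    Hmap e (p + p') (cup (pair1 W) p p' z s) =
      Y.cup (Hmap e p z) (Hmap unitHom p' s) := by
  refine Hmap_cup (pair1 W) (Y.mul q 0) e unitHom e (fun a b => val_injective ?_) z s
  rw [pair1_apply, map_smul, val_smul, val_mul, val_unitHom, mul_smul_comm, mul_one]

theorem Good.cup_scalar {F : (p q : ℕ) → Submodule (ZMod 2) (Y.H p q)} (hF : Good F)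
    (e : W ⟶ Y.obj q) {p p' : ℕ} (h : p' ≤ 8) {z : groupCohomology W p}
    (hz : Hmap e p z ∈ F p q) (s : groupCohomology W1 p') :
    Hmap e (p + p') (cup (pair1 W) p p' z s) ∈ F (p + p') q := by
  rw [Hmap_cup_scalar]
  exact hF.mul p q p' 0 _ _ hz (hF.mem h _)

theorem Gen.of_mulSurj {s : groupCohomology W1 1} (hs : MulSurj s W) (e : W ⟶ Y.obj q)
    (h0 : GenZero e) : Gen e := fun F hF p => by
  induction p with
  | zero => exact h0 F hF
  | succ p ih =>
    intro u
    obtain ⟨z, rfl⟩ := hs p u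
    exact hF.cup_scalar e (by norm_num) (ih z) s

theorem Gen.of_acyclic (hW : Acyclic W) (e : W ⟶ Y.obj q) (h0 : GenZero e) : Gen e :=
  fun F hF p => by
  rcases p with _ | p
  · exact h0 F hF
  · intro u
    rw [hW p u, map_zero]
    exact zero_mem _

/-- In degrees zero and one the bound on `q` suffices; higher classes are products by
`generation_of_traces`. -/
theorem Gen.of_traces (hb : TraceZero (sr 1) W) (ha : TraceZero (sr 0) (T wedgeMat W))
    (hq : q + 1 ≤ 8) (e : W ⟶ Y.obj q) : Gen e := fun F hF p => by
  induction p using Nat.twoStepInduction with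
  | zero => exact fun u => hF.mem (by omega) _
  | one => exact fun u => hF.mem (by omega) _
  | more p ih ih' =>
    intro u
    obtain ⟨a, b, rfl⟩ := generation_of_traces hb ha p u
    rw [map_add]
    exact add_mem (hF.cup_scalar e (by norm_num) (ih' a) sig)
      (hF.cup_scalar e (p' := 2) (by norm_num) (ih b) wcls)

section families

variable {I : Type} [Fintype I] [DecidableEq I]

/-- A family of elements of `Λ(M) ⊗ S(M)` of degree `r` which transforms according to the matrix
representation `ρ`. -/
structure Fam (ρ : D8 →* Matrix I I (ZMod 2)) (r : ℕ) where
  el : I → (Y.obj r).V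
  map_el : ∀ g j, (Y.obj r).ρ g (el j) = ∑ i, ρ g i j • el i

variable {ρ : D8 →* Matrix I I (ZMod 2)} (l : Fam ρ r)

/-- The product with a family. -/
def Fam.mulHom (e : W ⟶ Y.obj q) : T ρ W ⟶ Y.obj (q + r) :=
  pairHom (Y.mul q r) l.el l.map_el e

theorem Fam.mulHom_apply (e : W ⟶ Y.obj q) (f : I → W.V) :
    (l.mulHom e).hom f = ∑ i, (Y.mul q r).toLin (e.hom (f i)) (l.el i) := rfl

/-- The morphism defined by a family. -/
def Fam.hom : T ρ W1 ⟶ Y.obj r :=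
  mkHom (A := T ρ W1)
    { toFun := fun f => ∑ i, (f i : ZMod 2) • l.el i
      map_add' := fun f f' => by
        rw [← Finset.sum_add_distrib]
        exact Finset.sum_congr rfl fun i _ => add_smul (f i : ZMod 2) (f' i : ZMod 2) _
      map_smul' := fun c f => by
        rw [RingHom.id_apply, Finset.smul_sum]
        exact Finset.sum_congr rfl fun i _ => mul_smul c (f i : ZMod 2) _ }
    fun g f => by
      change ∑ i, (∑ j, ρ g i j • (f j : ZMod 2)) • l.el i =
        (Y.obj r).ρ g (∑ i, (f i : ZMod 2) • l.el i)
      simp only [map_sum, map_smul, Finset.sum_smul]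
      rw [Finset.sum_comm]
      refine Finset.sum_congr rfl fun j _ => ?_
      rw [l.map_el, Finset.smul_sum]
      refine Finset.sum_congr rfl fun i _ => ?_
      rw [smul_smul, smul_eq_mul, mul_comm]

theorem Hmap_cup_fam (e : W ⟶ Y.obj q) {p p' : ℕ} (z : groupCohomology W p)
    (s : groupCohomology (T ρ W1) p') :
    Hmap (l.mulHom e) (p + p') (cup (pairT ρ W) p p' z s) =
      Y.cup (Hmap e p z) (Hmap l.hom p' s) := by
  refine Hmap_cup (pairT ρ W) (Y.mul q r) e l.hom (l.mulHom e) (fun a b => ?_) z s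
  refine (l.mulHom_apply e _).trans (Eq.trans ?_
    (map_sum ((Y.mul q r).toLin (e.hom a)) (fun i => (b i : ZMod 2) • l.el i) Finset.univ).symm)
  refine Finset.sum_congr rfl fun i _ => ?_
  rw [map_smul]
  change (Y.mul q r).toLin (e.hom ((b i : ZMod 2) • a)) (l.el i) = _
  rw [map_smul, map_smul, LinearMap.smul_apply]

end families

/-- Generation passes from `W` to `ρ ⊗ W`, because the class of the extension `E` maps to a class of
total degree `1 + r`. -/
theorem Gen.fam {ρ : D8 →* Matrix (Fin 3) (Fin 3) (ZMod 2)} {a : D8} {Ω : Type} [Fintype Ω]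
    [DecidableEq Ω] [MulAction D8 Ω] (E : CosetExt ρ a Ω) (hW : TraceZero a W) (l : Fam ρ r)
    (hr : 1 + r ≤ 8) {e : W ⟶ Y.obj q} (he : Gen e) (h0 : GenZero (l.mulHom e)) :
    Gen (l.mulHom e) := fun F hF p => by
  induction p with
  | zero => exact h0 F hF
  | succ p ih =>
    intro u
    obtain ⟨z, b, rfl⟩ := E.generation hW p u
    rw [map_add, Hmap_cup_fam]
    exact add_mem (hF.mul p q 1 r _ _ (he F hF p z) (hF.mem hr _))
      (hF.cup_scalar _ (by norm_num) (ih b) sig)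

/-- The class of an invariant element. -/
def invCls (a : (Y.obj q).V) (h : ∀ g, (Y.obj q).ρ g a = a) : Y.H 0 q := cls₀ (A := Y.obj q) a h

/-- The invariant elements of degree `q` whose class lies in the subring generated in degrees at
most eight. -/
structure GenInv (q : ℕ) (u : ExtSym) : Prop where
  mem : u ∈ extSymDeg q
  inv : ∀ g, actA g u = u
  gen : ∀ F, Good F → ∀ h, invCls (q := q) (⟨u, mem⟩ : extSymDeg q) h ∈ F 0 q

theorem genInv_of_generators (h : q ≤ 8) {u : ExtSym} (hu : u ∈ extSymDeg q)
    (h1 : actA (DihedralGroup.r 1) u = u) (h2 : actA (sr 0) u = u) : GenInv q u :=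
  ⟨hu, actA_eq_of_generators h1 h2, fun _ hF _ => hF.mem (by omega) _⟩

theorem GenInv.inv' {u : ExtSym} (h : GenInv q u) (g : D8) :
    (Y.obj q).ρ g (⟨u, h.mem⟩ : extSymDeg q) = (⟨u, h.mem⟩ : extSymDeg q) :=
  val_injective (h.inv g)

theorem GenInv.add {u v : ExtSym} (hu : GenInv q u) (hv : GenInv q v) : GenInv q (u + v) where
  mem := add_mem hu.mem hv.mem
  inv g := by rw [map_add, hu.inv, hv.inv]
  gen F hF h := by
    have := add_mem (hu.gen F hF hu.inv') (hv.gen F hF hv.inv')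
    rw [invCls, invCls, cls₀, cls₀, ← cls_add] at this
    exact this

theorem GenInv.zero : GenInv q 0 where
  mem := zero_mem _
  inv g := map_zero _
  gen F hF h := by
    have e : invCls (q := q) (⟨0, zero_mem _⟩ : extSymDeg q) h = 0 := (cls₀_eq_zero _ h).2 rfl
    rw [e]
    exact zero_mem _

theorem GenInv.congr {r : ℕ} {u v : ExtSym} (hu : GenInv q u) (h : u = v) (hq : q = r) :
    GenInv r v := by
  subst h hq; exact hu

/-- The product with an invariant. -/
def mulInv (u : ExtSym) (hu : GenInv r u) (e : W ⟶ Y.obj q) : W ⟶ Y.obj (q + r) :=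
  mkHom (((Y.mul q r).toLin.flip (⟨u, hu.mem⟩ : extSymDeg r)).comp e.hom.toLinearMap) fun g w => by
    change (Y.mul q r).toLin (e.hom (W.ρ g w)) _ = (Y.obj (q +
        r)).ρ g ((Y.mul q r).toLin (e.hom w) _)
    rw [← (Y.mul q r).map_ρ, hu.inv', Rep.hom_comm_apply]

theorem val_mulInv (u : ExtSym) (hu : GenInv r u) (e : W ⟶ Y.obj q) (w : W.V) :
    val ((mulInv u hu e).hom w) = val (e.hom w) * u := rfl

theorem Hmap_mulInv (u : ExtSym) (hu : GenInv r u) (e : W ⟶ Y.obj q) {p : ℕ}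
    (z : groupCohomology W p) :
    Hmap (mulInv u hu e) p z = Y.cup (Hmap e p z) (invCls (q := r) _ hu.inv') := by
  let f : Y.obj q ⟶ Y.obj (q + r) :=
    mkHom ((Y.mul q r).toLin.flip (⟨u, hu.mem⟩ : extSymDeg r)) fun g w => by
      change (Y.mul q r).toLin ((Y.obj q).ρ g w) _ = (Y.obj (q + r)).ρ g ((Y.mul q r).toLin w _)
      rw [← (Y.mul q r).map_ρ, hu.inv']
  refine (Hmap_comp_apply e f p z).trans ?_
  exact (cup_zero_right (Y.mul q r) f _ hu.inv' _ (fun _ => rfl) _).symm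

theorem Gen.mulInv {u : ExtSym} (hu : GenInv r u) {e : W ⟶ Y.obj q} (he : Gen e) :
    Gen (mulInv u hu e) := fun F hF p z => by
  rw [Hmap_mulInv]
  exact hF.mul p q 0 r _ _ (he F hF p z) (hu.gen F hF _)

theorem GenInv.mul {u v : ExtSym} (hu : GenInv q u) (hv : GenInv r v) : GenInv (q + r) (u * v) where
  mem := extSymDeg_mul hu.mem hv.mem
  inv g := by rw [map_mul, hu.inv, hv.inv]
  gen F hF h := by
    have := hF.mul 0 q 0 r _ _ (hu.gen F hF hu.inv') (hv.gen F hF hv.inv')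
    have e : Y.cup (invCls (q := q) _ hu.inv') (invCls (q := r) _ hv.inv') =
        invCls (q := q + r) (⟨u * v, extSymDeg_mul hu.mem hv.mem⟩ : extSymDeg (q + r)) h := by
      refine (cup_cls (Y.mul q r) _ _).trans (cls_congr _ (funext fun x => ?_))
      change (Y.mul q r).toLin (⟨u, hu.mem⟩ : extSymDeg q) ((Y.obj r).ρ _ _) = _
      exact congrArg ((Y.mul q r).toLin (⟨u, hu.mem⟩ : extSymDeg q)) (hv.inv' _)
    rw [e] at this
    exact this

theorem GenInv.one : GenInv 0 1 :=
  genInv_of_generators (by norm_num) one_mem_deg (map_one _) (map_one _)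

theorem GenInv.pow {u : ExtSym} (hu : GenInv q u) (n : ℕ) : GenInv (q * n) (u ^ n) := by
  induction n with
  | zero => rw [pow_zero]; exact GenInv.one
  | succ n ih => rw [pow_succ]; exact ih.mul hu

theorem Gen.prodDesc {e : W ⟶ Y.obj q} {e' : W' ⟶ Y.obj q} (he : Gen e) (he' : Gen e') :
    Gen (prodDesc e e') := fun F hF p u => by
  obtain ⟨a, b, h⟩ := Hprod_decomp e e' u
  rw [h]
  exact add_mem (he F hF p a) (he' F hF p b)

end generation

section decompositions

/-- The subspace `R` of `Λ(M) ⊗ S(M)` in degree `q` is contained in the image of a module of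
dimension `d` whose cohomology has dimensions `h`, and this image on cohomology is contained in the
subring generated in degrees at most eight. -/
def Dec (q : ℕ) (R : Submodule (ZMod 2) ExtSym) (d : ℕ) (h : ℕ → ℕ) : Prop :=
  ∃ (W : Rep.{0} (ZMod 2) D8) (e : W ⟶ Y.obj q), Module.Finite (ZMod 2) W.V ∧
    Module.finrank (ZMod 2) W.V = d ∧ (∀ p, hdim W p = h p) ∧ Gen e ∧
    ∀ a ∈ R, ∃ w, val (e.hom w) = a

variable {q r d d' : ℕ} {R R' : Submodule (ZMod 2) ExtSym} {h h' : ℕ → ℕ}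

theorem Dec.mono (H : Dec q R d h) (hR : R' ≤ R) : Dec q R' d h := by
  obtain ⟨W, e, h1, h2, h3, h4, h5⟩ := H
  exact ⟨W, e, h1, h2, h3, h4, fun a ha => h5 a (hR ha)⟩

theorem Dec.add (H : Dec q R d h) (H' : Dec q R' d' h') :
    Dec q (R ⊔ R') (d + d') (h + h') := by
  obtain ⟨W, e, h1, h2, h3, h4, h5⟩ := H
  obtain ⟨W', e', h1', h2', h3', h4', h5'⟩ := H'
  refine ⟨prodRep W W', prodDesc e e', inferInstanceAs (Module.Finite (ZMod 2) (W.V × W'.V)),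
    ?_, fun p => ?_, h4.prodDesc h4', fun a ha => ?_⟩
  · rw [← h2, ← h2']
    exact Module.finrank_prod
  · rw [hdim_prod, h3, h3']; rfl
  · obtain ⟨b, hb, c, hc, rfl⟩ := Submodule.mem_sup.1 ha
    obtain ⟨w, rfl⟩ := h5 b hb
    obtain ⟨w', rfl⟩ := h5' c hc
    exact ⟨(w, w'), congrArg val (prodDesc_apply e e' (w, w'))⟩

theorem Dec.mulInv (H : Dec q R d h) {u : ExtSym} (hu : GenInv r u)
    (hR : ∀ a ∈ R', ∃ b ∈ R, a = b * u) : Dec (q + r) R' d h := by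
  obtain ⟨W, e, h1, h2, h3, h4, h5⟩ := H
  refine ⟨W, HS.mulInv u hu e, h1, h2, h3, h4.mulInv hu, fun a ha => ?_⟩
  obtain ⟨b, hb, rfl⟩ := hR a ha
  obtain ⟨w, rfl⟩ := h5 b hb
  exact ⟨w, val_mulInv u hu e w⟩

end decompositions

/-! ### Generators for the forms of each degree in three variables -/

section polynomials

variable {R : Type} [CommRing R] [Algebra (ZMod 2) R] (x y z : R)

theorem two_eq_zero_of_algebra (R : Type) [CommRing R] [Algebra (ZMod 2) R] : (2 : R) = 0 := by
  have : (2 : R) = (2 : ZMod 2) • (1 : R) := by rw [two_smul, one_add_one_eq_two]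
  rw [this, show (2 : ZMod 2) = 0 by decide, zero_smul]

theorem mem_of_eq_of_mem {T : Submodule (ZMod 2) R} {a b : R} (h : b ∈ T) (e : a = b) : a ∈ T :=
  e ▸ h

/-- The space of linear forms. -/
def polyM : Submodule (ZMod 2) R := Submodule.span (ZMod 2) {x, y, z}

/-- The span of the orbit of `z (z + y)`. -/
def polyY : Submodule (ZMod 2) R :=
  Submodule.span (ZMod 2) {z * (z + y), (z + y) * (z + x), (z + x) * (z + x + y), (z + x + y) * z}

/-- The span of the orbit of `z (z + x)`. -/
def polyX : Submodule (ZMod 2) R :=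
  Submodule.span (ZMod 2) {z * (z + x), z * (z + x) + y * (y + x)}

/-- The span of the orbit of `y z³`. -/
def polyF : Submodule (ZMod 2) R :=
  Submodule.span (ZMod 2) {y * z ^ 3, y * (z + x) ^ 3, y * (z + y) ^ 3, y * (z + x + y) ^ 3,
    (y + x) * z ^ 3, (y + x) * (z + x) ^ 3, (y + x) * (z + y) ^ 3, (y + x) * (z + x + y) ^ 3}

/-- The quadratic Dickson invariant of `x, y`. -/
def polyQ (x y : R) : R := x ^ 2 + x * y + y ^ 2

/-- The product of the translates of `z` by the span of `x, y`. -/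
def polyD : R := z ^ 4 + polyQ x y * z ^ 2 + (x ^ 2 * y + x * y ^ 2) * z

/-- The span of the monomials of degree `n`. -/
def monomials (n : ℕ) : Submodule (ZMod 2) R :=
  Submodule.span (ZMod 2) {m | ∃ a b c, a + b + c = n ∧ m = x ^ a * y ^ b * z ^ c}

theorem polyM_pow_le_monomials (n : ℕ) : polyM x y z ^ n ≤ monomials x y z n := by
  induction n with
  | zero =>
    rw [pow_zero, Submodule.one_le]
    exact Submodule.subset_span ⟨0, 0, 0, rfl, by simp⟩
  | succ n ih =>
    rw [pow_succ]
    refine (mul_le_mul' ih le_rfl).trans ?_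
    unfold polyM monomials
    rw [Submodule.span_mul_span, Submodule.span_le]
    rintro _ ⟨_, ⟨a, b, c, rfl, rfl⟩, _, rfl | rfl | rfl, rfl⟩
    · exact Submodule.subset_span ⟨a + 1, b, c, by omega, by ring⟩
    · exact Submodule.subset_span ⟨a, b + 1, c, by omega, by ring⟩
    · exact Submodule.subset_span ⟨a, b, c + 1, by omega, by ring⟩

theorem polyM_pow_le {n : ℕ} {T : Submodule (ZMod 2) R}
    (h : ∀ a b c, a + b + c = n → x ^ a * y ^ b * z ^ c ∈ T) : polyM x y z ^ n ≤ T := by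
  refine (polyM_pow_le_monomials x y z n).trans (Submodule.span_le.2 ?_)
  rintro _ ⟨a, b, c, e, rfl⟩
  exact h a b c e

theorem x_mem_polyM : x ∈ polyM x y z := Submodule.subset_span (by simp)
theorem y_mem_polyM : y ∈ polyM x y z := Submodule.subset_span (by simp)
theorem z_mem_polyM : z ∈ polyM x y z := Submodule.subset_span (by simp)

theorem monomial_mem {a b c n : ℕ} (h : a + b + c = n) :
    x ^ a * y ^ b * z ^ c ∈ polyM x y z ^ n := by
  subst h
  rw [pow_add, pow_add]
  exact Submodule.mul_mem_mul (Submodule.mul_mem_mul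
    (Submodule.pow_mem_pow _ (x_mem_polyM x y z) a) (Submodule.pow_mem_pow _ (y_mem_polyM x y z) b))
    (Submodule.pow_mem_pow _ (z_mem_polyM x y z) c)

theorem polyY_mem_0 : z * (z + y) ∈ polyY x y z := Submodule.subset_span (by simp)
theorem polyY_mem_1 : (z + y) * (z + x) ∈ polyY x y z := Submodule.subset_span (by simp)
theorem polyY_mem_2 : (z + x) * (z + x + y) ∈ polyY x y z := Submodule.subset_span (by simp)
theorem polyY_mem_3 : (z + x + y) * z ∈ polyY x y z := Submodule.subset_span (by simp)
theorem polyX_mem_0 : z * (z + x) ∈ polyX x y z := Submodule.subset_span (by simp)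
theorem polyX_mem_1 : z * (z + x) + y * (y + x) ∈ polyX x y z := Submodule.subset_span (by simp)

/-- Each quadratic monomial is a sum of elements of the two orbits. -/
theorem polyM_sq_le : polyM x y z ^ 2 ≤ polyY x y z ⊔ polyX x y z := by
  have h2 := two_eq_zero_of_algebra R
  have hY : ∀ a ∈ polyY x y z, a ∈ polyY x y z ⊔ polyX x y z := fun a h => le_sup_left (b :=
      polyX x y z) h
  have hX : ∀ a ∈ polyX x y z, a ∈ polyY x y z ⊔ polyX x y z := fun a h => le_sup_right (a :=
      polyY x y z) h
  have hY0 := hY _ (polyY_mem_0 x y z)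
  have hY1 := hY _ (polyY_mem_1 x y z)
  have hY2 := hY _ (polyY_mem_2 x y z)
  have hY3 := hY _ (polyY_mem_3 x y z)
  have hX0 := hX _ (polyX_mem_0 x y z)
  have hX1 := hX _ (polyX_mem_1 x y z)
  refine polyM_pow_le x y z fun a b c h => ?_
  obtain rfl | rfl | rfl : a = 0 ∨ a = 1 ∨ a = 2 := by omega
  · obtain ⟨rfl, rfl⟩ | ⟨rfl, rfl⟩ | ⟨rfl, rfl⟩ :
        b = 0 ∧ c = 2 ∨ b = 1 ∧ c = 1 ∨ b = 2 ∧ c = 0 := by omega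
    · exact mem_of_eq_of_mem (add_mem (add_mem hY0 hY3) hX0)
        (by linear_combination (-z^2 - y*z - x*z) * h2)
    · exact mem_of_eq_of_mem (add_mem hY3 hX0)
        (by linear_combination (-z^2 - x*z) * h2)
    · exact mem_of_eq_of_mem (add_mem (add_mem (add_mem hY1 hY3) hX0) hX1)
        (by linear_combination (-2*z^2 - y*z - 2*x*z - x*y) * h2)
  · obtain ⟨rfl, rfl⟩ | ⟨rfl, rfl⟩ :
        b = 0 ∧ c = 1 ∨ b = 1 ∧ c = 0 := by omega
    · exact mem_of_eq_of_mem (add_mem hY0 hY3)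
        (by linear_combination (-z^2 - y*z) * h2)
    · exact mem_of_eq_of_mem (add_mem hY1 hY3)
        (by linear_combination (-z^2 - y*z - x*z) * h2)
  · obtain ⟨rfl, rfl⟩ : b = 0 ∧ c = 0 := by omega
    exact mem_of_eq_of_mem (add_mem (add_mem (add_mem hY0 hY1) hY2) hY3)
      (by linear_combination (-2*z^2 - 2*y*z - 2*x*z - x*y) * h2)

theorem polyM_cube_le :
    polyM x y z ^ 3 ≤ polyY x y z * Submodule.span (ZMod 2) {x} ⊔ polyX x y z * polyM x y z := by
  have h2 := two_eq_zero_of_algebra R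
  have hY : ∀ a ∈ polyY x y z, a * x ∈
      polyY x y z * Submodule.span (ZMod 2) {x} ⊔ polyX x y z * polyM x y z := fun a h =>
    Submodule.mem_sup_left (Submodule.mul_mem_mul h (Submodule.mem_span_singleton_self x))
  have hX : ∀ a ∈ polyX x y z, ∀ b ∈ polyM x y z, a * b ∈
      polyY x y z * Submodule.span (ZMod 2) {x} ⊔ polyX x y z * polyM x y z := fun a h b h' =>
    Submodule.mem_sup_right (Submodule.mul_mem_mul h h')
  have hY0 := hY _ (polyY_mem_0 x y z)
  have hY1 := hY _ (polyY_mem_1 x y z)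
  have hY2 := hY _ (polyY_mem_2 x y z)
  have hY3 := hY _ (polyY_mem_3 x y z)
  have hX0x := hX _ (polyX_mem_0 x y z) _ (x_mem_polyM x y z)
  have hX0y := hX _ (polyX_mem_0 x y z) _ (y_mem_polyM x y z)
  have hX0z := hX _ (polyX_mem_0 x y z) _ (z_mem_polyM x y z)
  have hX1x := hX _ (polyX_mem_1 x y z) _ (x_mem_polyM x y z)
  have hX1y := hX _ (polyX_mem_1 x y z) _ (y_mem_polyM x y z)
  have hX1z := hX _ (polyX_mem_1 x y z) _ (z_mem_polyM x y z)
  refine polyM_pow_le x y z fun a b c h => ?_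
  obtain rfl | rfl | rfl | rfl : a = 0 ∨ a = 1 ∨ a = 2 ∨ a = 3 := by omega
  · obtain ⟨rfl, rfl⟩ | ⟨rfl, rfl⟩ | ⟨rfl, rfl⟩ | ⟨rfl, rfl⟩ :
        b = 0 ∧ c = 3 ∨ b = 1 ∧ c = 2 ∨ b = 2 ∧ c = 1 ∨ b = 3 ∧ c = 0 := by omega
    · exact mem_of_eq_of_mem (add_mem (add_mem (add_mem hY0 hY3) hX0x) hX0z)
        (by linear_combination (-x^2*z - 2*x*z^2 - x*y*z) * h2)
    · exact mem_of_eq_of_mem (add_mem (add_mem hY3 hX0x) hX0y)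
        (by linear_combination (-x^2*z - x*z^2 - x*y*z) * h2)
    · exact mem_of_eq_of_mem (add_mem (add_mem (add_mem hY3 hX0x) hX0z) hX1z)
        (by linear_combination (-z^3 - x^2*z - 2*x*z^2 - x*y*z) * h2)
    · exact mem_of_eq_of_mem (add_mem (add_mem (add_mem (add_mem (add_mem hY1 hY3) hX0x) hX0y) hX1x) hX1y)
        (by linear_combination (-y*z^2 - 2*x^2*z - x^2*y - 2*x*z^2 - x*y^2 - 2*x*y*z) * h2)
  · obtain ⟨rfl, rfl⟩ | ⟨rfl, rfl⟩ | ⟨rfl, rfl⟩ :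
        b = 0 ∧ c = 2 ∨ b = 1 ∧ c = 1 ∨ b = 2 ∧ c = 0 := by omega
    · exact mem_of_eq_of_mem (add_mem (add_mem hY0 hY3) hX0x)
        (by linear_combination (-x^2*z - x*z^2 - x*y*z) * h2)
    · exact mem_of_eq_of_mem (add_mem hY3 hX0x)
        (by linear_combination (-x^2*z - x*z^2) * h2)
    · exact mem_of_eq_of_mem (add_mem (add_mem (add_mem hY1 hY3) hX0x) hX1x)
        (by linear_combination (-2*x^2*z - x^2*y - 2*x*z^2 - x*y*z) * h2)
  · obtain ⟨rfl, rfl⟩ | ⟨rfl, rfl⟩ :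
        b = 0 ∧ c = 1 ∨ b = 1 ∧ c = 0 := by omega
    · exact mem_of_eq_of_mem (add_mem hY0 hY3)
        (by linear_combination (-x*z^2 - x*y*z) * h2)
    · exact mem_of_eq_of_mem (add_mem hY1 hY3)
        (by linear_combination (-x^2*z - x*z^2 - x*y*z) * h2)
  · obtain ⟨rfl, rfl⟩ : b = 0 ∧ c = 0 := by omega
    exact mem_of_eq_of_mem (add_mem (add_mem (add_mem hY0 hY1) hY2) hY3)
      (by linear_combination (-2*x^2*z - x^2*y - 2*x*z^2 - 2*x*y*z) * h2)

/-- The translates of `z³` by the span of `x, y` span the same space as `z³`, two differences and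
`x² y + x y²`. -/
theorem x_mul_mem_polyF :
    x * z ^ 3 ∈ polyF x y z ∧ x * (x * z ^ 2 + x ^ 2 * z + x ^ 3) ∈ polyF x y z ∧
      x * (y * z ^ 2 + y ^ 2 * z + y ^ 3) ∈ polyF x y z ∧
      x * (x ^ 2 * y + x * y ^ 2) ∈ polyF x y z := by
  have h2 := two_eq_zero_of_algebra R
  have g0 : y * z ^ 3 ∈ polyF x y z := Submodule.subset_span (by simp)
  have g1 : y * (z + x) ^ 3 ∈ polyF x y z := Submodule.subset_span (by simp)
  have g2 : y * (z + y) ^ 3 ∈ polyF x y z := Submodule.subset_span (by simp)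
  have g3 : y * (z + x + y) ^ 3 ∈ polyF x y z := Submodule.subset_span (by simp)
  have g4 : (y + x) * z ^ 3 ∈ polyF x y z := Submodule.subset_span (by simp)
  have g5 : (y + x) * (z + x) ^ 3 ∈ polyF x y z := Submodule.subset_span (by simp)
  have g6 : (y + x) * (z + y) ^ 3 ∈ polyF x y z := Submodule.subset_span (by simp)
  have g7 : (y + x) * (z + x + y) ^ 3 ∈ polyF x y z := Submodule.subset_span (by simp)
  refine ⟨mem_of_eq_of_mem (add_mem g0 g4)
    (by linear_combination (-y*z^3) * h2),
      mem_of_eq_of_mem (add_mem (add_mem (add_mem g0 g1) g4) g5)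
    (by linear_combination (-2*y*z^3 - x^3*z - x^3*y - x^2*z^2 - 3*x^2*y*z - x*z^3 - 3*x*y*z^2) *
        h2),
      mem_of_eq_of_mem (add_mem (add_mem (add_mem g0 g2) g4) g6)
    (by linear_combination (-y^4 - 3*y^3*z - 3*y^2*z^2 - 2*y*z^3 - x*z^3 - x*y^2*z - x*y*z^2) * h2),
      mem_of_eq_of_mem (add_mem (add_mem (add_mem (add_mem (add_mem (add_mem (add_mem g0 g1) g2) g3) g4) g5) g6) g7)
    (by linear_combination (-2*y^4 - 6*y^3*z - 6*y^2*z^2 - 4*y*z^3 - x^4 - 3*x^3*z - 3*x^3*y -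
        3*x^2*z^2 - 4*x^2*y^2 - 9*x^2*y*z - 2*x*z^3 - 4*x*y^3 - 9*x*y^2*z - 9*x*y*z^2) * h2)⟩

/-- The analogue of `x_mul_mem_polyF` for the multiples of `y`. -/
theorem y_mul_mem_polyF :
    y * z ^ 3 ∈ polyF x y z ∧ y * (x * z ^ 2 + x ^ 2 * z + x ^ 3) ∈ polyF x y z ∧
      y * (y * z ^ 2 + y ^ 2 * z + y ^ 3) ∈ polyF x y z ∧
      y * (x ^ 2 * y + x * y ^ 2) ∈ polyF x y z := by
  have h2 := two_eq_zero_of_algebra R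
  have g0 : y * z ^ 3 ∈ polyF x y z := Submodule.subset_span (by simp)
  have g1 : y * (z + x) ^ 3 ∈ polyF x y z := Submodule.subset_span (by simp)
  have g2 : y * (z + y) ^ 3 ∈ polyF x y z := Submodule.subset_span (by simp)
  have g3 : y * (z + x + y) ^ 3 ∈ polyF x y z := Submodule.subset_span (by simp)
  have g4 : (y + x) * z ^ 3 ∈ polyF x y z := Submodule.subset_span (by simp)
  have g5 : (y + x) * (z + x) ^ 3 ∈ polyF x y z := Submodule.subset_span (by simp)
  have g6 : (y + x) * (z + y) ^ 3 ∈ polyF x y z := Submodule.subset_span (by simp)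
  have g7 : (y + x) * (z + x + y) ^ 3 ∈ polyF x y z := Submodule.subset_span (by simp)
  refine ⟨mem_of_eq_of_mem (g0)
    (by ring),
      mem_of_eq_of_mem (add_mem g0 g1)
    (by linear_combination (-y*z^3 - x^2*y*z - x*y*z^2) * h2),
      mem_of_eq_of_mem (add_mem g0 g2)
    (by linear_combination (-y^3*z - y^2*z^2 - y*z^3) * h2),
      mem_of_eq_of_mem (add_mem (add_mem (add_mem g0 g1) g2) g3)
    (by linear_combination (-y^4 - 3*y^3*z - 3*y^2*z^2 - 2*y*z^3 - x^3*y - x^2*y^2 - 3*x^2*y*z -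
        x*y^3 - 3*x*y^2*z - 3*x*y*z^2) * h2)⟩

/-- The target of the reduction of forms of degree `j + 4` modulo `polyD` and `polyQ`. -/
def polyT (j : ℕ) : Submodule (ZMod 2) R :=
  polyM x y z ^ j * Submodule.span (ZMod 2) {polyD x y z} ⊔
    polyM x y z ^ (j + 2) * Submodule.span (ZMod 2) {polyQ x y} ⊔
    polyF x y z * Submodule.span (ZMod 2) {x ^ j}

variable {x y z}

theorem mem_polyT_D {j : ℕ} {a : R} (h : a ∈ polyM x y z ^ j) : a * polyD x y z ∈ polyT x y z j :=
  Submodule.mem_sup_left (Submodule.mem_sup_left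
    (Submodule.mul_mem_mul h (Submodule.mem_span_singleton_self _)))

theorem mem_polyT_Q {j : ℕ} {a : R} (h : a ∈ polyM x y z ^ (j + 2)) :
    a * polyQ x y ∈ polyT x y z j :=
  Submodule.mem_sup_left (Submodule.mem_sup_right
    (Submodule.mul_mem_mul h (Submodule.mem_span_singleton_self _)))

theorem mem_polyT_F {j : ℕ} {a : R} (h : a ∈ polyF x y z) : a * x ^ j ∈ polyT x y z j :=
  Submodule.mem_sup_right (Submodule.mul_mem_mul h (Submodule.mem_span_singleton_self _))

variable (x y z)

theorem mul_x_mem_polyT {j : ℕ} {a : R} (h : a ∈ polyT x y z j) : a * x ∈ polyT x y z (j + 1) := by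
  have hx : x ∈ polyM x y z := x_mem_polyM x y z
  suffices polyT x y z j * Submodule.span (ZMod 2) {x} ≤ polyT x y z (j + 1) from
    this (Submodule.mul_mem_mul h (Submodule.mem_span_singleton_self x))
  conv_lhs => unfold polyT
  rw [Submodule.sup_mul, Submodule.sup_mul, sup_le_iff, sup_le_iff]
  have hM : ∀ n, polyM x y z ^ n * Submodule.span (ZMod 2) {x} ≤ polyM x y z ^ (n + 1) :=
      fun n => by
    rw [pow_succ]
    exact mul_le_mul' le_rfl ((Submodule.span_singleton_le_iff_mem _ _).2 hx)
  refine ⟨⟨?_, ?_⟩, ?_⟩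
  · rw [mul_right_comm]
    exact (mul_le_mul' (hM j) le_rfl).trans (le_sup_of_le_left le_sup_left)
  · rw [mul_right_comm]
    exact (mul_le_mul' (hM (j + 2)) le_rfl).trans (le_sup_of_le_left le_sup_right)
  · rw [mul_assoc, Submodule.span_mul_span, Set.singleton_mul_singleton, ← pow_succ]
    exact le_sup_right

/-- The fifteen quartic monomials are expressed by multiples of `polyD` and `polyQ` and by elements of
`polyF`. -/
theorem polyM_pow_four_le : polyM x y z ^ 4 ≤ polyT x y z 0 := by
  have h2 := two_eq_zero_of_algebra R
  have hQ : polyQ x y = x ^ 2 + x * y + y ^ 2 := rfl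
  have hD : polyD x y z = z ^ 4 + (x ^ 2 + x * y + y ^ 2) * z ^ 2 + (x ^ 2 * y + x * y ^ 2) * z :=
    rfl
  obtain ⟨hFx0, hFx1, hFx2, hFx3⟩ := x_mul_mem_polyF x y z
  obtain ⟨hFy0, hFy1, hFy2, hFy3⟩ := y_mul_mem_polyF x y z
  have h4 := mem_polyT_D (x := x) (y := y) (z := z) (j := 0) (a :=
      1) (by rw [pow_zero]; exact Submodule.one_le.1 le_rfl)
  have hp := fun a b c (h : a + b + c = 2) => mem_polyT_Q (j := 0) (monomial_mem x y z h)
  replace hFx0 := mem_polyT_F (j := 0) hFx0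
  replace hFx1 := mem_polyT_F (j := 0) hFx1
  replace hFx2 := mem_polyT_F (j := 0) hFx2
  replace hFx3 := mem_polyT_F (j := 0) hFx3
  replace hFy0 := mem_polyT_F (j := 0) hFy0
  replace hFy1 := mem_polyT_F (j := 0) hFy1
  replace hFy2 := mem_polyT_F (j := 0) hFy2
  replace hFy3 := mem_polyT_F (j := 0) hFy3
  refine polyM_pow_le x y z fun a b c h => ?_
  obtain rfl | rfl | rfl | rfl | rfl : a = 0 ∨ a = 1 ∨ a = 2 ∨ a = 3 ∨ a = 4 := by omega
  · obtain ⟨rfl, rfl⟩ | ⟨rfl, rfl⟩ | ⟨rfl, rfl⟩ | ⟨rfl, rfl⟩ | ⟨rfl, rfl⟩ :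
        b = 0 ∧ c = 4 ∨ b = 1 ∧ c = 3 ∨ b = 2 ∧ c = 2 ∨ b = 3 ∧ c = 1 ∨ b = 4 ∧ c = 0 := by omega
    · exact mem_of_eq_of_mem (add_mem (add_mem (add_mem (add_mem (add_mem h4 (hp 0 0 2 rfl)) hFx2) hFx3) hFy1) hFy3)
        (by rw [hD, hQ]; linear_combination (-y^2*z^2 - x^3*y - x^2*z^2 - x^2*y^2 - x^2*y*z -
            x*y^3 - x*y^2*z - 2*x*y*z^2) * h2)
    · exact mem_of_eq_of_mem (hFy0)
        (by ring)
    · exact mem_of_eq_of_mem (add_mem (add_mem (add_mem (add_mem (add_mem (hp 0 1 1 rfl) (hp 0 2 0 rfl)) hFx2) hFx3) hFy1) hFy2)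
        (by rw [hQ]; linear_combination (-y^4 - y^3*z - x^3*y - x^2*y^2 - x^2*y*z - x*y^3 -
            x*y^2*z - x*y*z^2) * h2)
    · exact mem_of_eq_of_mem (add_mem (add_mem (add_mem (add_mem (hp 0 1 1 rfl) hFx2) hFx3) hFy1) hFy3)
        (by rw [hQ]; linear_combination (-x^3*y - x^2*y^2 - x^2*y*z - x*y^3 - x*y^2*z - x*y*z^2) *
            h2)
    · exact mem_of_eq_of_mem (add_mem (hp 0 2 0 rfl) hFy3)
        (by rw [hQ]; linear_combination (-x^2*y^2 - x*y^3) * h2)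
  · obtain ⟨rfl, rfl⟩ | ⟨rfl, rfl⟩ | ⟨rfl, rfl⟩ | ⟨rfl, rfl⟩ :
        b = 0 ∧ c = 3 ∨ b = 1 ∧ c = 2 ∨ b = 2 ∧ c = 1 ∨ b = 3 ∧ c = 0 := by omega
    · exact mem_of_eq_of_mem (hFx0)
        (by ring)
    · exact mem_of_eq_of_mem (add_mem (add_mem (add_mem (add_mem (add_mem (add_mem (add_mem (add_mem (hp 0 0 2 rfl) (hp 0 1 1 rfl)) (hp 0 2 0 rfl)) (hp 1 0 1 rfl)) (hp 2 0 0 rfl)) hFx1) hFx3) hFy2) hFy3)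
        (by rw [hQ]; linear_combination (-y^4 - y^3*z - y^2*z^2 - x^4 - x^3*z - x^3*y - x^2*z^2 -
            2*x^2*y^2 - x^2*y*z - x*y^3 - x*y^2*z) * h2)
    · exact mem_of_eq_of_mem (add_mem (add_mem (add_mem (add_mem (add_mem (add_mem (add_mem (add_mem (add_mem (hp 0 0 2 rfl) (hp 0 1 1 rfl)) (hp 0 2 0 rfl)) (hp 1 0 1 rfl)) (hp 1 1 0 rfl)) (hp 2 0 0 rfl)) hFx1) hFx2) hFy2) hFy3)
        (by rw [hQ]; linear_combination (-y^4 - y^3*z - y^2*z^2 - x^4 - x^3*z - x^3*y - x^2*z^2 -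
            2*x^2*y^2 - x^2*y*z - 2*x*y^3 - x*y^2*z - x*y*z^2) * h2)
    · exact mem_of_eq_of_mem (add_mem (hp 1 1 0 rfl) hFx3)
        (by rw [hQ]; linear_combination (-x^3*y - x^2*y^2) * h2)
  · obtain ⟨rfl, rfl⟩ | ⟨rfl, rfl⟩ | ⟨rfl, rfl⟩ :
        b = 0 ∧ c = 2 ∨ b = 1 ∧ c = 1 ∨ b = 2 ∧ c = 0 := by omega
    · exact mem_of_eq_of_mem (add_mem (add_mem (add_mem (add_mem (add_mem (hp 1 0 1 rfl) (hp 2 0 0 rfl)) hFx1) hFx2) hFy1) hFy3)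
        (by rw [hQ]; linear_combination (-x^4 - x^3*z - x^3*y - x^2*y^2 - x^2*y*z - x*y^3 -
            x*y^2*z - x*y*z^2) * h2)
    · exact mem_of_eq_of_mem (add_mem (add_mem (add_mem (add_mem (add_mem (add_mem (add_mem (add_mem (add_mem (hp 0 0 2 rfl) (hp 0 1 1 rfl)) (hp 0 2 0 rfl)) (hp 1 0 1 rfl)) (hp 1 1 0 rfl)) (hp 2 0 0 rfl)) hFx1) hFx3) hFy1) hFy2)
        (by rw [hQ]; linear_combination (-y^4 - y^3*z - y^2*z^2 - x^4 - x^3*z - 2*x^3*y - x^2*z^2 -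
            2*x^2*y^2 - x^2*y*z - x*y^3 - x*y^2*z - x*y*z^2) * h2)
    · exact mem_of_eq_of_mem (add_mem (add_mem (hp 1 1 0 rfl) hFx3) hFy3)
        (by rw [hQ]; linear_combination (-x^3*y - x^2*y^2 - x*y^3) * h2)
  · obtain ⟨rfl, rfl⟩ | ⟨rfl, rfl⟩ :
        b = 0 ∧ c = 1 ∨ b = 1 ∧ c = 0 := by omega
    · exact mem_of_eq_of_mem (add_mem (add_mem (add_mem (add_mem (hp 1 0 1 rfl) hFx2) hFx3) hFy1) hFy3)
        (by rw [hQ]; linear_combination (-x^3*y - x^2*y^2 - x^2*y*z - x*y^3 - x*y^2*z - x*y*z^2) *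
            h2)
    · exact mem_of_eq_of_mem (add_mem (hp 1 1 0 rfl) hFy3)
        (by rw [hQ]; linear_combination (-x^2*y^2 - x*y^3) * h2)
  · obtain ⟨rfl, rfl⟩ : b = 0 ∧ c = 0 := by omega
    exact mem_of_eq_of_mem (add_mem (hp 2 0 0 rfl) hFx3)
      (by rw [hQ]; linear_combination (-x^3*y - x^2*y^2) * h2)

/-- The same for the quintic monomials, where `polyF` is multiplied by `x`. -/
theorem polyM_pow_five_le : polyM x y z ^ 5 ≤ polyT x y z 1 := by
  have h2 := two_eq_zero_of_algebra R
  have hQ : polyQ x y = x ^ 2 + x * y + y ^ 2 := rfl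
  have hD : polyD x y z = z ^ 4 + (x ^ 2 + x * y + y ^ 2) * z ^ 2 + (x ^ 2 * y + x * y ^ 2) * z :=
    rfl
  obtain ⟨hFx0, hFx1, hFx2, hFx3⟩ := x_mul_mem_polyF x y z
  obtain ⟨hFy0, hFy1, hFy2, hFy3⟩ := y_mul_mem_polyF x y z
  have h4 := fun a (h : a ∈ polyM x y z) => mem_polyT_D (x := x) (y := y) (z := z) (j := 1) (a := a)
    (by rwa [pow_one])
  have h4y := h4 y (y_mem_polyM x y z)
  have h4z := h4 z (z_mem_polyM x y z)
  have hp := fun a b c (h : a + b + c = 3) => mem_polyT_Q (j := 1) (monomial_mem x y z h)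
  replace hFx0 := mem_polyT_F (j := 1) hFx0
  replace hFx1 := mem_polyT_F (j := 1) hFx1
  replace hFx2 := mem_polyT_F (j := 1) hFx2
  replace hFx3 := mem_polyT_F (j := 1) hFx3
  replace hFy0 := mem_polyT_F (j := 1) hFy0
  replace hFy1 := mem_polyT_F (j := 1) hFy1
  replace hFy2 := mem_polyT_F (j := 1) hFy2
  replace hFy3 := mem_polyT_F (j := 1) hFy3
  refine polyM_pow_le x y z fun a b c h => ?_
  rcases a with _ | a
  swap
  · exact mem_of_eq_of_mem (mul_x_mem_polyT x y z (polyM_pow_four_le x y z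
      (monomial_mem x y z (show a + b + c = 4 by omega)))) (by ring)
  have h : (b = 0 ∧ c = 5) ∨
      (b = 1 ∧ c = 4) ∨
      (b = 2 ∧ c = 3) ∨
      (b = 3 ∧ c = 2) ∨
      (b = 4 ∧ c = 1) ∨
      (b = 5 ∧ c = 0) := by omega
  rcases h with ⟨rfl, rfl⟩ | ⟨rfl, rfl⟩ | ⟨rfl, rfl⟩ | ⟨rfl, rfl⟩ | ⟨rfl, rfl⟩ | ⟨rfl, rfl⟩
  · exact mem_of_eq_of_mem (add_mem (add_mem (add_mem (add_mem (add_mem (add_mem (add_mem (add_mem h4z (hp 0 0 3 rfl)) (hp 1 0 2 rfl)) (hp 2 0 1 rfl)) (hp 3 0 0 rfl)) hFx1) hFx2) hFy1) hFy3)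
      (by rw [hD, hQ]; linear_combination (-y^2*z^3 - x^5 - x^4*z - x^4*y - x^3*z^2 - x^3*y^2 -
          x^3*y*z - x^2*z^3 - x^2*y^3 - x^2*y^2*z - 2*x^2*y*z^2 - x*y^2*z^2 - x*y*z^3) * h2)
  · exact mem_of_eq_of_mem (add_mem (add_mem (add_mem (add_mem (add_mem (add_mem (add_mem (add_mem (add_mem (add_mem h4y (hp 0 1 2 rfl)) (hp 1 0 2 rfl)) (hp 1 2 0 rfl)) (hp 2 0 1 rfl)) (hp 2 1 0 rfl)) (hp 3 0 0 rfl)) hFx1) hFx3) hFy1) hFy2)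
      (by rw [hD, hQ]; linear_combination (-y^3*z^2 - x^5 - x^4*z - 2*x^4*y - x^3*z^2 - 2*x^3*y^2 -
          x^3*y*z - x^2*y^3 - x^2*y^2*z - 2*x^2*y*z^2 - x*y^4 - x*y^3*z - 2*x*y^2*z^2) * h2)
  · exact mem_of_eq_of_mem (add_mem (add_mem (hp 0 0 3 rfl) hFx0) hFy0)
      (by rw [hQ]; linear_combination (-x^2*z^3 - x*y*z^3) * h2)
  · exact mem_of_eq_of_mem (add_mem (add_mem (add_mem (add_mem (add_mem (add_mem (add_mem (hp 0 1 2 rfl) (hp 1 0 2 rfl)) (hp 2 0 1 rfl)) (hp 3 0 0 rfl)) hFx1) hFx2) hFy1) hFy3)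
      (by rw [hQ]; linear_combination (-x^5 - x^4*z - x^4*y - x^3*z^2 - x^3*y^2 - x^3*y*z -
          x^2*y^3 - x^2*y^2*z - 2*x^2*y*z^2 - x*y^2*z^2) * h2)
  · exact mem_of_eq_of_mem (add_mem (add_mem (add_mem (add_mem (add_mem (add_mem (add_mem (add_mem (add_mem (hp 0 2 1 rfl) (hp 1 0 2 rfl)) (hp 1 2 0 rfl)) (hp 2 0 1 rfl)) (hp 2 1 0 rfl)) (hp 3 0 0 rfl)) hFx1) hFx3) hFy1) hFy2)
      (by rw [hQ]; linear_combination (-x^5 - x^4*z - 2*x^4*y - x^3*z^2 - 2*x^3*y^2 - x^3*y*z -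
          x^2*y^3 - x^2*y^2*z - x^2*y*z^2 - x*y^4 - x*y^3*z - x*y^2*z^2) * h2)
  · exact mem_of_eq_of_mem (add_mem (add_mem (add_mem (add_mem (hp 0 3 0 rfl) (hp 1 2 0 rfl)) (hp 2 1 0 rfl)) hFx3) hFy3)
      (by rw [hQ]; linear_combination (-x^4*y - 2*x^3*y^2 - 2*x^2*y^3 - x*y^4) * h2)

/-- By induction it suffices to reduce the products of linear forms with `polyF`, which are quintic. -/
theorem polyM_pow_add_four_le (j : ℕ) : polyM x y z ^ (j + 4) ≤ polyT x y z j := by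
  induction j with
  | zero => exact polyM_pow_four_le x y z
  | succ j ih =>
    have hx : Submodule.span (ZMod 2) {x ^ j} ≤ polyM x y z ^ j :=
      (Submodule.span_singleton_le_iff_mem _ _).2 (Submodule.pow_mem_pow _ (x_mem_polyM x y z) j)
    have hF : polyF x y z ≤ polyM x y z ^ 4 := by
      have hM : ∀ a b c d, a ∈ polyM x y z → b ∈ polyM x y z → c ∈ polyM x y z → d ∈ polyM x y z →
          a * (b * c * d) ∈ polyM x y z ^ 4 := fun a b c d ha hb hc hd => by
        rw [pow_succ', pow_succ, pow_two]
        exact Submodule.mul_mem_mul ha (Submodule.mul_mem_mul (Submodule.mul_mem_mul hb hc) hd)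
      have hM' : ∀ a b, a ∈ polyM x y z → b ∈ polyM x y z → a * b ^ 3 ∈ polyM x y z ^ 4 :=
        fun a b ha hb => mem_of_eq_of_mem (hM a b b b ha hb hb hb) (by ring)
      have h1 := x_mem_polyM x y z
      have h2 := y_mem_polyM x y z
      have h3 := z_mem_polyM x y z
      have h4 := add_mem h2 h1
      refine Submodule.span_le.2 ?_
      rintro _ (rfl | rfl | rfl | rfl | rfl | rfl | rfl | rfl)
      exacts [hM' _ _ h2 h3, hM' _ _ h2 (add_mem h3 h1), hM' _ _ h2 (add_mem h3 h2),
        hM' _ _ h2 (add_mem (add_mem h3 h1) h2), hM' _ _ h4 h3, hM' _ _ h4 (add_mem h3 h1),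
        hM' _ _ h4 (add_mem h3 h2), hM' _ _ h4 (add_mem (add_mem h3 h1) h2)]
    have h5 : polyM x y z * polyF x y z ≤ polyT x y z 1 :=
      (mul_le_mul' le_rfl hF).trans (by rw [← pow_succ']; exact polyM_pow_five_le x y z)
    rw [show j + 1 + 4 = (j + 4) + 1 by ring, pow_succ']
    refine (mul_le_mul' le_rfl ih).trans ?_
    unfold polyT
    rw [Submodule.mul_sup, Submodule.mul_sup, sup_le_iff, sup_le_iff]
    refine ⟨⟨?_, ?_⟩, ?_⟩
    · rw [← mul_assoc, ← pow_succ']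
      exact le_sup_of_le_left le_sup_left
    · rw [← mul_assoc, ← pow_succ']
      exact le_sup_of_le_left le_sup_right
    · rw [← mul_assoc]
      refine (mul_le_mul' h5 le_rfl).trans ?_
      unfold polyT
      rw [Submodule.sup_mul, Submodule.sup_mul, sup_le_iff, sup_le_iff]
      refine ⟨⟨?_, ?_⟩, ?_⟩
      · rw [mul_right_comm]
        refine (mul_le_mul' (mul_le_mul' le_rfl hx) le_rfl).trans ?_
        rw [← pow_add, add_comm]
        exact le_sup_of_le_left le_sup_left
      · rw [mul_right_comm]
        refine (mul_le_mul' (mul_le_mul' le_rfl hx) le_rfl).trans ?_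
        rw [← pow_add, show 1 + 2 + j = j + 1 + 2 by ring]
        exact le_sup_of_le_left le_sup_right
      · rw [mul_assoc, Submodule.span_mul_span, Set.singleton_mul_singleton, ← pow_add, add_comm]
        exact le_sup_right

/-- The pieces of the decomposition of the polynomial ring modulo `polyD`: the orbit spans in low
degrees, and in higher degrees multiples of `polyQ` and a free orbit times a power of `x`. -/
def polyP : ℕ → Submodule (ZMod 2) R
  | 0 => 1
  | 1 => polyM x y z
  | 2 => polyY x y z ⊔ polyX x y z
  | 3 => polyY x y z * Submodule.span (ZMod 2) {x} ⊔ polyX x y z * polyM x y z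
  | j + 4 => polyP (j + 2) * Submodule.span (ZMod 2) {polyQ x y} ⊔
      polyF x y z * Submodule.span (ZMod 2) {x ^ j}

/-- The pieces of the decomposition of the polynomial ring. -/
def polyS : ℕ → Submodule (ZMod 2) R
  | 0 => polyP x y z 0
  | 1 => polyP x y z 1
  | 2 => polyP x y z 2
  | 3 => polyP x y z 3
  | j + 4 => polyS j * Submodule.span (ZMod 2) {polyD x y z} ⊔ polyP x y z (j + 4)

/-- Only that the pieces span is proved here; that their sum is direct follows from a count of
dimensions. The second statement, closure under multiplication by `polyQ`, is needed because the
reduction produces arbitrary multiples of `polyQ`. -/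
theorem polyM_pow_le_polyS_and (j : ℕ) : polyM x y z ^ j ≤ polyS x y z j ∧
    polyS x y z j * Submodule.span (ZMod 2) {polyQ x y} ≤ polyS x y z (j + 2) := by
  have hQ2 : Submodule.span (ZMod 2) {polyQ x y} ≤ polyM x y z ^ 2 := by
    rw [Submodule.span_singleton_le_iff_mem]
    have h : ∀ a b c, a + b + c = 2 → x ^ a * y ^ b * z ^ c ∈ polyM x y z ^ 2 := fun a b c h =>
      monomial_mem x y z h
    exact mem_of_eq_of_mem (add_mem (add_mem (h 2 0 0 rfl) (h 1 1 0 rfl)) (h 0 2 0 rfl))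
      (by unfold polyQ; ring)
  induction j using Nat.strong_induction_on with
  | _ j ih =>
    match j, ih with
    | 0, _ =>
      refine ⟨by rw [pow_zero]; exact le_rfl, ?_⟩
      change 1 * _ ≤ _
      rw [one_mul]
      exact hQ2.trans (polyM_sq_le x y z)
    | 1, _ =>
      refine ⟨by rw [pow_one]; exact le_rfl, ?_⟩
      refine (mul_le_mul' le_rfl hQ2).trans ?_
      change polyM x y z * _ ≤ _
      rw [← pow_succ']
      exact polyM_cube_le x y z
    | 2, _ => exact ⟨polyM_sq_le x y z, le_sup_of_le_right le_sup_left⟩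
    | 3, _ => exact ⟨polyM_cube_le x y z, le_sup_of_le_right le_sup_left⟩
    | j + 4, ih =>
      constructor
      · refine (polyM_pow_add_four_le x y z j).trans ?_
        refine sup_le (sup_le ?_ ?_) ?_
        · exact (mul_le_mul' (ih j (by omega)).1 le_rfl).trans le_sup_left
        · exact (mul_le_mul' (ih (j + 2) (by omega)).1 le_rfl).trans (ih (j + 2) (by omega)).2
        · exact le_sup_of_le_right le_sup_right
      · change (polyS x y z j * _ ⊔ polyP x y z (j + 4)) * _ ≤ _
        rw [Submodule.sup_mul, sup_le_iff]
        constructor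
        · rw [mul_right_comm]
          exact (mul_le_mul' (ih j (by omega)).2 le_rfl).trans le_sup_left
        · exact le_sup_of_le_right le_sup_left

theorem polyM_pow_le_polyS (j : ℕ) : polyM x y z ^ j ≤ polyS x y z j :=
  (polyM_pow_le_polyS_and x y z j).1

variable (L : Submodule (ZMod 2) R)

theorem mul_polyP_two : L * polyP x y z 2 = L * polyY x y z ⊔ L * polyX x y z :=
  Submodule.mul_sup L _ _

theorem mul_polyP_three : L * polyP x y z 3 = L * polyY x y z * Submodule.span (ZMod 2) {x} ⊔
    L * (polyX x y z * polyM x y z) := by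
  rw [polyP, Submodule.mul_sup, mul_assoc]

theorem mul_polyP_add_four (j : ℕ) : L * polyP x y z (j + 4) =
    L * polyP x y z (j + 2) * Submodule.span (ZMod 2) {polyQ x y} ⊔
      L * polyF x y z * Submodule.span (ZMod 2) {x ^ j} := by
  rw [polyP, Submodule.mul_sup, mul_assoc, mul_assoc]

theorem mul_polyS_add_four (j : ℕ) : L * polyS x y z (j + 4) =
    L * polyS x y z j * Submodule.span (ZMod 2) {polyD x y z} ⊔ L * polyP x y z (j + 4) := by
  rw [polyS, Submodule.mul_sup, mul_assoc]

end polynomials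

/-! ### Families of elements and the images of their products -/

section constructions

/-- Induction from the generators `r 1` and `sr 0`. -/
theorem dihedral_induction {P : D8 → Prop} (one : P 1) (mul : ∀ g h, P g → P h → P (g * h))
    (h1 : P (r 1)) (h2 : P (sr 0)) (g : D8) : P g := by
  have h3 : ∀ n : ℕ, P (r 1 ^ n) := by
    intro n
    induction n with
    | zero => rwa [pow_zero]
    | succ n ih => rw [pow_succ]; exact mul _ _ ih h1
  have h4 : ∀ i : ZMod 4, P (r i) := fun i => by
    have := h3 i.val
    rwa [r_one_pow, ZMod.natCast_zmod_val] at this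
  rcases g with i | i
  · exact h4 i
  · rw [show (sr i : D8) = sr 0 * r i by rw [sr_mul_r, zero_add]]
    exact mul _ _ h2 (h4 i)

section

variable {I : Type} [Fintype I] [DecidableEq I] {n : ℕ}

/-- The transformation law of a family can be checked on generators of the group. -/
def Fam.ofGenerators (ρ : D8 →* Matrix I I (ZMod 2)) (el : I → ExtSym)
    (mem : ∀ i, el i ∈ extSymDeg n) (h1 : ∀ j, actA (r 1) (el j) = ∑ i, ρ (r 1) i j • el i)
    (h2 : ∀ j, actA (sr 0) (el j) = ∑ i, ρ (sr 0) i j • el i) : Fam ρ n where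
  el i := (⟨el i, mem i⟩ : extSymDeg n)
  map_el g j := by
    refine val_injective ?_
    rw [val_ρ, val_sum]
    change actA g (el j) = ∑ i, ρ g i j • el i
    revert j
    refine dihedral_induction (P := fun g => ∀ j, actA g (el j) = ∑ i, ρ g i j • el i)
      (fun j => ?_) (fun g h hg hh j => ?_) h1 h2 g
    · rw [actA_one, map_one]
      simp [Matrix.one_apply]
    · rw [actA_mul, hh, map_sum, map_mul]
      simp only [map_smul, hg, Matrix.mul_apply, Finset.sum_smul, Finset.smul_sum, smul_smul]
      rw [Finset.sum_comm]
      simp only [mul_comm]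

/-- A family permuted by the group. -/
def Fam.perm {Ω : Type} [Fintype Ω] [DecidableEq Ω] [MulAction D8 Ω] (el : Ω → ExtSym)
    (mem : ∀ i, el i ∈ extSymDeg n) (h1 : ∀ j, actA (r 1) (el j) = el ((r 1 : D8) • j))
    (h2 : ∀ j, actA (sr 0) (el j) = el ((sr 0 : D8) • j)) : Fam (permMat (ZMod 2) Ω) n :=
  Fam.ofGenerators _ el mem (fun j => by simp [permMat, h1]) fun j => by simp [permMat, h2]

end

theorem mul_mem_deg {m n k : ℕ} (h : m + n = k) {a b : ExtSym} (ha : a ∈ extSymDeg m)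
    (hb : b ∈ extSymDeg n) : a * b ∈ extSymDeg k :=
  mem_deg_of_eq h (extSymDeg_mul ha hb)

/-- The basis of `Λ¹(M)`. -/
def famE : Fam natMat 1 :=
  Fam.ofGenerators natMat ![eX, eY, eZ] (by
      intro i; fin_cases i; exacts [eX_mem, eY_mem, eZ_mem])
    (by intro j; fin_cases j <;> simp [Fin.sum_univ_three, natMat, natFun])
    (by intro j; fin_cases j <;> simp [Fin.sum_univ_three, natMat, natFun])

/-- The basis of `S¹(M)`. -/
def famS : Fam natMat 2 :=
  Fam.ofGenerators natMat ![sx, sy, sz] (by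
      intro i; fin_cases i; exacts [sx_mem, sy_mem, sz_mem])
    (by intro j; fin_cases j <;> simp [Fin.sum_univ_three, natMat, natFun])
    (by intro j; fin_cases j <;> simp [Fin.sum_univ_three, natMat, natFun])

/-- The basis of `Λ²(M)`. -/
def basE2 : Fin 3 → ExtSym := ![eX * eY, eX * eZ, eY * eZ]

theorem basE2_mem (i : Fin 3) : basE2 i ∈ extSymDeg 2 := by
  have h : ∀ {a b : ExtSym}, a ∈ extSymDeg 1 → b ∈ extSymDeg 1 → a * b ∈ extSymDeg 2 :=
    fun ha hb => mul_mem_deg (by norm_num) ha hb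
  fin_cases i
  exacts [h eX_mem eY_mem, h eX_mem eZ_mem, h eY_mem eZ_mem]

theorem sum_basE2 (c : Fin 3 → ZMod 2) : ∑ i, c i • basE2 i =
    c 0 • (eX * eY) + c 1 • (eX * eZ) + c 2 • (eY * eZ) :=
  Fin.sum_univ_three _

/-- The basis of `Λ²(M)`, as a family. -/
def famE2 : Fam wedgeMat 2 :=
  Fam.ofGenerators wedgeMat basE2 basE2_mem
    (by
      intro j
      rw [sum_basE2]
      fin_cases j
      · change actA (r 1) (eX * eY) = (1 : ZMod 2) • _ + (0 : ZMod 2) • _ + (0 : ZMod 2) • _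
        rw [map_mul, act_r1_eX, act_r1_eY, one_smul, zero_smul, zero_smul]
        linear_combination eX_mul_self
      · change actA (r 1) (eX * eZ) = (1 : ZMod 2) • _ + (1 : ZMod 2) • _ + (0 : ZMod 2) • _
        rw [map_mul, act_r1_eX, act_r1_eZ, one_smul, one_smul, zero_smul]
        ring
      · change actA (r 1) (eY * eZ) = (1 : ZMod 2) • _ + (1 : ZMod 2) • _ + (1 : ZMod 2) • _
        rw [map_mul, act_r1_eY, act_r1_eZ, one_smul, one_smul, one_smul]
        linear_combination eY_mul_self)
    (by
      intro j
      rw [sum_basE2]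
      fin_cases j
      · change actA (sr 0) (eX * eY) = (1 : ZMod 2) • _ + (0 : ZMod 2) • _ + (0 : ZMod 2) • _
        rw [map_mul, act_sr0_eX, act_sr0_eY, one_smul, zero_smul, zero_smul]
        ring
      · change actA (sr 0) (eX * eZ) = (1 : ZMod 2) • _ + (1 : ZMod 2) • _ + (0 : ZMod 2) • _
        rw [map_mul, act_sr0_eX, act_sr0_eZ, one_smul, one_smul, zero_smul]
        ring
      · change actA (sr 0) (eY * eZ) = (0 : ZMod 2) • _ + (0 : ZMod 2) • _ + (1 : ZMod 2) • _
        rw [map_mul, act_sr0_eY, act_sr0_eZ, one_smul, zero_smul, zero_smul]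
        linear_combination eY_mul_self)

theorem sq_mem {a b : ExtSym} (ha : a ∈ extSymDeg 2) (hb : b ∈ extSymDeg 2) : a * b ∈ extSymDeg 4 :=
  mul_mem_deg (by norm_num) ha hb

/-- The orbit of `z (z + y)`. -/
def orbY : Fin 4 → ExtSym :=
  ![sz * (sz + sy), (sz + sy) * (sz + sx), (sz + sx) * (sz + sx + sy), (sz + sx + sy) * sz]

theorem orbY_mem (i : Fin 4) : orbY i ∈ extSymDeg 4 := by
  have hx := sx_mem
  have hy := sy_mem
  have hz := sz_mem
  fin_cases i
  exacts [sq_mem hz (add_mem hz hy), sq_mem (add_mem hz hy) (add_mem hz hx),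
    sq_mem (add_mem hz hx) (add_mem (add_mem hz hx) hy), sq_mem (add_mem (add_mem hz hx) hy) hz]

theorem act_r1_orbY : ∀ j, actA (r 1) (orbY j) = orbY ((![1, 2, 3, 0] : Fin 4 → Fin 4) j) := by
  have h2 := extSym_two
  intro j
  fin_cases j
  · change actA (r 1) (sz * (sz + sy)) = (sz + sy) * (sz + sx)
    simp only [map_mul, map_add, act_r1_sy, act_r1_sz]
    linear_combination (sy^2 + sy*sz) * h2
  · change actA (r 1) ((sz + sy) * (sz + sx)) = (sz + sx) * (sz + sx + sy)
    simp only [map_mul, map_add, act_r1_sx, act_r1_sy, act_r1_sz]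
    linear_combination (sy^2 + sy*sz + sx*sy) * h2
  · change actA (r 1) ((sz + sx) * (sz + sx + sy)) = (sz + sx + sy) * sz
    simp only [map_mul, map_add, act_r1_sx, act_r1_sy, act_r1_sz]
    linear_combination (sy^2 + sy*sz + sx^2 + sx*sz + 2*sx*sy) * h2
  · change actA (r 1) ((sz + sx + sy) * sz) = sz * (sz + sy)
    simp only [map_mul, map_add, act_r1_sx, act_r1_sy, act_r1_sz]
    linear_combination (sy^2 + sy*sz + sx*sz + sx*sy) * h2

theorem act_sr0_orbY : ∀ j, actA (sr 0) (orbY j) = orbY ((![0, 3, 2, 1] : Fin 4 → Fin 4) j) := by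
  have h2 := extSym_two
  intro j
  fin_cases j
  · change actA (sr 0) (sz * (sz + sy)) = sz * (sz + sy)
    simp only [map_mul, map_add, act_sr0_sy, act_sr0_sz]
    linear_combination (sy^2 + sy*sz) * h2
  · change actA (sr 0) ((sz + sy) * (sz + sx)) = (sz + sx + sy) * sz
    simp only [map_mul, map_add, act_sr0_sx, act_sr0_sy, act_sr0_sz]
    linear_combination (sy^2 + sy*sz + sx*sy) * h2
  · change actA (sr 0) ((sz + sx) * (sz + sx + sy)) = (sz + sx) * (sz + sx + sy)
    simp only [map_mul, map_add, act_sr0_sx, act_sr0_sy, act_sr0_sz]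
    linear_combination (sy^2 + sy*sz + sx*sy) * h2
  · change actA (sr 0) ((sz + sx + sy) * sz) = (sz + sy) * (sz + sx)
    simp only [map_mul, map_add, act_sr0_sx, act_sr0_sy, act_sr0_sz]
    linear_combination (sy^2 + sy*sz) * h2

/-- The orbit of `z (z + y)`, as a family. -/
def famY : Fam permA 4 :=
  have h1 : ∀ j : Fin 4, @Eq (Fin 4) ((![1, 2, 3, 0] : Fin 4 → Fin 4) j) (Ωa.act (r 1) j) := by
    intro j; fin_cases j <;> rfl
  have h2 : ∀ j : Fin 4, @Eq (Fin 4) ((![0, 3, 2, 1] : Fin 4 → Fin 4) j) (Ωa.act (sr 0) j) := by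
    intro j; fin_cases j <;> rfl
  Fam.perm (Ω := Ωa) orbY orbY_mem (fun j => (act_r1_orbY j).trans (congrArg orbY (h1 j)))
    fun j => (act_sr0_orbY j).trans (congrArg orbY (h2 j))

/-- The orbit of `z (z + x)`. -/
def orbX : Fin 2 → ExtSym := ![sz * (sz + sx), sz * (sz + sx) + sy * (sy + sx)]

theorem orbX_mem (i : Fin 2) : orbX i ∈ extSymDeg 4 := by
  have hx := sx_mem
  have hy := sy_mem
  have hz := sz_mem
  fin_cases i
  exacts [sq_mem hz (add_mem hz hx),
    add_mem (sq_mem hz (add_mem hz hx)) (sq_mem hy (add_mem hy hx))]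

theorem act_r1_orbX : ∀ j, actA (r 1) (orbX j) = orbX ((![1, 0] : Fin 2 → Fin 2) j) := by
  have h2 := extSym_two
  intro j
  fin_cases j
  · change actA (r 1) (sz * (sz + sx)) = sz * (sz + sx) + sy * (sy + sx)
    simp only [map_mul, map_add, act_r1_sx, act_r1_sz]
    linear_combination (sy*sz) * h2
  · change actA (r 1) (sz * (sz + sx) + sy * (sy + sx)) = sz * (sz + sx)
    simp only [map_mul, map_add, act_r1_sx, act_r1_sy, act_r1_sz]
    linear_combination (sy^2 + sy*sz + sx^2 + 2*sx*sy) * h2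

theorem act_sr0_orbX : ∀ j, actA (sr 0) (orbX j) = orbX ((![1, 0] : Fin 2 → Fin 2) j) := by
  have h2 := extSym_two
  intro j
  fin_cases j
  · change actA (sr 0) (sz * (sz + sx)) = sz * (sz + sx) + sy * (sy + sx)
    simp only [map_mul, map_add, act_sr0_sx, act_sr0_sz]
    linear_combination (sy*sz) * h2
  · change actA (sr 0) (sz * (sz + sx) + sy * (sy + sx)) = sz * (sz + sx)
    simp only [map_mul, map_add, act_sr0_sx, act_sr0_sy, act_sr0_sz]
    linear_combination (sy^2 + sy*sz + sx*sy) * h2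

/-- The orbit of `z (z + x)`, as a family. -/
def famX : Fam (permMat (ZMod 2) Ωx) 4 :=
  have h1 : ∀ j : Fin 2, @Eq (Fin 2) ((![1, 0] : Fin 2 → Fin 2) j) (Ωx.act (r 1) j) := by
    intro j; fin_cases j <;> rfl
  have h2 : ∀ j : Fin 2, @Eq (Fin 2) ((![1, 0] : Fin 2 → Fin 2) j) (Ωx.act (sr 0) j) := by
    intro j; fin_cases j <;> rfl
  Fam.perm (Ω := Ωx) orbX orbX_mem (fun j => (act_r1_orbX j).trans (congrArg orbX (h1 j)))
    fun j => (act_sr0_orbX j).trans (congrArg orbX (h2 j))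

/-- The orbit of `y z³`. -/
def famF : Fam regMat 8 :=
  Fam.perm (Ω := D8) (fun g => actA g (sy * sz ^ 3))
    (fun g => extSymMap_mem _ (mul_mem_deg (by norm_num) sy_mem (pow_mem_deg sz_mem 3)))
    (fun _ => (actA_mul _ _ _).symm) fun _ => (actA_mul _ _ _).symm

end constructions

section realizations

variable {W : Rep.{0} (ZMod 2) D8} {q n : ℕ}

/-- The image of a morphism to `Λ(M) ⊗ S(M)`. -/
def img (e : W ⟶ Y.obj q) : Submodule (ZMod 2) ExtSym where
  carrier := {a | ∃ w, val (e.hom w) = a}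
  add_mem' := by
    rintro _ _ ⟨w, rfl⟩ ⟨w', rfl⟩
    exact ⟨w + w', by rw [map_add, val_add]⟩
  zero_mem' := ⟨0, by rw [map_zero]; rfl⟩
  smul_mem' := by
    rintro c _ ⟨w, rfl⟩
    exact ⟨c • w, by rw [map_smul, val_smul]⟩

theorem mem_img (e : W ⟶ Y.obj q) (w : W.V) : val (e.hom w) ∈ img e := ⟨w, rfl⟩

section

variable {I : Type} [Fintype I] [DecidableEq I] {ρ : D8 →* Matrix I I (ZMod 2)}

/-- The span of a family. -/
def Fam.span (l : Fam ρ n) : Submodule (ZMod 2) ExtSym :=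
  Submodule.span (ZMod 2) (Set.range fun i => val (l.el i))

theorem img_mulHom (l : Fam ρ n) (e : W ⟶ Y.obj q) : img (l.mulHom e) = img e * l.span := by
  apply le_antisymm
  · rintro _ ⟨f, rfl⟩
    rw [l.mulHom_apply, val_sum]
    exact sum_mem fun i _ => Submodule.mul_mem_mul (mem_img e _) (Submodule.subset_span ⟨i, rfl⟩)
  rw [Submodule.mul_le]
  rintro _ ⟨w, rfl⟩ b hb
  induction hb using Submodule.span_induction with
  | mem b hb =>
    obtain ⟨i, rfl⟩ := hb
    refine ⟨Pi.single i w, ?_⟩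
    rw [l.mulHom_apply, Finset.sum_eq_single i]
    · rw [Pi.single_eq_same]; rfl
    · intro j _ h
      rw [Pi.single_eq_of_ne h, map_zero, map_zero, LinearMap.zero_apply]
    · simp
  | zero => rw [mul_zero]; exact zero_mem _
  | add a b _ _ ha hb => rw [mul_add]; exact add_mem ha hb
  | smul c a _ ha => rw [mul_smul_comm]; exact Submodule.smul_mem _ _ ha

end

/-- The subspace `R` in degree `q` is the image of an equivariant map from `W`, and the cohomology
of `W` maps to the subring generated in degrees at most eight. -/
def Covers (W : Rep.{0} (ZMod 2) D8) (q : ℕ) (R : Submodule (ZMod 2) ExtSym) : Prop :=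
  ∃ e : W ⟶ Y.obj q, Gen e ∧ img e = R

theorem Covers.dec {R : Submodule (ZMod 2) ExtSym} [Module.Finite (ZMod 2) W.V] {d : ℕ} {h : ℕ → ℕ}
    (H : Covers W q R) (hd : Module.finrank (ZMod 2) W.V = d) (hh : ∀ p, hdim W p = h p) :
    Dec q R d h := by
  obtain ⟨e, h1, rfl⟩ := H
  exact ⟨W, e, inferInstance, hd, hh, h1, fun a ha => ha⟩

theorem img_unitHom : img unitHom = 1 := by
  apply le_antisymm
  · rintro _ ⟨c, rfl⟩
    rw [val_unitHom]
    exact Submodule.smul_mem _ _ (Submodule.one_le.1 le_rfl)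
  · exact Submodule.one_le.2 ⟨(1 : ZMod 2), by rw [val_unitHom, one_smul]⟩

theorem Covers.one : Covers W1 0 1 :=
  ⟨unitHom, Gen.of_traces traceZero_b_W1 traceZero_a_WM2 (by norm_num) _, img_unitHom⟩

variable {R : Submodule (ZMod 2) ExtSym}

theorem Covers.fam {ρ : D8 →* Matrix (Fin 3) (Fin 3) (ZMod 2)} {a : D8} {Ω : Type} [Fintype Ω]
    [DecidableEq Ω] [MulAction D8 Ω] (H : Covers W q R) (E : CosetExt ρ a Ω) (hW : TraceZero a W)
    (l : Fam ρ n) (hn : 1 + n ≤ 8) (hq : q + n ≤ 8) : Covers (T ρ W) (q + n) (R * l.span) := by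
  obtain ⟨e, h1, rfl⟩ := H
  exact ⟨l.mulHom e, Gen.fam E hW l hn h1 (genZero_of_le hq _), img_mulHom l e⟩

theorem Covers.permA (H : Covers W q R) (l : Fam permA n) (hq : q + n ≤ 8) :
    Covers (T permA W) (q + n) (R * l.span) := by
  obtain ⟨e, -, rfl⟩ := H
  exact ⟨l.mulHom e, Gen.of_mulSurj (Ca.mulSurj W) _ (genZero_of_le hq _), img_mulHom l e⟩

theorem Covers.permX (l : Fam (permMat (ZMod 2) Ωx) n) (hn : n + 1 ≤ 8) :
    Covers WX (0 + n) (1 * l.span) := by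
  obtain ⟨e, -, h⟩ := Covers.one
  rw [← h]
  exact ⟨l.mulHom e, Gen.of_traces traceZero_b_WX traceZero_a_WM2X (by omega) _, img_mulHom l e⟩

/-- The transfer of a product with `y z³`. -/
def trF : ExtSym →ₗ[ZMod 2] ExtSym :=
  ∑ g : D8, (actA g).toLinearMap.comp (LinearMap.mulRight (ZMod 2) (sy * sz ^ 3))

theorem trF_apply (a : ExtSym) : trF a = ∑ g : D8, actA g (a * (sy * sz ^ 3)) := by
  rw [trF, LinearMap.sum_apply]
  rfl

/-- The cohomology of a free module is that of its invariants, which are transfers. -/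
theorem Covers.reg (H : Covers W q R) (h0 : ∀ a ∈ R, GenInv (q + 8) (trF a)) :
    Covers (T regMat W) (q + 8) (R * famF.span) := by
  obtain ⟨e, -, rfl⟩ := H
  refine ⟨famF.mulHom e, Gen.of_acyclic (acyclic_regular W) _ fun F hF v => ?_, img_mulHom famF e⟩
  obtain ⟨f, hf, rfl⟩ := cls₀_surjective v
  rw [Hmap_cls₀]
  have key : val ((famF.mulHom e).hom f) = trF (val (e.hom (f 1))) := by
    rw [Fam.mulHom_apply, val_sum, trF_apply]
    refine Finset.sum_congr rfl fun g _ => ?_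
    rw [val_mul, map_mul, ← val_ρ, ← Rep.hom_comm_apply, ← invariant_regular f hf]
    rfl
  have hG := h0 _ (mem_img e (f 1))
  rw [← key] at hG
  exact hG.gen F hF _

theorem GenInv.smul {u : ExtSym} (c : ZMod 2) (hu : GenInv q u) : GenInv q (c • u) := by
  have h : ∀ c : ZMod 2, c = 0 ∨ c = 1 := by decide
  rcases h c with rfl | rfl
  · rw [zero_smul]; exact GenInv.zero
  · rwa [one_smul]

theorem genInv_of_mem_span {s : Set ExtSym} {a : ExtSym} (f : ExtSym →ₗ[ZMod 2] ExtSym)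
    (ha : a ∈ Submodule.span (ZMod 2) s) (h : ∀ b ∈ s, GenInv q (f b)) : GenInv q (f a) := by
  induction ha using Submodule.span_induction with
  | mem b hb => exact h b hb
  | zero => rw [map_zero]; exact GenInv.zero
  | add a b _ _ ha hb => rw [map_add]; exact ha.add hb
  | smul c a _ ha => rw [map_smul]; exact ha.smul c

end realizations

/-! ### Invariants and transfers -/

section invariants

theorem genInv_eX : GenInv 1 (eX) := by
  exact genInv_of_generators (by norm_num) eX_mem act_r1_eX act_sr0_eX

theorem genInv_sx : GenInv 2 (sx) := by
  exact genInv_of_generators (by norm_num) sx_mem act_r1_sx act_sr0_sx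

theorem genInv_Q : GenInv 4 (sx ^ 2 + sx * sy + sy ^ 2) := by
  -- Here and below, two polynomials with integer coefficients are compared modulo the relation
  -- `2 = 0` and the vanishing of the squares of `eX` and `eY`.
  have h2 := extSym_two
  refine genInv_of_generators (by norm_num) (add_mem (add_mem (pow_mem_deg sx_mem 2) (mul_mem_deg
    (k := 4) (by norm_num) sx_mem sy_mem)) (pow_mem_deg sy_mem 2)) ?_ ?_
  · simp only [map_add, map_mul, map_pow, act_r1_sx, act_r1_sy]
    linear_combination (sx^2 + sx*sy) * h2
  · simp only [map_add, map_mul, map_pow, act_sr0_sx, act_sr0_sy]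

theorem genInv_dickson : GenInv 4 (sy ^ 2 + sx * sy) := by
  have h2 := extSym_two
  refine genInv_of_generators (by norm_num) (add_mem (pow_mem_deg sy_mem 2) (mul_mem_deg (k := 4)
    (by norm_num) sx_mem sy_mem)) ?_ ?_
  · simp only [map_add, map_mul, map_pow, act_r1_sx, act_r1_sy]
    linear_combination (sx^2 + sx*sy) * h2
  · simp only [map_add, map_mul, map_pow, act_sr0_sx, act_sr0_sy]

/-- The product of the four conjugates of `z`. -/
theorem genInv_D : GenInv 8 (sz ^ 4 + (sx ^ 2 + sx * sy + sy ^ 2) * sz ^ 2 + (sx ^ 2 * sy + sx *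
  sy ^ 2) * sz) := by
  have h2 := extSym_two
  refine genInv_of_generators (by norm_num) (add_mem (add_mem (pow_mem_deg sz_mem 4) (mul_mem_deg
    (k := 8) (by norm_num) (add_mem (add_mem (pow_mem_deg sx_mem 2) (mul_mem_deg (k := 4) (by
    norm_num) sx_mem sy_mem)) (pow_mem_deg sy_mem 2)) (pow_mem_deg sz_mem 2))) (mul_mem_deg (k :=
    8) (by norm_num) (add_mem (mul_mem_deg (k := 6) (by norm_num) (pow_mem_deg sx_mem 2) sy_mem)
    (mul_mem_deg (k := 6) (by norm_num) sx_mem (pow_mem_deg sy_mem 2))) sz_mem)) ?_ ?_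
  · simp only [map_add, map_mul, map_pow, act_r1_sx, act_r1_sy, act_r1_sz]
    linear_combination (sy^4 + 3*sy^3*sz + 3*sy^2*sz^2 + 2*sy*sz^3 + sx^3*sz + sx^3*sy + sx^2*sz^2
        + 3*sx^2*sy^2 + 4*sx^2*sy*sz + 2*sx*sy^3 + 3*sx*sy^2*sz + sx*sy*sz^2) * h2
  · simp only [map_add, map_mul, map_pow, act_sr0_sx, act_sr0_sy, act_sr0_sz]
    linear_combination (sy^4 + 3*sy^3*sz + 3*sy^2*sz^2 + 2*sy*sz^3 + sx^2*sy^2 + sx^2*sy*sz +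
        sx*sy^3 + sx*sy^2*sz) * h2

theorem genInv_eXY : GenInv 2 (eX * eY) := by
  have h2 := extSym_two
  refine genInv_of_generators (by norm_num) (mul_mem_deg (k := 2) (by norm_num) eX_mem eY_mem) ?_
    ?_
  · simp only [map_mul, act_r1_eX, act_r1_eY]
    linear_combination (1) * eX_mul_self
  · simp only [map_mul, act_sr0_eX, act_sr0_eY]

theorem genInv_eXYZ : GenInv 3 (eX * eY * eZ) := by
  have h2 := extSym_two
  refine genInv_of_generators (by norm_num) (mul_mem_deg (k := 3) (by norm_num) (mul_mem_deg (k :=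
    2) (by norm_num) eX_mem eY_mem) eZ_mem) ?_ ?_
  · simp only [map_mul, act_r1_eX, act_r1_eY, act_r1_eZ]
    linear_combination (eZ + eY) * eX_mul_self + (eX) * eY_mul_self
  · simp only [map_mul, act_sr0_eX, act_sr0_eY, act_sr0_eZ]
    linear_combination (eX) * eY_mul_self

/-- The image of `x y`, which is invariant up to squares, under the equivariant derivation
`S(M) → Λ¹(M) ⊗ S(M)` which maps each linear form to the corresponding element of `Λ¹(M)`. -/
theorem genInv_N1 : GenInv 3 (sx * eY + sy * eX) := by
  have h2 := extSym_two
  refine genInv_of_generators (by norm_num) (add_mem (mul_mem_deg (k := 3) (by norm_num) sx_mem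
    eY_mem) (mul_mem_deg (k := 3) (by norm_num) sy_mem eX_mem)) ?_ ?_
  · simp only [map_add, map_mul, act_r1_eX, act_r1_eY, act_r1_sx, act_r1_sy]
    linear_combination (eX*sx) * h2
  · simp only [map_add, map_mul, act_sr0_eX, act_sr0_eY, act_sr0_sx, act_sr0_sy]

/-- The determinant of the matrix whose rows are `(eX, eY, eZ)`, `(x, y, z)` and `(x², y², z²)`. -/
theorem genInv_N3 : GenInv 7 (eZ * (sx ^ 2 * sy + sx * sy ^ 2) + eY * (sx ^ 2 * sz + sx * sz ^ 2)
  + eX * (sy ^ 2 * sz + sy * sz ^ 2)) := by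
  have h2 := extSym_two
  refine genInv_of_generators (by norm_num) (add_mem (add_mem (mul_mem_deg (k := 7) (by norm_num)
    eZ_mem (add_mem (mul_mem_deg (k := 6) (by norm_num) (pow_mem_deg sx_mem 2) sy_mem)
    (mul_mem_deg (k := 6) (by norm_num) sx_mem (pow_mem_deg sy_mem 2)))) (mul_mem_deg (k := 7) (by
    norm_num) eY_mem (add_mem (mul_mem_deg (k := 6) (by norm_num) (pow_mem_deg sx_mem 2) sz_mem)
    (mul_mem_deg (k := 6) (by norm_num) sx_mem (pow_mem_deg sz_mem 2))))) (mul_mem_deg (k := 7)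
    (by norm_num) eX_mem (add_mem (mul_mem_deg (k := 6) (by norm_num) (pow_mem_deg sy_mem 2)
    sz_mem) (mul_mem_deg (k := 6) (by norm_num) sy_mem (pow_mem_deg sz_mem 2))))) ?_ ?_
  · simp only [map_add, map_mul, map_pow, act_r1_eX, act_r1_eY, act_r1_eZ, act_r1_sx, act_r1_sy,
        act_r1_sz]
    linear_combination (eZ*sx^3 + eZ*sx^2*sy + eY*sx^3 + 2*eY*sx^2*sy + eY*sx*sy^2 + eY*sx*sy*sz +
        eX*sy^3 + eX*sy^2*sz + eX*sx^2*sz + eX*sx^2*sy + eX*sx*sz^2 + 2*eX*sx*sy^2 +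
            3*eX*sx*sy*sz) *
        h2
  · simp only [map_add, map_mul, map_pow, act_sr0_eX, act_sr0_eY, act_sr0_eZ, act_sr0_sx,
        act_sr0_sy, act_sr0_sz]
    linear_combination (eY*sx^2*sy + eY*sx*sy^2 + eY*sx*sy*sz + eX*sy^3 + eX*sy^2*sz) * h2

/-- The image of `eX eY eZ` under the contraction which maps each element of `Λ¹(M)` to the
corresponding linear form. -/
theorem genInv_L1 : GenInv 4 (sx * (eY * eZ) + sy * (eX * eZ) + sz * (eX * eY)) := by
  have h2 := extSym_two
  refine genInv_of_generators (by norm_num) (add_mem (add_mem (mul_mem_deg (k := 4) (by norm_num)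
    sx_mem (mul_mem_deg (k := 2) (by norm_num) eY_mem eZ_mem)) (mul_mem_deg (k := 4) (by norm_num)
    sy_mem (mul_mem_deg (k := 2) (by norm_num) eX_mem eZ_mem))) (mul_mem_deg (k := 4) (by
    norm_num) sz_mem (mul_mem_deg (k := 2) (by norm_num) eX_mem eY_mem))) ?_ ?_
  · simp only [map_add, map_mul, act_r1_eX, act_r1_eY, act_r1_eZ, act_r1_sx, act_r1_sy, act_r1_sz]
    linear_combination (eX*eZ*sx + eX*eY*sy + eX*eY*sx) * h2 + (sx) * eY_mul_self + (sz + sy) *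
        eX_mul_self
  · simp only [map_add, map_mul, act_sr0_eX, act_sr0_eY, act_sr0_eZ, act_sr0_sx, act_sr0_sy,
        act_sr0_sz]
    linear_combination (eX*eY*sy) * h2 + (sx) * eY_mul_self

/-- Multiplied by `x`, this is the product of `eX` with the invariant of `genInv_N3`. -/
theorem genInv_L2 : GenInv 6 (eX * eZ * (sy ^ 2 + sx * sy) + eX * eY * (sx * sz + sz ^ 2)) := by
  have h2 := extSym_two
  refine genInv_of_generators (by norm_num) (add_mem (mul_mem_deg (k := 6) (by norm_num)
    (mul_mem_deg (k := 2) (by norm_num) eX_mem eZ_mem) (add_mem (pow_mem_deg sy_mem 2)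
    (mul_mem_deg (k := 4) (by norm_num) sx_mem sy_mem))) (mul_mem_deg (k := 6) (by norm_num)
    (mul_mem_deg (k := 2) (by norm_num) eX_mem eY_mem) (add_mem (mul_mem_deg (k := 4) (by
    norm_num) sx_mem sz_mem) (pow_mem_deg sz_mem 2)))) ?_ ?_
  · simp only [map_add, map_mul, map_pow, act_r1_eX, act_r1_eY, act_r1_eZ, act_r1_sx, act_r1_sy,
        act_r1_sz]
    linear_combination (eX*eZ*sx^2 + eX*eZ*sx*sy + eX*eY*sy^2 + eX*eY*sy*sz + eX*eY*sx^2 +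
        2*eX*eY*sx*sy) * h2 + (sz^2 + sy^2 + 2*sy*sz + sx*sz + sx*sy) * eX_mul_self
  · simp only [map_add, map_mul, map_pow, act_sr0_eX, act_sr0_eY, act_sr0_eZ, act_sr0_sx,
        act_sr0_sy, act_sr0_sz]
    linear_combination (eX*eY*sy^2 + eX*eY*sy*sz + eX*eY*sx*sy) * h2

/-- The group consists of the products `r 2 ^ i * r 1 ^ j * sr 0 ^ k` with exponents `0` and `1`, which
allows the sum to be computed in three stages. -/
theorem trF_eq (a : ExtSym) : trF a =
    let b := a * (sy * sz ^ 3) + actA (sr 0) (a * (sy * sz ^ 3))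
    b + actA (r 1) b + actA (r 2) (b + actA (r 1) b) := by
  rw [trF_apply, show (Finset.univ : Finset D8) =
    {1, sr 0, r 1, r 1 * sr 0, r 2, r 2 * sr 0, r 2 * r 1, r 2 * (r 1 * sr 0)} by decide +kernel]
  rw [Finset.sum_insert (by decide), Finset.sum_insert (by decide), Finset.sum_insert (by decide),
    Finset.sum_insert (by decide), Finset.sum_insert (by decide), Finset.sum_insert (by decide),
    Finset.sum_insert (by decide), Finset.sum_singleton]
  simp only [actA_one, actA_mul, map_add]
  abel

/-- The transfers which follow have degree greater than eight. They are generated in degrees at most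
eight, because they are polynomials in the invariants above. -/
theorem genInv_trF_eX : GenInv 9 (trF (eX)) := by
  have h2 := extSym_two
  refine GenInv.congr (((genInv_eX.mul genInv_dickson).mul (genInv_sx.pow 2)).congr rfl (r := 9)
    (by norm_num)) ?_ rfl
  rw [trF_eq]
  simp only [map_add, map_mul, map_pow, act_sr0_eX, act_sr0_sy, act_sr0_sz, act_r1_eX, act_r1_sy,
    act_r1_sz, act_r2_eX, act_r2_sx, act_r2_sy, act_r2_sz]
  linear_combination (-10*eX*sy^4 - 18*eX*sy^3*sz - 12*eX*sy^2*sz^2 - 4*eX*sy*sz^3 - 5*eX*sx^4 -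
    9*eX*sx^3*sz - 22*eX*sx^3*sy - 6*eX*sx^2*sz^2 - 37*eX*sx^2*sy^2 - 33*eX*sx^2*sy*sz -
    2*eX*sx*sz^3 - 30*eX*sx*sy^3 - 39*eX*sx*sy^2*sz - 18*eX*sx*sy*sz^2) * h2

theorem genInv_trF_eY : GenInv 9 (trF (eY)) := by
  have h2 := extSym_two
  refine GenInv.congr ((((genInv_eX.mul genInv_dickson).mul (genInv_sx.pow 2)).congr rfl (r := 9)
    (by norm_num)).add (((genInv_N1.mul genInv_sx).mul genInv_dickson).congr rfl (r := 9) (by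
    norm_num))) ?_ rfl
  rw [trF_eq]
  simp only [map_add, map_mul, map_pow, act_sr0_eY, act_sr0_sy, act_sr0_sz, act_r1_eY, act_r1_sy,
    act_r1_sz, act_r2_eX, act_r2_eY, act_r2_sx, act_r2_sy, act_r2_sz]
  linear_combination (-10*eY*sy^4 - 18*eY*sy^3*sz - 12*eY*sy^2*sz^2 - 4*eY*sy*sz^3 - 5*eY*sx^4 -
    9*eY*sx^3*sz - 22*eY*sx^3*sy - 6*eY*sx^2*sz^2 - 37*eY*sx^2*sy^2 - 33*eY*sx^2*sy*sz -
    2*eY*sx*sz^3 - 30*eY*sx*sy^3 - 39*eY*sx*sy^2*sz - 18*eY*sx*sy*sz^2 - 9*eX*sy^4 - 15*eX*sy^3*sz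
    - 9*eX*sy^2*sz^2 - 2*eX*sy*sz^3 - 5*eX*sx^4 - 9*eX*sx^3*sz - 21*eX*sx^3*sy - 6*eX*sx^2*sz^2 -
    35*eX*sx^2*sy^2 - 30*eX*sx^2*sy*sz - 2*eX*sx*sz^3 - 28*eX*sx*sy^3 - 36*eX*sx*sy^2*sz -
    15*eX*sx*sy*sz^2) * h2

theorem genInv_trF_eZ : GenInv 9 (trF (eZ)) := by
  have h2 := extSym_two
  refine GenInv.congr (((genInv_N3.mul genInv_sx).congr rfl (r := 9) (by norm_num)).add
    (((genInv_N1.mul genInv_sx).mul genInv_Q).congr rfl (r := 9) (by norm_num))) ?_ rfl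
  rw [trF_eq]
  simp only [map_add, map_mul, map_pow, act_sr0_eZ, act_sr0_sy, act_sr0_sz, act_r1_eY, act_r1_eZ,
    act_r1_sy, act_r1_sz, act_r2_eX, act_r2_eY, act_r2_eZ, act_r2_sx, act_r2_sy, act_r2_sz]
  linear_combination (-10*eZ*sy^4 - 18*eZ*sy^3*sz - 12*eZ*sy^2*sz^2 - 4*eZ*sy*sz^3 - 5*eZ*sx^4 -
    9*eZ*sx^3*sz - 22*eZ*sx^3*sy - 6*eZ*sx^2*sz^2 - 37*eZ*sx^2*sy^2 - 33*eZ*sx^2*sy*sz -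
    2*eZ*sx*sz^3 - 30*eZ*sx*sy^3 - 39*eZ*sx*sy^2*sz - 18*eZ*sx*sy*sz^2 - 18*eY*sy^4 -
    30*eY*sy^3*sz - 18*eY*sy^2*sz^2 - 4*eY*sy*sz^3 - 9*eY*sx^4 - 16*eY*sx^3*sz - 41*eY*sx^3*sy -
    10*eY*sx^2*sz^2 - 70*eY*sx^2*sy^2 - 57*eY*sx^2*sy*sz - 3*eY*sx*sz^3 - 56*eY*sx*sy^3 -
    69*eY*sx*sy^2*sz - 27*eY*sx*sy*sz^2 - 13*eX*sy^4 - 21*eX*sy^3*sz - 12*eX*sy^2*sz^2 -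
    3*eX*sy*sz^3 - 9*eX*sx^4 - 15*eX*sx^3*sz - 38*eX*sx^3*sy - 9*eX*sx^2*sz^2 - 61*eX*sx^2*sy^2 -
    51*eX*sx^2*sy*sz - 2*eX*sx*sz^3 - 45*eX*sx*sy^3 - 55*eX*sx*sy^2*sz - 22*eX*sx*sy*sz^2) * h2

theorem genInv_trF_eXY : GenInv 10 (trF (eX * eY)) := by
  have h2 := extSym_two
  refine GenInv.congr (((genInv_eXY.mul genInv_dickson).mul (genInv_sx.pow 2)).congr rfl (r := 10)
    (by norm_num)) ?_ rfl
  rw [trF_eq]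
  simp only [map_add, map_mul, map_pow, act_sr0_eX, act_sr0_eY, act_sr0_sy, act_sr0_sz, act_r1_eX,
    act_r1_eY, act_r1_sy, act_r1_sz, act_r2_eX, act_r2_eY, act_r2_sx, act_r2_sy, act_r2_sz]
  linear_combination (-10*eX*eY*sy^4 - 18*eX*eY*sy^3*sz - 12*eX*eY*sy^2*sz^2 - 4*eX*eY*sy*sz^3 -
    5*eX*eY*sx^4 - 9*eX*eY*sx^3*sz - 22*eX*eY*sx^3*sy - 6*eX*eY*sx^2*sz^2 - 37*eX*eY*sx^2*sy^2 -
    33*eX*eY*sx^2*sy*sz - 2*eX*eY*sx*sz^3 - 30*eX*eY*sx*sy^3 - 39*eX*eY*sx*sy^2*sz -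
    18*eX*eY*sx*sy*sz^2) * h2 + (-18*sy^4 - 30*sy^3*sz - 18*sy^2*sz^2 - 4*sy*sz^3 - 10*sx^4 -
    18*sx^3*sz - 43*sx^3*sy - 12*sx^2*sz^2 - 72*sx^2*sy^2 - 60*sx^2*sy*sz - 4*sx*sz^3 - 57*sx*sy^3
    - 72*sx*sy^2*sz - 30*sx*sy*sz^2) * eX_mul_self

theorem genInv_trF_eXZ : GenInv 10 (trF (eX * eZ)) := by
  have h2 := extSym_two
  refine GenInv.congr ((((genInv_eXY.mul genInv_Q).mul (genInv_sx.pow 2)).congr rfl (r := 10) (by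
    norm_num)).add ((genInv_L2.mul (genInv_sx.pow 2)).congr rfl (r := 10) (by norm_num))) ?_ rfl
  rw [trF_eq]
  simp only [map_add, map_mul, map_pow, act_sr0_eX, act_sr0_eZ, act_sr0_sy, act_sr0_sz, act_r1_eX,
    act_r1_eY, act_r1_eZ, act_r1_sy, act_r1_sz, act_r2_eX, act_r2_eY, act_r2_eZ, act_r2_sx,
    act_r2_sy, act_r2_sz]
  linear_combination (-10*eX*eZ*sy^4 - 18*eX*eZ*sy^3*sz - 12*eX*eZ*sy^2*sz^2 - 4*eX*eZ*sy*sz^3 -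
    5*eX*eZ*sx^4 - 9*eX*eZ*sx^3*sz - 22*eX*eZ*sx^3*sy - 6*eX*eZ*sx^2*sz^2 - 37*eX*eZ*sx^2*sy^2 -
    33*eX*eZ*sx^2*sy*sz - 2*eX*eZ*sx*sz^3 - 30*eX*eZ*sx*sy^3 - 39*eX*eZ*sx*sy^2*sz -
    18*eX*eZ*sx*sy*sz^2 - 18*eX*eY*sy^4 - 30*eX*eY*sy^3*sz - 18*eX*eY*sy^2*sz^2 - 4*eX*eY*sy*sz^3
    - 9*eX*eY*sx^4 - 16*eX*eY*sx^3*sz - 41*eX*eY*sx^3*sy - 10*eX*eY*sx^2*sz^2 - 70*eX*eY*sx^2*sy^2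
    - 57*eX*eY*sx^2*sy*sz - 3*eX*eY*sx*sz^3 - 56*eX*eY*sx*sy^3 - 69*eX*eY*sx*sy^2*sz -
    27*eX*eY*sx*sy*sz^2) * h2 + (-26*sy^4 - 42*sy^3*sz - 24*sy^2*sz^2 - 6*sy*sz^3 - 18*sx^4 -
    30*sx^3*sz - 77*sx^3*sy - 18*sx^2*sz^2 - 123*sx^2*sy^2 - 102*sx^2*sy*sz - 4*sx*sz^3 -
    91*sx*sy^3 - 111*sx*sy^2*sz - 45*sx*sy*sz^2) * eX_mul_self

theorem genInv_trF_eYZ : GenInv 10 (trF (eY * eZ)) := by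
  have h2 := extSym_two
  refine GenInv.congr (((((genInv_eXY.mul genInv_Q).mul (genInv_sx.pow 2)).congr rfl (r := 10) (by
    norm_num)).add (((genInv_L1.mul genInv_sx).mul genInv_dickson).congr rfl (r := 10) (by
    norm_num))).add ((genInv_L2.mul (genInv_sx.pow 2)).congr rfl (r := 10) (by norm_num))) ?_ rfl
  rw [trF_eq]
  simp only [map_add, map_mul, map_pow, act_sr0_eY, act_sr0_eZ, act_sr0_sy, act_sr0_sz, act_r1_eY,
    act_r1_eZ, act_r1_sy, act_r1_sz, act_r2_eX, act_r2_eY, act_r2_eZ, act_r2_sx, act_r2_sy,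
    act_r2_sz]
  linear_combination (-10*eY*eZ*sy^4 - 18*eY*eZ*sy^3*sz - 12*eY*eZ*sy^2*sz^2 - 4*eY*eZ*sy*sz^3 -
    5*eY*eZ*sx^4 - 9*eY*eZ*sx^3*sz - 22*eY*eZ*sx^3*sy - 6*eY*eZ*sx^2*sz^2 - 37*eY*eZ*sx^2*sy^2 -
    33*eY*eZ*sx^2*sy*sz - 2*eY*eZ*sx*sz^3 - 30*eY*eZ*sx*sy^3 - 39*eY*eZ*sx*sy^2*sz -
    18*eY*eZ*sx*sy*sz^2 - 9*eX*eZ*sy^4 - 15*eX*eZ*sy^3*sz - 9*eX*eZ*sy^2*sz^2 - 2*eX*eZ*sy*sz^3 -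
    5*eX*eZ*sx^4 - 9*eX*eZ*sx^3*sz - 21*eX*eZ*sx^3*sy - 6*eX*eZ*sx^2*sz^2 - 35*eX*eZ*sx^2*sy^2 -
    30*eX*eZ*sx^2*sy*sz - 2*eX*eZ*sx*sz^3 - 28*eX*eZ*sx*sy^3 - 36*eX*eZ*sx*sy^2*sz -
    15*eX*eZ*sx*sy*sz^2 - 30*eX*eY*sy^4 - 48*eX*eY*sy^3*sz - 27*eX*eY*sy^2*sz^2 - 6*eX*eY*sy*sz^3
    - 18*eX*eY*sx^4 - 31*eX*eY*sx^3*sz - 79*eX*eY*sx^3*sy - 19*eX*eY*sx^2*sz^2 -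
    130*eX*eY*sx^2*sy^2 - 106*eX*eY*sx^2*sy*sz - 5*eX*eY*sx*sz^3 - 100*eX*eY*sx*sy^3 -
    121*eX*eY*sx*sy^2*sz - 48*eX*eY*sx*sy*sz^2) * h2 + (-36*sy^4 - 60*sy^3*sz - 36*sy^2*sz^2 -
    8*sy*sz^3 - 19*sx^4 - 33*sx^3*sz - 83*sx^3*sy - 21*sx^2*sz^2 - 141*sx^2*sy^2 - 114*sx^2*sy*sz
    - 6*sx*sz^3 - 112*sx*sy^3 - 138*sx*sy^2*sz - 54*sx*sy*sz^2) * eY_mul_self + (-25*sy^4 -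
    39*sy^3*sz - 21*sy^2*sz^2 - 4*sy*sz^3 - 18*sx^4 - 30*sx^3*sz - 75*sx^3*sy - 18*sx^2*sz^2 -
    120*sx^2*sy^2 - 96*sx^2*sy*sz - 4*sx*sz^3 - 88*sx*sy^3 - 105*sx*sy^2*sz - 39*sx*sy*sz^2) *
    eX_mul_self

end invariants

/-! ### The building blocks -/

section blocks

theorem Fam.span_eq {n : ℕ} {I : Type} [Fintype I] [DecidableEq I] {ρ : D8 →* Matrix I I (ZMod 2)}
    (l : Fam ρ n) {s : Set ExtSym} (h : Set.range (fun i => val (l.el i)) = s) :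
    l.span = Submodule.span (ZMod 2) s := congrArg _ h

theorem range_three {α : Type} (f : Fin 3 → α) : Set.range f = {f 0, f 1, f 2} := by
  ext a; simp [Fin.exists_fin_succ, eq_comm]

theorem range_four {α : Type} (f : Fin 4 → α) : Set.range f = {f 0, f 1, f 2, f 3} := by
  ext a; simp [Fin.exists_fin_succ, eq_comm]

theorem range_two {α : Type} (f : Fin 2 → α) : Set.range f = {f 0, f 1} := by
  ext a; simp [eq_comm]

-- The laws of the semiring of subspaces, specialized to `ExtSym` for rewriting.

theorem sub_mul_assoc (a b c : Submodule (ZMod 2) ExtSym) : a * b * c = a * (b * c) :=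
  mul_assoc a b c

theorem sub_mul_comm (a b : Submodule (ZMod 2) ExtSym) : a * b = b * a := mul_comm a b

theorem sub_mul_right_comm (a b c : Submodule (ZMod 2) ExtSym) : a * b * c = a * c * b :=
  mul_right_comm a b c

theorem sub_one_mul (a : Submodule (ZMod 2) ExtSym) : 1 * a = a := one_mul a

/-- The first exterior power. -/
def L1 : Submodule (ZMod 2) ExtSym := Submodule.span (ZMod 2) {eX, eY, eZ}

/-- The second exterior power. -/
def L2 : Submodule (ZMod 2) ExtSym := Submodule.span (ZMod 2) {eX * eY, eX * eZ, eY * eZ}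

/-- The third exterior power. -/
def L3 : Submodule (ZMod 2) ExtSym := Submodule.span (ZMod 2) {eX * eY * eZ}

theorem span_famE : famE.span = L1 := famE.span_eq (range_three _)

theorem span_famE2 : famE2.span = L2 := famE2.span_eq (range_three _)

theorem span_famS : famS.span = polyM sx sy sz := famS.span_eq (range_three _)

theorem span_famY : famY.span = polyY sx sy sz := famY.span_eq (range_four orbY)

theorem span_famX : famX.span = polyX sx sy sz := famX.span_eq (range_two orbX)

theorem act_r3 (a : ExtSym) : actA (r 3) a = actA (r 1) (actA (r 2) a) := by
  rw [← actA_mul, r_mul_r]; rfl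

theorem act_sr2 (a : ExtSym) : actA (sr 2) a = actA (sr 0) (actA (r 2) a) := by
  rw [← actA_mul, sr_mul_r]; rfl

theorem act_sr3 (a : ExtSym) : actA (sr 3) a = actA (sr 1) (actA (r 2) a) := by
  rw [← actA_mul, sr_mul_r]; rfl

theorem polyF_le_span_famF : polyF sx sy sz ≤ famF.span := by
  have h2 := extSym_two
  have h : ∀ g : D8, actA g (sy * sz ^ 3) ∈ famF.span := fun g =>
    Submodule.subset_span ⟨g, rfl⟩
  have h0 := h 1
  have h1 := h (r 1)
  have h3 := h (r 2)
  have h4 := h (r 3)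
  have h5 := h (sr 0)
  have h6 := h (sr 1)
  have h7 := h (sr 2)
  have h8 := h (sr 3)
  rw [actA_one] at h0
  rw [act_r3] at h4
  rw [act_sr2] at h7
  rw [act_sr3] at h8
  simp only [map_mul, map_pow, map_add, act_r1_sx, act_r1_sy, act_r1_sz, act_r2_sy, act_r2_sz,
    act_sr0_sx, act_sr0_sy, act_sr0_sz, act_sr1_sx, act_sr1_sy, act_sr1_sz] at h1 h3 h4 h5 h6 h7 h8
  refine Submodule.span_le.2 ?_
  rintro _ (rfl | rfl | rfl | rfl | rfl | rfl | rfl | rfl)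
  · exact h0
  · exact mem_of_eq_of_mem h3 (by ring)
  · exact mem_of_eq_of_mem h5 (by ring)
  · exact mem_of_eq_of_mem h7 (by ring)
  · exact mem_of_eq_of_mem h6 (by ring)
  · exact mem_of_eq_of_mem h8 (by ring)
  · exact mem_of_eq_of_mem h1 (by ring)
  · exact mem_of_eq_of_mem h4 (by ring)

theorem Dec.congr {q q' d d' : ℕ} {R R' : Submodule (ZMod 2) ExtSym} {h : ℕ → ℕ}
    (H : Dec q R d h) (hq : q = q') (hR : R' ≤ R) (hd : d = d') : Dec q' R' d' h := by
  subst hq hd; exact H.mono hR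

/-- Decompositions of the products of `L` with the building blocks of the polynomial ring, where `L`
has degree `i` and dimension `d`,
    and the remaining functions are the dimensions of the cohomology of
the blocks. -/
structure Blocks (i : ℕ) (L : Submodule (ZMod 2) ExtSym) (d : ℕ) (f fM fY fX fXM fF : ℕ → ℕ) :
    Prop where
  one : Dec i L d f
  M : Dec (i + 2) (L * polyM sx sy sz) (3 * d) fM
  Y : Dec (i + 4) (L * polyY sx sy sz) (4 * d) fY
  X : Dec (i + 4) (L * polyX sx sy sz) (2 * d) fX
  XM : Dec (i + 6) (L * (polyX sx sy sz * polyM sx sy sz)) (6 * d) fXM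
  F : Dec (i + 8) (L * polyF sx sy sz) (8 * d) fF

/-- The function which is `a` at zero, and `g` shifted by one otherwise. -/
def consFun (a : ℕ) (g : ℕ → ℕ) : ℕ → ℕ
  | 0 => a
  | p + 1 => g p

theorem eq_consFun {h : ℕ → ℕ} {a : ℕ} {g : ℕ → ℕ} (h0 : h 0 = a) (h1 : ∀ p, h (p + 1) =
    g p) (p : ℕ) :
    h p = consFun a g p := by
  rcases p with _ | p
  · exact h0
  · exact h1 p

theorem finrank_T {I : Type} [Fintype I] [DecidableEq I] (ρ : D8 →* Matrix I I (ZMod 2))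
    (W : Rep.{0} (ZMod 2) D8) [Module.Finite (ZMod 2) W.V] {d : ℕ}
    (h : Module.finrank (ZMod 2) W.V = d) :
    Module.finrank (ZMod 2) (T ρ W).V = Fintype.card I * d := by
  refine (Module.finrank_pi_fintype (ZMod 2) (M := fun _ : I => W.V)).trans ?_
  simp [h]

theorem coversX : Covers WX 4 (polyX sx sy sz) := by
  have := Covers.permX famX (by norm_num)
  rwa [span_famX, sub_one_mul] at this

/-- The dimensions of the cohomology of the blocks of `S(M)`. -/
theorem blocks_zero : Blocks 0 1 1 (· + 1) (· + 1) (fun _ => 1) (· + 1) (consFun 1 (· + 1))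
    (consFun 1 fun _ => 0) where
  one := Covers.one.dec finrank_W1 hdim_W1
  M := by
    have := Covers.one.fam Ca traceZero_a_W1 famS (by norm_num) (by norm_num)
    rw [span_famS] at this
    exact this.dec finrank_WM hdim_WM
  Y := by
    have := Covers.one.permA famY (by norm_num)
    rw [span_famY] at this
    refine this.dec (finrank_T _ _ finrank_W1) fun p => ?_
    rcases p with _ | p
    exacts [hdim_permA_zero, hdim_permA_succ p]
  X := by
    rw [sub_one_mul]
    exact coversX.dec finrank_WX hdim_WX
  XM := by
    have := coversX.fam Ca traceZero_a_WX famS (by norm_num) (by norm_num)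
    rw [span_famS] at this
    rw [sub_one_mul]
    exact this.dec finrank_WMX (eq_consFun hdim_WMX_zero hdim_WMX_succ)
  F := by
    have H : Covers (T regMat W1) (0 + 8) (1 * famF.span) := by
      obtain ⟨e, -, h⟩ := Covers.one
      rw [← h]
      exact ⟨famF.mulHom e, Gen.of_acyclic (acyclic_regular W1) _ (genZero_of_le (by norm_num) _),
        img_mulHom famF e⟩
    exact (H.dec (finrank_T _ _ finrank_W1) (eq_consFun ((hdim_regular_zero _).trans finrank_W1)
      (hdim_reg_succ _))).congr (by norm_num) (mul_le_mul' le_rfl polyF_le_span_famF) rfl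

theorem coversL1 : Covers WM 1 L1 := by
  have := Covers.one.fam Ca traceZero_a_W1 famE (by norm_num) (by norm_num)
  rwa [span_famE, sub_one_mul] at this

/-- The dimensions of the cohomology of the blocks of `Λ¹(M) ⊗ S(M)`. -/
theorem blocks_one : Blocks 1 L1 3 (· + 1) (consFun 2 (· + 2)) (consFun 2 fun _ => 1)
    (consFun 1 (· + 1)) (consFun 3 (consFun 1 (· + 1))) (consFun 3 fun _ => 0) where
  one := coversL1.dec finrank_WM hdim_WM
  M := by
    have := coversL1.fam Ca traceZero_a_WM famS (by norm_num) (by norm_num)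
    rw [span_famS] at this
    exact this.dec (finrank_T _ _ finrank_WM) (eq_consFun hdim_MM_zero hdim_MM_succ)
  Y := by
    have := coversL1.permA famY (by norm_num)
    rw [span_famY] at this
    exact this.dec (finrank_T _ _ finrank_WM) (eq_consFun hdim_permA_M_zero hdim_permA_M_succ)
  X := by
    have := coversX.fam Ca traceZero_a_WX famE (by norm_num) (by norm_num)
    rw [span_famE, sub_mul_comm] at this
    exact this.dec finrank_WMX (eq_consFun hdim_WMX_zero hdim_WMX_succ)
  XM := by
    have := (coversX.fam Ca traceZero_a_WX famS (by norm_num) (by norm_num)).fam Ca traceZero_a_WMX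
      famE (by norm_num) (by norm_num)
    rw [span_famE, span_famS, sub_mul_comm] at this
    exact this.dec (finrank_T _ _ finrank_WMX) (eq_consFun hdim_MMX_zero fun p =>
      (hdim_MMX_succ p).trans (eq_consFun hdim_WMX_zero hdim_WMX_succ p))
  F := by
    have := coversL1.reg fun a ha => genInv_of_mem_span trF ha (by
      rintro _ (rfl | rfl | rfl)
      exacts [genInv_trF_eX, genInv_trF_eY, genInv_trF_eZ])
    exact (this.dec (finrank_T _ _ finrank_WM) (eq_consFun ((hdim_regular_zero _).trans finrank_WM)
      (hdim_reg_succ _))).congr (by norm_num) (mul_le_mul' le_rfl polyF_le_span_famF) rfl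

theorem coversL2 : Covers WM2 2 L2 := by
  have := Covers.one.fam Cb traceZero_b_W1 famE2 (by norm_num) (by norm_num)
  rwa [span_famE2, sub_one_mul] at this

/-- The dimensions of the cohomology of the blocks of `Λ²(M) ⊗ S(M)`. -/
theorem blocks_two : Blocks 2 L2 3 (· + 1) (consFun 2 (· + 2)) (consFun 2 fun _ => 1)
    (· + 2) (consFun 3 (· + 2)) (consFun 3 fun _ => 0) where
  one := coversL2.dec finrank_WM2 hdim_WM2
  M := by
    have := coversL2.fam Ca traceZero_a_WM2 famS (by norm_num) (by norm_num)
    rw [span_famS] at this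
    exact this.dec (finrank_T _ _ finrank_WM2) (eq_consFun hdim_MM2_zero hdim_MM2_succ)
  Y := by
    have := coversL2.permA famY (by norm_num)
    rw [span_famY] at this
    exact this.dec (finrank_T _ _ finrank_WM2) (eq_consFun hdim_permA_M2_zero hdim_permA_M2_succ)
  X := by
    have := coversX.fam Cb traceZero_b_WX famE2 (by norm_num) (by norm_num)
    rw [span_famE2, sub_mul_comm] at this
    exact this.dec finrank_WM2X hdim_WM2X
  XM := by
    have := (coversX.fam Cb traceZero_b_WX famE2 (by norm_num) (by norm_num)).fam Ca
      traceZero_a_WM2X famS (by norm_num) (by norm_num)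
    rw [span_famE2, span_famS, sub_mul_comm (polyX sx sy sz), sub_mul_assoc] at this
    exact this.dec (finrank_T _ _ finrank_WM2X) (eq_consFun hdim_MM2X_zero hdim_MM2X_succ)
  F := by
    have := coversL2.reg fun a ha => genInv_of_mem_span trF ha (by
      rintro _ (rfl | rfl | rfl)
      exacts [genInv_trF_eXY, genInv_trF_eXZ, genInv_trF_eYZ])
    exact (this.dec (finrank_T _ _ finrank_WM2) (eq_consFun
      ((hdim_regular_zero _).trans finrank_WM2) (hdim_reg_succ _))).congr (by norm_num)
      (mul_le_mul' le_rfl polyF_le_span_famF) rfl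

theorem Dec.mulSpan {q n d : ℕ} {R : Submodule (ZMod 2) ExtSym} {h : ℕ → ℕ} (H : Dec q R d h)
    {u : ExtSym} (hu : GenInv n u) : Dec (q + n) (R * Submodule.span (ZMod 2) {u}) d h :=
  H.mulInv hu fun a ha => by
    obtain ⟨b, hb, rfl⟩ := Submodule.mem_mul_span_singleton.1 ha
    exact ⟨b, hb, rfl⟩

theorem Blocks.mulSpan {i d n k : ℕ} {L : Submodule (ZMod 2) ExtSym} {f fM fY fX fXM fF : ℕ → ℕ}
    (B : Blocks i L d f fM fY fX fXM fF) {u : ExtSym} (hu : GenInv n u) (hk : i + n = k) :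
    Blocks k (L * Submodule.span (ZMod 2) {u}) d f fM fY fX fXM fF where
  one := (B.one.mulSpan hu).congr hk le_rfl rfl
  M := (B.M.mulSpan hu).congr (by omega) (by rw [sub_mul_right_comm]) rfl
  Y := (B.Y.mulSpan hu).congr (by omega) (by rw [sub_mul_right_comm]) rfl
  X := (B.X.mulSpan hu).congr (by omega) (by rw [sub_mul_right_comm]) rfl
  XM := (B.XM.mulSpan hu).congr (by omega) (by rw [sub_mul_right_comm]) rfl
  F := (B.F.mulSpan hu).congr (by omega) (by rw [sub_mul_right_comm]) rfl

/-- The space `Λ³(M)` is spanned by an invariant, so its blocks are those of `S(M)`. -/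
theorem blocks_three : Blocks 3 L3 1 (· + 1) (· + 1) (fun _ => 1) (· + 1) (consFun 1 (· + 1))
    (consFun 1 fun _ => 0) := by
  have := blocks_zero.mulSpan genInv_eXYZ (k := 3) (by norm_num)
  rwa [sub_one_mul] at this

section sequences

variable {α : Type} [AddCommMonoid α] (f fM fY fX fXM fF : α)

/-- The value on the pieces `polyP` of an additive invariant with the given values on the blocks. -/
def seqP : ℕ → α
  | 0 => f
  | 1 => fM
  | 2 => fY + fX
  | 3 => fY + fXM
  | j + 4 => seqP (j + 2) + fF

/-- The value on the pieces `polyS` of an additive invariant with the given values on the blocks. -/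
def seqS : ℕ → α
  | 0 => f
  | 1 => fM
  | 2 => fY + fX
  | 3 => fY + fXM
  | j + 4 => seqS j + seqP f fM fY fX fXM fF (j + 4)

end sequences

variable {i d : ℕ} {L : Submodule (ZMod 2) ExtSym} {f fM fY fX fXM fF : ℕ → ℕ}

theorem Blocks.decP (B : Blocks i L d f fM fY fX fXM fF) (j : ℕ) :
    Dec (i + 2 * j) (L * polyP sx sy sz j)
      (seqP d (3 * d) (4 * d) (2 * d) (6 * d) (8 * d) j) (seqP f fM fY fX fXM fF j) := by
  induction j using Nat.strong_induction_on with
  | _ j ih =>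
    match j, ih with
    | 0, _ => exact B.one.congr (by omega) (mul_one (M := Submodule (ZMod 2) ExtSym) L).le rfl
    | 1, _ => exact B.M
    | 2, _ => exact (B.Y.add B.X).congr (by omega) (mul_polyP_two sx sy sz L).le rfl
    | 3, _ =>
      refine ((B.Y.mulSpan genInv_sx).add B.XM).congr (by omega) (mul_polyP_three sx sy sz L).le rfl
    | j + 4, ih =>
      refine (((ih (j + 2) (by omega)).mulSpan genInv_Q).add
        ((B.F.mulSpan (genInv_sx.pow j)).congr (by omega) le_rfl rfl)).congr (by omega)
        (mul_polyP_add_four sx sy sz L j).le rfl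

theorem Blocks.decS (B : Blocks i L d f fM fY fX fXM fF) (j : ℕ) :
    Dec (i + 2 * j) (L * polyS sx sy sz j)
      (seqS d (3 * d) (4 * d) (2 * d) (6 * d) (8 * d) j) (seqS f fM fY fX fXM fF j) := by
  induction j using Nat.strong_induction_on with
  | _ j ih =>
    match j, ih with
    | 0, _ => exact B.decP 0
    | 1, _ => exact B.decP 1
    | 2, _ => exact B.decP 2
    | 3, _ => exact B.decP 3
    | j + 4, ih =>
      refine (((ih j (by omega)).mulSpan genInv_D).congr (by omega) le_rfl rfl |>.add
        (B.decP (j + 4))).congr (by omega)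
        (mul_polyS_add_four sx sy sz L j).le rfl

end blocks

/-! ### The decomposition of `Λ(M) ⊗ S(M)` -/

section levels

variable {α : Type} (o : α)

/-- The sequence `a 0, o, a 1, o, …`. -/
def dbl (a : ℕ → α) : ℕ → α
  | 0 => a 0
  | 1 => o
  | q + 2 => dbl (fun j => a (j + 1)) q

/-- The sequence `a 0, o, a 1, o, …`, preceded by `i` terms `o`. -/
def lev : ℕ → (ℕ → α) → ℕ → α
  | 0, a, q => dbl o a q
  | _ + 1, _, 0 => o
  | i + 1, a, q + 1 => lev i a q

theorem dbl_two_mul (a : ℕ → α) (j : ℕ) : dbl o a (2 * j) = a j := by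
  induction j generalizing a with
  | zero => rfl
  | succ j ih => exact ih _

theorem dbl_two_mul_add_one (a : ℕ → α) (j : ℕ) : dbl o a (2 * j + 1) = o := by
  induction j generalizing a with
  | zero => rfl
  | succ j ih => exact ih _

theorem lev_of_lt (a : ℕ → α) {i q : ℕ} (h : q < i) : lev o i a q = o := by
  induction i generalizing q with
  | zero => omega
  | succ i ih =>
    rcases q with _ | q
    · rfl
    · exact ih (by omega)

theorem lev_add (a : ℕ → α) (i q : ℕ) : lev o i a (i + q) = dbl o a q := by
  induction i with
  | zero => rw [zero_add]; rfl
  | succ i ih =>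
    rw [show i + 1 + q = i + q + 1 by omega]
    exact ih

theorem lev_add_two_mul (a : ℕ → α) (i j : ℕ) : lev o i a (i + 2 * j) = a j := by
  rw [lev_add, dbl_two_mul]

end levels

section total

theorem subsingleton_groupCohomology {G : Type} [Group G] (W : Rep.{0} (ZMod 2) G) [Subsingleton W.V]
    (n : ℕ) : Subsingleton (groupCohomology W n) := by
  refine ⟨fun u v => ?_⟩
  obtain ⟨f, hf, rfl⟩ := cls_surjective u
  obtain ⟨g, hg, rfl⟩ := cls_surjective v
  exact cls_congr hf (Subsingleton.elim _ _)

theorem Dec.bot (q : ℕ) : Dec q ⊥ 0 0 := by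
  have : Subsingleton (T (1 : D8 →* Matrix (Fin 0) (Fin 0) (ZMod 2)) W1).V :=
    inferInstanceAs (Subsingleton (Fin 0 → ZMod 2))
  have hs := subsingleton_groupCohomology (T (1 : D8 →* Matrix (Fin 0) (Fin 0) (ZMod 2)) W1)
  refine ⟨T (1 : D8 →* Matrix (Fin 0) (Fin 0) (ZMod 2)) W1, mkHom 0 fun g a => (map_zero _).symm,
    inferInstance, Module.finrank_zero_of_subsingleton, fun p => ?_, fun F hF p u => ?_,
    fun a ha => ⟨0, ?_⟩⟩
  · have := hs p
    exact Module.finrank_zero_of_subsingleton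
  · have := hs p
    rw [Subsingleton.elim u 0, map_zero]
    exact zero_mem _
  · rw [(Submodule.mem_bot _).1 ha]; rfl

theorem Dec.dbl {i : ℕ} {R : ℕ → Submodule (ZMod 2) ExtSym} {d : ℕ → ℕ} {h : ℕ → ℕ → ℕ}
    (H : ∀ j, Dec (i + 2 * j) (R j) (d j) (h j)) (q : ℕ) :
    Dec (i + q) (HS.dbl ⊥ R q) (HS.dbl 0 d q) (HS.dbl 0 h q) := by
  obtain ⟨j, rfl | rfl⟩ := Nat.even_or_odd' q
  · rw [dbl_two_mul, dbl_two_mul, dbl_two_mul]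
    exact H j
  · rw [dbl_two_mul_add_one, dbl_two_mul_add_one, dbl_two_mul_add_one]
    exact Dec.bot _

theorem Dec.lev {i : ℕ} {R : ℕ → Submodule (ZMod 2) ExtSym} {d : ℕ → ℕ} {h : ℕ → ℕ → ℕ}
    (H : ∀ j, Dec (i + 2 * j) (R j) (d j) (h j)) (q : ℕ) :
    Dec q (HS.lev ⊥ i R q) (HS.lev 0 i d q) (HS.lev 0 i h q) := by
  by_cases hq : q < i
  · rw [lev_of_lt _ _ hq, lev_of_lt _ _ hq, lev_of_lt _ _ hq]
    exact Dec.bot _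
  · obtain ⟨q, rfl⟩ := Nat.exists_eq_add_of_le (not_lt.1 hq)
    rw [lev_add, lev_add, lev_add]
    exact Dec.dbl H q

/-- The exterior powers, as subspaces of `Λ(M) ⊗ S(M)`. -/
def ext : ℕ → Submodule (ZMod 2) ExtSym
  | 0 => 1
  | 1 => L1
  | 2 => L2
  | 3 => L3
  | _ + 4 => ⊥

theorem eX_mem_L1 : eX ∈ L1 := Submodule.subset_span (by simp)
theorem eY_mem_L1 : eY ∈ L1 := Submodule.subset_span (by simp)
theorem eZ_mem_L1 : eZ ∈ L1 := Submodule.subset_span (by simp)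

theorem extι_mem_L1 (v : M) : extι v ∈ L1 := by
  rw [ext_sum]
  exact add_mem (add_mem (Submodule.smul_mem _ _ eX_mem_L1) (Submodule.smul_mem _ _ eY_mem_L1))
    (Submodule.smul_mem _ _ eZ_mem_L1)

theorem symι_mem_polyM (v : M) : symι v ∈ polyM sx sy sz := by
  rw [sym_sum]
  exact add_mem (add_mem (Submodule.smul_mem _ _ (x_mem_polyM _ _ _))
    (Submodule.smul_mem _ _ (y_mem_polyM _ _ _))) (Submodule.smul_mem _ _ (z_mem_polyM _ _ _))

theorem span_mul_span_le {s t : Set ExtSym} {N : Submodule (ZMod 2) ExtSym}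
    (h : ∀ a ∈ s, ∀ b ∈ t, a * b ∈ N) {a b : ExtSym} (ha : a ∈ Submodule.span (ZMod 2) s)
    (hb : b ∈ Submodule.span (ZMod 2) t) : a * b ∈ N := by
  have : Submodule.span (ZMod 2) s * Submodule.span (ZMod 2) t ≤ N := by
    rw [Submodule.span_mul_span, Submodule.span_le]
    rintro _ ⟨a, ha, b, hb, rfl⟩
    exact h a ha b hb
  exact this (Submodule.mul_mem_mul ha hb)

theorem L1_mul_ext {i : ℕ} {a b : ExtSym} (ha : a ∈ L1) (hb : b ∈ ext i) : a * b ∈ ext (i + 1) := by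
  have hX := eX_mul_self
  have hY := eY_mul_self
  have hZ := eZ_mul_self
  match i, hb with
  | 0, hb =>
    obtain ⟨c, rfl⟩ := Submodule.mem_one.1 hb
    rw [mul_comm, ← Algebra.smul_def]
    exact Submodule.smul_mem _ c ha
  | 1, hb =>
    have h1 : eX * eY ∈ L2 := Submodule.subset_span (by simp)
    have h2 : eX * eZ ∈ L2 := Submodule.subset_span (by simp)
    have h3 : eY * eZ ∈ L2 := Submodule.subset_span (by simp)
    have h0 : (0 : ExtSym) ∈ L2 := zero_mem _
    refine span_mul_span_le ?_ ha hb
    rintro _ (rfl | rfl | rfl) _ (rfl | rfl | rfl)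
    exacts [mem_of_eq_of_mem h0 hX, h1, h2, mem_of_eq_of_mem h1 (by ring), mem_of_eq_of_mem h0 hY,
        h3,
      mem_of_eq_of_mem h2 (by ring), mem_of_eq_of_mem h3 (by ring), mem_of_eq_of_mem h0 hZ]
  | 2, hb =>
    have h1 : eX * eY * eZ ∈ L3 := Submodule.subset_span (by simp)
    have h0 : (0 : ExtSym) ∈ L3 := zero_mem _
    refine span_mul_span_le ?_ ha hb
    rintro _ (rfl | rfl | rfl) _ (rfl | rfl | rfl)
    · exact mem_of_eq_of_mem h0 (by linear_combination eY * hX)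
    · exact mem_of_eq_of_mem h0 (by linear_combination eZ * hX)
    · exact mem_of_eq_of_mem h1 (by ring)
    · exact mem_of_eq_of_mem h0 (by linear_combination eX * hY)
    · exact mem_of_eq_of_mem h1 (by ring)
    · exact mem_of_eq_of_mem h0 (by linear_combination eZ * hY)
    · exact mem_of_eq_of_mem h1 (by ring)
    · exact mem_of_eq_of_mem h0 (by linear_combination eX * hZ)
    · exact mem_of_eq_of_mem h0 (by linear_combination eY * hZ)
  | 3, hb =>
    refine span_mul_span_le ?_ ha hb
    rintro _ (rfl | rfl | rfl) _ rfl
    · exact (Submodule.mem_bot _).2 (by linear_combination eY * eZ * hX)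
    · exact (Submodule.mem_bot _).2 (by linear_combination eX * eZ * hY)
    · exact (Submodule.mem_bot _).2 (by linear_combination eX * eY * hZ)
  | i + 4, hb =>
    rw [(Submodule.mem_bot _).1 hb, mul_zero]
    exact zero_mem _

/-- The span of the pieces of `Λⁱ(M) ⊗ Sʲ(M)`. -/
def extS (i : ℕ) (j : ℕ) : Submodule (ZMod 2) ExtSym := ext i * polyS sx sy sz j

theorem extSymDeg_le_lev (q : ℕ) : extSymDeg q ≤
    lev ⊥ 0 (extS 0) q ⊔ lev ⊥ 1 (extS 1) q ⊔ lev ⊥ 2 (extS 2) q ⊔ lev ⊥ 3 (extS 3) q := by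
  refine extSymDeg_le (N := fun i j => ext i * polyM sx sy sz ^ j) ?_ ?_ ?_ ?_
  · refine mem_of_eq_of_mem (Submodule.mul_mem_mul (Submodule.one_le.1 le_rfl) ?_) (mul_one 1).symm
    rw [pow_zero]
    exact Submodule.one_le.1 le_rfl
  · intro j v a ha
    have := Submodule.mul_mem_mul (symι_mem_polyM v) ha
    refine mem_of_eq_of_mem (b := symι v * a) ?_ rfl
    change _ ∈ (1 : Submodule (ZMod 2) ExtSym) * _
    change _ ∈ _ * (1 * _) at this
    rw [sub_one_mul] at this ⊢
    rwa [pow_succ']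
  · intro i j v a ha
    have : L1 * (ext i * polyM sx sy sz ^ j) ≤ ext (i + 1) * polyM sx sy sz ^ j := by
      rw [← sub_mul_assoc]
      exact mul_le_mul' (Submodule.mul_le.2 fun a ha b hb => L1_mul_ext ha hb) le_rfl
    exact this (Submodule.mul_mem_mul (extι_mem_L1 v) ha)
  · intro i j h
    subst h
    have hS : ∀ i, ext i * polyM sx sy sz ^ j ≤ lev ⊥ i (extS i) (i + 2 * j) := fun i => by
      rw [lev_add_two_mul]
      exact mul_le_mul' le_rfl (polyM_pow_le_polyS _ _ _ j)
    match i with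
    | 0 => exact (hS 0).trans (le_sup_of_le_left (le_sup_of_le_left le_sup_left))
    | 1 => exact (hS 1).trans (le_sup_of_le_left (le_sup_of_le_left le_sup_right))
    | 2 => exact (hS 2).trans (le_sup_of_le_left le_sup_right)
    | 3 => exact (hS 3).trans le_sup_right
    | i + 4 =>
      refine le_trans ?_ bot_le
      exact (Submodule.bot_mul _).le

/-- The dimensions of `Λⁱ(M) ⊗ Sʲ(M)`, for `i = 0` and `i = 3`. -/
abbrev dim0 : ℕ → ℕ := seqS 1 (3 * 1) (4 * 1) (2 * 1) (6 * 1) (8 * 1)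

/-- The dimensions of `Λⁱ(M) ⊗ Sʲ(M)`, for `i = 1` and `i = 2`. -/
abbrev dim1 : ℕ → ℕ := seqS 3 (3 * 3) (4 * 3) (2 * 3) (6 * 3) (8 * 3)

/-- The dimensions of the cohomology of `Λ⁰(M) ⊗ Sʲ(M)` and `Λ³(M) ⊗ Sʲ(M)`. -/
abbrev coh0 : ℕ → ℕ → ℕ :=
  seqS (· + 1) (· + 1) (fun _ => 1) (· + 1) (consFun 1 (· + 1)) (consFun 1 fun _ => 0)

/-- The dimensions of the cohomology of `Λ¹(M) ⊗ Sʲ(M)`. -/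
abbrev coh1 : ℕ → ℕ → ℕ :=
  seqS (· + 1) (consFun 2 (· + 2)) (consFun 2 fun _ => 1) (consFun 1 (· + 1))
    (consFun 3 (consFun 1 (· + 1))) (consFun 3 fun _ => 0)

/-- The dimensions of the cohomology of `Λ²(M) ⊗ Sʲ(M)`. -/
abbrev coh2 : ℕ → ℕ → ℕ :=
  seqS (· + 1) (consFun 2 (· + 2)) (consFun 2 fun _ => 1) (· + 2) (consFun 3 (· + 2))
    (consFun 3 fun _ => 0)

/-- The dimension of the graded piece of degree `q`. -/
def dimA (q : ℕ) : ℕ := lev 0 0 dim0 q + lev 0 1 dim1 q + lev 0 2 dim1 q + lev 0 3 dim0 q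

/-- The dimension of the cohomology of the graded piece of degree `q`. -/
def cohA (q : ℕ) : ℕ → ℕ :=
  lev 0 0 coh0 q + lev 0 1 coh1 q + lev 0 2 coh2 q + lev 0 3 coh0 q

/-- The graded piece of degree `q` is the sum of the `Λⁱ(M) ⊗ Sʲ(M)` with `i + 2 j = q`. -/
theorem dec_extSymDeg (q : ℕ) : Dec q (extSymDeg q) (dimA q) (cohA q) :=
  ((((Dec.lev blocks_zero.decS q).add (Dec.lev blocks_one.decS q)).add
    (Dec.lev blocks_two.decS q)).add (Dec.lev blocks_three.decS q)).mono (extSymDeg_le_lev q)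

theorem seqP_add_two (d j : ℕ) : seqP d (3 * d) (4 * d) (2 * d) (6 * d) (8 * d) (j + 2) =
    (4 * j + 6) * d := by
  induction j using Nat.twoStepInduction with
  | zero => simp only [seqP]; ring
  | one => simp only [seqP]; ring
  | more j ih _ =>
    change seqP _ _ _ _ _ _ (j + 2) + 8 * d = _
    rw [ih]; ring

theorem two_mul_seqS (d j : ℕ) : 2 * seqS d (3 * d) (4 * d) (2 * d) (6 * d) (8 * d) j =
    (j + 1) * (j + 2) * d := by
  induction j using Nat.strong_induction_on with
  | _ j ih =>
    match j, ih with
    | 0, _ => simp only [seqS]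
    | 1, _ => simp only [seqS]; ring
    | 2, _ => simp only [seqS]; ring
    | 3, _ => simp only [seqS]; ring
    | j + 4, ih =>
      change 2 * (seqS _ _ _ _ _ _ j + seqP _ _ _ _ _ _ (j + 2 + 2)) = _
      rw [mul_add, ih j (by omega), seqP_add_two]
      ring

theorem two_mul_dimA (q : ℕ) : 2 * dimA q = (q + 1) * (q + 2) := by
  have h0 : ∀ j, 2 * dim0 j = (j + 1) * (j + 2) * 1 := two_mul_seqS 1
  have h1 : ∀ j, 2 * dim1 j = (j + 1) * (j + 2) * 3 := two_mul_seqS 3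
  unfold dimA
  obtain ⟨j, rfl | rfl⟩ := Nat.even_or_odd' q
  · rcases j with _ | j
    · rfl
    · have e0 := lev_add_two_mul 0 dim0 0 (j + 1)
      have e2 := lev_add_two_mul 0 dim1 2 j
      have e1 : lev 0 1 dim1 (1 + (2 * j + 1)) = 0 := by rw [lev_add, dbl_two_mul_add_one]
      have e3 : lev 0 3 dim0 (2 * (j + 1)) = 0 := by
        rcases j with _ | j
        · rfl
        · rw [show 2 * (j + 1 + 1) = 3 + (2 * j + 1) by omega, lev_add, dbl_two_mul_add_one]
      rw [zero_add] at e0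
      rw [show 1 + (2 * j + 1) = 2 * (j + 1) by omega] at e1
      rw [show 2 + 2 * j = 2 * (j + 1) by omega] at e2
      rw [e0, e1, e2, e3, add_zero, add_zero, mul_add, h0, h1]
      ring
  · have e1 := lev_add_two_mul 0 dim1 1 j
    have e0 : lev 0 0 dim0 (0 + (2 * j + 1)) = 0 := by rw [lev_add, dbl_two_mul_add_one]
    rcases j with _ | j
    · rfl
    · have e3 := lev_add_two_mul 0 dim0 3 j
      have e2 : lev 0 2 dim1 (2 + (2 * j + 1)) = 0 := by rw [lev_add, dbl_two_mul_add_one]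
      rw [zero_add] at e0
      rw [show 2 + (2 * j + 1) = 2 * (j + 1) + 1 by omega] at e2
      rw [show 1 + 2 * (j + 1) = 2 * (j + 1) + 1 by omega] at e1
      rw [show 3 + 2 * j = 2 * (j + 1) + 1 by omega] at e3
      rw [e0, e1, e2, e3, add_zero, zero_add, mul_add, h0, h1]
      ring

theorem finite_extSymDeg (q : ℕ) : Module.Finite (ZMod 2) (extSymDeg q) := by
  obtain ⟨W, e, h1, -, -, -, h5⟩ := dec_extSymDeg q
  exact Module.Finite.of_surjective (e.hom.toLinearMap : W.V →ₗ[ZMod 2] extSymDeg q) fun a =>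
    (h5 a.1 a.2).imp fun w hw => val_injective hw

theorem finrank_extSymDeg_le (q : ℕ) : Module.finrank (ZMod 2) (extSymDeg q) ≤ dimA q := by
  obtain ⟨W, e, h1, h2, -, -, h5⟩ := dec_extSymDeg q
  rw [← h2]
  exact LinearMap.finrank_le_finrank_of_surjective (f :=
      (e.hom.toLinearMap : W.V →ₗ[ZMod 2] extSymDeg q))
    fun a => (h5 a.1 a.2).imp fun w hw => val_injective hw

/-- Once the decomposition has the dimension of the graded piece, it is an isomorphism. -/
theorem exists_bijective {q : ℕ} (hq : dimA q ≤ Module.finrank (ZMod 2) (extSymDeg q)) :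
    ∃ (W : Rep.{0} (ZMod 2) D8) (e : W ⟶ Y.obj q), Function.Bijective e.hom ∧ Gen e ∧
      ∀ p, hdim W p = cohA q p := by
  have := finite_extSymDeg q
  obtain ⟨W, e, h1, h2, h3, h4, h5⟩ := dec_extSymDeg q
  have hs : Function.Surjective (e.hom.toLinearMap : W.V →ₗ[ZMod 2] extSymDeg q) :=
    fun a => (h5 a.1 a.2).imp fun w hw => val_injective hw
  have he := le_antisymm (h2.le.trans hq) (LinearMap.finrank_le_finrank_of_surjective hs)
  exact ⟨W, e, ⟨(LinearMap.injective_iff_surjective_of_finrank_eq_finrank he).2 hs, hs⟩, h4, h3⟩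

theorem hdim_A {q : ℕ} (hq : dimA q ≤ Module.finrank (ZMod 2) (extSymDeg q)) (p : ℕ) :
    hdim (Y.obj q) p = cohA q p := by
  obtain ⟨W, e, he, -, h⟩ := exists_bijective hq
  rw [← h, hdim_congr e he]

theorem generated_Y (hq : ∀ q, dimA q ≤ Module.finrank (ZMod 2) (extSymDeg q)) :
    Y.GeneratedInDegreesLE 8 := fun F h1 h2 p q => by
  obtain ⟨W, e, he, h4, -⟩ := exists_bijective (hq q)
  refine eq_top_iff.2 fun u _ => ?_
  obtain ⟨v, rfl⟩ := (HmapEquiv e he p).surjective u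
  exact h4 F ⟨h1, h2⟩ p v

end total

/-! ### The Poincaré series -/

section series

open PowerSeries

/-- The generating series of a function. -/
def row (f : ℕ → ℕ) : PowerSeries ℤ := PowerSeries.mk fun n => (f n : ℤ)

/-- The generating series, by total degree, of a function of two variables. -/
def tot (h : ℕ → ℕ → ℕ) : PowerSeries ℤ :=
  PowerSeries.mk fun n => ∑ q ∈ Finset.range (n + 1), (h q (n - q) : ℤ)

theorem row_add (f g : ℕ → ℕ) : row (f + g) = row f + row g := by
  ext n; simp [row]

theorem tot_add (f g : ℕ → ℕ → ℕ) : tot (f + g) = tot f + tot g := by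
  ext n; simp [tot, Finset.sum_add_distrib]

/-- Separating the terms with second variable zero. -/
theorem tot_eq (h : ℕ → ℕ → ℕ) : tot h = row (h 0) + X * tot fun q => h (q + 1) := by
  ext n
  rw [map_add, tot, coeff_mk, Finset.sum_range_succ', row, coeff_mk, add_comm, Nat.sub_zero]
  congr 1
  rcases n with _ | n
  · simp
  · rw [coeff_succ_X_mul, tot, coeff_mk]
    exact Finset.sum_congr rfl fun q _ => by rw [Nat.add_sub_add_right]

theorem row_zero : row 0 = 0 := by ext n; simp [row]

theorem row_consFun (a : ℕ) (g : ℕ → ℕ) : row (consFun a g) = C (a : ℤ) + X * row g := by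
  ext n
  rcases n with _ | n
  · simp [row, consFun]
  · rw [map_add, coeff_succ_X_mul, coeff_C, if_neg n.succ_ne_zero, zero_add]
    simp [row, consFun]

theorem eq_consFun' (f : ℕ → ℕ) : f = consFun (f 0) fun p => f (p + 1) := by
  funext p; cases p <;> rfl

theorem row_one : row (fun _ => 1) * (1 - X) = 1 := by
  have h := row_consFun 1 fun _ => 1
  rw [← eq_consFun' fun _ => 1] at h
  push_cast at h
  rw [map_one] at h
  linear_combination h

theorem row_succ : row (· + 1) * (1 - X) ^ 2 = 1 := by
  have h := row_consFun 0 (· + 1)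
  have e : (consFun 0 (· + 1)) + (fun _ => 1) = (· + 1) := by
    funext p; cases p <;> rfl
  have h' := row_add (consFun 0 (· + 1)) fun _ => 1
  rw [e, h] at h'
  push_cast at h'
  rw [map_zero] at h'
  linear_combination (1 - X) * h' + row_one

theorem row_add_two : row (· + 2) = row (· + 1) + row fun _ => 1 := by
  rw [← row_add]; rfl

theorem tot_dbl (a : ℕ → ℕ → ℕ) :
    tot (dbl 0 a) = row (a 0) + X ^ 2 * tot (dbl 0 fun j => a (j + 1)) := by
  rw [tot_eq, tot_eq]
  change row (a 0) + X * (row 0 + X * tot (dbl 0 fun j => a (j + 1))) = _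
  rw [row_zero]
  ring

theorem tot_lev_succ (i : ℕ) (a : ℕ → ℕ → ℕ) : tot (lev 0 (i + 1) a) = X * tot (lev 0 i a) := by
  rw [tot_eq]
  change row 0 + X * tot (lev 0 i a) = _
  rw [row_zero, zero_add]

theorem tot_dbl_const (f : ℕ → ℕ) : tot (dbl 0 fun _ => f) * (1 - X ^ 2) = row f := by
  linear_combination tot_dbl fun _ => f

theorem dbl_add (a b : ℕ → ℕ → ℕ) : dbl 0 (a + b) = dbl 0 a + dbl 0 b := by
  funext q
  obtain ⟨j, rfl | rfl⟩ := Nat.even_or_odd' q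
  · simp only [Pi.add_apply, dbl_two_mul]
  · simp only [Pi.add_apply, dbl_two_mul_add_one, add_zero]

variable (f fM fY fX fXM fF : ℕ → ℕ)

/-- The generating series of the terms of `seqP` with index less than four. -/
def low : PowerSeries ℤ :=
  row f + X ^ 2 * row fM + X ^ 4 * (row fY + row fX) + X ^ 6 * (row fY + row fXM)

theorem tot_dbl_four (a : ℕ → ℕ → ℕ) : tot (dbl 0 a) = row (a 0) + X ^ 2 * row (a 1) +
    X ^ 4 * row (a 2) + X ^ 6 * row (a 3) + X ^ 8 * tot (dbl 0 fun j => a (j + 4)) := by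
  rw [tot_dbl, tot_dbl, tot_dbl, tot_dbl]
  ring

theorem tot_seqP : tot (dbl 0 (seqP f fM fY fX fXM fF)) * ((1 - X ^ 4) * (1 - X ^ 2)) =
    (low f fM fY fX fXM - X ^ 4 * (row f + X ^ 2 * row fM)) * (1 - X ^ 2) + X ^ 8 * row fF := by
  have h1 := tot_dbl_four (seqP f fM fY fX fXM fF)
  have h2 : tot (dbl 0 (seqP f fM fY fX fXM fF)) = row f + X ^ 2 * (row fM +
      X ^ 2 * tot (dbl 0 fun j => seqP f fM fY fX fXM fF (j + 2))) := by
    rw [tot_dbl, tot_dbl]; rfl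
  have h3 : (fun j => seqP f fM fY fX fXM fF (j + 4)) =
    (fun j => seqP f fM fY fX fXM fF (j + 2)) + fun _ => fF := rfl
  have h4 : row (seqP f fM fY fX fXM fF 2) = row fY + row fX := row_add _ _
  have h5 : row (seqP f fM fY fX fXM fF 3) = row fY + row fXM := row_add _ _
  have h6 := tot_dbl_const fF
  rw [h3, dbl_add, tot_add, h4, h5] at h1
  change _ = row f + X ^ 2 * row fM + _ + _ + _ at h1
  unfold low
  linear_combination (1 - X ^ 2) * h1 - (1 - X ^ 2) * X ^ 4 * h2 + X ^ 8 * h6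

theorem tot_seqS : tot (dbl 0 (seqS f fM fY fX fXM fF)) * (1 - X ^ 8) =
    tot (dbl 0 (seqP f fM fY fX fXM fF)) := by
  have h1 := tot_dbl_four (seqS f fM fY fX fXM fF)
  have h2 := tot_dbl_four (seqP f fM fY fX fXM fF)
  have h3 : (fun j => seqS f fM fY fX fXM fF (j + 4)) =
    seqS f fM fY fX fXM fF + fun j => seqP f fM fY fX fXM fF (j + 4) := rfl
  rw [h3, dbl_add, tot_add] at h1
  change _ = row (seqP f fM fY fX fXM fF 0) + X ^ 2 * row (seqP f fM fY fX fXM fF 1) +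
    X ^ 4 * row (seqP f fM fY fX fXM fF 2) + X ^ 6 * row (seqP f fM fY fX fXM fF 3) + _ at h1
  linear_combination h1 - h2

/-- The series of one exterior power: the recursion for `seqS` gives the denominator `1 - X ^ 8` of the
invariant `polyD`, the one for `seqP` gives `1 - X ^ 4` for `polyQ`,
    and the free blocks times powers of
`x` give `1 - X ^ 2`. -/
theorem tot_level : tot (dbl 0 (seqS f fM fY fX fXM fF)) *
      ((1 - X ^ 4) * (1 - X ^ 8) * (1 - X ^ 2)) =
    (low f fM fY fX fXM - X ^ 4 * (row f + X ^ 2 * row fM)) * (1 - X ^ 2) + X ^ 8 * row fF := by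
  rw [← tot_seqP, ← tot_seqS]
  ring

theorem one_sub_X_sq_ne_zero : (1 - X ^ 2 : PowerSeries ℤ) ≠ 0 := fun h => by
  have := congrArg (coeff 0) h
  simp at this

/-- The factor `1 - X ^ 2` in the denominators cancels. -/
theorem tot_cohA : tot cohA * ((1 - X) ^ 2 * (1 - X ^ 4) * (1 - X ^ 8)) =
    (1 + X) ^ 2 * (1 - X + X ^ 2) * (1 + 2 * X ^ 2 - X ^ 5) := by
  have e : cohA = lev 0 0 coh0 + lev 0 1 coh1 + lev 0 2 coh2 + lev 0 3 coh0 := rfl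
  rw [e, tot_add, tot_add, tot_add, tot_lev_succ, tot_lev_succ, tot_lev_succ, tot_lev_succ,
    tot_lev_succ, tot_lev_succ]
  change (tot (dbl 0 coh0) + X * tot (dbl 0 coh1) + X * (X * tot (dbl 0 coh2)) +
    X * (X * (X * tot (dbl 0 coh0)))) * _ = _
  have z : row (fun _ => 0) = 0 := row_zero
  have h0 := tot_level (· + 1) (· + 1) (fun _ => 1) (· + 1) (consFun 1 (· + 1))
    (consFun 1 fun _ => 0)
  have h1 := tot_level (· + 1) (consFun 2 (· + 2)) (consFun 2 fun _ => 1) (consFun 1 (· + 1))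
    (consFun 3 (consFun 1 (· + 1))) (consFun 3 fun _ => 0)
  have h2 := tot_level (· + 1) (consFun 2 (· + 2)) (consFun 2 fun _ => 1) (· + 2)
    (consFun 3 (· + 2)) (consFun 3 fun _ => 0)
  simp only [low, row_consFun, row_add_two, z, Nat.cast_one, Nat.cast_ofNat, map_one,
    show (C (2 : ℤ) : PowerSeries ℤ) = 2 from rfl, show (C (3 : ℤ) : PowerSeries ℤ) =
        3 from rfl] at h0 h1 h2
  have r1 := row_one
  have r2 := row_succ
  refine mul_right_cancel₀ one_sub_X_sq_ne_zero ?_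
  generalize tot (dbl 0 coh0) = t0 at *
  generalize tot (dbl 0 coh1) = t1 at *
  generalize tot (dbl 0 coh2) = t2 at *
  generalize row (fun _ => 1) = a at *
  generalize row (· + 1) = b at *
  have r3 : a = b * (1 - X) := by
    refine mul_right_cancel₀ (b := (1 - X : PowerSeries ℤ)) (fun h => ?_) ?_
    · rw [h, mul_zero] at r1; exact zero_ne_one r1
    · linear_combination r1 - r2
  subst r3
  linear_combination (1 - X) ^ 2 * ((1 + X ^ 3) * h0 + X * h1 + X ^ 2 * h2) +
    -- The coefficient of `(1 - X) ^ 2 * row (· + 1) = 1`.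
    (X^12 - 2*X^11 + 2*X^10 + 2*X^9 - 5*X^8 - X^6 - X^5 + X^4 + X^2 + X + 1) * r2

end series

/-! ### The mod 2 cohomology ring of a group -/

section lifts

variable {R V A : Type} [CommRing R] [AddCommGroup V] [Module R V] [Ring A] [Algebra R A]

/-- The subalgebra generated by commuting elements is commutative. -/
abbrev adjoinCommRing (f : V →ₗ[R] A) (h : ∀ v w, f v * f w = f w * f v) :
    CommRing (Algebra.adjoin R (Set.range f)) where
  mul_comm := (Algebra.isMulCommutative_adjoin R (s := Set.range f) (by
    rintro _ ⟨v, rfl⟩ _ ⟨w, rfl⟩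
    exact h v w)).is_comm.comm

/-- The universal property of the symmetric algebra, for maps to an algebra which need not be
commutative but in which the values commute with each other. -/
def symLift (f : V →ₗ[R] A) (h : ∀ v w, f v * f w = f w * f v) : SymmetricAlgebra R V →ₐ[R] A :=
  letI := adjoinCommRing f h
  (Algebra.adjoin R (Set.range f)).val.comp (SymmetricAlgebra.lift
    (f.codRestrict (Subalgebra.toSubmodule (Algebra.adjoin R (Set.range f)))
      fun v => Algebra.subset_adjoin ⟨v, rfl⟩))

theorem symLift_ι (f : V →ₗ[R] A) (h : ∀ v w, f v * f w = f w * f v) (v : V) :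
    symLift f h (SymmetricAlgebra.ι R V v) = f v := by
  let := adjoinCommRing f h
  exact congrArg Subtype.val (SymmetricAlgebra.lift_ι_apply _ v)

/-- The universal property of `Λ(M) ⊗ S(M)`. -/
def extSymLift {A : Type} [Ring A] [Algebra (ZMod 2) A] (f g : M →ₗ[ZMod 2] A)
    (hf : ∀ v, f v * f v = 0)
    (hg : ∀ v w, g v * g w = g w * g v) (hfg : ∀ v w, f v * g w = g w * f v) :
    ExtSym →ₐ[ZMod 2] A :=
  Algebra.TensorProduct.lift (ExteriorAlgebra.lift (ZMod 2) ⟨f, hf⟩) (symLift g hg) fun a b => by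
    have h0 : ∀ v b, Commute (f v) (symLift g hg b) := fun v b => by
      induction b using SymmetricAlgebra.induction with
      | algebraMap r => rw [AlgHom.commutes]; exact (Algebra.commutes r _).symm
      | ι w => rw [symLift_ι]; exact hfg v w
      | mul a b ha hb => rw [map_mul]; exact ha.mul_right hb
      | add a b ha hb => rw [map_add]; exact ha.add_right hb
    induction a using ExteriorAlgebra.induction with
    | algebraMap r => rw [AlgHom.commutes]; exact Algebra.commutes r _
    | ι v => rw [ExteriorAlgebra.lift_ι_apply]; exact h0 v b
    | mul a a' ha hb => rw [map_mul]; exact ha.mul_left hb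
    | add a a' ha hb => rw [map_add]; exact ha.add_left hb

variable {A : Type} [Ring A] [Algebra (ZMod 2) A] {f g : M →ₗ[ZMod 2] A}
    {hf : ∀ v, f v * f v = 0} {hg : ∀ v w, g v * g w = g w * g v}
    {hfg : ∀ v w, f v * g w = g w * f v}

theorem extSymLift_ext (v : M) : extSymLift f g hf hg hfg (extι v) = f v := by
  simp [extSymLift, extι]

theorem extSymLift_sym (v : M) : extSymLift f g hf hg hfg (symι v) = g v := by
  simp [extSymLift, symι, symLift_ι]

end lifts

section ring

variable (G : Type) [Group G]

/-- The cohomology of `G` with coefficients `𝔽₂`. -/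
abbrev HG (n : ℕ) : Type := groupCohomology (triv (ZMod 2) G) n

variable {G}

/-- The cup product with coefficients `𝔽₂`. -/
abbrev cupG {p q : ℕ} (x : HG G p) (y : HG G q) : HG G (p + q) :=
  cup (trivialPairing (ZMod 2) G) p q x y

theorem cupG_eq_pair1 {p q : ℕ} (x : HG G p) (y : HG G q) :
    cupG x y = cup (pair1 (triv (ZMod 2) G)) p q x y := by
  have := Hmap_cup (trivialPairing (ZMod 2) G) (pair1 (triv (ZMod 2) G)) (𝟙 _) (𝟙 _) (𝟙 _)
    (fun a b => mul_comm (a : ZMod 2) b) x y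
  rwa [Hmap_id_apply, Hmap_id_apply, Hmap_id_apply] at this

theorem one_cupG {q : ℕ} (y : HG G q) :
    (⟨0 + q, cupG (oneCls (ZMod 2) G) y⟩ : Σ n, HG G n) = ⟨q, y⟩ := by
  refine (cup_zero_left (trivialPairing (ZMod 2) G) (𝟙 _) (fun _ => (1 : ZMod 2)) _
    (fun b => (one_mul (b : ZMod 2)).symm) y).trans ?_
  rw [Hmap_id_apply]

instance : GradedMonoid.GMul (HG G) where
  mul x y := cupG x y

instance : GradedMonoid.GOne (HG G) where
  one := oneCls (ZMod 2) G

instance : GradedMonoid.GMonoid (HG G) where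
  one_mul a := one_cupG a.2
  mul_one a := Sigma.ext rfl (heq_of_eq ((cupG_eq_pair1 _ _).trans (cup_one _ a.2)))
  mul_assoc a b c := cup_assoc _ _ _ _ (fun x y z => mul_assoc (x : ZMod 2) y z) a.2 b.2 c.2

instance : DirectSum.GRing (HG G) where
  mul_zero x := map_zero (cup (trivialPairing (ZMod 2) G) _ _ x)
  zero_mul x := by
    change cupG 0 x = 0
    rw [cupG, map_zero, LinearMap.zero_apply]
  mul_add x y z := map_add (cup (trivialPairing (ZMod 2) G) _ _ x) y z
  add_mul x y z := by
    change cupG (x + y) z = cupG x z + cupG y z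
    rw [cupG, map_add, LinearMap.add_apply]
  natCast n := n • oneCls (ZMod 2) G
  natCast_zero := zero_smul _ _
  natCast_succ n := add_smul n 1 _ |>.trans (congrArg _ (one_smul _ _))
  intCast n := n • oneCls (ZMod 2) G
  intCast_ofNat n := natCast_zsmul _ _
  intCast_negSucc_ofNat n := negSucc_zsmul _ _

open DirectSum

/-- The cohomology ring of `G` with coefficients `𝔽₂`. -/
abbrev HRing (G : Type) [Group G] : Type := ⨁ n, HG G n

instance : Algebra (ZMod 2) (HRing G) :=
  Algebra.ofModule
    (fun r x y => by
      obtain rfl | rfl : r = 0 ∨ r = 1 := by revert r; decide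
      · rw [zero_smul, zero_smul, zero_mul]
      · rw [one_smul, one_smul])
    (fun r x y => by
      obtain rfl | rfl : r = 0 ∨ r = 1 := by revert r; decide
      · rw [zero_smul, zero_smul, mul_zero]
      · rw [one_smul, one_smul])

/-- A class as an element of the cohomology ring. -/
abbrev inH (n : ℕ) : HG G n →ₗ[ZMod 2] HRing G := DirectSum.lof (ZMod 2) ℕ (HG G) n

theorem inH_mul {p q : ℕ} (x : HG G p) (y : HG G q) : inH p x * inH q y = inH (p + q) (cupG x y) :=
  DirectSum.of_mul_of x y

theorem inH_injective (n : ℕ) : Function.Injective (inH (G := G) n) := DirectSum.of_injective n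

theorem one_eq_inH : (1 : HRing G) = inH 0 (oneCls (ZMod 2) G) := rfl

theorem pullback_cls (f : G →* G) {n : ℕ} {c : (Fin n → G) → ZMod 2}
    (hc : dd (triv (ZMod 2) G) n c = 0) : pullback (ZMod 2) f n (cls c hc) =
      cls (A := triv (ZMod 2) G) (fun x => c (f ∘ x))
        (dd_map f (A := triv (ZMod 2) G) (𝟙 (triv (ZMod 2) G)) hc) :=
  map_cls f (A := triv (ZMod 2) G) (𝟙 (triv (ZMod 2) G)) hc

/-- The map of cohomology rings induced by an endomorphism of the group. -/
def pullH (f : G →* G) : HRing G →ₐ[ZMod 2] HRing G :=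
  AlgHom.ofLinearMap (DirectSum.toModule (ZMod 2) ℕ _ fun n => inH n ∘ₗ pullback (ZMod 2) f n)
    (by
      rw [one_eq_inH, DirectSum.toModule_lof]
      exact congrArg (inH 0) (pullback_cls f _))
    (fun x y => by
      induction x using DirectSum.induction_on with
      | zero => simp
      | add x x' h h' => rw [add_mul, map_add, map_add, h, h', add_mul]
      | of i x =>
        induction y using DirectSum.induction_on with
        | zero => simp
        | add y y' h h' => rw [mul_add, map_add, map_add, h, h', mul_add]
        | of j y =>
          change DirectSum.toModule (ZMod 2) ℕ _ _ (inH i x * inH j y) =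
            DirectSum.toModule (ZMod 2) ℕ _ _ (inH i x) *
                DirectSum.toModule (ZMod 2) ℕ _ _ (inH j y)
          rw [inH_mul, DirectSum.toModule_lof, DirectSum.toModule_lof, DirectSum.toModule_lof]
          simp only [LinearMap.comp_apply]
          rw [inH_mul]
          exact congrArg (inH (i + j)) (CupProduct.map_cup f (trivialPairing (ZMod 2) G)
            (trivialPairing (ZMod 2) G) (𝟙 _) (𝟙 _) (𝟙 _) (fun _ _ => rfl) i j x y))

theorem pullH_inH (f : G →* G) {n : ℕ} (x : HG G n) :
    pullH f (inH n x) = inH n (pullback (ZMod 2) f n x) :=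
  DirectSum.toModule_lof (ZMod 2) (M := HG G) (φ := fun n => inH n ∘ₗ pullback (ZMod 2) f n) n x

end ring

/-! ### Commutativity in low degrees -/

section lowDegrees

variable {G : Type} [Group G]

theorem triv_dd_one (F : G → ZMod 2) (x : ℕ → G) :
    ev (dd (triv (ZMod 2) G) 1 fun x => F (x 0)) x = (F (x 1) + F (x 0 * x 1) +
        F (x 0) : ZMod 2) := by
  rw [ev_dd, Finset.sum_range_succ, Finset.sum_range_one, ← add_assoc]
  rfl

theorem triv_dd_two (F : G → G → ZMod 2) (x : ℕ → G) :
    ev (dd (triv (ZMod 2) G) 2 fun x => F (x 0) (x 1)) x =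
      (F (x 1) (x 2) + F (x 0 * x 1) (x 2) + F (x 0) (x 1 * x 2) + F (x 0) (x 1) : ZMod 2) := by
  rw [ev_dd, Finset.sum_range_succ, Finset.sum_range_succ, Finset.sum_range_one, ← add_assoc,
    ← add_assoc]
  rfl

theorem triv_dd_three (F : G → G → G → ZMod 2) (x : ℕ → G) :
    ev (dd (triv (ZMod 2) G) 3 fun x => F (x 0) (x 1) (x 2)) x =
      (F (x 1) (x 2) (x 3) + F (x 0 * x 1) (x 2) (x 3) + F (x 0) (x 1 * x 2) (x 3) +
        F (x 0) (x 1) (x 2 * x 3) + F (x 0) (x 1) (x 2) : ZMod 2) := by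
  rw [ev_dd, Finset.sum_range_succ, Finset.sum_range_succ, Finset.sum_range_succ,
    Finset.sum_range_one, ← add_assoc, ← add_assoc, ← add_assoc]
  rfl

omit [Group G] in
/-- A cochain of degree one as a function on the group. -/
theorem cochain_one_eq (f : (Fin 1 → G) → ZMod 2) : f = fun x => (fun a => f ![a]) (x 0) := by
  funext x
  exact congrArg f (funext fun i => by fin_cases i; rfl)

omit [Group G] in
/-- A cochain of degree two as a function of two variables. -/
theorem cochain_two_eq (f : (Fin 2 → G) → ZMod 2) :
    f = fun x => (fun a b => f ![a, b]) (x 0) (x 1) := by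
  funext x
  exact congrArg f (funext fun i => by fin_cases i <;> rfl)

theorem cls_one_surjective (u : HG G 1) : ∃ (F : G → ZMod 2)
    (hf : dd (triv (ZMod 2) G) 1 (fun x => F (x 0)) = 0),
    u = cls (A := triv (ZMod 2) G) (fun x => F (x 0)) hf := by
  obtain ⟨f, hf, rfl⟩ := cls_surjective u
  have h := cochain_one_eq f
  exact ⟨fun a => f ![a], h ▸ hf, cls_congr hf h⟩

theorem cls_two_surjective (u : HG G 2) : ∃ (F : G → G → ZMod 2)
    (hf : dd (triv (ZMod 2) G) 2 (fun x => F (x 0) (x 1)) = 0),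
    u = cls (A := triv (ZMod 2) G) (fun x => F (x 0) (x 1)) hf := by
  obtain ⟨f, hf, rfl⟩ := cls_surjective u
  have h := cochain_two_eq f
  exact ⟨fun a b => f ![a, b], h ▸ hf, cls_congr hf h⟩

theorem triv_cocycle_one {F : G → ZMod 2} (hf : dd (triv (ZMod 2) G) 1 (fun x => F (x 0)) = 0)
    (a b : G) : F b + F (a * b) + F a = 0 := by
  have := triv_dd_one F fun i => if i = 0 then a else b
  rw [hf] at this
  exact this.symm

theorem triv_cocycle_two {F : G → G → ZMod 2}
    (hf : dd (triv (ZMod 2) G) 2 (fun x => F (x 0) (x 1)) = 0) (a b c : G) :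
    F b c + F (a * b) c + F a (b * c) + F a b = 0 := by
  have := triv_dd_two F fun i => if i = 0 then a else if i = 1 then b else c
  rw [hf] at this
  exact this.symm

/-- Classes of degrees one and two commute: the difference of the products is the coboundary of
their `∪₁`-product. -/
theorem inH_one_two_comm (a : HG G 1) (b : HG G 2) : inH 1 a * inH 2 b = inH 2 b * inH 1 a := by
  rw [inH_mul, inH_mul]
  refine congrArg (inH 3) ?_
  obtain ⟨F, hF, rfl⟩ := cls_one_surjective a
  obtain ⟨B, hB, rfl⟩ := cls_two_surjective b
  rw [cupG, cupG, cup_cls, cup_cls]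
  refine cls_eq_of_sub (A := triv (ZMod 2) G) (n := 2) _ _ (fun x => F (x 0 * x 1) * B (x 0) (x 1))
    (ext_ev fun x => ?_)
  have e := triv_dd_two (fun g h => F (g * h) * B g h) x
  have h0 := triv_cocycle_one hF (x 0) (x 1)
  have h1 := triv_cocycle_one hF (x 1) (x 2)
  have h2 := triv_cocycle_one hF (x 0) (x 1 * x 2)
  have h3 := triv_cocycle_two hB (x 0) (x 1) (x 2)
  change F (x 0) * B (x 1) (x 2) = B (x 0) (x 1) * F (x 2) + ev (dd (triv (ZMod 2) G) 2 _) x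
  rw [e, mul_assoc (x 0)]
  generalize F (x 0 * (x 1 * x 2)) = t at *
  generalize F (x 0 * x 1) = s at *
  generalize F (x 1 * x 2) = s' at *
  generalize B (x 0 * x 1) (x 2) = b1 at *
  generalize B (x 0) (x 1 * x 2) = b2 at *
  generalize B (x 0) (x 1) = b3 at *
  generalize B (x 1) (x 2) = b4 at *
  have two : (2 : ZMod 2) = 0 := by decide
  linear_combination b4 * h2 - t * h3 + b3 * (h0 + h1 + h2) -
    (b4 * s' + b3 * (F (x 2) + s + s' + F (x 0) + F (x 1))) * two

/-- Classes of degree two commute: the difference of the products is the coboundary of their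
`∪₁`-product. -/
theorem inH_two_comm (a b : HG G 2) : inH 2 a * inH 2 b = inH 2 b * inH 2 a := by
  rw [inH_mul, inH_mul]
  refine congrArg (inH 4) ?_
  obtain ⟨B, hB, rfl⟩ := cls_two_surjective a
  obtain ⟨C, hC, rfl⟩ := cls_two_surjective b
  rw [cupG, cupG, cup_cls, cup_cls]
  refine cls_eq_of_sub (A := triv (ZMod 2) G) (n := 3) _ _
    (fun x => B (x 0 * x 1) (x 2) * C (x 0) (x 1) + B (x 0) (x 1 * x 2) * C (x 1) (x 2))
    (ext_ev fun x => ?_)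
  have e := triv_dd_three (fun g h k => B (g * h) k * C g h + B g (h * k) * C h k) x
  have k1 := triv_cocycle_two hC (x 0) (x 1) (x 2)
  have k2 := triv_cocycle_two hC (x 1) (x 2) (x 3)
  have h1 := triv_cocycle_two hB (x 0) (x 1 * x 2) (x 3)
  have h2 := triv_cocycle_two hB (x 0) (x 1) (x 2 * x 3)
  have h3 := triv_cocycle_two hB (x 0 * x 1) (x 2) (x 3)
  change B (x 0) (x 1) * C (x 2) (x 3) =
    C (x 0) (x 1) * B (x 2) (x 3) + ev (dd (triv (ZMod 2) G) 3 _) x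
  rw [e]
  simp only [mul_assoc] at h1 h2 h3 k1 k2 ⊢
  have two : (2 : ZMod 2) = 0 := by decide
  linear_combination -(B (x 0 * (x 1 * x 2)) (x 3) * k1 + B (x 0) (x 1 * (x 2 * x 3)) * k2 +
    C (x 1) (x 2) * h1 + C (x 2) (x 3) * h2 + C (x 0) (x 1) * h3) +
    (B (x 0) (x 1) * C (x 2) (x 3) + B (x 0 * (x 1 * x 2)) (x 3) * (C (x 1) (x 2) + C (x 0) (x 1)) +
      B (x 0) (x 1 * (x 2 * x 3)) * (C (x 2) (x 3) + C (x 1) (x 2))) * two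

end lowDegrees

/-! ### Characters of order four -/

section characters

/-- The reduction modulo two. -/
def par (u : ZMod 4) : ZMod 2 := u.val

/-- The carry in the addition of digits modulo four. -/
def carry (u v : ZMod 4) : ZMod 2 := ((u.val + v.val) / 4 : ℕ)

variable {G : Type} [Group G]

/-- A character of order four, written additively. -/
abbrev toZ (χ : G →* Multiplicative (ZMod 4)) (g : G) : ZMod 4 := (χ g).toAdd

theorem toZ_mul (χ : G →* Multiplicative (ZMod 4)) (g h : G) : toZ χ (g * h) = toZ χ g + toZ χ h :=
  congrArg Multiplicative.toAdd (map_mul χ g h)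

theorem degOne_cocycle (χ : G →* Multiplicative (ZMod 4)) :
    dd (triv (ZMod 2) G) 1 (fun x => par (toZ χ (x 0))) = 0 := by
  refine ext_ev fun x => (triv_dd_one (fun g => par (toZ χ g)) x).trans ?_
  rw [toZ_mul]
  have key : ∀ u v : ZMod 4, par v + par (u + v) + par u = 0 := by decide
  exact key _ _

theorem degTwo_cocycle (χ : G →* Multiplicative (ZMod 4)) :
    dd (triv (ZMod 2) G) 2 (fun x => carry (toZ χ (x 0)) (toZ χ (x 1))) = 0 := by
  refine ext_ev fun x => (triv_dd_two (fun g h => carry (toZ χ g) (toZ χ h)) x).trans ?_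
  rw [toZ_mul, toZ_mul]
  have key : ∀ u v w : ZMod 4,
    carry v w + carry (u + v) w + carry u (v + w) + carry u v = 0 := by decide
  exact key _ _ _

/-- The class in `H¹` of the reduction modulo two of a character of order four. -/
def degOne (χ : G →* Multiplicative (ZMod 4)) : HG G 1 :=
  cls (A := triv (ZMod 2) G) (fun x => par (toZ χ (x 0))) (degOne_cocycle χ)

/-- The class in `H²` pulled back along a character of order four from the extension
`0 → 𝔽₂ → ℤ/8 → ℤ/4 → 0`. -/
def degTwo (χ : G →* Multiplicative (ZMod 4)) : HG G 2 :=
  cls (A := triv (ZMod 2) G) (fun x => carry (toZ χ (x 0)) (toZ χ (x 1))) (degTwo_cocycle χ)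

theorem degOne_mul (χ ψ : G →* Multiplicative (ZMod 4)) :
    degOne (χ * ψ) = degOne χ + degOne ψ := by
  have key : ∀ u v : ZMod 4, par (u + v) = par u + par v := by decide
  have e : (fun x : Fin 1 → G => par (toZ (χ * ψ) (x 0))) =
      (fun x => par (toZ χ (x 0))) + fun x => par (toZ ψ (x 0)) := funext fun x => key _ _
  unfold degOne
  rw [← cls_add (A := triv (ZMod 2) G) (degOne_cocycle χ) (degOne_cocycle ψ)
    (e ▸ degOne_cocycle (χ * ψ))]
  exact cls_congr (A := triv (ZMod 2) G) _ e

theorem degTwo_mul (χ ψ : G →* Multiplicative (ZMod 4)) :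
    degTwo (χ * ψ) = degTwo χ + degTwo ψ := by
  unfold degTwo
  have h : dd (triv (ZMod 2) G) 2 ((fun x => carry (toZ χ (x 0)) (toZ χ (x 1))) +
      fun x => carry (toZ ψ (x 0)) (toZ ψ (x 1))) = 0 :=
    (dd_add _ _).trans (by rw [degTwo_cocycle χ, degTwo_cocycle ψ, add_zero])
  rw [← cls_add (A := triv (ZMod 2) G) (degTwo_cocycle χ) (degTwo_cocycle ψ) h]
  refine cls_eq_of_sub (A := triv (ZMod 2) G) _ _ (fun x => carry (toZ χ (x 0)) (toZ ψ (x 0)))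
    (ext_ev fun x => ?_)
  have e := triv_dd_one (fun g => carry (toZ χ g) (toZ ψ g)) x
  change carry (toZ χ (x 0) + toZ ψ (x 0)) (toZ χ (x 1) + toZ ψ (x 1)) =
    carry (toZ χ (x 0)) (toZ χ (x 1)) + carry (toZ ψ (x 0)) (toZ ψ (x 1)) +
      ev (dd (triv (ZMod 2) G) 1 _) x
  rw [e, toZ_mul, toZ_mul]
  -- The cochain is the carry in the addition of the values of the two characters.
  have key : ∀ u v u' v' : ZMod 4, carry (u + u') (v + v') = carry u v + carry u' v' +
    (carry v v' + carry (u + v) (u' + v') + carry u u') := by decide +kernel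
  exact key _ _ _ _

/-- The square of a class of degree one is its Bockstein, which vanishes on classes that lift to
`ℤ/4`; the cochain is the second binary digit. -/
theorem degOne_mul_self (χ : G →* Multiplicative (ZMod 4)) :
    inH 1 (degOne χ) * inH 1 (degOne χ) = 0 := by
  rw [inH_mul, ← map_zero (inH 2)]
  refine congrArg (inH 2) ?_
  unfold degOne
  rw [cupG, cup_cls]
  refine (cls_eq_zero_succ (A := triv (ZMod 2) G) (n := 1) _).2
    ⟨fun x => if toZ χ (x 0) = 0 ∨ toZ χ (x 0) = 1 then 0 else 1, ext_ev fun x => ?_⟩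
  have e := triv_dd_one (fun g => if toZ χ g = 0 ∨ toZ χ g = 1 then 0 else 1) x
  refine Eq.trans ?_ e.symm
  change par (toZ χ (x 0)) * par (toZ χ (x 1)) = _
  simp only [toZ_mul]
  have key : ∀ u v : ZMod 4, par u * par v = (if v = 0 ∨ v = 1 then 0 else 1) +
    (if u + v = 0 ∨ u + v = 1 then 0 else 1) + (if u = 0 ∨ u = 1 then 0 else 1) := by decide
  exact key _ _

theorem pullback_degOne (f : G →* G) (χ : G →* Multiplicative (ZMod 4)) :
    pullback (ZMod 2) f 1 (degOne χ) = degOne (χ.comp f) := pullback_cls f _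

theorem pullback_degTwo (f : G →* G) (χ : G →* Multiplicative (ZMod 4)) :
    pullback (ZMod 2) f 2 (degTwo χ) = degTwo (χ.comp f) := pullback_cls f _

end characters

/-! ### The Gysin sequence of a character of order four -/

section cyclic

/-- The matrices of the action of `ℤ/4` on the sum zero part of its regular module, with the basis
`eᵢ + eᵢ₊₁`, `0 ≤ i ≤ 2`. -/
def sumZeroFun (u : ZMod 4) : Matrix (Fin 3) (Fin 3) (ZMod 2) := !![0, 0, 1; 1, 0, 1; 0, 1,
    1] ^ u.val

variable {G : Type} [Group G]

/-- The sum zero part of the module of functions on the values of a character of order four. -/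
def sumZeroMat (χ : G →* Multiplicative (ZMod 4)) : G →* Matrix (Fin 3) (Fin 3) (ZMod 2) where
  toFun g := sumZeroFun (toZ χ g)
  map_one' := by
    have : toZ χ 1 = 0 := congrArg Multiplicative.toAdd (map_one χ)
    rw [this]
    decide
  map_mul' g h := by
    rw [toZ_mul]
    have key : ∀ u v : ZMod 4, sumZeroFun (u + v) = sumZeroFun u * sumZeroFun v := by decide +kernel
    exact key _ _

/-- The set of values of a character of order four, on which the group acts by translations. -/
def Ω4 (_ : G →* Multiplicative (ZMod 4)) : Type := ZMod 4

variable (χ : G →* Multiplicative (ZMod 4))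

instance : Fintype (Ω4 χ) := inferInstanceAs (Fintype (ZMod 4))
instance : DecidableEq (Ω4 χ) := inferInstanceAs (DecidableEq (ZMod 4))

instance : MulAction G (Ω4 χ) where
  smul g u := toZ χ g + (show ZMod 4 from u)
  one_smul u := by
    have : toZ χ 1 = 0 := congrArg Multiplicative.toAdd (map_one χ)
    change toZ χ 1 + (show ZMod 4 from u) = u
    rw [this, zero_add]
  mul_smul g h u := by
    change toZ χ (g * h) + (show ZMod 4 from u) = toZ χ g + (toZ χ h + show ZMod 4 from u)
    rw [toZ_mul, add_assoc]

/-- The translation matrices. -/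
def transMat (u : ZMod 4) : Matrix (ZMod 4) (ZMod 4) (ZMod 2) :=
  Matrix.of fun i j => if i = u + j then 1 else 0

/-- The inclusion of the sum zero part. -/
def sumZeroP : Matrix (ZMod 4) (Fin 3) (ZMod 2) :=
  Matrix.of fun i j => if i.val = j.val ∨ i.val = j.val + 1 then 1 else 0

/-- A retraction onto the sum zero part. -/
def sumZeroP' : Matrix (Fin 3) (ZMod 4) (ZMod 2) :=
  Matrix.of fun i j => if j.val ≤ i.val then 1 else 0

/-- The map `f ↦ f - s f` to the sum zero part, where `s` is the shift. -/
def sumZeroQ : Matrix (Fin 3) (ZMod 4) (ZMod 2) :=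
  Matrix.of fun i j => if j.val = i.val ∨ j = 3 then 1 else 0

/-- A section of `f ↦ f - s f`. -/
def sumZeroQ' : Matrix (ZMod 4) (Fin 3) (ZMod 2) :=
  Matrix.of fun i j => if i.val = j.val then 1 else 0

/-- The augmentation. -/
def sumRow : Matrix Unit (ZMod 4) (ZMod 2) := Matrix.of fun _ _ => 1

/-- A section of the augmentation. -/
def lastCol : Matrix (ZMod 4) Unit (ZMod 2) := Matrix.of fun i _ => if i = 3 then 1 else 0

/-- The inclusion of the constants. -/
def constCol : Matrix (ZMod 4) Unit (ZMod 2) := Matrix.of fun _ _ => 1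

/-- A retraction onto the constants. -/
def lastRow : Matrix Unit (ZMod 4) (ZMod 2) := Matrix.of fun _ j => if j = 3 then 1 else 0

/-- The augmentation of the functions on the values of a character. -/
def augSES : MatSES (sumZeroMat χ) (permMat (ZMod 2) (Ω4 χ)) (oneMat (ZMod 2) G) where
  P := sumZeroP
  Q := sumRow
  P' := sumZeroP'
  Q' := lastCol
  hP g := by
    have key : ∀ u : ZMod 4, sumZeroP * sumZeroFun u = transMat u * sumZeroP := by decide +kernel
    exact key (toZ χ g)
  hQ g := by
    have key : ∀ u : ZMod 4, sumRow * transMat u = (1 : Matrix Unit Unit (ZMod 2)) * sumRow :=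
        by decide +kernel
    exact key (toZ χ g)
  left_inv := (by decide +kernel : sumZeroP' * sumZeroP = 1)
  right_inv := (by decide +kernel : sumRow * lastCol = 1)
  comp := (by decide +kernel : sumRow * sumZeroP = 0)
  split := (by decide +kernel : sumZeroP * sumZeroP' + lastCol * sumRow = 1)

/-- The inclusion of the constants in the functions on the values of a character. -/
def coaugSES : MatSES (oneMat (ZMod 2) G) (permMat (ZMod 2) (Ω4 χ)) (sumZeroMat χ) where
  P := constCol
  Q := sumZeroQ
  P' := lastRow
  Q' := sumZeroQ'
  hP g := by
    have key : ∀ u : ZMod 4, constCol * (1 : Matrix Unit Unit (ZMod 2)) = transMat u * constCol :=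
        by decide +kernel
    exact key (toZ χ g)
  hQ g := by
    have key : ∀ u : ZMod 4, sumZeroQ * transMat u = sumZeroFun u * sumZeroQ := by decide +kernel
    exact key (toZ χ g)
  left_inv := (by decide +kernel : lastRow * constCol = 1)
  right_inv := (by decide +kernel : sumZeroQ * sumZeroQ' = 1)
  comp := (by decide +kernel : sumZeroQ * constCol = 0)
  split := (by decide +kernel : constCol * lastRow + sumZeroQ' * sumZeroQ = 1)

/-- The coordinates of the constant function with value one, which has sum zero. -/
def constVec : Fin 3 → ZMod 2 := fun i => if i = 1 then 0 else 1

theorem constVec_invariant (g : G) :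
    (T (sumZeroMat χ) (triv (ZMod 2) G)).ρ g constVec = constVec := by
  have key : ∀ u : ZMod 4, (fun i : Fin 3 => ∑ j, sumZeroFun u i j • constVec j) = constVec := by
    decide +kernel
  exact key (toZ χ g)

/-- The class in `H⁰` of the constant function with value one. -/
def constCls : groupCohomology (T (sumZeroMat χ) (triv (ZMod 2) G)) 0 :=
  cls₀ (A := T (sumZeroMat χ) (triv (ZMod 2) G)) constVec (constVec_invariant χ)

theorem coaug_δ_constCls :
    ((coaugSES χ).coaug (triv (ZMod 2) G)).δ 0 (constCls χ) = degOne χ := by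
  unfold constCls cls₀ degOne
  let b₀ : ZMod 4 → ZMod 2 := fun j => if j = 0 ∨ j = 2 then 1 else 0
  let b : (Fin 0 → G) → Ω4 χ → ZMod 2 := fun _ => b₀
  refine SES.δ_cls _ _ b (fun x => ?_) _ (fun x => ?_) _
  · have key : (fun i : Fin 3 => ∑ j, sumZeroQ i j • if j = 0 ∨ j = 2 then (1 : ZMod 2) else 0) =
      constVec := by decide +kernel
    exact key
  · refine congr_fun (ext_ev (f := fun x => ((coaugSES χ).coaug (triv (ZMod 2) G)).i.hom
      (par (toZ χ (x 0)))) (g := dd (T (permMat (ZMod 2) (Ω4 χ)) (triv (ZMod 2) G)) 0 b)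
      fun x => ?_) x
    rw [dd_zero_apply]
    refine ((coaugSES χ).coaug_i_apply _ _).trans (funext fun j => ?_)
    have key : ∀ u j : ZMod 4, (1 : ZMod 2) * par u = (∑ l, transMat u j l •
      if l = 0 ∨ l = 2 then (1 : ZMod 2) else 0) - if j = 0 ∨ j = 2 then 1 else 0 := by
      decide +kernel
    exact key (toZ χ (x 0)) j

/-- The coboundary of the function with value one at zero, in the coordinates of the sum zero part. -/
theorem θ_cocycle : dd (T (sumZeroMat χ) (triv (ZMod 2) G)) 1
    (fun x (i : Fin 3) => if i.val < (toZ χ (x 0)).val then (1 : ZMod 2) else 0) = 0 := by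
  refine ext_ev fun x => ?_
  rw [ev_dd, Finset.sum_range_succ, Finset.sum_range_one]
  have key : ∀ u v : ZMod 4, ((fun i : Fin 3 => ∑ j : Fin 3, sumZeroFun u i j •
    if j.val < v.val then (1 : ZMod 2) else 0) +
      ((fun i => if i.val < (u + v).val then 1 else 0) + fun i => if i.val < u.val then 1 else 0)) =
      0 := by decide +kernel
  have h := key (toZ χ (x 0)) (toZ χ (x 1))
  rw [← toZ_mul] at h
  exact h

theorem θ_eq_cls : (augSES χ).θ = cls _ (θ_cocycle χ) := by
  unfold MatSES.θ oneCls cls₀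
  let b₀ : ZMod 4 → ZMod 2 := fun j => if j = 0 then 1 else 0
  let b : (Fin 0 → G) → Ω4 χ → ZMod 2 := fun _ => b₀
  refine SES.δ_cls _ _ b (fun x => ?_) _ (fun x => ?_) _
  · have key : ∑ j, sumRow () j • (if j = 0 then (1 : ZMod 2) else 0) = 1 := by decide +kernel
    exact key
  · refine congr_fun (ext_ev (f := fun x => ((augSES χ).aug (triv (ZMod 2) G)).i.hom
      (fun i : Fin 3 => if i.val < (toZ χ (x 0)).val then (1 : ZMod 2) else 0))
      (g := dd (T (permMat (ZMod 2) (Ω4 χ)) (triv (ZMod 2) G)) 0 b)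
      fun x => ?_) x
    rw [dd_zero_apply]
    refine funext fun j => ?_
    have key : ∀ u j : ZMod 4, (∑ l : Fin 3,
        sumZeroP j l • if l.val < u.val then (1 : ZMod 2) else 0) =
      (∑ l, transMat u j l • if l = 0 then (1 : ZMod 2) else 0) - if j = 0 then 1 else 0 := by
      decide +kernel
    exact key (toZ χ (x 0)) j

/-- The class in `H²` of a character of order four is the Yoneda product of the inclusion of the
constants with the augmentation. -/
theorem coaug_δ_θ : ((coaugSES χ).coaug (triv (ZMod 2) G)).δ 1 (augSES χ).θ = degTwo χ := by
  rw [θ_eq_cls]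
  unfold degTwo
  let b : (Fin 1 → G) → Ω4 χ → ZMod 2 :=
    fun x j => if ZMod.val (n := 4) j < (toZ χ (x 0)).val then 1 else 0
  refine SES.δ_cls _ _ b (fun x => ?_) _ (fun x => ?_) _
  · have key : ∀ u : ZMod 4, (fun i : Fin 3 => ∑ j : ZMod 4, sumZeroQ i j •
      if j.val < u.val then (1 : ZMod 2) else 0) = fun i => if i.val < u.val then 1 else 0 := by
      decide +kernel
    exact key (toZ χ (x 0))
  · refine congr_fun (ext_ev (f := fun x => ((coaugSES χ).coaug (triv (ZMod 2) G)).i.hom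
      (carry (toZ χ (x 0)) (toZ χ (x 1))))
      (g := dd (T (permMat (ZMod 2) (Ω4 χ)) (triv (ZMod 2) G)) 1 b) fun x => ?_) x
    rw [ev_dd, Finset.sum_range_succ, Finset.sum_range_one]
    refine ((coaugSES χ).coaug_i_apply _ _).trans (funext fun j => ?_)
    have key : ∀ u v j : ZMod 4, (1 : ZMod 2) * carry u v =
      (∑ l : ZMod 4, transMat u j l • if l.val < v.val then (1 : ZMod 2) else 0) +
        ((if j.val < (u + v).val then 1 else 0) + if j.val < u.val then 1 else 0) := by
      decide +kernel
    have h := key (toZ χ (x 0)) (toZ χ (x 1)) j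
    rw [← toZ_mul] at h
    exact h

end cyclic

section gysin

variable {G : Type} [Group G] (χ : G →* Multiplicative (ZMod 4)) {W : Rep.{0} (ZMod 2) G}
  (i : triv (ZMod 2) G ⟶ W) (F : ∀ p, Submodule (ZMod 2) (HG G p))

/-- The inclusion of the constants factors through the sum zero part, because four is even. -/
theorem aug_i_constCls {p : ℕ} (w : groupCohomology W p) :
    Hmap ((augSES χ).aug W).i p (cup (pairT (sumZeroMat χ) W) p 0 w (constCls χ)) =
      Hmap ((coaugSES χ).coaug W).i p w := by
  let f : W ⟶ T (sumZeroMat χ) W := mkHom ((pairT (sumZeroMat χ) W).toLin.flip constVec)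
    fun g a => by
      have := (pairT (sumZeroMat χ) W).map_ρ g a constVec
      rwa [constVec_invariant] at this
  have h := cup_zero_right (pairT (sumZeroMat χ) W) f constVec (constVec_invariant χ)
    ((dd_const_iff _).2 (constVec_invariant χ)) (fun a => rfl) w
  refine (congrArg _ h).trans ?_
  rw [← Hmap_comp_apply]
  refine LinearMap.congr_fun (Hmap_congr (fun a => ?_) p) w
  refine Eq.trans ?_ ((coaugSES χ).coaug_i_apply W a).symm
  have key : act sumZeroP constVec = fun j => constCol j () := by decide +kernel
  refine (smul_eq_act sumZeroP a constVec).trans ?_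
  rw [key]
  rfl

/-- The Gysin argument. If the cohomology of the functions with values in `W` on the values of `χ`
comes from classes in `F`, and `F` is closed under products with the two classes of `χ`, then the
cohomology of `W` comes from classes in `F`. -/
theorem gysin_surjective (h1 : ∀ p, ∀ x ∈ F p, cupG x (degOne χ) ∈ F (p + 1))
    (h2 : ∀ p, ∀ x ∈ F p, cupG x (degTwo χ) ∈ F (p + 2))
    (hV : ∀ p (v : groupCohomology (T (permMat (ZMod 2) (Ω4 χ)) W) p),
      ∃ x ∈ F p, Hmap ((coaugSES χ).coaug W).i p (Hmap i p x) = v)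
    (p : ℕ) (u : groupCohomology W p) : ∃ x ∈ F p, Hmap i p x = u := by
  induction p using Nat.strong_induction_on with
  | _ p ih =>
    obtain ⟨r, hr, e⟩ := hV p (Hmap ((coaugSES χ).coaug W).i p u)
    rw [← sub_eq_zero, ← map_sub] at e
    rcases p with _ | p
    · have := ((coaugSES χ).coaug W).injective_zero (e.trans (map_zero _).symm)
      exact ⟨r, hr, sub_eq_zero.1 this⟩
    -- After subtracting `r`, the class is the image of a class `y` in the sum zero part, which after
    -- subtracting a multiple of `constCls` comes from a class of lower degree in `W`.
    obtain ⟨y, hy⟩ := (((coaugSES χ).coaug W).exact₁ p _).1 e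
    obtain ⟨r', hr', e'⟩ := hV p (Hmap ((augSES χ).aug W).i p y)
    rw [← aug_i_constCls, ← sub_eq_zero, ← map_sub] at e'
    have hX : ((coaugSES χ).coaug W).δ p (cup (pairT (sumZeroMat χ) W) p 0 (Hmap i p r')
        (constCls χ)) = Hmap i (p + 1) (cupG r' (degOne χ)) := by
      refine ((coaugSES χ).coaug_δ W (Hmap i p r') (constCls χ)).trans ?_
      rw [coaug_δ_constCls, cupG_eq_pair1, Hmap_pair1]
    rcases p with _ | p
    · have := ((augSES χ).aug W).injective_zero (e'.trans (map_zero _).symm)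
      rw [sub_eq_zero] at this
      rw [← this, hX] at hy
      refine ⟨r - cupG r' (degOne χ), sub_mem hr (h1 _ _ hr'), ?_⟩
      rw [map_sub, hy]
      abel
    obtain ⟨w, hw⟩ := (((augSES χ).aug W).exact₁ p _).1 e'
    obtain ⟨s, hs, rfl⟩ := ih p (by omega) w
    have hβ : ((coaugSES χ).coaug W).δ (p + 1) (((augSES χ).aug W).δ p (Hmap i p s)) =
        Hmap i (p + 2) (cupG s (degTwo χ)) := by
      rw [(augSES χ).aug_δ]
      refine ((coaugSES χ).coaug_δ W (Hmap i p s) (augSES χ).θ).trans ?_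
      rw [coaug_δ_θ, cupG_eq_pair1, Hmap_pair1]
    have e3 := congrArg (((coaugSES χ).coaug W).δ (p + 1)) hw
    rw [hβ, map_sub, hX, hy] at e3
    refine ⟨r - cupG r' (degOne χ) + cupG s (degTwo χ), ?_, ?_⟩
    · exact add_mem (sub_mem hr (h1 _ _ hr')) (h2 _ _ hs)
    · rw [map_add, map_sub, e3]
      abel

/-- The augmentation of a constant is four times its value. -/
theorem aug_coaug_eq_zero {p : ℕ} (w : groupCohomology W p) :
    Hmap ((augSES χ).aug W).p p (Hmap ((coaugSES χ).coaug W).i p w) = 0 := by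
  rw [← Hmap_comp_apply]
  refine Hmap_zero_apply _ (fun a => ?_) w
  have key : ∑ j : ZMod 4, sumRow () j * constCol j () = 0 := by decide +kernel
  have h := congrArg (fun f => ((augSES χ).aug W).p.hom f) ((coaugSES χ).coaug_i_apply W a)
  refine h.trans ?_
  rw [MatSES.aug_p_apply]
  simp only [smul_smul, ← Finset.sum_smul]
  exact (congrArg (· • a) key).trans (zero_smul _ a)

section dimensions

variable [Finite G] [Module.Finite (ZMod 2) W.V]
  (hs : ∀ p, Function.Surjective (Hmap ((coaugSES χ).coaug W).i p))

include hs

omit [Finite G] [Module.Finite (ZMod 2) W.V] in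
theorem gysin_hdim_zero : hdim W 0 = hdim (T (permMat (ZMod 2) (Ω4 χ)) W) 0 :=
  (LinearEquiv.ofBijective _ ⟨((coaugSES χ).coaug W).injective_zero, hs 0⟩).finrank_eq

theorem gysin_hdim_succ (p : ℕ) : hdim W (p + 1) =
    hdim (T (sumZeroMat χ) W) p + hdim (T (permMat (ZMod 2) (Ω4 χ)) W) (p + 1) := by
  have := finite_groupCohomology W (p + 1)
  refine finrank_eq_add_of_exact (((coaugSES χ).coaug W).δ p) _ ?_
    (((coaugSES χ).coaug W).exact₁ p) (hs (p + 1))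
  rw [injective_iff_map_eq_zero]
  intro z hz
  obtain ⟨y, rfl⟩ := (((coaugSES χ).coaug W).exact₃ p z).1 hz
  obtain ⟨y, rfl⟩ := hs p y
  exact (((coaugSES χ).coaug W).exact₂ p).apply_apply_eq_zero y

omit [Finite G] [Module.Finite (ZMod 2) W.V] in
theorem gysin_aug_eq_zero (p : ℕ) (u : groupCohomology (T (permMat (ZMod 2) (Ω4 χ)) W) p) :
    Hmap ((augSES χ).aug W).p p u = 0 := by
  obtain ⟨y, rfl⟩ := hs p u
  exact aug_coaug_eq_zero χ y

omit [Finite G] [Module.Finite (ZMod 2) W.V] in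
theorem gysin_hdim_sumZero_zero :
    hdim (T (sumZeroMat χ) W) 0 = hdim (T (permMat (ZMod 2) (Ω4 χ)) W) 0 :=
  (LinearEquiv.ofBijective (Hmap ((augSES χ).aug W).i 0) ⟨((augSES χ).aug W).injective_zero,
    fun u => (((augSES χ).aug W).exact₂ 0 u).1 (gysin_aug_eq_zero χ hs 0 u)⟩).finrank_eq

theorem gysin_hdim_sumZero_succ (p : ℕ) : hdim (T (sumZeroMat χ) W) (p + 1) =
    hdim W p + hdim (T (permMat (ZMod 2) (Ω4 χ)) W) (p + 1) := by
  have := finite_groupCohomology (T (sumZeroMat χ) W) (p + 1)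
  refine finrank_eq_add_of_exact (((augSES χ).aug W).δ p) (Hmap ((augSES χ).aug W).i (p + 1)) ?_
    (((augSES χ).aug W).exact₁ p)
    fun u => (((augSES χ).aug W).exact₂ (p + 1) u).1 (gysin_aug_eq_zero χ hs _ u)
  rw [injective_iff_map_eq_zero]
  intro z hz
  obtain ⟨y, rfl⟩ := (((augSES χ).aug W).exact₃ p z).1 hz
  exact gysin_aug_eq_zero χ hs p y

/-- If the inclusion of the constants is onto on cohomology, both long exact sequences split into short
ones, and the sum zero part has the same dimensions as `W`. -/
theorem gysin_hdim (p : ℕ) : hdim W (p + 1) =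
    hdim W p + hdim (T (permMat (ZMod 2) (Ω4 χ)) W) (p + 1) := by
  have h : ∀ p, hdim (T (sumZeroMat χ) W) p = hdim W p := by
    intro p
    induction p with
    | zero => rw [gysin_hdim_sumZero_zero χ hs, gysin_hdim_zero χ hs]
    | succ p ih => rw [gysin_hdim_sumZero_succ χ hs, gysin_hdim_succ χ hs, ih]
  rw [gysin_hdim_succ χ hs, h]

end dimensions

end gysin

/-! ### The cohomology ring of `(ℤ/4)³` -/

section lattice

/-- The group `(ℤ/4)³`. -/
abbrev N4 : Type := Multiplicative (Fin 3 → ZMod 4)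

/-- The coordinate characters. -/
def coord (i : Fin 3) : N4 →* Multiplicative (ZMod 4) :=
  (Pi.evalAddMonoidHom (fun _ : Fin 3 => ZMod 4) i).toMultiplicative

/-- The coordinates of an element of `(ℤ/4)³`. -/
def coordPt (i : Fin 3) (g : N4) : Ω4 (coord i) := toZ (coord i) g

/-- The permutation representation of `(ℤ/4)³` on the values of a coordinate. -/
abbrev coordMat (i : Fin 3) : N4 →* Matrix (Ω4 (coord i)) (Ω4 (coord i)) (ZMod 2) :=
  permMat (ZMod 2) (Ω4 (coord i))

/-- The functions of the last coordinate. -/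
abbrev V1 : Rep.{0} (ZMod 2) N4 := T (coordMat 2) (triv (ZMod 2) N4)

/-- The functions of the last two coordinates. -/
abbrev V2 : Rep.{0} (ZMod 2) N4 := T (coordMat 1) V1

/-- The functions of three coordinates. -/
abbrev V3 : Rep.{0} (ZMod 2) N4 := T (coordMat 0) V2

/-- The functions on `(ℤ/4)³` as functions of three coordinates. -/
def evalTriple : V3 ⟶ T (permMat (ZMod 2) N4) (triv (ZMod 2) N4) :=
  mkHom (A := V3) (B := T (permMat (ZMod 2) N4) (triv (ZMod 2) N4))
    { toFun := fun F g => F (coordPt 0 g) (coordPt 1 g) (coordPt 2 g)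
      map_add' := fun _ _ => rfl
      map_smul' := fun _ _ => rfl }
    fun g F => funext fun u => by
      refine Eq.trans ?_ (permMat_ρ_apply (W := triv (ZMod 2) N4) g _ u).symm
      change Tρ (coordMat 0) V2 g F (coordPt 0 u) (coordPt 1 u) (coordPt 2 u) = _
      rw [permMat_ρ_apply, permMat_ρ_apply, permMat_ρ_apply]
      rfl

theorem evalTriple_bijective : Function.Bijective evalTriple.hom := by
  constructor
  · intro F F' e
    funext i j l
    exact congr_fun e (.ofAdd ![i, j, l])
  · intro f
    refine ⟨fun i j l => f (.ofAdd ![i, j, l]), funext fun g => congrArg f ?_⟩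
    refine congrArg Multiplicative.ofAdd (funext fun i => ?_)
    fin_cases i <;> rfl

theorem acyclic_V3 : Acyclic V3 :=
  (acyclic_regular (triv (ZMod 2) N4)).congr (invHom _ evalTriple_bijective)
    ⟨(Function.RightInverse.injective (hom_invHom _ _)),
      Function.LeftInverse.surjective (invHom_hom _ _)⟩

theorem hdim_V3_zero : hdim V3 0 = 1 := by
  rw [hdim_congr _ evalTriple_bijective, hdim_regular_zero]
  exact Module.finrank_self (ZMod 2)

/-- The constants in the functions of the last coordinate. -/
def ι1 : triv (ZMod 2) N4 ⟶ V1 := ((coaugSES (coord 2)).coaug (triv (ZMod 2) N4)).i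

/-- The constants in the functions of the last two coordinates. -/
def ι2 : triv (ZMod 2) N4 ⟶ V2 := ι1 ≫ ((coaugSES (coord 1)).coaug V1).i

/-- The constants in the functions of three coordinates. -/
def ι3 : triv (ZMod 2) N4 ⟶ V3 := ι2 ≫ ((coaugSES (coord 0)).coaug V2).i

section generation

variable {F : ∀ p, Submodule (ZMod 2) (HG N4 p)} (h0 : oneCls (ZMod 2) N4 ∈ F 0)
  (h1 : ∀ i p, ∀ x ∈ F p, cupG x (degOne (coord i)) ∈ F (p + 1))
  (h2 : ∀ i p, ∀ x ∈ F p, cupG x (degTwo (coord i)) ∈ F (p + 2))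

include h0 in
/-- The functions of three coordinates form the regular module, which is acyclic and whose invariants
are the constants. -/
theorem ι3_surjective (p : ℕ) (v : groupCohomology V3 p) : ∃ x ∈ F p, Hmap ι3 p x = v := by
  rcases p with _ | p
  · have hne : Hmap ι3 0 (oneCls (ZMod 2) N4) ≠ 0 := by
      unfold ι3 ι2 ι1
      rw [Hmap_comp_apply, Hmap_comp_apply]
      intro h
      have h := ((coaugSES (coord 0)).coaug V2).injective_zero (h.trans (map_zero _).symm)
      have h := ((coaugSES (coord 1)).coaug V1).injective_zero (h.trans (map_zero _).symm)
      have h := ((coaugSES (coord 2)).coaug _).injective_zero (h.trans (map_zero _).symm)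
      exact one_ne_zero (α := ZMod 2) ((cls₀_eq_zero _ _).1 h)
    obtain ⟨c, rfl⟩ := exists_smul_eq_of_finrank_eq_one hdim_V3_zero hne v
    exact ⟨c • oneCls (ZMod 2) N4, Submodule.smul_mem _ _ h0, map_smul _ _ _⟩
  · exact ⟨0, zero_mem _, by rw [map_zero, acyclic_V3 p v]⟩

include h0 h1 h2

theorem ι2_surjective (p : ℕ) (v : groupCohomology V2 p) : ∃ x ∈ F p, Hmap ι2 p x = v :=
  gysin_surjective (coord 0) ι2 F (h1 0) (h2 0) (fun p v => by
    obtain ⟨x, hx, rfl⟩ := ι3_surjective h0 p v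
    exact ⟨x, hx, (Hmap_comp_apply _ _ _ _).symm⟩) p v

theorem ι1_surjective (p : ℕ) (v : groupCohomology V1 p) : ∃ x ∈ F p, Hmap ι1 p x = v :=
  gysin_surjective (coord 1) ι1 F (h1 1) (h2 1) (fun p v => by
    obtain ⟨x, hx, rfl⟩ := ι2_surjective h0 h1 h2 p v
    exact ⟨x, hx, (Hmap_comp_apply _ _ _ _).symm⟩) p v

/-- The cohomology ring of `(ℤ/4)³` is generated by the classes of the coordinate characters. -/
theorem cohomology_generated (p : ℕ) : F p = ⊤ := by
  refine eq_top_iff.2 fun u _ => ?_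
  obtain ⟨x, hx, rfl⟩ := gysin_surjective (coord 2) (𝟙 _) F (h1 2) (h2 2) (fun p v => by
    obtain ⟨x, hx, rfl⟩ := ι1_surjective h0 h1 h2 p v
    exact ⟨x, hx, by rw [Hmap_id_apply]; rfl⟩) p u
  rwa [Hmap_id_apply]

end generation

theorem coaug_surjective_two (p : ℕ) :
    Function.Surjective (Hmap ((coaugSES (coord 0)).coaug V2).i p) := fun v => by
  obtain ⟨x, -, rfl⟩ := ι3_surjective (F := fun _ => ⊤) trivial p v
  exact ⟨Hmap ι2 p x, (Hmap_comp_apply _ _ _ _).symm⟩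

theorem coaug_surjective_one (p : ℕ) :
    Function.Surjective (Hmap ((coaugSES (coord 1)).coaug V1).i p) := fun v => by
  obtain ⟨x, -, rfl⟩ := ι2_surjective (F := fun _ => ⊤) trivial (fun _ _ _ _ => trivial)
    (fun _ _ _ _ => trivial) p v
  exact ⟨Hmap ι1 p x, (Hmap_comp_apply _ _ _ _).symm⟩

theorem coaug_surjective_zero (p : ℕ) :
    Function.Surjective (Hmap ((coaugSES (coord 2)).coaug (triv (ZMod 2) N4)).i p) := fun v => by
  obtain ⟨x, -, rfl⟩ := ι1_surjective (F := fun _ => ⊤) trivial (fun _ _ _ _ => trivial)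
    (fun _ _ _ _ => trivial) p v
  exact ⟨x, rfl⟩

theorem hdim_V2 (p : ℕ) : hdim V2 p = 1 := by
  induction p with
  | zero => rw [gysin_hdim_zero _ coaug_surjective_two, hdim_V3_zero]
  | succ p ih => rw [gysin_hdim _ coaug_surjective_two, ih, acyclic_V3.hdim]

theorem hdim_V1 (p : ℕ) : hdim V1 p = p + 1 := by
  induction p with
  | zero => rw [gysin_hdim_zero _ coaug_surjective_one, hdim_V2]
  | succ p ih => rw [gysin_hdim _ coaug_surjective_one, ih, hdim_V2]

theorem two_mul_hdim_triv (p : ℕ) : 2 * hdim (triv (ZMod 2) N4) p = (p + 1) * (p + 2) := by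
  induction p with
  | zero => rw [gysin_hdim_zero _ coaug_surjective_zero, hdim_V1]
  | succ p ih =>
    rw [gysin_hdim _ coaug_surjective_zero, mul_add, ih, hdim_V1]
    ring

/-- Both dimensions are `(p + 1) (p + 2) / 2`. -/
theorem hdim_triv (p : ℕ) : hdim (triv (ZMod 2) N4) p = dimA p := by
  have h1 := two_mul_hdim_triv p
  have h2 := two_mul_dimA p
  omega

end lattice

/-! ### Comparison of the cohomology ring of `(ℤ/4)³` with `Λ(M) ⊗ S(M)` -/

section characters

variable {V : Type} [AddCommGroup V] [Module (ZMod 2) V] (c : (N4 →* Multiplicative (ZMod 4)) → V)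

/-- The character of `(ℤ/4)³` with given coefficients. -/
def charOf (a : Fin 3 → ℕ) : N4 →* Multiplicative (ZMod 4) :=
  coord 0 ^ a 0 * coord 1 ^ a 1 * coord 2 ^ a 2

/-- The linear map which sends the basis vectors of `𝔽₂³` to the values of `c` on the
coordinates. -/
def coordLin : (Fin 3 → ZMod 2) →ₗ[ZMod 2] V :=
  Fintype.linearCombination (ZMod 2) fun i => c (coord i)

theorem coordLin_apply (u : Fin 3 → ZMod 2) :
    coordLin c u = u 0 • c (coord 0) + u 1 • c (coord 1) + u 2 • c (coord 2) := by
  rw [coordLin, Fintype.linearCombination_apply, Fin.sum_univ_three]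

variable {c} (hc : ∀ χ ψ, c (χ * ψ) = c χ + c ψ)

include hc

theorem map_char_pow (χ : N4 →* Multiplicative (ZMod 4)) (n : ℕ) :
    c (χ ^ n) = (n : ZMod 2) • c χ := by
  induction n with
  | zero =>
    have := hc 1 1
    rw [one_mul, left_eq_add] at this
    rw [pow_zero, this, Nat.cast_zero, zero_smul]
  | succ n ih => rw [pow_succ, hc, ih, Nat.cast_succ, add_smul, one_smul]

theorem map_charOf (a : Fin 3 → ℕ) : c (charOf a) = coordLin c fun i => a i := by
  rw [charOf, hc, hc, map_char_pow hc, map_char_pow hc, map_char_pow hc, coordLin_apply]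

theorem coordLin_eq_map (u : Fin 3 → ZMod 2) : coordLin c u = c (charOf fun i => (u i).val) := by
  rw [map_charOf hc]
  congr 1
  funext i
  exact (ZMod.natCast_zmod_val _).symm

omit hc in
theorem coord_comp (Q : Matrix (Fin 3) (Fin 3) (ZMod 4)) (f : N4 →* N4)
    (hf : ∀ v, (f v).toAdd = Q.mulVec v.toAdd) (i : Fin 3) :
    (coord i).comp f = charOf fun j => (Q i j).val := by
  refine MonoidHom.ext fun v => Multiplicative.toAdd.injective ?_
  refine (congr_fun (hf v) i).trans ?_
  change Q.mulVec v.toAdd i = (Q i 0).val • v.toAdd 0 + (Q i 1).val • v.toAdd 1 +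
      (Q i 2).val • v.toAdd 2
  simp [Matrix.mulVec, dotProduct, Fin.sum_univ_three]

/-- The transpose of the reduction modulo two of a matrix over `ℤ/4`. -/
def redT (Q : Matrix (Fin 3) (Fin 3) (ZMod 4)) : Matrix (Fin 3) (Fin 3) (ZMod 2) :=
  Matrix.of fun j i => (Q i j).val

omit hc in
theorem map_coordLin_of_pullback {W : Type} [AddCommGroup W] [Module (ZMod 2) W] (p : V →ₗ[ZMod 2] W)
    {c' : (N4 →* Multiplicative (ZMod 4)) → W} (hc' : ∀ χ ψ, c' (χ * ψ) = c' χ + c' ψ)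
    (Q : Matrix (Fin 3) (Fin 3) (ZMod 4)) (f : N4 →* N4)
    (hf : ∀ v, (f v).toAdd = Q.mulVec v.toAdd) (hp : ∀ χ, p (c χ) = c' (χ.comp f))
    (u : Fin 3 → ZMod 2) : p (coordLin c u) = coordLin c' ((redT Q).mulVec u) := by
  rw [coordLin_apply]
  simp only [map_add, map_smul, hp, coord_comp Q f hf, map_charOf hc', coordLin_apply]
  simp only [Matrix.mulVec, dotProduct, Fin.sum_univ_three, redT, Matrix.of_apply]
  module

end characters

section comparison

/-- The change of basis which identifies the reduction modulo two of the dual lattice with the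
natural module. -/
def baseChange : Matrix (Fin 3) (Fin 3) (ZMod 2) := !![1, 1, 0; 1, 0, 0; 1, 1, 1]

/-- The inverse of `baseChange`. -/
def baseChangeInv : Matrix (Fin 3) (Fin 3) (ZMod 2) := !![0, 1, 0; 1, 1, 0; 1, 0, 1]

theorem baseChange_mulVec (u : M) : baseChange.mulVec (baseChangeInv.mulVec u) = u := by
  rw [Matrix.mulVec_mulVec, show baseChange * baseChangeInv = 1 by decide +kernel,
      Matrix.one_mulVec]

/-- The matrices of the action on the dual lattice, reduced modulo two, are conjugate to those of the
natural module. The inverse appears because the group acts on characters on the right. -/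
theorem redT_baseChange (g : D8) (v : M) : (redT (hsMatrix g⁻¹)).mulVec (baseChange.mulVec v) =
    baseChange.mulVec ((natFun g).mulVec v) := by
  have key : ∀ g : D8, redT (hsMatrix g⁻¹) * baseChange = baseChange * natFun g := by decide +kernel
  rw [Matrix.mulVec_mulVec, Matrix.mulVec_mulVec, key]

/-- The natural module in `H¹`. -/
def natOne : M →ₗ[ZMod 2] HG N4 1 := coordLin degOne ∘ₗ baseChange.mulVecLin

/-- The natural module in `H²`. -/
def natTwo : M →ₗ[ZMod 2] HG N4 2 := coordLin degTwo ∘ₗ baseChange.mulVecLin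

/-- The action of an element of the dihedral group on the cohomology of `(ℤ/4)³`. -/
abbrev pullD (g : D8) (n : ℕ) : HG N4 n →ₗ[ZMod 2] HG N4 n :=
  pullback (ZMod 2) (hsAction g⁻¹).toMonoidHom n

theorem pullD_natOne (g : D8) (v : M) : pullD g 1 (natOne v) = natOne ((natFun g).mulVec v) := by
  refine (map_coordLin_of_pullback (pullD g 1) degOne_mul (hsMatrix g⁻¹) _ (fun _ => rfl)
    (pullback_degOne _) _).trans ?_
  exact congrArg (coordLin degOne) (redT_baseChange g v)

theorem pullD_natTwo (g : D8) (v : M) : pullD g 2 (natTwo v) = natTwo ((natFun g).mulVec v) := by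
  refine (map_coordLin_of_pullback (pullD g 2) degTwo_mul (hsMatrix g⁻¹) _ (fun _ => rfl)
    (pullback_degTwo _) _).trans ?_
  exact congrArg (coordLin degTwo) (redT_baseChange g v)

theorem exists_natOne (i : Fin 3) : ∃ v, natOne v = degOne (coord i) := by
  refine ⟨baseChangeInv.mulVec (Pi.single i 1), ?_⟩
  refine (congrArg (coordLin degOne) (baseChange_mulVec _)).trans ?_
  simp [coordLin]

theorem exists_natTwo (i : Fin 3) : ∃ v, natTwo v = degTwo (coord i) := by
  refine ⟨baseChangeInv.mulVec (Pi.single i 1), ?_⟩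
  refine (congrArg (coordLin degTwo) (baseChange_mulVec _)).trans ?_
  simp [coordLin]

/-- The comparison map to the cohomology ring of `(ℤ/4)³`. -/
def compare : ExtSym →ₐ[ZMod 2] HRing N4 :=
  extSymLift (inH 1 ∘ₗ natOne) (inH 2 ∘ₗ natTwo)
    (fun v => by
      have : natOne v = degOne _ := coordLin_eq_map degOne_mul _
      simp only [LinearMap.comp_apply]
      rw [this]
      exact degOne_mul_self _)
    (fun _ _ => inH_two_comm _ _) (fun _ _ => inH_one_two_comm _ _)

theorem compare_ext (v : M) : compare (extι v) = inH 1 (natOne v) := extSymLift_ext v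

theorem compare_sym (v : M) : compare (symι v) = inH 2 (natTwo v) := extSymLift_sym v

theorem mem_range_of_eq {m n : ℕ} (h : m = n) {a : HRing N4}
    (ha : a ∈ LinearMap.range (inH (G := N4) m)) : a ∈ LinearMap.range (inH (G := N4) n) := h ▸ ha

theorem compare_mem {n : ℕ} {a : ExtSym} (ha : a ∈ extSymDeg n) :
    compare a ∈ LinearMap.range (inH (G := N4) n) := by
  refine (extSymDeg_le (N := fun i j => (LinearMap.range (inH (G := N4) (i + 2 * j))).comap
    compare.toLinearMap) ?_ (fun j v a ha => ?_) (fun i j v a ha => ?_) (fun i j h => ?_) :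
    extSymDeg n ≤ (LinearMap.range (inH (G := N4) n)).comap compare.toLinearMap) ha
  · exact ⟨oneCls (ZMod 2) N4, one_eq_inH.symm.trans (map_one compare).symm⟩
  · obtain ⟨x, hx⟩ := ha
    refine mem_range_of_eq (m := 2 + (0 + 2 * j)) (by omega) ⟨cupG (natTwo v) x, ?_⟩
    rw [← inH_mul, hx, ← compare_sym]
    exact (map_mul compare _ _).symm
  · obtain ⟨x, hx⟩ := ha
    refine mem_range_of_eq (m := 1 + (i + 2 * j)) (by omega) ⟨cupG (natOne v) x, ?_⟩
    rw [← inH_mul, hx, ← compare_ext]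
    exact (map_mul compare _ _).symm
  · subst h; exact le_rfl

/-- The comparison map in degree `n`. -/
def compareDeg (n : ℕ) : extSymDeg n →ₗ[ZMod 2] HG N4 n :=
  DirectSum.component (ZMod 2) ℕ (HG N4) n ∘ₗ compare.toLinearMap ∘ₗ (extSymDeg n).subtype

theorem inH_compareDeg {n : ℕ} (a : extSymDeg n) : inH n (compareDeg n a) = compare a.1 := by
  obtain ⟨x, hx⟩ := compare_mem a.2
  have : compareDeg n a = x := by
    change DirectSum.component (ZMod 2) ℕ (HG N4) n (compare a.1) = x
    rw [← hx]
    exact DirectSum.component.lof_self (ZMod 2) n x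
  rw [this, hx]

theorem compareDeg_mul {m n : ℕ} (a : extSymDeg m) (b : extSymDeg n) :
    compareDeg (m + n) ⟨a.1 * b.1, extSymDeg_mul a.2 b.2⟩ =
        cupG (compareDeg m a) (compareDeg n b) := by
  refine inH_injective _ ?_
  rw [← inH_mul, inH_compareDeg, inH_compareDeg, inH_compareDeg]
  exact map_mul compare _ _

/-- The image contains the classes of the coordinate characters. -/
theorem compareDeg_surjective (n : ℕ) : Function.Surjective (compareDeg n) := by
  refine LinearMap.range_eq_top.1 (cohomology_generated
    (F := fun n => LinearMap.range (compareDeg n)) ?_ ?_ ?_ n)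
  · refine ⟨⟨1, one_mem_deg⟩, inH_injective _ ?_⟩
    rw [inH_compareDeg, ← one_eq_inH]
    exact map_one compare
  · rintro i p _ ⟨a, rfl⟩
    obtain ⟨v, hv⟩ := exists_natOne i
    refine ⟨⟨a.1 * extι v, extSymDeg_mul a.2 (extι_mem v)⟩, inH_injective _ ?_⟩
    rw [inH_compareDeg, ← inH_mul, inH_compareDeg, ← hv, ← compare_ext]
    exact map_mul compare _ _
  · rintro i p _ ⟨a, rfl⟩
    obtain ⟨v, hv⟩ := exists_natTwo i
    refine ⟨⟨a.1 * symι v, extSymDeg_mul a.2 (symι_mem v)⟩, inH_injective _ ?_⟩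
    rw [inH_compareDeg, ← inH_mul, inH_compareDeg, ← hv, ← compare_sym]
    exact map_mul compare _ _

theorem finrank_HG (n : ℕ) : Module.finrank (ZMod 2) (HG N4 n) = dimA n := hdim_triv n

/-- The lower bound for the dimension of the graded pieces comes from the cohomology of `(ℤ/4)³`. -/
theorem dimA_le (n : ℕ) : dimA n ≤ Module.finrank (ZMod 2) (extSymDeg n) := by
  have := finite_extSymDeg n
  rw [← finrank_HG]
  exact LinearMap.finrank_le_finrank_of_surjective (compareDeg_surjective n)

/-- A surjective map to a space of dimension `dimA n` from a space of dimension at most `dimA n`. -/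
theorem compareDeg_bijective (n : ℕ) : Function.Bijective (compareDeg n) := by
  have := finite_extSymDeg n
  have := finite_groupCohomology (triv (ZMod 2) N4) n
  have he : Module.finrank (ZMod 2) (extSymDeg n) = Module.finrank (ZMod 2) (HG N4 n) :=
    le_antisymm ((finrank_extSymDeg_le n).trans (finrank_HG n).ge) ((finrank_HG n).le.trans (dimA_le n))
  exact ⟨(LinearMap.injective_iff_surjective_of_finrank_eq_finrank he).2 (compareDeg_surjective n),
    compareDeg_surjective n⟩

/-- Both sides are multiplicative in `a`, so it suffices to compare them on `extι v` and `symι v`. -/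
theorem compare_actA (g : D8) {n : ℕ} {a : ExtSym} (ha : a ∈ extSymDeg n) :
    compare (actA g a) = pullH (hsAction g⁻¹).toMonoidHom (compare a) := by
  refine (extSymDeg_le (N := fun _ _ => LinearMap.eqLocus (compare.comp (actA g)).toLinearMap
    ((pullH (hsAction g⁻¹).toMonoidHom).comp compare).toLinearMap) ?_ (fun j v a ha => ?_)
    (fun i j v a ha => ?_) (fun i j _ => le_rfl) : extSymDeg n ≤ _) ha
  · exact (map_one (compare.comp (actA g))).trans
      (map_one ((pullH (hsAction g⁻¹).toMonoidHom).comp compare)).symm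
  · refine (map_mul (compare.comp (actA g)) _ _).trans (Eq.trans ?_
      (map_mul ((pullH (hsAction g⁻¹).toMonoidHom).comp compare) _ _).symm)
    refine congrArg₂ _ ?_ ha
    simp only [AlgHom.comp_apply]
    rw [actA_sym, compare_sym, compare_sym, pullH_inH]
    exact congrArg (inH 2) (pullD_natTwo g v).symm
  · refine (map_mul (compare.comp (actA g)) _ _).trans (Eq.trans ?_
      (map_mul ((pullH (hsAction g⁻¹).toMonoidHom).comp compare) _ _).symm)
    refine congrArg₂ _ ?_ ha
    simp only [AlgHom.comp_apply]
    rw [actA_ext, compare_ext, compare_ext, pullH_inH]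
    exact congrArg (inH 1) (pullD_natOne g v).symm

theorem compareDeg_act (g : D8) (n : ℕ) (a : extSymDeg n) :
    compareDeg n (Aρ n g a) = pullD g n (compareDeg n a) := by
  refine inH_injective _ ?_
  rw [← pullH_inH, inH_compareDeg, inH_compareDeg, Aρ_apply, compare_actA g a.2]

end comparison

/-! ### Transport along isomorphisms -/

section transport

variable {k G H : Type} [CommRing k] [Group G] [Group H]

/-- The map on cohomology induced by a homomorphism of groups and a compatible map of coefficients. -/
def mapOf (φ : G →* H) {A : Rep.{0} k H} {B : Rep.{0} k G} (α : A.V →ₗ[k] B.V)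
    (h : ∀ g a, α (A.ρ (φ g) a) = B.ρ g (α a)) (n : ℕ) :
    groupCohomology A n →ₗ[k] groupCohomology B n :=
  (groupCohomology.map φ (mkHom (A := Rep.res φ A) α h) n).hom

theorem mapOf_mapOf (e : G ≃* H) {A : Rep.{0} k H} {B : Rep.{0} k G} (α : A.V →ₗ[k] B.V)
    (β : B.V →ₗ[k] A.V) (h : ∀ g a, α (A.ρ (e g) a) = B.ρ g (α a))
    (h' : ∀ g a, β (B.ρ (e.symm g) a) = A.ρ g (β a)) (hβ : ∀ a, β (α a) = a) (n : ℕ)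
    (u : groupCohomology A n) :
    mapOf e.symm.toMonoidHom β h' n (mapOf e.toMonoidHom α h n u) = u := by
  obtain ⟨c, hc, rfl⟩ := cls_surjective u
  refine (congrArg _ (map_cls _ _ hc)).trans ((map_cls _ _ _).trans (cls_congr _ (funext fun x => ?_)))
  refine (hβ _).trans (congrArg c (funext fun i => ?_))
  exact e.apply_symm_apply _

/-- An isomorphism of groups and a compatible isomorphism of coefficients induce isomorphisms on
cohomology. -/
def mapEquiv (e : G ≃* H) {A : Rep.{0} k H} {B : Rep.{0} k G} (α : A.V ≃ₗ[k] B.V)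
    (h : ∀ g a, α (A.ρ (e g) a) = B.ρ g (α a)) (n : ℕ) :
    groupCohomology A n ≃ₗ[k] groupCohomology B n :=
  have h' : ∀ g b, α.symm (B.ρ (e.symm g) b) = A.ρ g (α.symm b) := fun g b => by
    have := h (e.symm g) (α.symm b)
    rw [e.apply_symm_apply, α.apply_symm_apply] at this
    rw [← this, α.symm_apply_apply]
  LinearEquiv.ofLinearMap (mapOf e.toMonoidHom α.toLinearMap h n)
    (mapOf e.symm.toMonoidHom α.symm.toLinearMap h' n)
    (LinearMap.ext fun u => mapOf_mapOf e.symm α.symm.toLinearMap α.toLinearMap h' h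
      α.apply_symm_apply n u)
    (LinearMap.ext fun u => mapOf_mapOf e α.toLinearMap α.symm.toLinearMap h h'
      α.symm_apply_apply n u)

namespace GradedCoeff

/-- Isomorphic groups with isomorphic graded coefficients have isomorphic cohomology. -/
def CohomologyIso.ofEquiv {X : GradedCoeff k G} {Z : GradedCoeff k H} (e : G ≃* H)
    (α : ∀ q, (Z.obj q).V ≃ₗ[k] (X.obj q).V)
    (h : ∀ q g a, α q ((Z.obj q).ρ (e g) a) = (X.obj q).ρ g (α q a))
    (hm : ∀ i j a b, α (i + j) ((Z.mul i j).toLin a b) = (X.mul i j).toLin (α i a) (α j b)) :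
    X.CohomologyIso Z where
  equiv p q := (mapEquiv e (α q) (h q) p).symm
  map_cup {p q p' q'} x y := by
    rw [LinearEquiv.symm_apply_eq]
    have := CupProduct.map_cup e.toMonoidHom (Z.mul q q') (X.mul q q')
      (mkHom (A := Rep.res e.toMonoidHom (Z.obj q)) (α q).toLinearMap (h q))
      (mkHom (A := Rep.res e.toMonoidHom (Z.obj q')) (α q').toLinearMap (h q'))
      (mkHom (A := Rep.res e.toMonoidHom (Z.obj (q + q'))) (α (q + q')).toLinearMap (h (q + q')))
      (hm q q') p p' ((mapEquiv e (α q) (h q) p).symm x) ((mapEquiv e (α q') (h q') p').symm y)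
    refine Eq.trans ?_ this.symm
    exact congrArg₂ (fun x y => CupProduct.cup (X.mul q q') p p' x y)
      ((mapEquiv e (α q) (h q) p).apply_symm_apply x).symm
      ((mapEquiv e (α q') (h q') p').apply_symm_apply y).symm

variable {X : GradedCoeff k G} {Z : GradedCoeff k H} (I : X.CohomologyIso Z)

include I

theorem CohomologyIso.generatedInDegreesLE {d : ℕ} (h : Z.GeneratedInDegreesLE d) :
    X.GeneratedInDegreesLE d := fun F h1 h2 p q => by
  have := h (fun p q => (F p q).comap (I.equiv p q).symm.toLinearMap)
    (fun p q hpq => by rw [h1 p q hpq, Submodule.comap_top])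
    (fun p q p' q' x y hx hy => by
      have e : (I.equiv (p + p') (q + q')).symm (Z.cup x y) =
          X.cup ((I.equiv p q).symm x) ((I.equiv p' q').symm y) := by
        rw [LinearEquiv.symm_apply_eq, I.map_cup, LinearEquiv.apply_symm_apply,
          LinearEquiv.apply_symm_apply]
      change (I.equiv (p + p') (q + q')).symm (Z.cup x y) ∈ F (p + p') (q + q')
      rw [e]
      exact h2 _ _ _ _ _ _ hx hy) p q
  refine eq_top_iff.2 fun u _ => ?_
  have hu : I.equiv p q u ∈ (F p q).comap (I.equiv p q).symm.toLinearMap := this ▸ trivial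
  rw [Submodule.mem_comap] at hu
  exact ((I.equiv p q).symm_apply_apply u) ▸ hu

end GradedCoeff

end transport

section final

/-- The comparison map in degree `n` as an isomorphism. -/
def compareEquiv (n : ℕ) : extSymDeg n ≃ₗ[ZMod 2] HG N4 n :=
  LinearEquiv.ofBijective (compareDeg n) (compareDeg_bijective n)

/-- The second page of the spectral sequence as the cohomology of `U₃` with coefficients in
`Λ(M) ⊗ S(M)`. -/
def isoExtSym : E2.CohomologyIso extSym :=
  .ofEquiv (MulEquiv.ofBijective toU3 toU3_bijective) compareEquiv
    (fun q g a => compareDeg_act g q a) (fun _ _ a b => compareDeg_mul a b)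

/-- The second page of the spectral sequence as the cohomology of the dihedral group with
coefficients in `Λ(M) ⊗ S(M)`. -/
def isoY : E2.CohomologyIso Y :=
  .ofEquiv (MulEquiv.refl D8) compareEquiv
    (fun q g a => compareDeg_act g q a) (fun _ _ a b => compareDeg_mul a b)

theorem finrank_E2 (p q : ℕ) : Module.finrank (ZMod 2) (E2.H p q) = cohA q p :=
  (isoY.equiv p q).finrank_eq.trans (hdim_A (dimA_le q) p)

theorem finite_E2 (p q : ℕ) : Module.Finite (ZMod 2) (E2.H p q) := by
  have : Module.Finite (ZMod 2) (E2.obj q).V := finite_groupCohomology (triv (ZMod 2) N4) q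
  exact finite_groupCohomology (E2.obj q) p

theorem poincareSeries_E2 : E2.poincareSeries = tot cohA := by
  refine congrArg PowerSeries.mk (funext fun n => ?_)
  rw [← Finset.Nat.sum_antidiagonal_swap, Finset.Nat.sum_antidiagonal_eq_sum_range_succ_mk]
  exact Finset.sum_congr rfl fun q _ => congrArg Nat.cast (finrank_E2 _ _)

end final

end HS

end

theorem mainTheorem5 :
    Nonempty (HS.E2.CohomologyIso HS.extSym) ∧
    (∀ p q : ℕ, Module.Finite (ZMod 2) (HS.E2.H p q)) ∧
    HS.E2.poincareSeries *
        ((1 - PowerSeries.X) ^ 2 * (1 - PowerSeries.X ^ 4) * (1 - PowerSeries.X ^ 8)) =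
      (1 + PowerSeries.X) ^ 2 * (1 - PowerSeries.X + PowerSeries.X ^ 2) *
        (1 + 2 * PowerSeries.X ^ 2 - PowerSeries.X ^ 5) ∧
    HS.E2.GeneratedInDegreesLE 8 :=
  ⟨⟨HS.isoExtSym⟩, HS.finite_E2, HS.poincareSeries_E2 ▸ HS.tot_cohA,
    HS.isoY.generatedInDegreesLE (HS.generated_Y HS.dimA_le)⟩
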